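/- Let $X$ be a finite dimensional $C^\infty$, real analytic or complex manifold, let $\mathcal{O}_X$ be its sheaf of $k$-valued functions of the given class ($k=\mathbb{R}$ or $k=\mathbb{C}$; $k=\mathbb{C}$ for a complex manifold), and write $\mathcal{T}_X$, $\Omega^\bullet_X$ for the sheaves of ($k$-valued) vector fields and differential forms. Let $X^\sharp=(X,\Omega^\bullet_X,d)$. Let $\mathcal{A}$ be an $\mathcal{O}_X$-Lie algebroid which is locally free of finite rank over $\mathcal{O}_X$. *Definitions.* (1) $\mathcal{A}^\sharp$ is the DG Lie algebroid over $\Omega^\bullet_X$ with underlying DG module $\Omega^\bullet_X[\epsilon]\otimes_{\mathcal{O}_X}\mathcal{A}$, where $\deg\epsilon=-1$, the differential is $d+\partial_\epsilon$, and $f\in\mathcal{O}_X$ acts on $\Omega^\bullet_X[\epsilon]$ as $f+df\cdot\epsilon$; its bracket and anchor are determined by $[a\epsilon,b\epsilon]=0$, $[a,b\epsilon]=[a,b]\epsilon$ and $\sigma(a\epsilon)=\iota_{\sigma(a)}$. (2) $\mathrm{CExt}(\mathcal{A})$ is the groupoid of Courant extensions of $\mathcal{A}$: Courant algebroids $\mathcal{Q}$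 (with a symmetric pairing that may be degenerate, anchor $\pi$ and co-anchor $\pi^\dagger$) with a morphism to $\mathcal{A}$ inducing an isomorphism of Lie algebroids $\operatorname{coker}(\pi^\dagger)\cong\mathcal{A}$ and such that $0\to\Omega^1_X\xrightarrow{\pi^\dagger}\mathcal{Q}\to\mathcal{A}\to 0$ is exact. Morphisms are the $\mathcal{O}_X$-linear maps which preserve brackets, pairings, anchors, co-anchors and the maps to $\mathcal{A}$. (3) $\mathrm{OExt}_2(\mathcal{A}^\sharp)$ is the groupoid of $\mathcal{O}_{X^\sharp}[2]$-extensions of $\mathcal{A}^\sharp$: DG Lie algebroids $\mathcal{B}$ over $\Omega^\bullet_X$ with a closed central global section $\mathfrak{c}$ of degree $-2$ and a morphism $\mathcal{B}\to\mathcal{A}^\sharp$ such that $0\to\Omega^\bullet_X[2]\xrightarrow{\cdot\mathfrak{c}}\mathcal{B}\to\mathcal{A}^\sharp\to 0$ is exact. Morphisms are the morphisms of DG Lie algebroids which preserve $\mathfrak{c}$ and the maps to $\mathcal{A}^\sharp$. (4) A $k$-vector space in categories is a groupoid with functors $(Y_1,\dots,Y_n)\mapsto\lambda_1Y_1\dotplus\cdots\dotplus\lambda_nY_n$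 for all $n\geq 0$ and $\lambda\in k^n$, and with natural isomorphisms $\dotplus_i\delta_{ij}Y_i\cong Y_j$ and $\dotplus_j\lambda_j(\dotplus_i\mu_{ji}Y_i)\cong\dotplus_i(\sum_j\lambda_j\mu_{ji})Y_i$ that are associative and unital. A morphism is a functor $F$ with natural isomorphisms $F(\dotplus_i\lambda_iY_i)\cong\dotplus_i\lambda_iF(Y_i)$ compatible with these. The operation $Y_1\dotplus Y_2$ makes it a Picard groupoid (a symmetric monoidal groupoid with all objects invertible). On $\mathrm{CExt}(\mathcal{A})$ the combination $\dotplus_i\lambda_i\mathcal{Q}_i$ is the push-out of $\mathcal{Q}_1\times_{\mathcal{A}}\cdots\times_{\mathcal{A}}\mathcal{Q}_n$ along $(\Omega^1_X)^n\to\Omega^1_X$, $(\alpha_i)\mapsto\sum_i\lambda_i\alpha_i$, with the bracket for which the map from the fibre product preserves brackets and the pairing induced by $\sum_i\lambda_i\langle\cdot,\cdot\rangle_i$; on $\mathrm{OExt}_2(\mathcal{A}^\sharp)$ it is the push-out of $\mathcal{B}_1\times_{\mathcal{A}^\sharp}\cdots\times_{\mathcal{A}^\sharp}\mathcal{B}_n$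 along $(\Omega^\bullet_X[2])^n\to\Omega^\bullet_X[2]$, $(\alpha_i)\mapsto\sum_i\lambda_i\alpha_i$, with the bracket for which the map from the fibre product preserves brackets. The coherence isomorphisms are those induced by the maps from the fibre products. (5) For $\mathcal{Q}\in\mathrm{CExt}(\mathcal{A})$ the transgression $\tau\mathcal{Q}$ is the cokernel of $(\int,-\mathrm{id}\otimes\pi^\dagger)\colon\Omega^\bullet_X[\epsilon]\otimes_{\mathcal{O}_X}\Omega^1_X\to\Omega^\bullet_X[2]\oplus\Omega^\bullet_X[\epsilon]\otimes_{\mathcal{O}_X}\mathcal{Q}$, where $\int$ is the morphism of DG $\Omega_X^\bullet$-modules with $\int\alpha\epsilon=\alpha$ for $\alpha\in\Omega^1_X$; $\mathfrak{c}$ is the image of $1\in\Omega^\bullet_X[2]$, the anchor satisfies $\sigma(q\epsilon)=\iota_{\pi(q)}$, and the bracket is determined by centrality of $\mathfrak{c}$ and $[q_1\epsilon,q_2\epsilon]=\langle q_1,q_2\rangle\mathfrak{c}$, $[q_1,q_2\epsilon]=\{q_1,q_2\}\epsilon$, $[q_1\epsilon,q_2]=-d\langle q_1,q_2\rangle\mathfrak{c}+\{q_1,q_2\}\epsilon$.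 (6) For $\mathcal{B}\in\mathrm{OExt}_2(\mathcal{A}^\sharp)$, $\mathtt{Q}(\mathcal{B})$ is the degree $-1$ component $\mathcal{B}^{-1}$ with the bracket $\{a,b\}=[\partial a,b]$ ($\partial$ the differential of $\mathcal{B}$), the pairing given by $\langle a,b\rangle\mathfrak{c}=[a,b]$, the anchor given by $\sigma(a)=\iota_{\pi(a)}$, the co-anchor $\alpha\mapsto\alpha\mathfrak{c}$ and the map to $(\mathcal{A}^\sharp)^{-1}=\mathcal{A}\epsilon\cong\mathcal{A}$. **Proposition.** The DG Lie algebroid $\mathcal{A}^\sharp$, the structures of a $k$-vector space in categories on $\mathrm{CExt}(\mathcal{A})$ and $\mathrm{OExt}_2(\mathcal{A}^\sharp)$, and the functors $$\tau\colon\mathrm{CExt}(\mathcal{A})\longrightarrow\mathrm{OExt}_2(\mathcal{A}^\sharp),\qquad\mathtt{Q}\colon\mathrm{OExt}_2(\mathcal{A}^\sharp)\longrightarrow\mathrm{CExt}(\mathcal{A})$$ described above exist, and $\tau$ and $\mathtt{Q}$ are mutually quasi-inverse equivalences. Both $\tau$ and $\mathtt{Q}$ are morphisms of $k$-vector spaces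 in categories, through the canonical isomorphisms $\tau(\dotplus_i\lambda_i\mathcal{Q}_i)\cong\dotplus_i\lambda_i\,\tau\mathcal{Q}_i$ (which send the class of $(q_i)_i\,\epsilon$ to the class of $(q_i\epsilon)_i$) and $\mathtt{Q}(\dotplus_i\lambda_i\mathcal{B}_i)\cong\dotplus_i\lambda_i\,\mathtt{Q}(\mathcal{B}_i)$ (which are the identity on classes of families $(b_i)_i$ of sections of the $\mathcal{B}_i^{-1}$). In particular, they are morphisms of Picard groupoids. -/

import Mathlib

open TopologicalSpace CategoryTheory
open scoped Manifold ContDiff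

universe u v

set_option linter.unusedSimpArgs false
set_option linter.unusedVariables false

namespace OddTransgression

structure Mnfd (𝕜 𝕂 : Type) [RCLike 𝕜] [RCLike 𝕂] [NormedAlgebra 𝕜 𝕂] where
  E : Type u
  pt : Type u
  [normedGroup : NormedAddCommGroup E]
  [normedSpace : NormedSpace 𝕜 E]
  [finDim : FiniteDimensional 𝕜 E]
  [top : TopologicalSpace pt]
  [charted : ChartedSpace E pt]
  reg : WithTop ℕ∞
  reg_eq : reg = ∞ ∨ reg = ω
  [manifold : IsManifold 𝓘(𝕜, E) reg pt]

attribute [instance] Mnfd.normedGroup Mnfd.normedSpace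
  Mnfd.finDim Mnfd.top Mnfd.charted Mnfd.manifold

noncomputable section

section Manifolds
variable {𝕜 𝕂 : Type} [RCLike 𝕜] [RCLike 𝕂] [NormedAlgebra 𝕜 𝕂] {X : Mnfd.{u} 𝕜 𝕂}

/-- Extension by zero of a function on an open subset. -/
def ext0 {U : Opens X.pt} (f : U → 𝕂) : X.pt → 𝕂 := Function.extend Subtype.val f 0

theorem ext0_apply {U : Opens X.pt} (f : U → 𝕂) (x : U) : ext0 f x = f x :=
  Subtype.val_injective.extend_apply _ _ _

theorem ext0_eventuallyEq {U V : Opens X.pt} (h : V ≤ U) (f : U → 𝕂) (x : V) :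
    ext0 (fun y : V => f ⟨y, h y.2⟩) =ᶠ[nhds (x : X.pt)] ext0 f := by
  filter_upwards [V.isOpen.mem_nhds x.2] with y hy
  rw [show y = ((⟨y, hy⟩ : V) : X.pt) from rfl, ext0_apply]
  exact (ext0_apply f ⟨y, h hy⟩).symm

/-- `f` is of the regularity class of the manifold. -/
def Smooth {U : Opens X.pt} (f : U → 𝕂) : Prop :=
  ∀ x : U, ContMDiffAt 𝓘(𝕜, X.E) 𝓘(𝕜, 𝕂) X.reg (ext0 f) x

theorem Smooth.congr {U : Opens X.pt} {f : U → 𝕂} (F : X.pt → 𝕂)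
    (hF : ∀ x : U, ContMDiffAt 𝓘(𝕜, X.E) 𝓘(𝕜, 𝕂) X.reg F x) (h : ∀ x : U, f x = F x) :
    Smooth f := by
  intro x
  refine (hF x).congr_of_eventuallyEq ?_
  filter_upwards [U.isOpen.mem_nhds x.2] with y hy
  rw [show y = ((⟨y, hy⟩ : U) : X.pt) from rfl, ext0_apply, h]

/-- The functions `U → 𝕂` of the regularity class of the manifold. -/
def fnSubalgebra (U : Opens X.pt) : Subalgebra 𝕂 (U → 𝕂) where
  carrier := {f | Smooth f}
  mul_mem' {f g} hf hg := by
    refine Smooth.congr (fun x => ext0 f x * ext0 g x) (fun x => ?_) (fun x => ?_)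
    · have h : ContDiff 𝕜 X.reg (fun p : 𝕂 × 𝕂 => p.1 * p.2) := contDiff_mul
      exact h.contDiffAt.contMDiffAt.comp (x : X.pt) ((hf x).prodMk_space (hg x))
    · simp [ext0_apply]
  add_mem' {f g} hf hg := by
    refine Smooth.congr (fun x => ext0 f x + ext0 g x) (fun x => ?_) (fun x => ?_)
    · exact (hf x).add (hg x)
    · simp [ext0_apply]
  algebraMap_mem' c := Smooth.congr (fun _ => c) (fun _ => contMDiffAt_const) (fun _ => rfl)

/-- The ring `𝒪_X(U)`. -/
def Fn (U : Opens X.pt) : Type u := fnSubalgebra U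

instance (U : Opens X.pt) : CommRing (Fn U) := inferInstanceAs (CommRing (fnSubalgebra U))

instance (U : Opens X.pt) : Algebra 𝕂 (Fn U) := inferInstanceAs (Algebra 𝕂 (fnSubalgebra U))

/-- The space of `𝕂`-valued covectors (at any point, as `Mathlib` identifies all tangent spaces with
the model space `E`). -/
abbrev Cot (X : Mnfd.{u} 𝕜 𝕂) : Type u := X.E →L[𝕜] 𝕂

/-- The exterior algebra of the space of covectors. -/
abbrev Ext (X : Mnfd.{u} 𝕜 𝕂) : Type u := ExteriorAlgebra 𝕂 (Cot X)

def dAt {U : Opens X.pt} (f : Fn U) (x : U) : Cot X :=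
  mfderiv 𝓘(𝕜, X.E) 𝓘(𝕜, 𝕂) (ext0 f.1) (x : X.pt)

def resFn {U V : Opens X.pt} (h : V ≤ U) (f : Fn U) : Fn V :=
  ⟨fun x => f.1 ⟨x, h x.2⟩, fun x => (f.2 ⟨x, h x.2⟩).congr_of_eventuallyEq
    (ext0_eventuallyEq h f.1 x)⟩

theorem dAt_resFn {U V : Opens X.pt} (h : V ≤ U) (f : Fn U) (x : V) :
    dAt (resFn h f) x = dAt f ⟨x, h x.2⟩ := by
  unfold dAt
  exact (ext0_eventuallyEq h f.1 x).mfderiv_eq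

/-- `𝕂`-valued vector fields on `U`: sections of the (complexified, if `𝕂 ≠ 𝕜`) tangent bundle, a
tangent vector being a functional on covectors. -/
structure VField (U : Opens X.pt) where
  toFun : U → Module.Dual 𝕂 (Cot X)
  smooth : ∀ (V : Opens X.pt) (h : V ≤ U) (f : Fn V),
    Smooth (fun x : V => toFun ⟨x, h x.2⟩ (dAt f x))

end Manifolds

/-! ## Vector spaces in categories -/

structure VectCat (k : Type) [CommRing k] (P : Type u) [Category.{v} P] where
  isIso : ∀ {X Y : P} (f : X ⟶ Y), IsIso f
  lin : ∀ {n : ℕ}, (Fin n → k) → (Fin n → P) → P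
  linMap : ∀ {n : ℕ} (a : Fin n → k) {X Y : Fin n → P}, (∀ i, X i ⟶ Y i) → (lin a X ⟶ lin a Y)
  linMap_id : ∀ {n : ℕ} (a : Fin n → k) (X : Fin n → P), linMap a (fun i => 𝟙 (X i)) = 𝟙 (lin a X)
  linMap_comp : ∀ {n : ℕ} (a : Fin n → k) {X Y Z : Fin n → P} (f : ∀ i, X i ⟶ Y i)
    (g : ∀ i, Y i ⟶ Z i), linMap a (fun i => f i ≫ g i) = linMap a f ≫ linMap a g
  proj : ∀ {n : ℕ} (i : Fin n) (X : Fin n → P), lin (Pi.single i 1) X ⟶ X i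
  proj_naturality : ∀ {n : ℕ} (i : Fin n) {X Y : Fin n → P} (f : ∀ i, X i ⟶ Y i),
    linMap (Pi.single i 1) f ≫ proj i Y = proj i X ≫ f i
  comp : ∀ {m n : ℕ} (a : Fin m → k) (b : Fin m → Fin n → k) (c : Fin n → k),
    (∀ i, c i = ∑ j, a j * b j i) → ∀ X : Fin n → P, lin a (fun j => lin (b j) X) ⟶ lin c X
  comp_naturality : ∀ {m n : ℕ} (a : Fin m → k) (b : Fin m → Fin n → k) (c : Fin n → k)
    (h : ∀ i, c i = ∑ j, a j * b j i) {X Y : Fin n → P} (f : ∀ i, X i ⟶ Y i),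
    linMap a (fun j => linMap (b j) f) ≫ comp a b c h Y = comp a b c h X ≫ linMap c f
  comp_proj : ∀ {m n : ℕ} (j : Fin m) (b : Fin m → Fin n → k)
    (h : ∀ i, b j i = ∑ l, (Pi.single j 1 : Fin m → k) l * b l i) (X : Fin n → P),
    comp (Pi.single j 1) b (b j) h X = proj j (fun l => lin (b l) X)
  proj_comp : ∀ {n : ℕ} (a : Fin n → k)
    (h : ∀ i, a i = ∑ j, a j * (Pi.single j 1 : Fin n → k) i) (X : Fin n → P),
    comp a (fun j => Pi.single j 1) a h X = linMap a (fun j => proj j X)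
  assoc : ∀ {l m n : ℕ} (a : Fin l → k) (b : Fin l → Fin m → k) (c : Fin m → Fin n → k)
    (ab : Fin m → k) (bc : Fin l → Fin n → k) (abc : Fin n → k)
    (hab : ∀ i, ab i = ∑ j, a j * b j i) (hbc : ∀ p i, bc p i = ∑ j, b p j * c j i)
    (h₁ : ∀ i, abc i = ∑ j, ab j * c j i) (h₂ : ∀ i, abc i = ∑ j, a j * bc j i)
    (X : Fin n → P),
    linMap a (fun j => comp (b j) c (bc j) (hbc j) X) ≫ comp a bc abc h₂ X =
      comp a b ab hab (fun i => lin (c i) X) ≫ comp ab c abc h₁ X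

namespace VectCat
variable {k : Type} [CommRing k] {P : Type u} [Category.{v} P] (V : VectCat k P)

/-- A pair of morphisms, as a family. -/
def pair {A B A' B' : P} (f : A ⟶ A') (g : B ⟶ B') : ∀ i : Fin 2, ![A, B] i ⟶ ![A', B'] i
  | 0 => f
  | 1 => g

/-- The sum of two objects. -/
abbrev tensor (A B : P) : P := V.lin ![1, 1] ![A, B]

/-- The zero object. -/
abbrev unit : P := V.lin (n := 0) ![] ![]

def tensorMap {A B A' B' : P} (f : A ⟶ A') (g : B ⟶ B') : V.tensor A B ⟶ V.tensor A' B' :=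
  V.linMap ![1, 1] (pair f g)

/-- A pair of morphisms to combinations of a family, as a family. -/
def pairLin {n : ℕ} {X : Fin n → P} {A B : P} {v w : Fin n → k} (r : A ⟶ V.lin v X)
    (t : B ⟶ V.lin w X) : ∀ i : Fin 2, ![A, B] i ⟶ V.lin (![v, w] i) X
  | 0 => r
  | 1 => t

/-- If `A` and `B` are identified with linear combinations of a family `X`, so is `A + B`. -/
def add {n : ℕ} {X : Fin n → P} {A B : P} {v w : Fin n → k} (r : A ⟶ V.lin v X)
    (t : B ⟶ V.lin w X) (z : Fin n → k) (h : z = v + w) : V.tensor A B ⟶ V.lin z X :=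
  V.linMap ![1, 1] (V.pairLin r t) ≫
    V.comp ![1, 1] ![v, w] z (fun i => by simp [h, Fin.sum_univ_two]) X

/-- The zero object is the combination of any family with zero coefficients. -/
def zero {n : ℕ} (X : Fin n → P) (z : Fin n → k) (h : z = 0) : V.unit ⟶ V.lin z X :=
  V.linMap ![] (fun i => i.elim0) ≫
    V.comp (![] : Fin 0 → k) ![] z (fun i => by simp [h]) X

/-- The identification of `X i` with the combination having the single coefficient `1`. -/
def var {n : ℕ} (X : Fin n → P) (i : Fin n) : X i ⟶ V.lin (Pi.single i 1) X :=
  haveI := V.isIso (V.proj i X)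
  inv (V.proj i X)

/-- Substitution of combinations of `Y` in a combination of `X`. -/
def subst {m n : ℕ} {X : Fin m → P} {Y : Fin n → P} (c : Fin m → Fin n → k)
    (r : ∀ i, X i ⟶ V.lin (c i) Y) (a : Fin m → k) (z : Fin n → k)
    (h : ∀ i, z i = ∑ j, a j * c j i) : V.lin a X ⟶ V.lin z Y :=
  V.linMap a r ≫ V.comp a c z h Y

theorem var_subst {m n : ℕ} {X : Fin m → P} {Y : Fin n → P} (c : Fin m → Fin n → k)
    (r : ∀ i, X i ⟶ V.lin (c i) Y) (i : Fin m) 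
    (h : ∀ p, c i p = ∑ j, (Pi.single i 1 : Fin m → k) j * c j p) :
    V.var X i ≫ V.subst c r (Pi.single i 1) (c i) h = r i := by
  have := V.isIso (V.proj i X)
  rw [subst, V.comp_proj, V.proj_naturality, var, IsIso.inv_hom_id_assoc]

theorem add_subst {m n : ℕ} {X : Fin m → P} {Y : Fin n → P} (c : Fin m → Fin n → k)
    (r : ∀ i, X i ⟶ V.lin (c i) Y) {A B : P} {v w : Fin m → k} (s : A ⟶ V.lin v X)
    (t : B ⟶ V.lin w X) (z : Fin m → k) (h : z = v + w) (v' w' z' : Fin n → k)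
    (hv : ∀ i, v' i = ∑ j, v j * c j i) (hw : ∀ i, w' i = ∑ j, w j * c j i)
    (hz : ∀ i, z' i = ∑ j, z j * c j i) (h' : z' = v' + w') :
    V.add s t z h ≫ V.subst c r z z' hz =
      V.add (s ≫ V.subst c r v v' hv) (t ≫ V.subst c r w w' hw) z' h' := by
  have e : V.pairLin (s ≫ V.subst c r v v' hv) (t ≫ V.subst c r w w' hw) =
      fun i => V.pairLin s t i ≫ (V.linMap (![v, w] i) r ≫
        V.comp (![v, w] i) c (![v', w'] i) (by fin_cases i <;> assumption) Y) := by
    funext i; fin_cases i <;> rfl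
  rw [add, add, e, V.linMap_comp, V.linMap_comp, subst]
  simp only [Category.assoc]
  rw [V.assoc ![1, 1] ![v, w] c z ![v', w'] z' (fun i => by simp [h, Fin.sum_univ_two]) _ hz
    (fun i => by simp [h', Fin.sum_univ_two]) Y]
  rw [← Category.assoc (V.linMap ![1, 1] fun j => V.linMap (![v, w] j) r),
    V.comp_naturality ![1, 1] ![v, w] z]
  simp only [Category.assoc]

theorem zero_subst {m n : ℕ} {X : Fin m → P} {Y : Fin n → P} (c : Fin m → Fin n → k)
    (r : ∀ i, X i ⟶ V.lin (c i) Y) (z : Fin m → k) (h : z = 0) (z' : Fin n → k)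
    (hz : ∀ i, z' i = ∑ j, z j * c j i) (h' : z' = 0) :
    V.zero X z h ≫ V.subst c r z z' hz = V.zero Y z' h' := by
  have e : (fun i => i.elim0 : ∀ i : Fin 0, (![] : Fin 0 → P) i ⟶ V.lin ((![] : Fin 0 → Fin n → k) i) Y) =
      fun i => (fun i => i.elim0 : ∀ i : Fin 0, (![] : Fin 0 → P) i ⟶ V.lin ((![] : Fin 0 → Fin m → k) i) X) i ≫ (V.linMap ((![] : Fin 0 → Fin m → k) i) r ≫
        V.comp ((![] : Fin 0 → Fin m → k) i) c ((![] : Fin 0 → Fin n → k) i) (fun _ => i.elim0) Y) := by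
    funext i; exact i.elim0
  rw [zero, zero, e, V.linMap_comp, V.linMap_comp, subst]
  simp only [Category.assoc]
  rw [V.assoc ![] ![] c z ![] z' (fun i => by simp [h]) _ hz
    (fun i => by simp [h']) Y]
  rw [← Category.assoc (V.linMap ![] fun j => V.linMap ((![] : Fin 0 → Fin m → k) j) r),
    V.comp_naturality ![] ![] z]
  simp only [Category.assoc]

theorem tensorMap_add {n : ℕ} {X : Fin n → P} {A B A' B' : P} {v w : Fin n → k} (f : A' ⟶ A)
    (g : B' ⟶ B) (r : A ⟶ V.lin v X) (t : B ⟶ V.lin w X) (z : Fin n → k) (h : z = v + w) :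
    V.tensorMap f g ≫ V.add r t z h = V.add (f ≫ r) (g ≫ t) z h := by
  have e : V.pairLin (f ≫ r) (g ≫ t) = fun i => pair f g i ≫ V.pairLin r t i := by
    funext i; fin_cases i <;> rfl
  rw [tensorMap, add, add, e, V.linMap_comp, Category.assoc]

/-- Identifications of `A`, `B` with combinations of `X` having the same coefficients. -/
def via {n : ℕ} {X : Fin n → P} {A B : P} {z : Fin n → k} (r : A ⟶ V.lin z X)
    (t : B ⟶ V.lin z X) : A ⟶ B :=
  haveI := V.isIso t
  r ≫ inv t

theorem via_comp {n : ℕ} {X : Fin n → P} {A B : P} {z : Fin n → k} (r : A ⟶ V.lin z X)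
    (t : B ⟶ V.lin z X) : V.via r t ≫ t = r := by
  have := V.isIso t
  simp [via]

theorem via_eq {n : ℕ} {X : Fin n → P} {A B : P} {z : Fin n → k} (r : A ⟶ V.lin z X)
    (t : B ⟶ V.lin z X) (f : A ⟶ B) (h : f ≫ t = r) : V.via r t = f := by
  have := V.isIso t
  simp [via, ← h]

/-- The associativity constraint. -/
def assocHom (A B C : P) : V.tensor (V.tensor A B) C ⟶ V.tensor A (V.tensor B C) :=
  V.via (X := ![A, B, C])
    (V.add (V.add (V.var ![A, B, C] 0) (V.var ![A, B, C] 1) (Pi.single 0 1 + Pi.single 1 1) rfl)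
      (V.var ![A, B, C] 2) (Pi.single 0 1 + Pi.single 1 1 + Pi.single 2 1) rfl)
    (V.add (V.var ![A, B, C] 0)
      (V.add (V.var ![A, B, C] 1) (V.var ![A, B, C] 2) (Pi.single 1 1 + Pi.single 2 1) rfl)
      (Pi.single 0 1 + Pi.single 1 1 + Pi.single 2 1) (by abel))

/-- The commutativity constraint. -/
def braidHom (A B : P) : V.tensor A B ⟶ V.tensor B A :=
  V.via (X := ![A, B])
    (V.add (V.var ![A, B] 0) (V.var ![A, B] 1) (Pi.single 0 1 + Pi.single 1 1) rfl)
    (V.add (V.var ![A, B] 1) (V.var ![A, B] 0) (Pi.single 0 1 + Pi.single 1 1) (by abel))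

/-- The left unit constraint. -/
def leftHom (A : P) : V.tensor V.unit A ⟶ A :=
  V.via (X := ![A])
    (V.add (V.zero ![A] 0 rfl) (V.var ![A] 0) (Pi.single 0 1) (by abel)) (V.var ![A] 0)

/-- The right unit constraint. -/
def rightHom (A : P) : V.tensor A V.unit ⟶ A :=
  V.via (X := ![A])
    (V.add (V.var ![A] 0) (V.zero ![A] 0 rfl) (Pi.single 0 1) (by abel)) (V.var ![A] 0)

section
variable {n : ℕ} {Y : Fin n → P} {A B C : P} {a b c : Fin n → k}
  (r : A ⟶ V.lin a Y) (s : B ⟶ V.lin b Y) (t : C ⟶ V.lin c Y)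

theorem assocHom_add (ab bc z : Fin n → k) (h₁ : ab = a + b) (h₂ : bc = b + c) (h₃ : z = ab + c)
    (h₄ : z = a + bc) :
    V.assocHom A B C ≫ V.add r (V.add s t bc h₂) z h₄ = V.add (V.add r s ab h₁) t z h₃ := by
  let R : ∀ i, ![A, B, C] i ⟶ V.lin (![a, b, c] i) Y := fun i => match i with
    | 0 => r | 1 => s | 2 => t
  have e0 := V.var_subst ![a, b, c] R 0 (fun p => by simp [Pi.single_apply])
  have e1 := V.var_subst ![a, b, c] R 1 (fun p => by simp [Pi.single_apply])
  have e2 := V.var_subst ![a, b, c] R 2 (fun p => by simp [Pi.single_apply])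
  have hL := V.add_subst ![a, b, c] R
    (V.add (V.var ![A, B, C] 0) (V.var ![A, B, C] 1) (Pi.single 0 1 + Pi.single 1 1) rfl)
    (V.var ![A, B, C] 2) (Pi.single 0 1 + Pi.single 1 1 + Pi.single 2 1) rfl ab c z
    (fun i => by simp [h₁, Fin.sum_univ_three, Pi.single_apply]) (fun i => by simp [Fin.sum_univ_three, Pi.single_apply])
    (fun i => by simp [h₁, h₃, Fin.sum_univ_three, Pi.single_apply]) h₃
  have hL' := V.add_subst ![a, b, c] R (V.var ![A, B, C] 0) (V.var ![A, B, C] 1)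
    (Pi.single 0 1 + Pi.single 1 1) rfl a b ab
    (fun i => by simp [Fin.sum_univ_three, Pi.single_apply]) (fun i => by simp [Fin.sum_univ_three, Pi.single_apply])
    (fun i => by simp [h₁, Fin.sum_univ_three, Pi.single_apply]) h₁
  have hR := V.add_subst ![a, b, c] R (V.var ![A, B, C] 0)
    (V.add (V.var ![A, B, C] 1) (V.var ![A, B, C] 2) (Pi.single 1 1 + Pi.single 2 1) rfl)
    (Pi.single 0 1 + Pi.single 1 1 + Pi.single 2 1) (by abel) a bc z
    (fun i => by simp [Fin.sum_univ_three, Pi.single_apply]) (fun i => by simp [h₂, Fin.sum_univ_three, Pi.single_apply])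
    (fun i => by simp [h₁, h₃, Fin.sum_univ_three, Pi.single_apply]) h₄
  have hR' := V.add_subst ![a, b, c] R (V.var ![A, B, C] 1) (V.var ![A, B, C] 2)
    (Pi.single 1 1 + Pi.single 2 1) rfl b c bc
    (fun i => by simp [Fin.sum_univ_three, Pi.single_apply]) (fun i => by simp [Fin.sum_univ_three, Pi.single_apply])
    (fun i => by simp [h₂, Fin.sum_univ_three, Pi.single_apply]) h₂
  erw [hL', e0, e1, e2] at hL
  erw [hR', e0, e1, e2] at hR
  refine Eq.trans ?_ hL
  erw [← hR, ← Category.assoc, assocHom, V.via_comp]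
  rfl

theorem braidHom_add (z : Fin n → k) (h₁ : z = a + b) (h₂ : z = b + a) :
    V.braidHom A B ≫ V.add s r z h₂ = V.add r s z h₁ := by
  let R : ∀ i, ![A, B] i ⟶ V.lin (![a, b] i) Y := fun i => match i with
    | 0 => r | 1 => s
  have e0 := V.var_subst ![a, b] R 0 (fun p => by simp [Pi.single_apply])
  have e1 := V.var_subst ![a, b] R 1 (fun p => by simp [Pi.single_apply])
  have hL := V.add_subst ![a, b] R (V.var ![A, B] 0) (V.var ![A, B] 1)
    (Pi.single 0 1 + Pi.single 1 1) rfl a b z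
    (fun i => by simp [Pi.single_apply]) (fun i => by simp [Pi.single_apply])
    (fun i => by simp [h₁, Pi.single_apply]) h₁
  have hR := V.add_subst ![a, b] R (V.var ![A, B] 1) (V.var ![A, B] 0)
    (Pi.single 0 1 + Pi.single 1 1) (by abel) b a z
    (fun i => by simp [Pi.single_apply]) (fun i => by simp [Pi.single_apply])
    (fun i => by simp [h₁, Pi.single_apply]) h₂
  erw [e0, e1] at hL
  erw [e0, e1] at hR
  refine Eq.trans ?_ hL
  erw [← hR, ← Category.assoc, braidHom, V.via_comp]
  rfl

theorem leftHom_comp (z : Fin n → k) (hz : z = 0) (h : a = z + a) :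
    V.leftHom A ≫ r = V.add (V.zero Y z hz) r a h := by
  let R : ∀ i, ![A] i ⟶ V.lin (![a] i) Y := fun i => match i with
    | 0 => r
  have e0 := V.var_subst ![a] R 0 (fun p => by simp [Pi.single_apply])
  have hL := V.add_subst ![a] R (V.zero ![A] 0 rfl) (V.var ![A] 0) (Pi.single 0 1) (by abel) z a a
    (fun i => by simp [hz]) (fun i => by simp [Pi.single_apply])
    (fun i => by simp [Pi.single_apply]) h
  rw [V.zero_subst _ _ _ _ _ _ hz] at hL
  erw [e0] at hL
  refine Eq.trans ?_ hL
  refine (congrArg (fun q => V.leftHom A ≫ q) e0.symm).trans ?_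
  erw [← Category.assoc, leftHom, V.via_comp]
  rfl

theorem rightHom_comp (z : Fin n → k) (hz : z = 0) (h : a = a + z) :
    V.rightHom A ≫ r = V.add r (V.zero Y z hz) a h := by
  let R : ∀ i, ![A] i ⟶ V.lin (![a] i) Y := fun i => match i with
    | 0 => r
  have e0 := V.var_subst ![a] R 0 (fun p => by simp [Pi.single_apply])
  have hL := V.add_subst ![a] R (V.var ![A] 0) (V.zero ![A] 0 rfl) (Pi.single 0 1) (by abel) a z a
    (fun i => by simp [Pi.single_apply]) (fun i => by simp [hz])
    (fun i => by simp [Pi.single_apply]) h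
  rw [V.zero_subst _ _ _ _ _ _ hz] at hL
  erw [e0] at hL
  refine Eq.trans ?_ hL
  refine (congrArg (fun q => V.rightHom A ≫ q) e0.symm).trans ?_
  erw [← Category.assoc, rightHom, V.via_comp]
  rfl

end

/-- A morphism into a combination is monic. -/
theorem cancel {n : ℕ} {Y : Fin n → P} {A B : P} {a : Fin n → k} (t : B ⟶ V.lin a Y) {f g : A ⟶ B}
    (h : f ≫ t = g ≫ t) : f = g := by
  have := V.isIso t
  exact (cancel_mono t).1 h

theorem tensorMap_id (A B : P) : V.tensorMap (𝟙 A) (𝟙 B) = 𝟙 _ := by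
  rw [tensorMap, ← V.linMap_id]
  congr 1; funext i; fin_cases i <;> rfl

theorem tensorMap_comp {A B A' B' A'' B'' : P} (f : A ⟶ A') (g : B ⟶ B') (f' : A' ⟶ A'')
    (g' : B' ⟶ B'') : V.tensorMap (f ≫ f') (g ≫ g') = V.tensorMap f g ≫ V.tensorMap f' g' := by
  rw [tensorMap, tensorMap, tensorMap, ← V.linMap_comp]
  congr 1; funext i; fin_cases i <;> rfl

/-- Any four objects are combinations of one family. -/
theorem exists_family (A B C D : P) : ∃ (n : ℕ) (Y : Fin n → P) (a b c d : Fin n → k)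
    (_ : A ⟶ V.lin a Y) (_ : B ⟶ V.lin b Y) (_ : C ⟶ V.lin c Y) (_ : D ⟶ V.lin d Y), True :=
  ⟨4, ![A, B, C, D], _, _, _, _, V.var ![A, B, C, D] 0, V.var ![A, B, C, D] 1,
    V.var ![A, B, C, D] 2, V.var ![A, B, C, D] 3, trivial⟩

theorem assocHom_naturality {A A' B B' C C' : P} (f : A ⟶ A') (g : B ⟶ B') (h : C ⟶ C') :
    V.tensorMap (V.tensorMap f g) h ≫ V.assocHom A' B' C' =
      V.assocHom A B C ≫ V.tensorMap f (V.tensorMap g h) := by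
  obtain ⟨n, Y, a, b, c, -, r, s, t, -, -⟩ := V.exists_family A' B' C' A'
  apply V.cancel (V.add r (V.add s t _ rfl) _ rfl)
  rw [Category.assoc, Category.assoc,
    V.assocHom_add _ _ _ _ _ _ rfl rfl (add_assoc a b c).symm, V.tensorMap_add, V.tensorMap_add,
    V.tensorMap_add, V.tensorMap_add, V.assocHom_add _ _ _ _ _ _ rfl rfl (add_assoc a b c).symm]

theorem leftHom_naturality {A B : P} (f : A ⟶ B) :
    V.tensorMap (𝟙 V.unit) f ≫ V.leftHom B = V.leftHom A ≫ f := by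
  obtain ⟨n, Y, a, -, -, -, r, -, -, -, -⟩ := V.exists_family B B B B
  apply V.cancel r
  rw [Category.assoc, Category.assoc, V.leftHom_comp r 0 rfl (zero_add a).symm, V.tensorMap_add,
    V.leftHom_comp (f ≫ r) 0 rfl (zero_add a).symm, Category.id_comp]

theorem rightHom_naturality {A B : P} (f : A ⟶ B) :
    V.tensorMap f (𝟙 V.unit) ≫ V.rightHom B = V.rightHom A ≫ f := by
  obtain ⟨n, Y, a, -, -, -, r, -, -, -, -⟩ := V.exists_family B B B B
  apply V.cancel r
  rw [Category.assoc, Category.assoc, V.rightHom_comp r 0 rfl (add_zero a).symm, V.tensorMap_add,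
    V.rightHom_comp (f ≫ r) 0 rfl (add_zero a).symm, Category.id_comp]

theorem braidHom_naturality {A A' B B' : P} (f : A ⟶ A') (g : B ⟶ B') :
    V.tensorMap f g ≫ V.braidHom A' B' = V.braidHom A B ≫ V.tensorMap g f := by
  obtain ⟨n, Y, a, b, -, -, r, s, -, -, -⟩ := V.exists_family A' B' B' B'
  apply V.cancel (V.add s r _ rfl)
  rw [Category.assoc, Category.assoc, V.braidHom_add _ _ _ (add_comm b a), V.tensorMap_add,
    V.tensorMap_add, V.braidHom_add _ _ _ (add_comm b a)]

theorem assocHom_pentagon (A B C D : P) :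
    V.tensorMap (V.assocHom A B C) (𝟙 D) ≫ V.assocHom A (V.tensor B C) D ≫
      V.tensorMap (𝟙 A) (V.assocHom B C D) =
    V.assocHom (V.tensor A B) C D ≫ V.assocHom A B (V.tensor C D) := by
  obtain ⟨n, Y, a, b, c, d, r, s, t, q, -⟩ := V.exists_family A B C D
  apply V.cancel (V.add r (V.add s (V.add t q (c + d) rfl) (b + (c + d)) rfl)
    (a + (b + (c + d))) rfl)
  simp only [Category.assoc]
  rw [V.tensorMap_add, Category.id_comp,
    V.assocHom_add s t q (b + c) (c + d) _ rfl rfl (add_assoc b c d).symm,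
    V.assocHom_add r (V.add s t (b + c) rfl) q (a + (b + c)) _ _ rfl (add_assoc b c d).symm
      (by abel),
    V.tensorMap_add, Category.id_comp,
    V.assocHom_add r s t (a + b) (b + c) _ rfl rfl (add_assoc a b c).symm,
    V.assocHom_add r s (V.add t q (c + d) rfl) (a + b) _ _ rfl rfl (by abel),
    V.assocHom_add (V.add r s (a + b) rfl) t q (a + (b + c)) (c + d) _ (by abel) rfl (by abel)]

theorem assocHom_triangle (A B : P) :
    V.assocHom A V.unit B ≫ V.tensorMap (𝟙 A) (V.leftHom B) = V.tensorMap (V.rightHom A) (𝟙 B) := by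
  obtain ⟨n, Y, a, b, -, -, r, s, -, -, -⟩ := V.exists_family A B B B
  apply V.cancel (V.add r s _ rfl)
  rw [Category.assoc, V.tensorMap_add, V.tensorMap_add, Category.id_comp, Category.id_comp,
    V.leftHom_comp s 0 rfl (zero_add b).symm, V.rightHom_comp r 0 rfl (add_zero a).symm,
    V.assocHom_add r (V.zero Y 0 rfl) s a b _ (add_zero a).symm (zero_add b).symm rfl]

theorem braidHom_symm (A B : P) : V.braidHom A B ≫ V.braidHom B A = 𝟙 (V.tensor A B) := by
  obtain ⟨n, Y, a, b, -, -, r, s, -, -, -⟩ := V.exists_family A B B B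
  apply V.cancel (V.add r s _ rfl)
  rw [Category.assoc, V.braidHom_add s r _ (add_comm a b), V.braidHom_add r s _ rfl,
    Category.id_comp]

theorem braidHom_hexagon (A B C : P) :
    V.assocHom A B C ≫ V.braidHom A (V.tensor B C) ≫ V.assocHom B C A =
      V.tensorMap (V.braidHom A B) (𝟙 C) ≫ V.assocHom B A C ≫
        V.tensorMap (𝟙 B) (V.braidHom A C) := by
  obtain ⟨n, Y, a, b, c, -, r, s, t, -, -⟩ := V.exists_family A B C C
  apply V.cancel (V.add s (V.add t r (a + c) (add_comm a c)) (a + b + c) (by abel))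
  simp only [Category.assoc]
  rw [V.tensorMap_add, Category.id_comp, V.braidHom_add r t (a + c) rfl,
    V.assocHom_add s r t (a + b) _ _ (add_comm a b) rfl rfl, V.tensorMap_add, Category.id_comp,
    V.braidHom_add r s (a + b) rfl,
    V.assocHom_add s t r (b + c) (a + c) _ rfl (add_comm a c) (by abel),
    V.braidHom_add r (V.add s t (b + c) rfl) _ (by abel),
    V.assocHom_add r s t (a + b) (b + c) _ rfl rfl rfl]

/-- All morphisms are isomorphisms. -/
def iso {A B : P} (f : A ⟶ B) : A ≅ B :=
  haveI := V.isIso f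
  asIso f

theorem iso_inv_comp {A B C : P} (f : A ⟶ B) (g : B ⟶ C) (h : A ⟶ C) (e : f ≫ g = h) :
    (V.iso f).inv ≫ h = g := by
  rw [← e, ← Category.assoc]
  exact (congrArg (· ≫ g) (V.iso f).inv_hom_id).trans (Category.id_comp g)

theorem braidHom_hexagon' (A B C : P) :
    (V.iso (V.assocHom A B C)).inv ≫ V.braidHom (V.tensor A B) C ≫
        (V.iso (V.assocHom C A B)).inv =
      V.tensorMap (𝟙 A) (V.braidHom B C) ≫ (V.iso (V.assocHom A C B)).inv ≫
        V.tensorMap (V.braidHom A C) (𝟙 B) := by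
  obtain ⟨n, Y, a, b, c, -, r, s, t, -, -⟩ := V.exists_family A B C C
  apply V.cancel (V.add (V.add t r (a + c) (add_comm a c)) s (a + b + c) (by abel))
  simp only [Category.assoc]
  rw [V.iso_inv_comp _ _ _ (V.assocHom_add t r s (a + c) (a + b) (a + b + c) (add_comm a c) rfl
      (by abel) (by abel)), V.tensorMap_add, Category.id_comp, V.braidHom_add r t (a + c) rfl,
    V.iso_inv_comp _ _ _ (V.assocHom_add r t s (a + c) (b + c) (a + b + c) rfl (add_comm b c)
      (by abel) (by abel)), V.tensorMap_add, Category.id_comp, V.braidHom_add s t (b + c) rfl,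
    V.braidHom_add (V.add r s (a + b) rfl) t (a + b + c) rfl,
    V.iso_inv_comp _ _ _ (V.assocHom_add r s t (a + b) (b + c) (a + b + c) rfl rfl rfl
      (by abel))]

/-- The monoidal structure given by the sum. -/
@[reducible] def monoidal : MonoidalCategory P where
  tensorObj A B := V.tensor A B
  whiskerLeft A _ _ f := V.tensorMap (𝟙 A) f
  whiskerRight f B := V.tensorMap f (𝟙 B)
  tensorHom f g := V.tensorMap f g
  tensorUnit := V.unit
  associator A B C := V.iso (V.assocHom A B C)
  leftUnitor A := V.iso (V.leftHom A)
  rightUnitor A := V.iso (V.rightHom A)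
  tensorHom_def f g := by
    rw [← V.tensorMap_comp, Category.id_comp, Category.comp_id]
  id_tensorHom_id A B := V.tensorMap_id A B
  tensorHom_comp_tensorHom f g f' g' := (V.tensorMap_comp f g f' g').symm
  whiskerLeft_id A B := V.tensorMap_id A B
  id_whiskerRight A B := V.tensorMap_id A B
  associator_naturality f g h := V.assocHom_naturality f g h
  leftUnitor_naturality f := V.leftHom_naturality f
  rightUnitor_naturality f := V.rightHom_naturality f
  pentagon A B C D := V.assocHom_pentagon A B C D
  triangle A B := V.assocHom_triangle A B

/-- The symmetry of the sum. -/
@[reducible] def symmetric : letI := V.monoidal; SymmetricCategory P :=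
  letI := V.monoidal
  { braiding := fun A B => V.iso (V.braidHom A B)
    braiding_naturality_right := fun A _ _ f => V.braidHom_naturality (𝟙 A) f
    braiding_naturality_left := fun f C => V.braidHom_naturality f (𝟙 C)
    hexagon_forward := fun A B C => V.braidHom_hexagon A B C
    hexagon_reverse := fun A B C => V.braidHom_hexagon' A B C
    symmetry := fun A B => V.braidHom_symm A B }

end VectCat

/-- Picard groupoids: symmetric monoidal groupoids in which all objects are invertible. -/
structure PicardGroupoid (P : Type u) [Category.{v} P] where
  isIso : ∀ {X Y : P} (f : X ⟶ Y), IsIso f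
  monoidal : MonoidalCategory P
  symmetric : SymmetricCategory P
  invertible : ∀ X : P, ∃ Y : P, Nonempty (monoidal.tensorObj X Y ≅ monoidal.tensorUnit)

/-- The structure of a morphism of Picard groupoids (a braided monoidal functor) on `F`. -/
abbrev PicardFunctor {P : Type u} [Category.{v} P] {Q : Type u} [Category.{v} Q]
    (V : PicardGroupoid P) (W : PicardGroupoid Q) (F : P ⥤ Q) :=
  letI := V.monoidal
  letI := V.symmetric
  letI := W.monoidal
  letI := W.symmetric
  F.Braided

/-- The Picard groupoid underlying a vector space in categories. -/
def VectCat.picard {k : Type} [CommRing k] {P : Type u} [Category.{v} P] (V : VectCat k P) :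
    PicardGroupoid P where
  isIso f := V.isIso f
  monoidal := V.monoidal
  symmetric := V.symmetric
  invertible A := ⟨V.lin ![-1] ![A], ⟨V.iso (V.via
    (V.add (V.var ![A] 0) (𝟙 (V.lin ![-1] ![A])) 0 (by ext i; fin_cases i; simp))
    (V.zero ![A] 0 rfl))⟩⟩

/-- The structure of a morphism of `k`-vector spaces in categories on a functor `F`: natural
isomorphisms `F (∔ aᵢ Xᵢ) ≅ ∔ aᵢ F Xᵢ` compatible with the structures. -/
structure LinearFunctor {k : Type} [CommRing k] {P : Type u} [Category.{v} P] {Q : Type u}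
    [Category.{v} Q] (V : VectCat k P) (W : VectCat k Q) (F : P ⥤ Q) where
  mu : ∀ {n : ℕ} (a : Fin n → k) (X : Fin n → P),
    F.obj (V.lin a X) ⟶ W.lin a (fun i => F.obj (X i))
  naturality : ∀ {n : ℕ} (a : Fin n → k) {X Y : Fin n → P} (f : ∀ i, X i ⟶ Y i),
    F.map (V.linMap a f) ≫ mu a Y = mu a X ≫ W.linMap a (fun i => F.map (f i))
  proj : ∀ {n : ℕ} (i : Fin n) (X : Fin n → P),
    mu (Pi.single i 1) X ≫ W.proj i (fun i => F.obj (X i)) = F.map (V.proj i X)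
  comp : ∀ {m n : ℕ} (a : Fin m → k) (b : Fin m → Fin n → k) (c : Fin n → k)
    (h : ∀ i, c i = ∑ j, a j * b j i) (X : Fin n → P),
    F.map (V.comp a b c h X) ≫ mu c X =
      mu a (fun j => V.lin (b j) X) ≫ W.linMap a (fun j => mu (b j) X) ≫
        W.comp a b c h (fun i => F.obj (X i))

/-- The isomorphisms `F X + F Y ≅ F (X + Y)` of the morphism `B` of Picard groupoids are the inverses
of those of `L`. -/
def LinearFunctor.IsUnderlying {k : Type} [CommRing k] {P : Type u} [Category.{v} P] {Q : Type u}
    [Category.{v} Q] {V : VectCat k P} {W : VectCat k Q} {F : P ⥤ Q} (L : LinearFunctor V W F)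
    (B : PicardFunctor V.picard W.picard F) : Prop :=
  letI := V.picard.monoidal
  letI := V.picard.symmetric
  letI := W.picard.monoidal
  letI := W.picard.symmetric
  letI := B
  ∀ X Y : P, (L.mu ![1, 1] ![X, Y] ≫
    W.linMap ![1, 1] (fun | 0 => 𝟙 (F.obj X) | 1 => 𝟙 (F.obj Y) :
      ∀ i, F.obj (![X, Y] i) ⟶ ![F.obj X, F.obj Y] i)) ≫ Functor.LaxMonoidal.μ F X Y =
    𝟙 (F.obj (V.tensor X Y))

/-! ## Sheaves, modules, differential forms -/

section Geometry
variable {𝕜 𝕂 : Type} [RCLike 𝕜] [RCLike 𝕂] [NormedAlgebra 𝕜 𝕂] {X : Mnfd.{u} 𝕜 𝕂}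

instance (U : Opens X.pt) : Module (Fn U) (U → Ext X) :=
  inferInstanceAs (Module (fnSubalgebra U) (U → Ext X))

/-- Restriction of functions with values in the exterior algebra of the cotangent space. -/
def resExt {U V : Opens X.pt} (h : V ≤ U) : (U → Ext X) →+ (V → Ext X) where
  toFun w x := w ⟨x, h x.2⟩
  map_zero' := rfl
  map_add' _ _ := rfl

/-- The products `f dg₁ ∧ ⋯ ∧ dg_k` on `V` (none if `k < 0`). -/
def monomials (k : ℤ) (V : Opens X.pt) : Set (V → Ext X) :=
  {w | ∃ (f : Fn V) (L : List (Fn V)), (L.length : ℤ) = k ∧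
    w = fun x => f.1 x • (L.map fun g => ExteriorAlgebra.ι 𝕂 (dAt g x)).prod}

/-- The pairs `(f dg₁ ∧ ⋯ ∧ dg_k, df ∧ dg₁ ∧ ⋯ ∧ dg_k)` on `V`. -/
def dMonomials (k : ℤ) (V : Opens X.pt) : Set ((V → Ext X) × (V → Ext X)) :=
  {w | ∃ (f : Fn V) (L : List (Fn V)), (L.length : ℤ) = k ∧
    w.1 = (fun x => f.1 x • (L.map fun g => ExteriorAlgebra.ι 𝕂 (dAt g x)).prod) ∧
    w.2 = fun x => ExteriorAlgebra.ι 𝕂 (dAt f x) *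
      (L.map fun g => ExteriorAlgebra.ι 𝕂 (dAt g x)).prod}

theorem resExt_monomials {k : ℤ} {U V : Opens X.pt} (h : V ≤ U) {w : U → Ext X}
    (hw : w ∈ AddSubgroup.closure (monomials k U)) :
    resExt h w ∈ AddSubgroup.closure (monomials k V) := by
  induction hw using AddSubgroup.closure_induction with
  | mem w hw =>
    obtain ⟨f, L, hL, rfl⟩ := hw
    refine AddSubgroup.subset_closure ⟨resFn h f, L.map (resFn h), by simpa using hL, ?_⟩
    funext x
    simp only [List.map_map, Function.comp_def, dAt_resFn]
    rfl
  | zero => rw [map_zero]; exact zero_mem _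
  | add a b _ _ ha hb => rw [map_add]; exact add_mem ha hb
  | neg a _ ha => rw [map_neg]; exact neg_mem ha

theorem smul_monomials {k : ℤ} {U : Opens X.pt} (f : Fn U) {w : U → Ext X}
    (hw : w ∈ AddSubgroup.closure (monomials k U)) :
    f • w ∈ AddSubgroup.closure (monomials k U) := by
  induction hw using AddSubgroup.closure_induction with
  | mem w hw =>
    obtain ⟨g, L, hL, rfl⟩ := hw
    refine AddSubgroup.subset_closure ⟨f * g, L, hL, ?_⟩
    funext x
    exact (mul_smul (f.1 x) (g.1 x) _).symm
  | zero => rw [smul_zero]; exact zero_mem _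
  | add a b _ _ ha hb => rw [smul_add]; exact add_mem ha hb
  | neg a _ ha => rw [smul_neg]; exact neg_mem ha

theorem mul_monomials {k l m : ℤ} (hm : k + l = m) {U : Opens X.pt} {w w' : U → Ext X}
    (hw : w ∈ AddSubgroup.closure (monomials k U))
    (hw' : w' ∈ AddSubgroup.closure (monomials l U)) :
    w * w' ∈ AddSubgroup.closure (monomials m U) := by
  induction hw using AddSubgroup.closure_induction with
  | mem w hw =>
    induction hw' using AddSubgroup.closure_induction with
    | mem w' hw' =>
      obtain ⟨g, L, hL, rfl⟩ := hw
      obtain ⟨g', L', hL', rfl⟩ := hw'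
      refine AddSubgroup.subset_closure ⟨g * g', L ++ L', by simp [hL, hL', hm], ?_⟩
      funext x
      simp only [Pi.mul_apply, List.map_append, List.prod_append, smul_mul_smul_comm]
      rfl
    | zero => rw [mul_zero]; exact zero_mem _
    | add a b _ _ ha hb => rw [mul_add]; exact add_mem ha hb
    | neg a _ ha => rw [mul_neg]; exact neg_mem ha
  | zero => rw [zero_mul]; exact zero_mem _
  | add a b _ _ ha hb => rw [add_mul]; exact add_mem ha hb
  | neg a _ ha => rw [neg_mul]; exact neg_mem ha

/-- Differential forms of degree `k` on `U`, as functions with values in the exterior algebra. -/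
def formSubmodule (k : ℤ) (U : Opens X.pt) : Submodule (Fn U) (U → Ext X) where
  carrier := {w | ∀ x : U, ∃ (V : Opens X.pt) (h : V ≤ U), (x : X.pt) ∈ V ∧
    resExt h w ∈ AddSubgroup.closure (monomials k V)}
  zero_mem' x := ⟨U, le_rfl, x.2, zero_mem _⟩
  add_mem' {a b} ha hb x := by
    obtain ⟨V, hV, hx, ha⟩ := ha x
    obtain ⟨V', hV', hx', hb⟩ := hb x
    refine ⟨V ⊓ V', inf_le_left.trans hV, ⟨hx, hx'⟩, ?_⟩
    exact add_mem (resExt_monomials (inf_le_left : V ⊓ V' ≤ V) ha)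
      (resExt_monomials (inf_le_right : V ⊓ V' ≤ V') hb)
  smul_mem' f a ha x := by
    obtain ⟨V, hV, hx, ha⟩ := ha x
    exact ⟨V, hV, hx, smul_monomials (resFn hV f) ha⟩

/-- Differential forms of degree `k` on `U`. -/
def Form (k : ℤ) (U : Opens X.pt) : Type u := formSubmodule k U

instance (k : ℤ) (U : Opens X.pt) : AddCommGroup (Form k U) :=
  inferInstanceAs (AddCommGroup (formSubmodule k U))

instance (k : ℤ) (U : Opens X.pt) : Module (Fn U) (Form k U) :=
  inferInstanceAs (Module (Fn U) (formSubmodule k U))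

namespace Form
variable {U V : Opens X.pt}

def res {k : ℤ} (h : V ≤ U) : Form k U →+ Form k V where
  toFun w := ⟨resExt h w.1, fun x => by
    obtain ⟨V', hV', hx, hw⟩ := w.2 ⟨x, h x.2⟩
    exact ⟨V ⊓ V', inf_le_left, ⟨x.2, hx⟩, resExt_monomials (inf_le_right : V ⊓ V' ≤ V') hw⟩⟩
  map_zero' := rfl
  map_add' _ _ := rfl

def mul {k l m : ℤ} (hm : k + l = m) (w : Form k U) (w' : Form l U) : Form m U :=
  ⟨w.1 * w'.1, fun x => by
    obtain ⟨V, hV, hx, ha⟩ := w.2 x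
    obtain ⟨V', hV', hx', hb⟩ := w'.2 x
    refine ⟨V ⊓ V', inf_le_left.trans hV, ⟨hx, hx'⟩, ?_⟩
    exact mul_monomials hm (resExt_monomials (inf_le_left : V ⊓ V' ≤ V) ha)
      (resExt_monomials (inf_le_right : V ⊓ V' ≤ V') hb)⟩

/-- A function as a form of degree `0`. -/
def ofFn (f : Fn U) : Form 0 U :=
  ⟨fun x => algebraMap 𝕂 (Ext X) (f.1 x), fun x => ⟨U, le_rfl, x.2,
    AddSubgroup.subset_closure ⟨f, [], rfl, by
      funext y
      simp only [List.map_nil, List.prod_nil, Algebra.smul_def, mul_one]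
      rfl⟩⟩⟩

/-- The differential of a function. -/
def dFn (f : Fn U) : Form 1 U :=
  ⟨fun x => ExteriorAlgebra.ι 𝕂 (dAt f x), fun x => ⟨U, le_rfl, x.2,
    AddSubgroup.subset_closure ⟨1, [f], rfl, by
      funext y
      simp only [List.map_cons, List.map_nil, List.prod_cons, List.prod_nil, mul_one]
      exact (one_smul 𝕂 _).symm⟩⟩⟩

/-- `IsD w w'` means `w' = dw`: locally, `w` is a sum of products `f dg₁ ∧ ⋯ ∧ dg_k` and `w'` is
the corresponding sum of the products `df ∧ dg₁ ∧ ⋯ ∧ dg_k`. -/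
def IsD {k l : ℤ} (w : Form k U) (w' : Form l U) : Prop :=
  l = k + 1 ∧ ∀ x : U, ∃ (V : Opens X.pt) (h : V ≤ U), (x : X.pt) ∈ V ∧
    (resExt h w.1, resExt h w'.1) ∈ AddSubgroup.closure (dMonomials k V)

end Form

/-- The contraction of an exterior form with a tangent vector. -/
def contract (v : Module.Dual 𝕂 (Cot X)) (w : Ext X) : Ext X :=
  CliffordAlgebra.contractLeft v w

/-- The function `v(f)`. -/
def VField.apply {U : Opens X.pt} (v : VField U) (f : Fn U) : Fn U :=
  ⟨fun x => v.toFun x (dAt f x), v.smooth U le_rfl f⟩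

/-- `v.Contracts w w'` means `w' = ι_v w`. -/
def VField.Contracts {U : Opens X.pt} {k l : ℤ} (v : VField U) (w : Form k U) (w' : Form l U) :
    Prop :=
  ∀ x, w'.1 x = contract (v.toFun x) (w.1 x)

/-- `v.LieDer w w'` means that the one-form `w'` is `L_v w = ι_v dw + d ι_v w`. -/
def VField.LieDer {U : Opens X.pt} (v : VField U) (w w' : Form 1 U) : Prop :=
  ∃ (dw : Form 2 U) (f : Fn U) (idw : Form 1 U), Form.IsD w dw ∧ v.Contracts w (Form.ofFn f) ∧
    v.Contracts dw idw ∧ w' = idw + Form.dFn f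

variable (X) in
/-- Sheaves of abelian groups on `X`. -/
structure AbSheaf where
  sec : Opens X.pt → Type u
  [grp : ∀ U, AddCommGroup (sec U)]
  res : ∀ {U V : Opens X.pt}, V ≤ U → (sec U →+ sec V)
  res_id : ∀ {U : Opens X.pt} (s : sec U), res le_rfl s = s
  res_res : ∀ {U V W : Opens X.pt} (h : V ≤ U) (h' : W ≤ V) (s : sec U),
    res h' (res h s) = res (h'.trans h) s
  glue : ∀ {ι : Type u} (U : ι → Opens X.pt) (s : ∀ i, sec (U i)),
    (∀ i j, res (inf_le_left : U i ⊓ U j ≤ U i) (s i) =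
      res (inf_le_right : U i ⊓ U j ≤ U j) (s j)) →
    ∃! t : sec (iSup U), ∀ i, res (le_iSup U i) t = s i

attribute [instance] AbSheaf.grp

variable (X) in
/-- Sheaves of `𝒪`-modules on `X`. -/
structure OMod extends AbSheaf X where
  [mod : ∀ U, Module (Fn U) (sec U)]
  res_smul : ∀ {U V : Opens X.pt} (h : V ≤ U) (f : Fn U) (s : sec U),
    res h (f • s) = resFn h f • res h s

attribute [instance] OMod.mod

variable (X) in
/-- The sheaf of `𝒪`-modules `Ω¹`. -/
def Omega1 : OMod X where
  sec U := Form 1 U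
  res h := Form.res h
  res_id _ := rfl
  res_res _ _ _ := rfl
  glue {ι} U s hs := by
    have key : ∀ i j (x : X.pt) (hi : x ∈ U i) (hj : x ∈ U j),
        (s i).1 ⟨x, hi⟩ = (s j).1 ⟨x, hj⟩ := fun i j x hi hj =>
      congrFun (congrArg Subtype.val (hs i j)) ⟨x, hi, hj⟩
    have hmem : ∀ x : ↥(iSup U : Opens X.pt), ∃ i, (x : X.pt) ∈ U i := fun x =>
      Opens.mem_iSup.1 x.2
    choose p hp using hmem
    let w : ↥(iSup U : Opens X.pt) → Ext X := fun x => (s (p x)).1 ⟨x, hp x⟩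
    have hw : ∀ i, resExt (le_iSup U i) w = (s i).1 := fun i => by
      funext x
      exact key _ _ _ _ _
    refine ⟨⟨w, fun x => ?_⟩, fun i => Subtype.ext (hw i), fun t ht => Subtype.ext ?_⟩
    · obtain ⟨V, hV, hx, h⟩ := (s (p x)).2 ⟨x, hp x⟩
      refine ⟨V, hV.trans (le_iSup U _), hx, ?_⟩
      rw [← hw] at h
      exact h
    · funext x
      exact congrFun (congrArg Subtype.val (ht (p x))) ⟨x, hp x⟩
  res_smul _ _ _ := rfl

/-! ## Lie algebroids and Courant algebroids -/

variable (X) in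
/-- `𝒪_X`-Lie algebroids. The bracket is `𝕂`-bilinear by the Leibniz rule, as vector fields
annihilate constants. -/
structure LieAlgebroid extends OMod X where
  br : ∀ {U : Opens X.pt}, sec U → sec U → sec U
  anchor : ∀ {U : Opens X.pt}, sec U → VField U
  add_br : ∀ {U : Opens X.pt} (a b c : sec U), br (a + b) c = br a c + br b c
  br_add : ∀ {U : Opens X.pt} (a b c : sec U), br a (b + c) = br a b + br a c
  res_br : ∀ {U V : Opens X.pt} (h : V ≤ U) (a b : sec U), res h (br a b) = br (res h a) (res h b)
  br_self : ∀ {U : Opens X.pt} (a : sec U), br a a = 0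
  jacobi : ∀ {U : Opens X.pt} (a b c : sec U), br a (br b c) = br (br a b) c + br b (br a c)
  anchor_add : ∀ {U : Opens X.pt} (a b : sec U) (x : U),
    (anchor (a + b)).toFun x = (anchor a).toFun x + (anchor b).toFun x
  anchor_smul : ∀ {U : Opens X.pt} (f : Fn U) (a : sec U) (x : U),
    (anchor (f • a)).toFun x = f.1 x • (anchor a).toFun x
  anchor_res : ∀ {U V : Opens X.pt} (h : V ≤ U) (a : sec U) (x : V),
    (anchor (res h a)).toFun x = (anchor a).toFun ⟨x, h x.2⟩
  anchor_br : ∀ {U : Opens X.pt} (a b : sec U) (f : Fn U), (anchor (br a b)).apply f =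
    (anchor a).apply ((anchor b).apply f) - (anchor b).apply ((anchor a).apply f)
  leibniz : ∀ {U : Opens X.pt} (a b : sec U) (f : Fn U),
    br a (f • b) = (anchor a).apply f • b + f • br a b

/-- `E` is locally free of finite rank. -/
def OMod.LocallyFree (E : OMod X) : Prop :=
  ∀ x : X.pt, ∃ (V : Opens X.pt) (r : ℕ) (e : Fin r → E.sec V), x ∈ V ∧
    ∀ (W : Opens X.pt) (h : W ≤ V) (s : E.sec W),
      ∃! f : Fin r → Fn W, s = ∑ i, f i • E.res h (e i)

variable (X) in
/-- Courant algebroids; `pair` is the symmetric pairing, `coanchor` the map `Ω¹ → 𝒬`. -/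
structure CourantAlgebroid extends OMod X where
  br : ∀ {U : Opens X.pt}, sec U → sec U → sec U
  anchor : ∀ {U : Opens X.pt}, sec U → VField U
  pair : ∀ {U : Opens X.pt}, sec U → sec U → Fn U
  coanchor : ∀ {U : Opens X.pt}, Form 1 U →ₗ[Fn U] sec U
  add_br : ∀ {U : Opens X.pt} (a b c : sec U), br (a + b) c = br a c + br b c
  br_add : ∀ {U : Opens X.pt} (a b c : sec U), br a (b + c) = br a b + br a c
  res_br : ∀ {U V : Opens X.pt} (h : V ≤ U) (a b : sec U), res h (br a b) = br (res h a) (res h b)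
  leibnizIdentity : ∀ {U : Opens X.pt} (a b c : sec U),
    br a (br b c) = br (br a b) c + br b (br a c)
  anchor_add : ∀ {U : Opens X.pt} (a b : sec U) (x : U),
    (anchor (a + b)).toFun x = (anchor a).toFun x + (anchor b).toFun x
  anchor_smul : ∀ {U : Opens X.pt} (f : Fn U) (a : sec U) (x : U),
    (anchor (f • a)).toFun x = f.1 x • (anchor a).toFun x
  anchor_res : ∀ {U V : Opens X.pt} (h : V ≤ U) (a : sec U) (x : V),
    (anchor (res h a)).toFun x = (anchor a).toFun ⟨x, h x.2⟩
  anchor_br : ∀ {U : Opens X.pt} (a b : sec U) (f : Fn U), (anchor (br a b)).apply f =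
    (anchor a).apply ((anchor b).apply f) - (anchor b).apply ((anchor a).apply f)
  pair_symm : ∀ {U : Opens X.pt} (a b : sec U), pair a b = pair b a
  pair_add : ∀ {U : Opens X.pt} (a b c : sec U), pair a (b + c) = pair a b + pair a c
  pair_smul : ∀ {U : Opens X.pt} (f : Fn U) (a b : sec U), pair a (f • b) = f * pair a b
  res_pair : ∀ {U V : Opens X.pt} (h : V ≤ U) (a b : sec U),
    resFn h (pair a b) = pair (res h a) (res h b)
  res_coanchor : ∀ {U V : Opens X.pt} (h : V ≤ U) (w : Form 1 U),
    res h (coanchor w) = coanchor (Form.res h w)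
  anchor_coanchor : ∀ {U : Opens X.pt} (w : Form 1 U) (x : U), (anchor (coanchor w)).toFun x = 0
  leibniz : ∀ {U : Opens X.pt} (a b : sec U) (f : Fn U),
    br a (f • b) = f • br a b + (anchor a).apply f • b
  pair_br : ∀ {U : Opens X.pt} (a b c : sec U),
    pair (br a b) c + pair b (br a c) = (anchor a).apply (pair b c)
  br_coanchor : ∀ {U : Opens X.pt} (a : sec U) (w w' : Form 1 U), (anchor a).LieDer w w' →
    br a (coanchor w) = coanchor w'
  pair_coanchor : ∀ {U : Opens X.pt} (a : sec U) (w : Form 1 U),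
    (anchor a).Contracts w (Form.ofFn (pair a (coanchor w)))
  br_symm : ∀ {U : Opens X.pt} (a b : sec U), br a b + br b a = coanchor (Form.dFn (pair a b))

/-- Courant extensions of a Lie algebroid `A`: a Courant algebroid with a map to `A` which exhibits
`A` as the Lie algebroid `coker (Ω¹ → 𝒬)` and for which `0 → Ω¹ → 𝒬 → A → 0` is exact. -/
structure CExt (A : LieAlgebroid X) extends CourantAlgebroid X where
  proj : ∀ {U : Opens X.pt}, sec U →ₗ[Fn U] A.sec U
  res_proj : ∀ {U V : Opens X.pt} (h : V ≤ U) (q : sec U), A.res h (proj q) = proj (res h q)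
  proj_br : ∀ {U : Opens X.pt} (p q : sec U), proj (br p q) = A.br (proj p) (proj q)
  anchor_proj : ∀ {U : Opens X.pt} (q : sec U) (x : U),
    (A.anchor (proj q)).toFun x = (anchor q).toFun x
  coanchor_injective : ∀ {U : Opens X.pt} (w : Form 1 U), coanchor w = 0 → w = 0
  proj_eq_zero : ∀ {U : Opens X.pt} (q : sec U), proj q = 0 ↔ ∃ w : Form 1 U, coanchor w = q
  proj_surjective : ∀ {U : Opens X.pt} (a : A.sec U) (x : U), ∃ (V : Opens X.pt) (h : V ≤ U)
    (q : sec V), (x : X.pt) ∈ V ∧ proj q = A.res h a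

namespace CExt
variable {A : LieAlgebroid X}

/-- Morphisms of Courant extensions of `A`. -/
@[ext] structure Hom (P Q : CExt A) where
  map : ∀ U : Opens X.pt, P.sec U →ₗ[Fn U] Q.sec U
  res_map : ∀ {U V : Opens X.pt} (h : V ≤ U) (p : P.sec U), Q.res h (map U p) = map V (P.res h p)
  map_br : ∀ {U : Opens X.pt} (p q : P.sec U), map U (P.br p q) = Q.br (map U p) (map U q)
  map_pair : ∀ {U : Opens X.pt} (p q : P.sec U), Q.pair (map U p) (map U q) = P.pair p q
  map_coanchor : ∀ {U : Opens X.pt} (w : Form 1 U), map U (P.coanchor w) = Q.coanchor w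
  map_anchor : ∀ {U : Opens X.pt} (p : P.sec U) (x : U),
    (Q.anchor (map U p)).toFun x = (P.anchor p).toFun x
  map_proj : ∀ {U : Opens X.pt} (p : P.sec U), Q.proj (map U p) = P.proj p

instance : Category.{u} (CExt A) where
  Hom := Hom
  id P := ⟨fun _ => LinearMap.id, fun _ _ => rfl, fun _ _ => rfl, fun _ _ => rfl, fun _ => rfl,
    fun _ _ => rfl, fun _ => rfl⟩
  comp f g := ⟨fun U => (g.map U).comp (f.map U), fun h p => by simp [g.res_map, f.res_map],
    fun p q => by simp [f.map_br, g.map_br], fun p q => by simp [f.map_pair, g.map_pair],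
    fun w => by simp [f.map_coanchor, g.map_coanchor],
    fun p x => by simp [f.map_anchor, g.map_anchor], fun p => by simp [f.map_proj, g.map_proj]⟩

/-- Sections of the fibre product `𝒬₁ ×_A ⋯ ×_A 𝒬ₙ` (which is `A` for `n = 0`). -/
def fibSubmodule {n : ℕ} (Q : Fin n → CExt A) (U : Opens X.pt) :
    Submodule (Fn U) (A.sec U × ∀ i, (Q i).sec U) where
  carrier := {p | ∀ i, (Q i).proj (p.2 i) = p.1}
  zero_mem' i := map_zero _
  add_mem' {p q} hp hq i := (map_add _ _ _).trans (congrArg₂ (· + ·) (hp i) (hq i))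
  smul_mem' f p hp i := (map_smul _ _ _).trans (congrArg (f • ·) (hp i))

/-- Sections of the fibre product `𝒬₁ ×_A ⋯ ×_A 𝒬ₙ`. -/
def Fib {n : ℕ} (Q : Fin n → CExt A) (U : Opens X.pt) : Type u := fibSubmodule Q U

instance {n : ℕ} (Q : Fin n → CExt A) (U : Opens X.pt) : AddCommGroup (Fib Q U) :=
  inferInstanceAs (AddCommGroup (fibSubmodule Q U))

instance {n : ℕ} (Q : Fin n → CExt A) (U : Opens X.pt) : Module (Fn U) (Fib Q U) :=
  inferInstanceAs (Module (Fn U) (fibSubmodule Q U))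

namespace Fib
variable {n : ℕ} {Q : Fin n → CExt A} {U V : Opens X.pt}

def res (h : V ≤ U) (p : Fib Q U) : Fib Q V :=
  ⟨(A.res h p.1.1, fun i => (Q i).res h (p.1.2 i)), fun i => by
    rw [← (Q i).res_proj]; exact congrArg _ (p.2 i)⟩

def br (p q : Fib Q U) : Fib Q U :=
  ⟨(A.br p.1.1 q.1.1, fun i => (Q i).br (p.1.2 i) (q.1.2 i)), fun i => by
    change (Q i).proj ((Q i).br _ _) = A.br _ _
    rw [(Q i).proj_br, p.2 i, q.2 i]⟩

/-- The map `Ω¹ × ⋯ × Ω¹ → 𝒬₁ ×_A ⋯ ×_A 𝒬ₙ`. -/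
def ofForms (w : Fin n → Form 1 U) : Fib Q U :=
  ⟨(0, fun i => (Q i).coanchor (w i)), fun i => ((Q i).proj_eq_zero _).2 ⟨w i, rfl⟩⟩

end Fib

/-- `R`, with the map `s` from the fibre product of the `𝒬ᵢ`, is the linear combination
`a₁ 𝒬₁ ∔ ⋯ ∔ aₙ 𝒬ₙ`: the square formed by `s`, `Ω¹ × ⋯ × Ω¹ → 𝒬₁ ×_A ⋯ ×_A 𝒬ₙ`,
`(w₁, …, wₙ) ↦ ∑ aᵢ wᵢ` and `Ω¹ → R` is cocartesian in the category of sheaves, and `s` is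
compatible with the structures. -/
structure IsLinComb {n : ℕ} (a : Fin n → 𝕂) (Q : Fin n → CExt A) (R : CExt A)
    (s : ∀ U : Opens X.pt, Fib Q U →ₗ[Fn U] R.sec U) : Prop where
  res : ∀ {U V : Opens X.pt} (h : V ≤ U) (p : Fib Q U), R.res h (s U p) = s V (p.res h)
  proj : ∀ {U : Opens X.pt} (p : Fib Q U), R.proj (s U p) = p.1.1
  br : ∀ {U : Opens X.pt} (p q : Fib Q U), s U (p.br q) = R.br (s U p) (s U q)
  pair : ∀ {U : Opens X.pt} (p q : Fib Q U), R.pair (s U p) (s U q) =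
    ∑ i, algebraMap 𝕂 (Fn U) (a i) * (Q i).pair (p.1.2 i) (q.1.2 i)
  square : ∀ {U : Opens X.pt} (w : Fin n → Form 1 U),
    s U (Fib.ofForms w) = R.coanchor (∑ i, algebraMap 𝕂 (Fn U) (a i) • w i)
  surj : ∀ {U : Opens X.pt} (r : R.sec U) (x : U), ∃ (V : Opens X.pt) (h : V ≤ U) (p : Fib Q V)
    (w : Form 1 V), (x : X.pt) ∈ V ∧ R.res h r = s V p + R.coanchor w
  inj : ∀ {U : Opens X.pt} (p : Fib Q U) (w : Form 1 U), s U p + R.coanchor w = 0 →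
    ∀ x : U, ∃ (V : Opens X.pt) (h : V ≤ U) (v : Fin n → Form 1 V), (x : X.pt) ∈ V ∧
      p.res h = Fib.ofForms v ∧ Form.res h w = -∑ i, algebraMap 𝕂 (Fn V) (a i) • v i

end CExt

variable (A : LieAlgebroid X) in
/-- The canonical structures of a `𝕂`-vector space in categories on `CExt A`: the combinations are
those of `CExt.IsLinComb`, and all functors and isomorphisms are induced by the maps `s`. -/
structure CExtLin where
  lc : VectCat 𝕂 (CExt A)
  s : ∀ {n : ℕ} (a : Fin n → 𝕂) (Q : Fin n → CExt A) (U : Opens X.pt),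
    CExt.Fib Q U →ₗ[Fn U] (lc.lin a Q).sec U
  isLinComb : ∀ {n : ℕ} (a : Fin n → 𝕂) (Q : Fin n → CExt A),
    CExt.IsLinComb a Q (lc.lin a Q) (s a Q)
  linMap_s : ∀ {n : ℕ} (a : Fin n → 𝕂) {P Q : Fin n → CExt A} (f : ∀ i, P i ⟶ Q i)
    {U : Opens X.pt} (p : CExt.Fib P U) (q : CExt.Fib Q U), q.1.1 = p.1.1 →
    (∀ i, q.1.2 i = (f i).map U (p.1.2 i)) → (lc.linMap a f).map U (s a P U p) = s a Q U q
  proj_s : ∀ {n : ℕ} (i : Fin n) (Q : Fin n → CExt A) {U : Opens X.pt} (p : CExt.Fib Q U),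
    (lc.proj i Q).map U (s _ Q U p) = p.1.2 i
  comp_s : ∀ {m n : ℕ} (a : Fin m → 𝕂) (b : Fin m → Fin n → 𝕂) (c : Fin n → 𝕂)
    (h : ∀ i, c i = ∑ j, a j * b j i) (Q : Fin n → CExt A) {U : Opens X.pt} (p : CExt.Fib Q U)
    (q : CExt.Fib (fun j => lc.lin (b j) Q) U), q.1.1 = p.1.1 →
    (∀ j, q.1.2 j = s (b j) Q U p) → (lc.comp a b c h Q).map U (s a _ U q) = s c Q U p

/-! ## DG modules and Lie algebroids over the de Rham complex -/

variable (X) in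
/-- DG modules over the DG manifold `X♯`, i.e. sheaves of DG modules over the de Rham complex. -/
structure DGMod where
  sh : ℤ → AbSheaf X
  act : ∀ {k i j : ℤ}, k + i = j → ∀ {U : Opens X.pt}, Form k U → (sh i).sec U → (sh j).sec U
  D : ∀ {i j : ℤ}, i + 1 = j → ∀ {U : Opens X.pt}, (sh i).sec U →+ (sh j).sec U
  add_act : ∀ {k i j : ℤ} (h : k + i = j) {U : Opens X.pt} (w w' : Form k U) (m : (sh i).sec U),
    act h (w + w') m = act h w m + act h w' m
  act_add : ∀ {k i j : ℤ} (h : k + i = j) {U : Opens X.pt} (w : Form k U) (m m' : (sh i).sec U),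
    act h w (m + m') = act h w m + act h w m'
  one_act : ∀ {i : ℤ} (h : 0 + i = i) {U : Opens X.pt} (m : (sh i).sec U),
    act h (Form.ofFn 1) m = m
  mul_act : ∀ {k l p i j q : ℤ} (h : k + l = p) (h₁ : l + i = j) (h₂ : k + j = q) (h₃ : p + i = q)
    {U : Opens X.pt} (w : Form k U) (w' : Form l U) (m : (sh i).sec U),
    act h₃ (Form.mul h w w') m = act h₂ w (act h₁ w' m)
  res_act : ∀ {k i j : ℤ} (h : k + i = j) {U V : Opens X.pt} (hV : V ≤ U) (w : Form k U)
    (m : (sh i).sec U), (sh j).res hV (act h w m) = act h (Form.res hV w) ((sh i).res hV m)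
  res_D : ∀ {i j : ℤ} (h : i + 1 = j) {U V : Opens X.pt} (hV : V ≤ U) (m : (sh i).sec U),
    (sh j).res hV (D h m) = D h ((sh i).res hV m)
  D_D : ∀ {i j l : ℤ} (h : i + 1 = j) (h' : j + 1 = l) {U : Opens X.pt} (m : (sh i).sec U),
    D h' (D h m) = 0
  D_act : ∀ {k k' i j i' l : ℤ} (h : k + i = j) (h₁ : j + 1 = l) (h₂ : k' + i = l) (h₃ : i + 1 = i')
    (h₄ : k + i' = l) {U : Opens X.pt} (w : Form k U) (w' : Form k' U) (m : (sh i).sec U),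
    Form.IsD w w' → D h₁ (act h w m) = act h₂ w' m + (k.negOnePow : ℤ) • act h₄ w (D h₃ m)

/-- Morphisms of DG modules over the de Rham complex. -/
@[ext] structure DGMod.Hom (M N : DGMod X) where
  map : ∀ (i : ℤ) (U : Opens X.pt), (M.sh i).sec U →+ (N.sh i).sec U
  res_map : ∀ {i : ℤ} {U V : Opens X.pt} (h : V ≤ U) (m : (M.sh i).sec U),
    (N.sh i).res h (map i U m) = map i V ((M.sh i).res h m)
  map_act : ∀ {k i j : ℤ} (h : k + i = j) {U : Opens X.pt} (w : Form k U) (m : (M.sh i).sec U),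
    map j U (M.act h w m) = N.act h w (map i U m)
  map_D : ∀ {i j : ℤ} (h : i + 1 = j) {U : Opens X.pt} (m : (M.sh i).sec U),
    map j U (M.D h m) = N.D h (map i U m)

variable (X) in
/-- DG Lie algebroids over `X♯`. The anchor, a morphism from the underlying DG module to the
derivations of the de Rham complex, is recorded as an action on differential forms. -/
structure DGLie extends DGMod X where
  br : ∀ {i j l : ℤ}, i + j = l → ∀ {U : Opens X.pt}, (sh i).sec U → (sh j).sec U → (sh l).sec U
  anchor : ∀ {i k l : ℤ}, i + k = l → ∀ {U : Opens X.pt}, (sh i).sec U → Form k U → Form l U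
  add_br : ∀ {i j l : ℤ} (h : i + j = l) {U : Opens X.pt} (a a' : (sh i).sec U) (b : (sh j).sec U),
    br h (a + a') b = br h a b + br h a' b
  br_add : ∀ {i j l : ℤ} (h : i + j = l) {U : Opens X.pt} (a : (sh i).sec U) (b b' : (sh j).sec U),
    br h a (b + b') = br h a b + br h a b'
  res_br : ∀ {i j l : ℤ} (h : i + j = l) {U V : Opens X.pt} (hV : V ≤ U) (a : (sh i).sec U)
    (b : (sh j).sec U), (sh l).res hV (br h a b) = br h ((sh i).res hV a) ((sh j).res hV b)
  br_symm : ∀ {i j l : ℤ} (h : i + j = l) (h' : j + i = l) {U : Opens X.pt} (a : (sh i).sec U)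
    (b : (sh j).sec U), br h a b = -(((i * j).negOnePow : ℤ) • br h' b a)
  jacobi : ∀ {i j l ij jl il t : ℤ} (hij : i + j = ij) (hjl : j + l = jl) (hil : i + l = il)
    (h₁ : i + jl = t) (h₂ : ij + l = t) (h₃ : j + il = t) {U : Opens X.pt} (a : (sh i).sec U)
    (b : (sh j).sec U) (c : (sh l).sec U),
    br h₁ a (br hjl b c) = br h₂ (br hij a b) c + ((i * j).negOnePow : ℤ) • br h₃ b (br hil a c)
  D_br : ∀ {i j l i' j' l' : ℤ} (h : i + j = l) (hi : i + 1 = i') (hj : j + 1 = j')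
    (hl : l + 1 = l') (h₁ : i' + j = l') (h₂ : i + j' = l') {U : Opens X.pt} (a : (sh i).sec U)
    (b : (sh j).sec U),
    D hl (br h a b) = br h₁ (D hi a) b + (i.negOnePow : ℤ) • br h₂ a (D hj b)
  anchor_add_left : ∀ {i k l : ℤ} (h : i + k = l) {U : Opens X.pt} (a a' : (sh i).sec U)
    (w : Form k U), anchor h (a + a') w = anchor h a w + anchor h a' w
  anchor_add : ∀ {i k l : ℤ} (h : i + k = l) {U : Opens X.pt} (a : (sh i).sec U)
    (w w' : Form k U), anchor h a (w + w') = anchor h a w + anchor h a w'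
  anchor_const : ∀ {i l : ℤ} (h : i + 0 = l) {U : Opens X.pt} (a : (sh i).sec U) (c : 𝕂),
    anchor h a (Form.ofFn (algebraMap 𝕂 (Fn U) c)) = 0
  anchor_res : ∀ {i k l : ℤ} (h : i + k = l) {U V : Opens X.pt} (hV : V ≤ U) (a : (sh i).sec U)
    (w : Form k U), Form.res hV (anchor h a w) = anchor h ((sh i).res hV a) (Form.res hV w)
  anchor_mul : ∀ {i k l k' l' p q : ℤ} (h : i + k = k') (h' : i + l = l') (hp : k + l = p)
    (hq : i + p = q) (h₁ : k' + l = q) (h₂ : k + l' = q) {U : Opens X.pt} (a : (sh i).sec U)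
    (w : Form k U) (w' : Form l U), anchor hq a (Form.mul hp w w') =
      Form.mul h₁ (anchor h a w) w' + ((i * k).negOnePow : ℤ) • Form.mul h₂ w (anchor h' a w')
  anchor_act : ∀ {p i j k l q : ℤ} (hj : p + i = j) (h : i + k = l) (h₁ : j + k = q)
    (h₂ : p + l = q) {U : Opens X.pt} (v : Form p U) (a : (sh i).sec U) (w : Form k U),
    anchor h₁ (act hj v a) w = Form.mul h₂ v (anchor h a w)
  anchor_br : ∀ {i j ij k ik jk t : ℤ} (h : i + j = ij) (hik : i + k = ik) (hjk : j + k = jk)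
    (h₁ : ij + k = t) (h₂ : i + jk = t) (h₃ : j + ik = t) {U : Opens X.pt} (a : (sh i).sec U)
    (b : (sh j).sec U) (w : Form k U), anchor h₁ (br h a b) w =
      anchor h₂ a (anchor hjk b w) - ((i * j).negOnePow : ℤ) • anchor h₃ b (anchor hik a w)
  anchor_D : ∀ {i i' k l k' l' : ℤ} (hi : i + 1 = i') (h : i + k = l) (h₁ : i' + k = l')
    (h₂ : i + k' = l') {U : Opens X.pt} (a : (sh i).sec U) (w : Form k U) (dw : Form k' U)
    (daw : Form l' U), Form.IsD w dw → Form.IsD (anchor h a w) daw →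
      anchor h₁ (D hi a) w = daw - (i.negOnePow : ℤ) • anchor h₂ a dw
  leibniz : ∀ {i j k l ij kj t : ℤ} (hkj : k + j = kj) (hl : i + k = l) (hij : i + j = ij)
    (h₁ : i + kj = t) (h₂ : l + j = t) (h₃ : k + ij = t) {U : Opens X.pt} (a : (sh i).sec U)
    (b : (sh j).sec U) (w : Form k U), br h₁ a (act hkj w b) =
      act h₂ (anchor hl a w) b + ((i * k).negOnePow : ℤ) • act h₃ w (br hij a b)

/-- Morphisms of DG Lie algebroids over `X♯`. -/
@[ext] structure DGLie.Hom (M N : DGLie X) extends toModHom : DGMod.Hom M.toDGMod N.toDGMod where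
  map_br : ∀ {i j l : ℤ} (h : i + j = l) {U : Opens X.pt} (a : (M.sh i).sec U) (b : (M.sh j).sec U),
    map l U (M.br h a b) = N.br h (map i U a) (map j U b)
  map_anchor : ∀ {i k l : ℤ} (h : i + k = l) {U : Opens X.pt} (a : (M.sh i).sec U) (w : Form k U),
    N.anchor h (map i U a) w = M.anchor h a w

/-! ## The functor `pr_* ev^*` and transgression of Lie algebroids -/

/-- Generators `(w + v ε) ⊗ e` of the degree `m` part of `Ω[ε] ⊗_𝒪 E`. -/
abbrev EvGen (E : OMod X) (m : ℤ) (U : Opens X.pt) : Type u :=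
  Form m U × Form (m + 1) U × E.sec U

/-- The relations of the tensor product `Ω[ε] ⊗_𝒪 E`, in which `f ∈ 𝒪` acts on `Ω[ε]` as
multiplication with `ev^* f = f + df ε`. -/
inductive EvRel (E : OMod X) (m : ℤ) (U : Opens X.pt) : FreeAbelianGroup (EvGen E m U) → Prop
  | add_left (w w' : Form m U) (v v' : Form (m + 1) U) (e : E.sec U) : EvRel E m U
      (FreeAbelianGroup.of (w + w', v + v', e) - FreeAbelianGroup.of (w, v, e) -
        FreeAbelianGroup.of (w', v', e))
  | add_right (w : Form m U) (v : Form (m + 1) U) (e e' : E.sec U) : EvRel E m U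
      (FreeAbelianGroup.of (w, v, e + e') - FreeAbelianGroup.of (w, v, e) -
        FreeAbelianGroup.of (w, v, e'))
  | balanced (w : Form m U) (v : Form (m + 1) U) (f : Fn U) (e : E.sec U) : EvRel E m U
      (FreeAbelianGroup.of (f • w, f • v + Form.mul rfl w (Form.dFn f), e) -
        FreeAbelianGroup.of (w, v, f • e))

/-- The DG module `pr_* ev^* E`, i.e. the sheaf tensor product `Ω[ε] ⊗_𝒪 E` over `Ω`, where
`deg ε = -1` and the differential is `d + ∂/∂ε`. It is given up to unique isomorphism by the
section `j e = ε ⊗ e` (so that `D (j e) = 1 ⊗ e`): the map which sends `(w + v ε) ⊗ e` to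
`w · D (j e) + v · j e`, from the presheaf tensor product, is locally surjective and locally
injective. -/
structure OddPullback (E : OMod X) (N : DGMod X)
    (j : ∀ U : Opens X.pt, E.sec U →+ (N.sh (-1)).sec U) : Prop where
  res_j : ∀ {U V : Opens X.pt} (h : V ≤ U) (e : E.sec U),
    (N.sh (-1)).res h (j U e) = j V (E.res h e)
  j_smul : ∀ {U : Opens X.pt} (f : Fn U) (e : E.sec U),
    j U (f • e) = N.act (zero_add _) (Form.ofFn f) (j U e)
  surj : ∀ {m : ℤ} {U : Opens X.pt} (y : (N.sh m).sec U) (x : U), ∃ (V : Opens X.pt) (h : V ≤ U)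
    (t : FreeAbelianGroup (EvGen E m V)), (x : X.pt) ∈ V ∧ (N.sh m).res h y =
      FreeAbelianGroup.lift (fun g => N.act (add_zero m) g.1 (N.D (neg_add_cancel 1) (j V g.2.2)) +
        N.act (add_neg_cancel_right m 1) g.2.1 (j V g.2.2)) t
  inj : ∀ {m : ℤ} {U : Opens X.pt} (t : FreeAbelianGroup (EvGen E m U)),
    FreeAbelianGroup.lift (fun g => N.act (add_zero m) g.1 (N.D (neg_add_cancel 1) (j U g.2.2)) +
        N.act (add_neg_cancel_right m 1) g.2.1 (j U g.2.2)) t = 0 →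
    ∀ x : U, ∃ (V : Opens X.pt) (h : V ≤ U), (x : X.pt) ∈ V ∧
      FreeAbelianGroup.map (fun g : EvGen E m U =>
        ((Form.res h g.1, Form.res h g.2.1, E.res h g.2.2) : EvGen E m V)) t ∈
        AddSubgroup.closure {r | EvRel E m V r}

/-- The transgression `A♯` of a Lie algebroid `A`: the DG Lie algebroid over `X♯` with underlying
DG module `pr_* ev^* A` in which `[a ε, b ε] = 0`, `[a, b ε] = [a, b] ε` and `a ε` acts on forms as
`ι_{σ(a)}`. -/
structure Sharp (A : LieAlgebroid X) where
  alg : DGLie X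
  j : ∀ U : Opens X.pt, A.sec U →+ (alg.sh (-1)).sec U
  oddPullback : OddPullback A.toOMod alg.toDGMod j
  br_j_j : ∀ {l : ℤ} (h : -1 + -1 = l) {U : Opens X.pt} (a b : A.sec U),
    alg.br h (j U a) (j U b) = 0
  br_D_j : ∀ {U : Opens X.pt} (a b : A.sec U),
    alg.br (zero_add _) (alg.D (neg_add_cancel 1) (j U a)) (j U b) = j U (A.br a b)
  anchor_j : ∀ {k l : ℤ} (h : -1 + k = l) {U : Opens X.pt} (a : A.sec U) (w : Form k U),
    (A.anchor a).Contracts w (alg.anchor h (j U a) w)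

/-! ## `𝒪[2]`-extensions -/

/-- `𝒪_{X♯}[2]`-extensions of a DG Lie algebroid `B`: a marked DG Lie algebroid `(alg, c)` with a
morphism to `B` such that `0 → 𝒪[2] → alg → B → 0` is exact, where `𝒪[2] → alg` is `w ↦ w · c`. -/
structure OExt2 (B : DGLie X) where
  alg : DGLie X
  c : (alg.sh (-2)).sec ⊤
  D_c : ∀ {j : ℤ} (h : -2 + 1 = j), alg.D h c = 0
  central : ∀ {i l : ℤ} (h : -2 + i = l) {U : Opens X.pt} (a : (alg.sh i).sec U),
    alg.br h ((alg.sh (-2)).res le_top c) a = 0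
  proj : DGLie.Hom alg B
  mark_injective : ∀ {k i : ℤ} (h : k + -2 = i) {U : Opens X.pt} (w : Form k U),
    alg.act h w ((alg.sh (-2)).res le_top c) = 0 → w = 0
  proj_eq_zero : ∀ {k i : ℤ} (h : k + -2 = i) {U : Opens X.pt} (a : (alg.sh i).sec U),
    proj.map i U a = 0 ↔ ∃ w : Form k U, alg.act h w ((alg.sh (-2)).res le_top c) = a
  proj_surjective : ∀ {i : ℤ} {U : Opens X.pt} (b : (B.sh i).sec U) (x : U),
    ∃ (V : Opens X.pt) (h : V ≤ U) (a : (alg.sh i).sec V), (x : X.pt) ∈ V ∧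
      proj.map i V a = (B.sh i).res h b

namespace OExt2
variable {B : DGLie X}

/-- The map `𝒪[2] → T`, `w ↦ w · c`. -/
def mark (T : OExt2 B) {k i : ℤ} (h : k + -2 = i) {U : Opens X.pt} (w : Form k U) :
    (T.alg.sh i).sec U :=
  T.alg.act h w ((T.alg.sh (-2)).res le_top T.c)

/-- Morphisms of `𝒪[2]`-extensions of `B`. -/
@[ext] structure Hom (S T : OExt2 B) extends toLieHom : DGLie.Hom S.alg T.alg where
  map_c : map (-2) ⊤ S.c = T.c
  map_proj : ∀ {i : ℤ} {U : Opens X.pt} (a : (S.alg.sh i).sec U),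
    T.proj.map i U (map i U a) = S.proj.map i U a

instance : Category.{u} (OExt2 B) where
  Hom := Hom
  id S := ⟨⟨⟨fun _ _ => AddMonoidHom.id _, fun _ _ => rfl, fun _ _ _ _ => rfl, fun _ _ _ => rfl⟩,
    fun _ _ _ _ => rfl, fun _ _ _ _ => rfl⟩, rfl, fun _ => rfl⟩
  comp f g := ⟨⟨⟨fun i U => (g.map i U).comp (f.map i U),
    fun h m => by simp [g.res_map, f.res_map],
    fun h _ w m => by simp [g.map_act, f.map_act],
    fun h _ m => by simp [g.map_D, f.map_D]⟩,
    fun h _ a b => by simp [g.map_br, f.map_br],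
    fun h _ a w => by simp [g.map_anchor, f.map_anchor]⟩,
    by simp [g.map_c, f.map_c], fun a => by simp [g.map_proj, f.map_proj]⟩

/-- Sections of degree `i` of the fibre product `T₁ ×_B ⋯ ×_B Tₙ` (which is `B` for `n = 0`). -/
def fibSubgroup {n : ℕ} (T : Fin n → OExt2 B) (i : ℤ) (U : Opens X.pt) :
    AddSubgroup ((B.sh i).sec U × ∀ r, ((T r).alg.sh i).sec U) where
  carrier := {p | ∀ r, (T r).proj.map i U (p.2 r) = p.1}
  zero_mem' r := map_zero _
  add_mem' {p q} hp hq r := (map_add _ _ _).trans (congrArg₂ (· + ·) (hp r) (hq r))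
  neg_mem' {p} hp r := (map_neg _ _).trans (congrArg Neg.neg (hp r))

/-- Sections of degree `i` of the fibre product `T₁ ×_B ⋯ ×_B Tₙ`. -/
def Fib {n : ℕ} (T : Fin n → OExt2 B) (i : ℤ) (U : Opens X.pt) : Type u := fibSubgroup T i U

instance {n : ℕ} (T : Fin n → OExt2 B) (i : ℤ) (U : Opens X.pt) : AddCommGroup (Fib T i U) :=
  inferInstanceAs (AddCommGroup (fibSubgroup T i U))

namespace Fib
variable {n : ℕ} {T : Fin n → OExt2 B} {U V : Opens X.pt}

def res {i : ℤ} (h : V ≤ U) (p : Fib T i U) : Fib T i V :=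
  ⟨((B.sh i).res h p.1.1, fun r => ((T r).alg.sh i).res h (p.1.2 r)), fun r => by
    rw [← (T r).proj.res_map]; exact congrArg _ (p.2 r)⟩

def act {k i j : ℤ} (h : k + i = j) (w : Form k U) (p : Fib T i U) : Fib T j U :=
  ⟨(B.act h w p.1.1, fun r => (T r).alg.act h w (p.1.2 r)), fun r => by
    rw [(T r).proj.map_act]; exact congrArg _ (p.2 r)⟩

def D {i j : ℤ} (h : i + 1 = j) (p : Fib T i U) : Fib T j U :=
  ⟨(B.D h p.1.1, fun r => (T r).alg.D h (p.1.2 r)), fun r => by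
    rw [(T r).proj.map_D]; exact congrArg _ (p.2 r)⟩

def br {i j l : ℤ} (h : i + j = l) (p : Fib T i U) (q : Fib T j U) : Fib T l U :=
  ⟨(B.br h p.1.1 q.1.1, fun r => (T r).alg.br h (p.1.2 r) (q.1.2 r)), fun r => by
    change (T r).proj.map l U ((T r).alg.br h _ _) = B.br h _ _
    rw [(T r).proj.map_br, p.2 r, q.2 r]⟩

/-- The map `𝒪[2] × ⋯ × 𝒪[2] → T₁ ×_B ⋯ ×_B Tₙ`. -/
def ofForms {k i : ℤ} (h : k + -2 = i) (w : Fin n → Form k U) : Fib T i U :=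
  ⟨(0, fun r => (T r).mark h (w r)), fun r => ((T r).proj_eq_zero h _).2 ⟨w r, rfl⟩⟩

end Fib

/-- `R`, with the map `s` from the fibre product of the `Tᵣ`, is the linear combination
`a₁ T₁ ∔ ⋯ ∔ aₙ Tₙ`: the square formed by `s`, `𝒪[2] × ⋯ × 𝒪[2] → T₁ ×_B ⋯ ×_B Tₙ`,
`(w₁, …, wₙ) ↦ ∑ aᵣ wᵣ` and `𝒪[2] → R` is cocartesian in the category of sheaves of DG modules,
and `s` is compatible with the structures. -/
structure IsLinComb {n : ℕ} (a : Fin n → 𝕂) (T : Fin n → OExt2 B) (R : OExt2 B)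
    (s : ∀ (i : ℤ) (U : Opens X.pt), Fib T i U →+ (R.alg.sh i).sec U) : Prop where
  res : ∀ {i : ℤ} {U V : Opens X.pt} (h : V ≤ U) (p : Fib T i U),
    (R.alg.sh i).res h (s i U p) = s i V (p.res h)
  act : ∀ {k i j : ℤ} (h : k + i = j) {U : Opens X.pt} (w : Form k U) (p : Fib T i U),
    s j U (p.act h w) = R.alg.act h w (s i U p)
  D : ∀ {i j : ℤ} (h : i + 1 = j) {U : Opens X.pt} (p : Fib T i U),
    s j U (p.D h) = R.alg.D h (s i U p)
  proj : ∀ {i : ℤ} {U : Opens X.pt} (p : Fib T i U), R.proj.map i U (s i U p) = p.1.1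
  br : ∀ {i j l : ℤ} (h : i + j = l) {U : Opens X.pt} (p : Fib T i U) (q : Fib T j U),
    s l U (p.br h q) = R.alg.br h (s i U p) (s j U q)
  square : ∀ {k i : ℤ} (h : k + -2 = i) {U : Opens X.pt} (w : Fin n → Form k U),
    s i U (Fib.ofForms h w) = R.mark h (∑ r, algebraMap 𝕂 (Fn U) (a r) • w r)
  surj : ∀ {k i : ℤ} (hk : k + -2 = i) {U : Opens X.pt} (r : (R.alg.sh i).sec U) (x : U),
    ∃ (V : Opens X.pt) (h : V ≤ U) (p : Fib T i V) (w : Form k V), (x : X.pt) ∈ V ∧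
      (R.alg.sh i).res h r = s i V p + R.mark hk w
  inj : ∀ {k i : ℤ} (hk : k + -2 = i) {U : Opens X.pt} (p : Fib T i U) (w : Form k U),
    s i U p + R.mark hk w = 0 → ∀ x : U, ∃ (V : Opens X.pt) (h : V ≤ U) (v : Fin n → Form k V),
      (x : X.pt) ∈ V ∧ p.res h = Fib.ofForms hk v ∧
        Form.res h w = -∑ r, algebraMap 𝕂 (Fn V) (a r) • v r

end OExt2

variable (B : DGLie X) in
/-- The canonical structures of a `𝕂`-vector space in categories on the category of
`𝒪[2]`-extensions of `B`: the combinations are those of `OExt2.IsLinComb`, and all functors and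
isomorphisms are induced by the maps `s`. -/
structure OExt2Lin where
  lc : VectCat 𝕂 (OExt2 B)
  s : ∀ {n : ℕ} (a : Fin n → 𝕂) (T : Fin n → OExt2 B) (i : ℤ) (U : Opens X.pt),
    OExt2.Fib T i U →+ ((lc.lin a T).alg.sh i).sec U
  isLinComb : ∀ {n : ℕ} (a : Fin n → 𝕂) (T : Fin n → OExt2 B),
    OExt2.IsLinComb a T (lc.lin a T) (s a T)
  linMap_s : ∀ {n : ℕ} (a : Fin n → 𝕂) {S T : Fin n → OExt2 B} (f : ∀ r, S r ⟶ T r) {i : ℤ}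
    {U : Opens X.pt} (p : OExt2.Fib S i U) (q : OExt2.Fib T i U), q.1.1 = p.1.1 →
    (∀ r, q.1.2 r = (f r).map i U (p.1.2 r)) → (lc.linMap a f).map i U (s a S i U p) = s a T i U q
  proj_s : ∀ {n : ℕ} (r : Fin n) (T : Fin n → OExt2 B) {i : ℤ} {U : Opens X.pt}
    (p : OExt2.Fib T i U), (lc.proj r T).map i U (s _ T i U p) = p.1.2 r
  comp_s : ∀ {m n : ℕ} (a : Fin m → 𝕂) (b : Fin m → Fin n → 𝕂) (c : Fin n → 𝕂)
    (h : ∀ r, c r = ∑ t, a t * b t r) (T : Fin n → OExt2 B) {i : ℤ} {U : Opens X.pt}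
    (p : OExt2.Fib T i U) (q : OExt2.Fib (fun t => lc.lin (b t) T) i U), q.1.1 = p.1.1 →
    (∀ t, q.1.2 t = s (b t) T i U p) → (lc.comp a b c h T).map i U (s a _ i U q) = s c T i U p

/-! ## Transgression of Courant extensions, and the Courant algebroid of a marked Lie algebroid -/

/-- The sheaf part of the transgression of `𝒬`: the DG module of `T` is the cokernel of
`(∫, -pr_* ev^* π†) : pr_* ev^* Ω¹ → 𝒪[2] ⊕ pr_* ev^* 𝒬` in the category of sheaves, the maps to `T`
being `w ↦ w · c` and a map which sends `q ε` to `j q`. -/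
structure TransgressionSquare {A : LieAlgebroid X} {B : DGLie X} (Q : CExt A) (T : OExt2 B)
    (j : ∀ U : Opens X.pt, Q.sec U →+ (T.alg.sh (-1)).sec U) where
  /-- `pr_* ev^* Ω¹` -/
  evO : DGMod X
  jO : ∀ U : Opens X.pt, (Omega1 X).sec U →+ (evO.sh (-1)).sec U
  isEvO : OddPullback (Omega1 X) evO jO
  /-- `pr_* ev^* 𝒬` -/
  evQ : DGMod X
  jQ : ∀ U : Opens X.pt, Q.sec U →+ (evQ.sh (-1)).sec U
  isEvQ : OddPullback Q.toOMod evQ jQ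
  /-- `pr_* ev^* π†` -/
  evπ : DGMod.Hom evO evQ
  evπ_j : ∀ {U : Opens X.pt} (w : Form 1 U), evπ.map (-1) U (jO U w) = jQ U (Q.coanchor w)
  /-- the map `∫ : pr_* ev^* Ω¹ → 𝒪[2]` -/
  int : ∀ {i k : ℤ}, i + 2 = k → ∀ U : Opens X.pt, (evO.sh i).sec U →+ Form k U
  res_int : ∀ {i k : ℤ} (hk : i + 2 = k) {U V : Opens X.pt} (h : V ≤ U) (z : (evO.sh i).sec U),
    Form.res h (int hk U z) = int hk V ((evO.sh i).res h z)
  int_act : ∀ {i k l i' k' : ℤ} (hk : i + 2 = k) (hk' : i' + 2 = k') (h : l + i = i')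
    (h' : l + k = k') {U : Opens X.pt} (w : Form l U) (z : (evO.sh i).sec U),
    int hk' U (evO.act h w z) = Form.mul h' w (int hk U z)
  int_D : ∀ {i k i' k' : ℤ} (hk : i + 2 = k) (hk' : i' + 2 = k') (h : i + 1 = i')
    {U : Opens X.pt} (z : (evO.sh i).sec U), Form.IsD (int hk U z) (int hk' U (evO.D h z))
  int_j : ∀ (h : -1 + 2 = (1 : ℤ)) {U : Opens X.pt} (w : Form 1 U), int h U (jO U w) = w
  /-- `pr_* ev^* 𝒬 → T` -/
  toT : DGMod.Hom evQ T.alg.toDGMod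
  toT_j : ∀ {U : Opens X.pt} (q : Q.sec U), toT.map (-1) U (jQ U q) = j U q
  comm : ∀ {i k : ℤ} (h : i + 2 = k) (h' : k + -2 = i) {U : Opens X.pt} (z : (evO.sh i).sec U),
    toT.map i U (evπ.map i U z) = T.mark h' (int h U z)
  surj : ∀ {i k : ℤ} (hk : k + -2 = i) {U : Opens X.pt} (t : (T.alg.sh i).sec U) (x : U),
    ∃ (V : Opens X.pt) (h : V ≤ U) (w : Form k V) (y : (evQ.sh i).sec V), (x : X.pt) ∈ V ∧
      (T.alg.sh i).res h t = T.mark hk w + toT.map i V y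
  inj : ∀ {i k : ℤ} (hk : k + -2 = i) (hk' : i + 2 = k) {U : Opens X.pt} (w : Form k U)
    (y : (evQ.sh i).sec U), T.mark hk w + toT.map i U y = 0 →
    ∀ x : U, ∃ (V : Opens X.pt) (h : V ≤ U) (z : (evO.sh i).sec V), (x : X.pt) ∈ V ∧
      int hk' V z = Form.res h w ∧ -evπ.map i V z = (evQ.sh i).res h y

/-- `T`, with the section `q ε = j q` of degree `-1` for `q ∈ 𝒬`, is the transgression `τ𝒬` of
the Courant extension `𝒬` of `A`, regarded as an extension of `A♯`. -/
structure IsTransgression {A : LieAlgebroid X} (S : Sharp A) (Q : CExt A) (T : OExt2 S.alg)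
    (j : ∀ U : Opens X.pt, Q.sec U →+ (T.alg.sh (-1)).sec U) : Prop where
  square : Nonempty (TransgressionSquare Q T j)
  proj_j : ∀ {U : Opens X.pt} (q : Q.sec U), T.proj.map (-1) U (j U q) = S.j U (Q.proj q)
  anchor_j : ∀ {k l : ℤ} (h : -1 + k = l) {U : Opens X.pt} (q : Q.sec U) (w : Form k U),
    (Q.anchor q).Contracts w (T.alg.anchor h (j U q) w)
  br_j_j : ∀ (h : -1 + -1 = (-2 : ℤ)) {U : Opens X.pt} (p q : Q.sec U),
    T.alg.br h (j U p) (j U q) = T.mark (zero_add (-2)) (Form.ofFn (Q.pair p q))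
  br_D_j : ∀ {U : Opens X.pt} (p q : Q.sec U),
    T.alg.br (zero_add _) (T.alg.D (neg_add_cancel 1) (j U p)) (j U q) = j U (Q.br p q)
  br_j_D : ∀ (h : 1 + -2 = (-1 : ℤ)) {U : Opens X.pt} (p q : Q.sec U),
    T.alg.br (add_zero _) (j U p) (T.alg.D (neg_add_cancel 1) (j U q)) =
      -T.mark h (Form.dFn (Q.pair p q)) + j U (Q.br p q)

/-- The functor `τ : CExt A ⥤ OExt₂ A♯`. -/
structure Transgression {A : LieAlgebroid X} (S : Sharp A) where
  functor : CExt A ⥤ OExt2 S.alg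
  j : ∀ (Q : CExt A) (U : Opens X.pt), Q.sec U →+ (((functor.obj Q).alg.sh (-1)).sec U)
  isTransgression : ∀ Q, IsTransgression S Q (functor.obj Q) (j Q)
  map_j : ∀ {P Q : CExt A} (f : P ⟶ Q) {U : Opens X.pt} (p : P.sec U),
    (functor.map f).map (-1) U (j P U p) = j Q U (f.map U p)

/-- `Q` is the Courant extension of `A` which an extension `T` of `A♯` has in degree `-1`, with
`κ` the identification of `Q` with the degree `-1` part of `T`. -/
structure IsCour {A : LieAlgebroid X} (S : Sharp A) (T : OExt2 S.alg) (Q : CExt A)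
    (κ : ∀ U : Opens X.pt, Q.sec U ≃+ (T.alg.sh (-1)).sec U) : Prop where
  res_κ : ∀ {U V : Opens X.pt} (h : V ≤ U) (q : Q.sec U),
    (T.alg.sh (-1)).res h (κ U q) = κ V (Q.res h q)
  κ_smul : ∀ {U : Opens X.pt} (f : Fn U) (q : Q.sec U),
    κ U (f • q) = T.alg.act (zero_add _) (Form.ofFn f) (κ U q)
  κ_br : ∀ {U : Opens X.pt} (p q : Q.sec U),
    κ U (Q.br p q) = T.alg.br (zero_add _) (T.alg.D (neg_add_cancel 1) (κ U p)) (κ U q)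
  κ_pair : ∀ (h : -1 + -1 = (-2 : ℤ)) {U : Opens X.pt} (p q : Q.sec U),
    T.mark (zero_add (-2)) (Form.ofFn (Q.pair p q)) = T.alg.br h (κ U p) (κ U q)
  κ_anchor : ∀ {k l : ℤ} (h : -1 + k = l) {U : Opens X.pt} (q : Q.sec U) (w : Form k U),
    (Q.anchor q).Contracts w (T.alg.anchor h (κ U q) w)
  κ_coanchor : ∀ (h : 1 + -2 = (-1 : ℤ)) {U : Opens X.pt} (w : Form 1 U),
    κ U (Q.coanchor w) = T.mark h w
  κ_proj : ∀ {U : Opens X.pt} (q : Q.sec U), T.proj.map (-1) U (κ U q) = S.j U (Q.proj q)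

/-- The functor `Q : OExt₂ A♯ ⥤ CExt A`. -/
structure CourFunctor {A : LieAlgebroid X} (S : Sharp A) where
  functor : OExt2 S.alg ⥤ CExt A
  κ : ∀ (T : OExt2 S.alg) (U : Opens X.pt), (functor.obj T).sec U ≃+ (T.alg.sh (-1)).sec U
  isCour : ∀ T, IsCour S T (functor.obj T) (κ T)
  map_κ : ∀ {T T' : OExt2 S.alg} (f : T ⟶ T') {U : Opens X.pt} (q : (functor.obj T).sec U),
    κ T' U ((functor.map f).map U q) = f.map (-1) U (κ T U q)

/-- The isomorphisms `τ(∔ aᵢ 𝒬ᵢ) → ∔ aᵢ τ𝒬ᵢ` of `L` are the canonical ones: they send `s(qᵢ) ε`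
to `s(qᵢ ε)`. -/
def Transgression.IsCanonical {A : LieAlgebroid X} {S : Sharp A} (τ : Transgression S)
    (V : CExtLin A) (W : OExt2Lin S.alg) (L : LinearFunctor V.lc W.lc τ.functor) : Prop :=
  ∀ {n : ℕ} (a : Fin n → 𝕂) (Q : Fin n → CExt A) {U : Opens X.pt} (p : CExt.Fib Q U)
    (p' : OExt2.Fib (fun i => τ.functor.obj (Q i)) (-1) U), p'.1.1 = S.j U p.1.1 →
    (∀ i, p'.1.2 i = τ.j (Q i) U (p.1.2 i)) →
    (L.mu a Q).map (-1) U (τ.j _ U (V.s a Q U p)) = W.s a _ (-1) U p'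

/-- The isomorphisms `Q(∔ aᵢ Tᵢ) → ∔ aᵢ Q(Tᵢ)` of `L` are the canonical ones. -/
def CourFunctor.IsCanonical {A : LieAlgebroid X} {S : Sharp A} (G : CourFunctor S)
    (V : CExtLin A) (W : OExt2Lin S.alg) (L : LinearFunctor W.lc V.lc G.functor) : Prop :=
  ∀ {n : ℕ} (a : Fin n → 𝕂) (T : Fin n → OExt2 S.alg) {U : Opens X.pt}
    (p : CExt.Fib (fun i => G.functor.obj (T i)) U) (p' : OExt2.Fib T (-1) U),
    p'.1.1 = S.j U p.1.1 → (∀ i, p'.1.2 i = G.κ (T i) U (p.1.2 i)) →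
    ∀ q, G.κ _ U q = W.s a T (-1) U p' → (L.mu a T).map U q = V.s a _ U p

end Geometry

end

end OddTransgression

/-- Proofs of equalities of degrees. -/
local notation "◇" => (by omega)

namespace OddTransgression

noncomputable section

variable {𝕜 𝕂 : Type} [RCLike 𝕜] [RCLike 𝕂] [NormedAlgebra 𝕜 𝕂] {X : Mnfd.{u} 𝕜 𝕂}

/-! ### Functions and their differentials in a chart -/

@[ext] lemma Fn.ext {U : Opens X.pt} {f g : Fn U} (h : ∀ x, f.1 x = g.1 x) : f = g :=
  Subtype.ext (funext h)

lemma Fn.smooth {U : Opens X.pt} (f : Fn U) : Smooth f.1 := f.2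

lemma Fn.add_val {U : Opens X.pt} (f g : Fn U) (x : U) : (f + g).1 x = f.1 x + g.1 x := rfl
lemma Fn.mul_val {U : Opens X.pt} (f g : Fn U) (x : U) : (f * g).1 x = f.1 x * g.1 x := rfl
lemma Fn.neg_val {U : Opens X.pt} (f : Fn U) (x : U) : (-f).1 x = -f.1 x := rfl
lemma Fn.sub_val {U : Opens X.pt} (f g : Fn U) (x : U) : (f - g).1 x = f.1 x - g.1 x := rfl
lemma Fn.zero_val {U : Opens X.pt} (x : U) : (0 : Fn U).1 x = 0 := rfl
lemma Fn.one_val {U : Opens X.pt} (x : U) : (1 : Fn U).1 x = 1 := rfl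
lemma Fn.smul_val {U : Opens X.pt} (c : 𝕂) (f : Fn U) (x : U) : (c • f).1 x = c * f.1 x := rfl
lemma Fn.algebraMap_val {U : Opens X.pt} (c : 𝕂) (x : U) :
    (algebraMap 𝕂 (Fn U) c).1 x = c := rfl

lemma ext0_add {U : Opens X.pt} (f g : Fn U) : ext0 (f + g).1 = ext0 f.1 + ext0 g.1 := by
  funext y
  by_cases hy : y ∈ U
  · obtain ⟨z, rfl⟩ : ∃ z : U, (z : X.pt) = y := ⟨⟨y, hy⟩, rfl⟩
    exact (ext0_apply _ z).trans (congrArg₂ (· + ·) (ext0_apply f.1 z) (ext0_apply g.1 z)).symm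
  · have h : ¬ ∃ a : U, (a : X.pt) = y := fun ⟨a, ha⟩ => hy (ha ▸ a.2)
    simp [ext0, Function.extend_apply' _ _ _ h]

lemma ext0_mul {U : Opens X.pt} (f g : Fn U) : ext0 (f * g).1 = ext0 f.1 * ext0 g.1 := by
  funext y
  by_cases hy : y ∈ U
  · obtain ⟨z, rfl⟩ : ∃ z : U, (z : X.pt) = y := ⟨⟨y, hy⟩, rfl⟩
    exact (ext0_apply _ z).trans (congrArg₂ (· * ·) (ext0_apply f.1 z) (ext0_apply g.1 z)).symm
  · have h : ¬ ∃ a : U, (a : X.pt) = y := fun ⟨a, ha⟩ => hy (ha ▸ a.2)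
    simp [ext0, Function.extend_apply' _ _ _ h]

lemma ext0_algebraMap {U : Opens X.pt} (c : 𝕂) (x : U) :
    ext0 (algebraMap 𝕂 (Fn U) c).1 =ᶠ[nhds (x : X.pt)] fun _ => c := by
  filter_upwards [U.isOpen.mem_nhds x.2] with y hy
  rw [show y = ((⟨y, hy⟩ : U) : X.pt) from rfl, ext0_apply]; rfl

lemma reg_ne_zero : X.reg ≠ 0 := by
  rcases X.reg_eq with h | h <;> rw [h] <;> simp

lemma one_le_reg : 1 ≤ X.reg := by
  rcases X.reg_eq with h | h <;> rw [h] <;> simp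

lemma two_le_reg : 2 ≤ X.reg := by
  rcases X.reg_eq with h | h <;> rw [h]
  · exact WithTop.coe_le_coe.2 le_top
  · exact le_top

lemma reg_add_one : X.reg + 1 ≤ X.reg := by
  rcases X.reg_eq with h | h <;> rw [h] <;> simp

lemma Fn.mdifferentiableAt {U : Opens X.pt} (f : Fn U) (x : U) :
    MDifferentiableAt 𝓘(𝕜, X.E) 𝓘(𝕜, 𝕂) (ext0 f.1) (x : X.pt) :=
  (f.2 x).mdifferentiableAt reg_ne_zero

lemma dAt_add {U : Opens X.pt} (f g : Fn U) (x : U) : dAt (f + g) x = dAt f x + dAt g x := by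
  unfold dAt
  rw [ext0_add]
  exact ((f.mdifferentiableAt x).hasMFDerivAt.add (g.mdifferentiableAt x).hasMFDerivAt).mfderiv

lemma dAt_mul {U : Opens X.pt} (f g : Fn U) (x : U) :
    dAt (f * g) x = f.1 x • dAt g x + g.1 x • dAt f x := by
  have := ((f.mdifferentiableAt x).hasMFDerivAt.mul (g.mdifferentiableAt x).hasMFDerivAt).mfderiv
  rw [← ext0_mul, ext0_apply f.1, ext0_apply g.1] at this
  exact this

lemma dAt_algebraMap {U : Opens X.pt} (c : 𝕂) (x : U) :
    dAt (algebraMap 𝕂 (Fn U) c) x = 0 := by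
  unfold dAt
  rw [(ext0_algebraMap c x).mfderiv_eq]
  exact mfderiv_const

lemma dAt_one {U : Opens X.pt} (x : U) : dAt (1 : Fn U) x = 0 := by
  rw [← map_one (algebraMap 𝕂 (Fn U))]; exact dAt_algebraMap 1 x

/-- The domain of the preferred chart at a point. -/
def chartDom (x₀ : X.pt) : Opens X.pt := ⟨(chartAt X.E x₀).source, (chartAt X.E x₀).open_source⟩

/-- The coordinate expression of a function in the preferred chart at `x₀`. -/
def coordFn (x₀ : X.pt) {V : Opens X.pt} (f : Fn V) : X.E → 𝕂 :=
  ext0 f.1 ∘ (extChartAt 𝓘(𝕜, X.E) x₀).symm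

section Chart
variable {x₀ : X.pt} {V : Opens X.pt} (hV : V ≤ chartDom x₀)
include hV

lemma mem_extChart (y : V) : (y : X.pt) ∈ (extChartAt 𝓘(𝕜, X.E) x₀).source := by
  rw [extChartAt_source]; exact hV y.2

lemma coordFn_contDiffAt (f : Fn V) (y : V) :
    ContDiffAt 𝕜 X.reg (coordFn x₀ f) (extChartAt 𝓘(𝕜, X.E) x₀ y) := by
  rw [← contMDiffAt_iff_contDiffAt]
  have h₁ : ContMDiffAt 𝓘(𝕜, X.E) 𝓘(𝕜, X.E) X.reg (extChartAt 𝓘(𝕜, X.E) x₀).symm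
      (extChartAt 𝓘(𝕜, X.E) x₀ y) :=
    (contMDiffOn_extChartAt_symm x₀).contMDiffAt ((isOpen_extChartAt_target x₀).mem_nhds
      ((extChartAt 𝓘(𝕜, X.E) x₀).map_source (mem_extChart hV y)))
  refine ContMDiffAt.comp _ ?_ h₁
  rw [(extChartAt 𝓘(𝕜, X.E) x₀).left_inv (mem_extChart hV y)]
  exact f.2 y

lemma coordFn_differentiableAt (f : Fn V) (y : V) :
    DifferentiableAt 𝕜 (coordFn x₀ f) (extChartAt 𝓘(𝕜, X.E) x₀ y) :=
  (coordFn_contDiffAt hV f y).differentiableAt reg_ne_zero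

lemma dAt_eq_coord (f : Fn V) (y : V) :
    dAt f y = (fderiv 𝕜 (coordFn x₀ f) (extChartAt 𝓘(𝕜, X.E) x₀ y)).comp
      (mfderiv 𝓘(𝕜, X.E) 𝓘(𝕜, X.E) (extChartAt 𝓘(𝕜, X.E) x₀) (y : X.pt)) := by
  have hφ : ContMDiffAt 𝓘(𝕜, X.E) 𝓘(𝕜, X.E) X.reg (extChartAt 𝓘(𝕜, X.E) x₀) (y : X.pt) :=
    contMDiffAt_extChartAt' (hV y.2)
  have he : ext0 f.1 =ᶠ[nhds (y : X.pt)] coordFn x₀ f ∘ extChartAt 𝓘(𝕜, X.E) x₀ := by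
    filter_upwards [V.isOpen.mem_nhds y.2] with z hz
    simp only [coordFn, Function.comp_apply]
    rw [(extChartAt 𝓘(𝕜, X.E) x₀).left_inv (mem_extChart hV ⟨z, hz⟩)]
  unfold dAt
  rw [he.mfderiv_eq, mfderiv_comp (I' := 𝓘(𝕜, X.E)) _
    (coordFn_differentiableAt hV f y).mdifferentiableAt
    (hφ.mdifferentiableAt reg_ne_zero), mfderiv_eq_fderiv]
  rfl

/-- The derivative of a function in a coordinate direction. -/
def coordD (e : X.E) (f : Fn V) : Fn V :=
  ⟨fun y => fderiv 𝕜 (coordFn x₀ f) (extChartAt 𝓘(𝕜, X.E) x₀ y) e, by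
    refine Smooth.congr (fun y => fderiv 𝕜 (coordFn x₀ f) (extChartAt 𝓘(𝕜, X.E) x₀ y) e)
      (fun y => ?_) (fun _ => rfl)
    have h₁ : ContDiffAt 𝕜 X.reg (fun z => fderiv 𝕜 (coordFn x₀ f) z e)
        (extChartAt 𝓘(𝕜, X.E) x₀ y) :=
      ((coordFn_contDiffAt hV f y).fderiv_right reg_add_one).clm_apply contDiffAt_const
    exact h₁.contMDiffAt.comp (y : X.pt) (contMDiffAt_extChartAt' (hV y.2))⟩

lemma coordD_val (e : X.E) (f : Fn V) (y : V) :
    (coordD hV e f).1 y = fderiv 𝕜 (coordFn x₀ f) (extChartAt 𝓘(𝕜, X.E) x₀ y) e := rfl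

lemma coordD_add (e : X.E) (f g : Fn V) :
    coordD hV e (f + g) = coordD hV e f + coordD hV e g := by
  ext y
  rw [Fn.add_val, coordD_val, coordD_val, coordD_val]
  have : coordFn x₀ (f + g) = coordFn x₀ f + coordFn x₀ g := by
    unfold coordFn; rw [ext0_add]; rfl
  rw [this, fderiv_add (coordFn_differentiableAt hV f y) (coordFn_differentiableAt hV g y)]
  rfl

lemma coordD_mul (e : X.E) (f g : Fn V) :
    coordD hV e (f * g) = f * coordD hV e g + g * coordD hV e f := by
  ext y
  rw [Fn.add_val, Fn.mul_val, Fn.mul_val, coordD_val, coordD_val, coordD_val]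
  have : coordFn x₀ (f * g) = coordFn x₀ f * coordFn x₀ g := by
    unfold coordFn; rw [ext0_mul]; rfl
  rw [this, fderiv_mul (coordFn_differentiableAt hV f y) (coordFn_differentiableAt hV g y)]
  have h : ∀ k : Fn V, coordFn x₀ k (extChartAt 𝓘(𝕜, X.E) x₀ y) = k.1 y := fun k => by
    simp only [coordFn, Function.comp_apply]
    rw [(extChartAt 𝓘(𝕜, X.E) x₀).left_inv (mem_extChart hV y), ext0_apply]
  rw [h, h]
  rfl

lemma coordFn_eventually {P : Fn V} {G : X.E → 𝕂}
    (h : ∀ y : V, P.1 y = G (extChartAt 𝓘(𝕜, X.E) x₀ y)) (y : V) :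
    coordFn x₀ P =ᶠ[nhds (extChartAt 𝓘(𝕜, X.E) x₀ y)] G := by
  have hc : ContinuousAt (extChartAt 𝓘(𝕜, X.E) x₀).symm (extChartAt 𝓘(𝕜, X.E) x₀ y) :=
    continuousAt_extChartAt_symm'' ((extChartAt 𝓘(𝕜, X.E) x₀).map_source (mem_extChart hV y))
  have hm : (V : Set X.pt) ∈ nhds ((extChartAt 𝓘(𝕜, X.E) x₀).symm
      (extChartAt 𝓘(𝕜, X.E) x₀ y)) := by
    rw [(extChartAt 𝓘(𝕜, X.E) x₀).left_inv (mem_extChart hV y)]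
    exact V.isOpen.mem_nhds y.2
  filter_upwards [hc hm, (isOpen_extChartAt_target x₀).mem_nhds
      ((extChartAt 𝓘(𝕜, X.E) x₀).map_source (mem_extChart hV y))] with z hz hz'
  have := h ⟨_, hz⟩
  rw [(extChartAt 𝓘(𝕜, X.E) x₀).right_inv hz'] at this
  rw [← this, coordFn, Function.comp_apply]
  exact ext0_apply P.1 ⟨_, hz⟩

lemma coordD_algebraMap (e : X.E) (c : 𝕂) : coordD hV e (algebraMap 𝕂 (Fn V) c) = 0 := by
  ext y
  rw [coordD_val, (coordFn_eventually hV (G := fun _ => c) (fun _ => rfl) y).fderiv_eq]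
  simp [Fn.zero_val]

lemma coordD_comm (e e' : X.E) (f : Fn V) :
    coordD hV e' (coordD hV e f) = coordD hV e (coordD hV e' f) := by
  have key : ∀ (e e' : X.E) (y : V), (coordD hV e' (coordD hV e f)).1 y =
      fderiv 𝕜 (fderiv 𝕜 (coordFn x₀ f)) (extChartAt 𝓘(𝕜, X.E) x₀ y) e' e := fun e e' y => by
    rw [coordD_val, (coordFn_eventually hV (P := coordD hV e f)
      (G := fun z => fderiv 𝕜 (coordFn x₀ f) z e) (fun _ => rfl) y).fderiv_eq]
    have hd : DifferentiableAt 𝕜 (fderiv 𝕜 (coordFn x₀ f)) (extChartAt 𝓘(𝕜, X.E) x₀ y) :=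
      ((coordFn_contDiffAt hV f y).fderiv_right reg_add_one).differentiableAt reg_ne_zero
    rw [fderiv_clm_apply hd (differentiableAt_const e)]
    simp
  ext y
  rw [key, key]
  refine ((coordFn_contDiffAt hV f y).isSymmSndFDerivAt ?_) e' e
  rw [minSmoothness_of_isRCLikeNormedField]
  exact two_le_reg

end Chart

/-- The coordinate covectors of a basis of the model space. -/
def coordCov (X : Mnfd.{u} 𝕜 𝕂) (l : Fin (Module.finrank 𝕜 X.E)) : Cot X :=
  (Algebra.linearMap 𝕜 𝕂).toContinuousLinearMap.comp
    ((Module.finBasis 𝕜 X.E).coord l).toContinuousLinearMap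

lemma cot_eq_sum (ξ : Cot X) :
    ξ = ∑ l, ξ (Module.finBasis 𝕜 X.E l) • coordCov X l := by
  ext e
  conv_lhs => rw [← (Module.finBasis 𝕜 X.E).sum_repr e]
  rw [map_sum, sum_apply]
  refine Finset.sum_congr rfl fun l _ => ?_
  rw [map_smul]
  simp [coordCov, Algebra.smul_def, mul_comm]

/-- The change of trivialization of the cotangent space, from the preferred chart at `x₀` to the
one at `y`. -/
def cotChange (x₀ y : X.pt) : Cot X →ₗ[𝕂] Cot X where
  toFun ξ := ξ.comp (mfderiv 𝓘(𝕜, X.E) 𝓘(𝕜, X.E) (extChartAt 𝓘(𝕜, X.E) x₀) y : X.E →L[𝕜] X.E)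
  map_add' _ _ := rfl
  map_smul' _ _ := rfl

lemma cotChange_ker {x₀ y : X.pt} (h : y ∈ chartDom (X := X) x₀) :
    (cotChange (X := X) x₀ y).ker = ⊥ := by
  have h1 : IsManifold 𝓘(𝕜, X.E) 1 X.pt := IsManifold.of_le (one_le_reg (X := X))
  have hi : (mfderiv 𝓘(𝕜, X.E) 𝓘(𝕜, X.E) (extChartAt 𝓘(𝕜, X.E) x₀) y).IsInvertible :=
    isInvertible_mfderiv_extChartAt (I := 𝓘(𝕜, X.E)) (by rw [extChartAt_source]; exact h)
  obtain ⟨M, hM⟩ := hi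
  rw [LinearMap.ker_eq_bot']
  intro ξ hξ
  ext e
  have h0 : ξ ((mfderiv 𝓘(𝕜, X.E) 𝓘(𝕜, X.E) (extChartAt 𝓘(𝕜, X.E) x₀) y : X.E →L[𝕜] X.E)
      (M.symm e)) = 0 := congrArg (fun η : Cot X => η (M.symm e)) hξ
  have hs : (mfderiv 𝓘(𝕜, X.E) 𝓘(𝕜, X.E) (extChartAt 𝓘(𝕜, X.E) x₀) y : X.E →L[𝕜] X.E)
      (M.symm e) = e := by
    rw [← hM]; exact M.apply_symm_apply e
  exact (congrArg ξ hs).symm.trans h0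

lemma dAt_eq_sum {x₀ : X.pt} {V : Opens X.pt} (hV : V ≤ chartDom x₀) (f : Fn V) (y : V) :
    dAt f y = ∑ l, (coordD hV (Module.finBasis 𝕜 X.E l) f).1 y •
      cotChange x₀ y (coordCov X l) := by
  rw [dAt_eq_coord hV f y, cot_eq_sum (fderiv 𝕜 (coordFn x₀ f) _)]
  have := map_sum (cotChange x₀ (y : X.pt)) (fun l => fderiv 𝕜 (coordFn x₀ f)
    (extChartAt 𝓘(𝕜, X.E) x₀ y) (Module.finBasis 𝕜 X.E l) • coordCov X l) Finset.univ
  refine this.trans (Finset.sum_congr rfl fun l _ => ?_)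
  rw [map_smul]
  rfl

section Differential

/-! ### The exterior derivative -/

open TensorProduct

/-- Evaluation of functions at a point. -/
def evalAt {V : Opens X.pt} (y : V) : Fn V →ₐ[𝕂] 𝕂 where
  toFun f := f.1 y
  map_one' := rfl
  map_mul' _ _ := rfl
  map_zero' := rfl
  map_add' _ _ := rfl
  commutes' _ := rfl

/-- Forms with function coefficients in the chart at `x₀`, evaluated at a point. -/
def chartEval (x₀ : X.pt) {V : Opens X.pt} (y : V) : Fn V ⊗[𝕂] Ext X →ₐ[𝕂] Ext X :=
  Algebra.TensorProduct.lift ((Algebra.ofId 𝕂 (Ext X)).comp (evalAt y))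
    (ExteriorAlgebra.map (cotChange x₀ y)) fun f w => by
      simp only [AlgHom.comp_apply, Algebra.ofId_apply]
      exact Algebra.commutes _ _

lemma chartEval_tmul (x₀ : X.pt) {V : Opens X.pt} (y : V) (f : Fn V) (w : Ext X) :
    chartEval x₀ y (f ⊗ₜ w) = f.1 y • ExteriorAlgebra.map (cotChange (X := X) x₀ y) w := by
  rw [chartEval, Algebra.TensorProduct.lift_tmul, Algebra.smul_def]; rfl

lemma chartEval_injective {x₀ : X.pt} {V : Opens X.pt} (hV : V ≤ chartDom (X := X) x₀)
    {z : Fn V ⊗[𝕂] Ext X} (h : ∀ y : V, chartEval x₀ y z = 0) : z = 0 := by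
  classical
  let b := Module.Basis.ofVectorSpace 𝕂 (Ext X)
  let e := TensorProduct.equivFinsuppOfBasisRight (M := Fn V) b
  obtain ⟨c, rfl⟩ := e.symm.surjective z
  suffices hc : c = 0 by rw [hc, map_zero]
  ext i y
  have hy := h y
  have he : e.symm c = c.sum fun i r => r ⊗ₜ[𝕂] b i :=
    TensorProduct.equivFinsuppOfBasisRight_symm_apply (M := Fn V) b c
  rw [he, Finsupp.sum, map_sum] at hy
  simp only [chartEval_tmul, ← map_smul, ← map_sum] at hy
  have hz := (map_eq_zero_iff _
    (ExteriorAlgebra.map_injective_field (cotChange_ker (hV y.2)))).1 hy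
  by_cases hi : i ∈ c.support
  · exact (linearIndependent_iff'.1 b.linearIndependent) c.support (fun i => (c i).1 y) hz i hi
  · rw [Finsupp.notMem_support_iff.1 hi]; rfl

section
variable {x₀ : X.pt} {V : Opens X.pt} (hV : V ≤ chartDom (X := X) x₀)

/-- The derivative in a coordinate direction, as a linear map. -/
def coordDL (l : Fin (Module.finrank 𝕜 X.E)) : Fn V →ₗ[𝕂] Fn V where
  toFun f := coordD hV (Module.finBasis 𝕜 X.E l) f
  map_add' := coordD_add hV _
  map_smul' c f := by
    rw [Algebra.smul_def, coordD_mul, coordD_algebraMap, mul_zero, add_zero, RingHom.id_apply,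
      Algebra.smul_def]

/-- The derivative of the coefficients of a form in a coordinate direction. -/
def coefD (l : Fin (Module.finrank 𝕜 X.E)) : Fn V ⊗[𝕂] Ext X →ₗ[𝕂] Fn V ⊗[𝕂] Ext X :=
  (coordDL hV l).rTensor (Ext X)

lemma coefD_mul (l : Fin (Module.finrank 𝕜 X.E)) (z z' : Fn V ⊗[𝕂] Ext X) :
    coefD hV l (z * z') = coefD hV l z * z' + z * coefD hV l z' := by
  induction z using TensorProduct.induction_on with
  | zero => simp
  | add a b ha hb => rw [add_mul, map_add, ha, hb, map_add]; noncomm_ring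
  | tmul f w =>
    induction z' using TensorProduct.induction_on with
    | zero => simp
    | add a b ha hb => rw [mul_add, map_add, ha, hb, map_add]; noncomm_ring
    | tmul g w' =>
      simp only [coefD, Algebra.TensorProduct.tmul_mul_tmul, LinearMap.rTensor_tmul]
      rw [← TensorProduct.add_tmul]
      congr 1
      exact (coordD_mul hV _ f g).trans (by rw [add_comm, mul_comm g]; rfl)

/-- The coordinate covectors as forms with function coefficients. -/
def dx (V : Opens X.pt) (l : Fin (Module.finrank 𝕜 X.E)) : Fn V ⊗[𝕂] Ext X :=
  1 ⊗ₜ ExteriorAlgebra.ι 𝕂 (coordCov X l)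

/-- The exterior derivative in a chart, on forms with function coefficients. -/
def chartD : Fn V ⊗[𝕂] Ext X →ₗ[𝕂] Fn V ⊗[𝕂] Ext X :=
  ∑ l, (LinearMap.mulLeft 𝕂 (dx V l)).comp (coefD hV l)

/-- The differential of a function, with function coefficients. -/
def chartDFn (g : Fn V) : Fn V ⊗[𝕂] Ext X :=
  ∑ l, coordDL hV l g ⊗ₜ ExteriorAlgebra.ι 𝕂 (coordCov X l)

lemma chartD_apply (z : Fn V ⊗[𝕂] Ext X) : chartD hV z = ∑ l, dx V l * coefD hV l z := by
  simp [chartD]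

lemma ι_mul_ι_swap (a b : Cot X) : ExteriorAlgebra.ι 𝕂 a * ExteriorAlgebra.ι 𝕂 b =
    -(ExteriorAlgebra.ι 𝕂 b * ExteriorAlgebra.ι 𝕂 a) :=
  eq_neg_of_add_eq_zero_left (ExteriorAlgebra.ι_add_mul_swap a b)

lemma dx_mul_chartDFn (l : Fin (Module.finrank 𝕜 X.E)) (g : Fn V) :
    dx V l * chartDFn hV g = -(chartDFn hV g * dx V l) := by
  simp only [dx, chartDFn, Finset.mul_sum, Finset.sum_mul, Algebra.TensorProduct.tmul_mul_tmul,
    one_mul, mul_one, ← Finset.sum_neg_distrib]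
  refine Finset.sum_congr rfl fun k _ => ?_
  rw [ι_mul_ι_swap, TensorProduct.tmul_neg]

lemma chartD_chartDFn (g : Fn V) : chartD hV (chartDFn hV g) = 0 := by
  have h : chartD hV (chartDFn hV g) = ∑ l, ∑ k, coordDL hV l (coordDL hV k g) ⊗ₜ
      (ExteriorAlgebra.ι 𝕂 (coordCov X l) * ExteriorAlgebra.ι 𝕂 (coordCov X k)) := by
    rw [chartD_apply]
    refine Finset.sum_congr rfl fun l _ => ?_
    rw [chartDFn, map_sum, Finset.mul_sum]
    refine Finset.sum_congr rfl fun k _ => ?_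
    simp [dx, coefD]
  have h' : chartD hV (chartDFn hV g) = -chartD hV (chartDFn hV g) := by
    conv_lhs => rw [h, Finset.sum_comm]
    rw [h, ← Finset.sum_neg_distrib]
    refine Finset.sum_congr rfl fun l _ => ?_
    rw [← Finset.sum_neg_distrib]
    refine Finset.sum_congr rfl fun k _ => ?_
    rw [ι_mul_ι_swap, TensorProduct.tmul_neg]
    congr 2
    exact coordD_comm hV _ _ g
  have h2 : (2 : 𝕂) • chartD hV (chartDFn hV g) = 0 := by
    rw [two_smul]; nth_rewrite 1 [h']; exact neg_add_cancel _
  exact (smul_eq_zero.1 h2).resolve_left two_ne_zero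

lemma chartD_chartDFn_mul (g : Fn V) (m : Fn V ⊗[𝕂] Ext X) :
    chartD hV (chartDFn hV g * m) = -(chartDFn hV g * chartD hV m) := by
  have h0 := chartD_chartDFn hV g
  rw [chartD_apply] at h0
  simp only [chartD_apply, coefD_mul, mul_add, Finset.sum_add_distrib, ← mul_assoc,
    ← Finset.sum_mul, h0, zero_mul, zero_add, dx_mul_chartDFn]
  simp only [neg_mul, Finset.sum_neg_distrib, Finset.mul_sum, mul_assoc]

lemma chartD_tmul_one_mul (f : Fn V) (m : Fn V ⊗[𝕂] Ext X) :
    chartD hV ((f ⊗ₜ 1) * m) = chartDFn hV f * m + (f ⊗ₜ 1) * chartD hV m := by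
  simp only [chartD_apply, coefD_mul, mul_add, Finset.sum_add_distrib, ← mul_assoc,
    ← Finset.sum_mul]
  congr 1
  · congr 1
    refine Finset.sum_congr rfl fun l _ => ?_
    simp [dx, coefD]
  · rw [Finset.mul_sum]
    refine Finset.sum_congr rfl fun l _ => ?_
    rw [← mul_assoc]
    congr 1
    simp [dx]

lemma chartD_prod (L : List (Fn V)) : chartD hV (L.map (chartDFn hV)).prod = 0 := by
  induction L with
  | nil =>
    simp only [List.map_nil, List.prod_nil, chartD_apply]
    refine Finset.sum_eq_zero fun l _ => ?_
    have : coefD hV l (1 : Fn V ⊗[𝕂] Ext X) = 0 := by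
      have h := coefD_mul hV l (1 : Fn V ⊗[𝕂] Ext X) 1
      simp only [mul_one, one_mul] at h
      exact left_eq_add.1 h
    rw [this, mul_zero]
  | cons g L ih => rw [List.map_cons, List.prod_cons, chartD_chartDFn_mul, ih, mul_zero, neg_zero]

lemma chartEval_chartDFn (g : Fn V) (y : V) :
    chartEval x₀ y (chartDFn hV g) = ExteriorAlgebra.ι 𝕂 (dAt g y) := by
  rw [chartDFn, map_sum, dAt_eq_sum hV g y, map_sum]
  refine Finset.sum_congr rfl fun l _ => ?_
  rw [chartEval_tmul, ExteriorAlgebra.map_apply_ι, map_smul]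
  rfl

lemma chartEval_prod (L : List (Fn V)) (y : V) : chartEval x₀ y (L.map (chartDFn hV)).prod =
    (L.map fun g => ExteriorAlgebra.ι 𝕂 (dAt g y)).prod := by
  rw [map_list_prod, List.map_map]
  congr 1
  exact List.map_congr_left fun g _ => chartEval_chartDFn hV g y

include hV in
lemma dMonomials_lift {k : ℤ} {w : (V → Ext X) × (V → Ext X)}
    (h : w ∈ AddSubgroup.closure (dMonomials k V)) : ∃ z : Fn V ⊗[𝕂] Ext X,
      (∀ y, chartEval x₀ y z = w.1 y) ∧ ∀ y, chartEval x₀ y (chartD hV z) = w.2 y := by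
  induction h using AddSubgroup.closure_induction with
  | mem w hw =>
    obtain ⟨f, L, -, h1, h2⟩ := hw
    refine ⟨(f ⊗ₜ 1) * (L.map (chartDFn hV)).prod, fun y => ?_, fun y => ?_⟩
    · rw [map_mul, chartEval_prod, chartEval_tmul, map_one, h1, smul_mul_assoc, one_mul]
    · rw [chartD_tmul_one_mul, chartD_prod, mul_zero, add_zero, map_mul, chartEval_prod,
        chartEval_chartDFn, h2]
  | zero => exact ⟨0, by simp, by simp⟩
  | add a b _ _ ha hb =>
    obtain ⟨z, h1, h2⟩ := ha
    obtain ⟨z', h1', h2'⟩ := hb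
    exact ⟨z + z', fun y => by rw [map_add, h1, h1']; rfl,
      fun y => by rw [map_add, map_add, h2, h2']; rfl⟩
  | neg a _ ha =>
    obtain ⟨z, h1, h2⟩ := ha
    exact ⟨-z, fun y => by rw [map_neg, h1]; rfl, fun y => by rw [map_neg, map_neg, h2]; rfl⟩

include hV in
/-- A combination of the pairs `(f dg₁ ⋯ dg_k, df dg₁ ⋯ dg_k)` with first component zero has
second component zero. -/
lemma dMonomials_eq_zero {k : ℤ} {w : (V → Ext X) × (V → Ext X)}
    (h : w ∈ AddSubgroup.closure (dMonomials k V)) (h0 : w.1 = 0) : w.2 = 0 := by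
  obtain ⟨z, h1, h2⟩ := dMonomials_lift hV h
  have hz : z = 0 := chartEval_injective hV fun y => by rw [h1, h0]; rfl
  funext y
  rw [← h2, hz, map_zero, map_zero]
  rfl

end

end Differential

/-! ### Sheaves of abelian groups: locality, gluing, sheafification -/

namespace AbSheaf
variable (F : AbSheaf X)

/-- Sections which agree locally are equal. -/
lemma eq_of_local {U : Opens X.pt} {s t : F.sec U}
    (h : ∀ x : U, ∃ (V : Opens X.pt) (hV : V ≤ U), (x : X.pt) ∈ V ∧ F.res hV s = F.res hV t) :
    s = t := by
  choose V hV hx he using h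
  have hle : iSup V ≤ U := iSup_le hV
  have hge : U ≤ iSup V := fun x hx' => Opens.mem_iSup.2 ⟨⟨x, hx'⟩, hx _⟩
  obtain ⟨r, -, hr⟩ := F.glue V (fun i => F.res (hV i) s) fun i j => by rw [F.res_res, F.res_res]
  have h1 : F.res hle s = r := hr _ fun i => F.res_res _ _ _
  have h2 : F.res hle t = r := hr _ fun i => (F.res_res _ _ _).trans (he i).symm
  rw [← F.res_id s, ← F.res_id t, ← F.res_res hle hge, ← F.res_res hle hge, h1, h2]

lemma eq_zero_of_local {U : Opens X.pt} {s : F.sec U}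
    (h : ∀ x : U, ∃ (V : Opens X.pt) (hV : V ≤ U), (x : X.pt) ∈ V ∧ F.res hV s = 0) : s = 0 :=
  F.eq_of_local fun x => by
    obtain ⟨V, hV, hx, he⟩ := h x
    exact ⟨V, hV, hx, by rw [he, map_zero]⟩

/-- A relation which holds for some section locally, and for at most one, defines a section. -/
lemma glue_local {U : Opens X.pt} (P : ∀ V : Opens X.pt, F.sec V → Prop)
    (hex : ∀ x : U, ∃ V : Opens X.pt, V ≤ U ∧ (x : X.pt) ∈ V ∧ ∃ s, P V s)
    (huniq : ∀ (V V' : Opens X.pt) (s : F.sec V) (s' : F.sec V'), V ≤ U → V' ≤ U → P V s →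
      P V' s' → F.res (inf_le_left : V ⊓ V' ≤ V) s = F.res (inf_le_right : V ⊓ V' ≤ V') s') :
    ∃ t : F.sec U, ∀ (V : Opens X.pt) (h : V ≤ U) (s : F.sec V), P V s → F.res h t = s := by
  choose V hV hx s hs using hex
  have hge : U ≤ iSup V := fun x hx' => Opens.mem_iSup.2 ⟨⟨x, hx'⟩, hx _⟩
  obtain ⟨r, hr, -⟩ := F.glue V s fun i j => huniq _ _ _ _ (hV i) (hV j) (hs i) (hs j)
  refine ⟨F.res hge r, fun W h s' hs' => F.eq_of_local fun y => ?_⟩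
  refine ⟨V ⟨y, h y.2⟩ ⊓ W, inf_le_right, ⟨hx _, y.2⟩, ?_⟩
  rw [F.res_res, F.res_res, ← huniq _ _ _ _ (hV _) h (hs ⟨y, h y.2⟩) hs', ← hr, F.res_res]

end AbSheaf

variable (X) in
/-- Presheaves of abelian groups on `X`. -/
structure AbPre where
  sec : Opens X.pt → Type u
  [grp : ∀ U, AddCommGroup (sec U)]
  res : ∀ {U V : Opens X.pt}, V ≤ U → (sec U →+ sec V)
  res_id : ∀ {U : Opens X.pt} (s : sec U), res le_rfl s = s
  res_res : ∀ {U V W : Opens X.pt} (h : V ≤ U) (h' : W ≤ V) (s : sec U),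
    res h' (res h s) = res (h'.trans h) s

attribute [instance] AbPre.grp

/-- The presheaf underlying a sheaf. -/
@[reducible] def AbSheaf.pre (F : AbSheaf X) : AbPre X where
  sec := F.sec
  res := F.res
  res_id := F.res_id
  res_res := F.res_res

/-- The quotient of a presheaf by a subpresheaf, as a functor. -/
def AbPre.quotFunctor (P : AbPre X) (K : ∀ U, AddSubgroup (P.sec U))
    (hK : ∀ {U V : Opens X.pt} (h : V ≤ U) (p : P.sec U), p ∈ K U → P.res h p ∈ K V) :
    (Opens (TopCat.of X.pt))ᵒᵖ ⥤ AddCommGrpCat.{u} where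
  obj U := AddCommGrpCat.of (P.sec U.unop ⧸ K U.unop)
  map f := AddCommGrpCat.ofHom (QuotientAddGroup.map _ _ (P.res f.unop.le) fun p hp => hK _ p hp)
  map_id U := by
    ext p
    exact congrArg QuotientAddGroup.mk (P.res_id p)
  map_comp f g := by
    ext p
    exact congrArg QuotientAddGroup.mk (P.res_res _ _ p).symm

/-- A sheaf in the sense of `Mathlib`, as an `AbSheaf`. -/
def AbSheaf.ofSheaf (F : TopCat.Sheaf AddCommGrpCat.{u} (TopCat.of X.pt)) : AbSheaf X where
  sec U := F.obj.obj (.op U)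
  res h := (F.obj.map (homOfLE h).op).hom
  res_id s := ConcreteCategory.congr_hom (F.obj.map_id _) s
  res_res h h' s := (ConcreteCategory.congr_hom (F.obj.map_comp (homOfLE h).op (homOfLE h').op) s).symm
  glue U s hs := TopCat.Sheaf.existsUnique_gluing F U s hs

/-- The sheaf associated to the quotient of a presheaf by a subpresheaf. -/
lemma AbPre.exists_sheafify (P : AbPre X) (K : ∀ U, AddSubgroup (P.sec U))
    (hK : ∀ {U V : Opens X.pt} (h : V ≤ U) (p : P.sec U), p ∈ K U → P.res h p ∈ K V) :
    ∃ (F : AbSheaf X) (π : ∀ U, P.sec U →+ F.sec U),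
      (∀ (U V : Opens X.pt) (h : V ≤ U) (p : P.sec U), F.res h (π U p) = π V (P.res h p)) ∧
      (∀ (U : Opens X.pt) (s : F.sec U) (x : U), ∃ (V : Opens X.pt) (h : V ≤ U) (p : P.sec V),
        (x : X.pt) ∈ V ∧ F.res h s = π V p) ∧
      (∀ (U : Opens X.pt) (p : P.sec U), p ∈ K U → π U p = 0) ∧
      ∀ (U : Opens X.pt) (p : P.sec U), π U p = 0 → ∀ x : U, ∃ (V : Opens X.pt) (h : V ≤ U),
        (x : X.pt) ∈ V ∧ P.res h p ∈ K V := by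
  let G := P.quotFunctor K hK
  let J := Opens.grothendieckTopology (TopCat.of X.pt)
  let S : TopCat.Sheaf AddCommGrpCat.{u} (TopCat.of X.pt) :=
    (presheafToSheaf J AddCommGrpCat.{u}).obj G
  let η : G ⟶ S.obj := toSheafify J G
  let π : ∀ U : Opens X.pt, P.sec U →+ (AbSheaf.ofSheaf S).sec U := fun U =>
    (η.app (.op U)).hom.comp (QuotientAddGroup.mk' (K U))
  refine ⟨AbSheaf.ofSheaf S, π, fun U V h p => ?_, fun U s x => ?_, fun U p hp => ?_,
    fun U p hp x => ?_⟩
  · exact (NatTrans.naturality_apply η (homOfLE h).op (QuotientAddGroup.mk' (K U) p)).symm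
  · have : Presheaf.IsLocallySurjective J η :=
      inferInstanceAs (Presheaf.IsLocallySurjective J (toSheafify J G))
    obtain ⟨V, f, ⟨t, ht⟩, hx⟩ := Presheaf.imageSieve_mem J η (U := .op U) s x.1 x.2
    obtain ⟨p, rfl⟩ := QuotientAddGroup.mk_surjective t
    exact ⟨V, f.le, p, hx, ht.symm⟩
  · have h0 : QuotientAddGroup.mk' (K U) p = 0 := (QuotientAddGroup.eq_zero_iff p).2 hp
    exact (congrArg (η.app (.op U)).hom h0).trans (map_zero _)
  · have : Presheaf.IsLocallyInjective J η :=
      inferInstanceAs (Presheaf.IsLocallyInjective J (toSheafify J G))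
    have h0 : η.app (.op U) (QuotientAddGroup.mk' (K U) p : G.obj (.op U)) =
        η.app (.op U) (0 : G.obj (.op U)) := hp.trans (map_zero (η.app (.op U)).hom).symm
    obtain ⟨V, f, hV, hx⟩ := Presheaf.equalizerSieve_mem J η _ _ h0 x.1 x.2
    refine ⟨V, f.le, hx, (QuotientAddGroup.eq_zero_iff _).1 ?_⟩
    exact hV.trans (map_zero (G.map f.op).hom)

/-- A map from a presheaf to a sheaf which exhibits the latter, up to local isomorphism, as a
quotient of the former. -/
structure IsSheafQuot (P : AbPre X) (F : AbSheaf X) (π : ∀ U, P.sec U →+ F.sec U) : Prop where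
  res : ∀ {U V : Opens X.pt} (h : V ≤ U) (p : P.sec U), F.res h (π U p) = π V (P.res h p)
  surj : ∀ {U : Opens X.pt} (s : F.sec U) (x : U), ∃ (V : Opens X.pt) (h : V ≤ U) (p : P.sec V),
    (x : X.pt) ∈ V ∧ F.res h s = π V p

namespace IsSheafQuot
variable {P A : AbPre X} {F G : AbSheaf X} {π : ∀ U, P.sec U →+ F.sec U}

/-- Biadditive maps descend from a presheaf to its quotient sheaf. -/
lemma descend₂ (H : IsSheafQuot P F π) (φ : ∀ U, P.sec U →+ A.sec U →+ G.sec U)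
    (hφ : ∀ {U V : Opens X.pt} (h : V ≤ U) (p : P.sec U) (a : A.sec U),
      G.res h (φ U p a) = φ V (P.res h p) (A.res h a))
    (h0 : ∀ {U : Opens X.pt} (p : P.sec U) (a : A.sec U), π U p = 0 → φ U p a = 0) :
    ∃ ψ : ∀ U, F.sec U →+ A.sec U →+ G.sec U,
      (∀ {U V : Opens X.pt} (h : V ≤ U) (s : F.sec U) (a : A.sec U),
        G.res h (ψ U s a) = ψ V (F.res h s) (A.res h a)) ∧
      ∀ {U : Opens X.pt} (p : P.sec U) (a : A.sec U), ψ U (π U p) a = φ U p a := by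
  have key : ∀ {U : Opens X.pt} (s : F.sec U) (a : A.sec U), ∃ t : G.sec U,
      ∀ (V : Opens X.pt) (h : V ≤ U) (p : P.sec V), F.res h s = π V p →
        G.res h t = φ V p (A.res h a) := by
    intro U s a
    obtain ⟨t, ht⟩ := G.glue_local (U := U) (fun V r => ∃ (h : V ≤ U) (p : P.sec V),
      F.res h s = π V p ∧ r = φ V p (A.res h a)) (fun x => by
        obtain ⟨V, h, p, hx, hp⟩ := H.surj s x
        exact ⟨V, h, hx, _, h, p, hp, rfl⟩) (by
        rintro V V' _ _ hV hV' ⟨h, p, hp, rfl⟩ ⟨h', p', hp', rfl⟩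
        rw [hφ, hφ, A.res_res, A.res_res, ← sub_eq_zero, ← AddMonoidHom.sub_apply, ← map_sub]
        apply h0
        rw [map_sub, ← H.res, ← H.res, ← hp, ← hp', F.res_res, F.res_res, sub_self])
    exact ⟨t, fun V h p hp => ht V h _ ⟨h, p, hp, rfl⟩⟩
  choose ψ hψ using @key
  have huniq : ∀ {U : Opens X.pt} (s : F.sec U) (a : A.sec U) (t : G.sec U),
      (∀ (V : Opens X.pt) (h : V ≤ U) (p : P.sec V), F.res h s = π V p →
        G.res h t = φ V p (A.res h a)) → ψ s a = t := by
    intro U s a t ht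
    refine G.eq_of_local fun x => ?_
    obtain ⟨V, h, p, hx, hp⟩ := H.surj s x
    exact ⟨V, h, hx, by rw [hψ s a V h p hp, ht V h p hp]⟩
  have hadd : ∀ {U : Opens X.pt} (s s' : F.sec U) (a : A.sec U),
      ψ (s + s') a = ψ s a + ψ s' a := by
    intro U s s' a
    refine G.eq_of_local fun x => ?_
    obtain ⟨V, h, p, hx, hp⟩ := H.surj s x
    obtain ⟨W, h', p', hx', hp'⟩ := H.surj (F.res h s') ⟨x, hx⟩
    rw [F.res_res] at hp'
    have hp2 : F.res (h'.trans h) s = π W (P.res h' p) := by rw [← F.res_res h h', hp, H.res]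
    refine ⟨W, h'.trans h, hx', ?_⟩
    rw [map_add, hψ s a W _ _ hp2, hψ s' a W _ _ hp', hψ (s + s') a W _ (P.res h' p + p')
      (by rw [map_add, map_add, hp2, hp']), map_add]
    rfl
  refine ⟨fun U => AddMonoidHom.mk' (fun s => AddMonoidHom.mk' (fun a => ψ s a) fun a a' =>
    huniq _ _ _ fun V h p hp => ?_) fun s s' => ?_, fun {U V} h s a => ?_, fun {U} p a => ?_⟩
  · rw [map_add, hψ s a V h p hp, hψ s a' V h p hp, map_add, map_add]
  · ext a; exact hadd s s' a
  · change G.res h (ψ s a) = ψ (F.res h s) (A.res h a)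
    refine (huniq _ _ _ fun W h' p hp => ?_).symm
    rw [F.res_res] at hp
    rw [G.res_res, A.res_res]
    exact hψ s a W _ p hp
  · refine huniq _ _ _ fun V h p' hp => ?_
    rw [hφ, ← sub_eq_zero, ← AddMonoidHom.sub_apply, ← map_sub]
    apply h0
    rw [map_sub, ← H.res, hp, sub_self]

/-- Additive maps descend from a presheaf to its quotient sheaf. -/
lemma descend (H : IsSheafQuot P F π) (φ : ∀ U, P.sec U →+ G.sec U)
    (hφ : ∀ {U V : Opens X.pt} (h : V ≤ U) (p : P.sec U), G.res h (φ U p) = φ V (P.res h p))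
    (h0 : ∀ {U : Opens X.pt} (p : P.sec U), π U p = 0 → φ U p = 0) :
    ∃ ψ : ∀ U, F.sec U →+ G.sec U,
      (∀ {U V : Opens X.pt} (h : V ≤ U) (s : F.sec U), G.res h (ψ U s) = ψ V (F.res h s)) ∧
      ∀ {U : Opens X.pt} (p : P.sec U), ψ U (π U p) = φ U p := by
  let A : AbPre X := ⟨fun _ => ULift ℤ, fun _ => AddMonoidHom.id _, fun _ => rfl, fun _ _ _ => rfl⟩
  obtain ⟨ψ, h1, h2⟩ := H.descend₂ (A := A) (G := G)
    (fun U => AddMonoidHom.mk' (fun p => AddMonoidHom.mk' (fun n : ULift ℤ => n.down • φ U p)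
      fun a b => add_smul _ _ _) fun p q => by ext n; simp)
    (fun h p a => (map_zsmul _ _ _).trans (congrArg (fun t => a.down • t) (hφ h p)))
    (fun p a h => (congrArg (fun t => a.down • t) (h0 p h)).trans (smul_zero _))
  exact ⟨fun U => (ψ U).flip ⟨1⟩, fun h s => h1 h s ⟨1⟩, fun p => (h2 p ⟨1⟩).trans (one_smul ℤ _)⟩

end IsSheafQuot

/-! ### Signs -/

/-- The sign `(-1)ⁿ`. -/
abbrev sg (n : ℤ) : ℤ := (n.negOnePow : ℤ)

lemma sg_add (m n : ℤ) : sg (m + n) = sg m * sg n := by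
  simp [sg, Int.negOnePow_add]

lemma sg_neg (n : ℤ) : sg (-n) = sg n := by simp [sg, Int.negOnePow_neg]

lemma sg_sub (m n : ℤ) : sg (m - n) = sg m * sg n := by
  rw [sub_eq_add_neg, sg_add, sg_neg]

lemma sg_zero : sg 0 = 1 := by simp [sg]

lemma sg_one : sg 1 = -1 := by simp [sg]

lemma sg_cases (n : ℤ) : sg n = 1 ∨ sg n = -1 := by
  rcases Int.even_or_odd n with h | h
  · exact Or.inl (by simp [sg, Int.negOnePow_even n h])
  · exact Or.inr (by simp [sg, Int.negOnePow_odd n h])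

lemma sg_mul_self (n : ℤ) : sg n * sg n = 1 := by
  rcases sg_cases n with h | h <;> rw [h] <;> rfl

lemma sg_sq (n : ℤ) : sg (n * n) = sg n := by
  rcases Int.even_or_odd n with h | h
  · simp [sg, Int.negOnePow_even n h, Int.negOnePow_even _ (h.mul_left n)]
  · simp [sg, Int.negOnePow_odd n h, Int.negOnePow_odd _ (h.mul h)]

/-! ### The graded algebra of differential forms -/

namespace Form
variable {U V W : Opens X.pt} {k l m : ℤ}

@[ext] lemma ext {w w' : Form k U} (h : ∀ x, w.1 x = w'.1 x) : w = w' :=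
  Subtype.ext (funext h)

lemma add_val (w w' : Form k U) (x : U) : (w + w').1 x = w.1 x + w'.1 x := rfl
lemma neg_val (w : Form k U) (x : U) : (-w).1 x = -w.1 x := rfl
lemma sub_val (w w' : Form k U) (x : U) : (w - w').1 x = w.1 x - w'.1 x := rfl
lemma zero_val (x : U) : (0 : Form k U).1 x = 0 := rfl
lemma smul_val (f : Fn U) (w : Form k U) (x : U) : (f • w).1 x = f.1 x • w.1 x := rfl
lemma zsmul_val (n : ℤ) (w : Form k U) (x : U) : (n • w).1 x = n • w.1 x := rfl
lemma mul_val (h : k + l = m) (w : Form k U) (w' : Form l U) (x : U) :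
    (mul h w w').1 x = w.1 x * w'.1 x := rfl
lemma ofFn_val (f : Fn U) (x : U) : (ofFn f).1 x = algebraMap 𝕂 (Ext X) (f.1 x) := rfl
lemma dFn_val (f : Fn U) (x : U) : (dFn f).1 x = ExteriorAlgebra.ι 𝕂 (dAt f x) := rfl
lemma res_val (h : V ≤ U) (w : Form k U) (x : V) : (res h w).1 x = w.1 ⟨x, h x.2⟩ := rfl

variable (X) in
/-- The sheaf of differential forms of degree `k`. -/
@[reducible] def sheaf (k : ℤ) : AbSheaf X where
  sec U := Form k U
  res h := Form.res h
  res_id _ := rfl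
  res_res _ _ _ := rfl
  glue {ι} U s hs := by
    have key : ∀ i j (x : X.pt) (hi : x ∈ U i) (hj : x ∈ U j),
        (s i).1 ⟨x, hi⟩ = (s j).1 ⟨x, hj⟩ := fun i j x hi hj =>
      congrFun (congrArg Subtype.val (hs i j)) ⟨x, hi, hj⟩
    have hmem : ∀ x : ↥(iSup U : Opens X.pt), ∃ i, (x : X.pt) ∈ U i := fun x =>
      Opens.mem_iSup.1 x.2
    choose p hp using hmem
    let w : ↥(iSup U : Opens X.pt) → Ext X := fun x => (s (p x)).1 ⟨x, hp x⟩
    have hw : ∀ i, resExt (le_iSup U i) w = (s i).1 := fun i => by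
      funext x
      exact key _ _ _ _ _
    refine ⟨⟨w, fun x => ?_⟩, fun i => Subtype.ext (hw i), fun t ht => Subtype.ext ?_⟩
    · obtain ⟨V, hV, hx, h⟩ := (s (p x)).2 ⟨x, hp x⟩
      refine ⟨V, hV.trans (le_iSup U _), hx, ?_⟩
      rw [← hw] at h
      exact h
    · funext x
      exact congrFun (congrArg Subtype.val (ht (p x))) ⟨x, hp x⟩

/-- Induction principle for differential forms: locally, these are sums of the products
`f dg₁ ∧ ⋯ ∧ dg_k`. -/
lemma induction (P : ∀ (V : Opens X.pt) (k : ℤ), Form k V → Prop)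
    (hloc : ∀ (V : Opens X.pt) (k : ℤ) (w : Form k V), (∀ x : V, ∃ (W : Opens X.pt) (h : W ≤ V),
      (x : X.pt) ∈ W ∧ P W k (res h w)) → P V k w)
    (hadd : ∀ (V : Opens X.pt) (k : ℤ) (w w' : Form k V), P V k w → P V k w' → P V k (w + w'))
    (hneg : ∀ (V : Opens X.pt) (k : ℤ) (w : Form k V), P V k w → P V k (-w))
    (hzero : ∀ (V : Opens X.pt) (k : ℤ), P V k 0)
    (hfn : ∀ (V : Opens X.pt) (f : Fn V), P V 0 (ofFn f))
    (hsmul : ∀ (V : Opens X.pt) (k : ℤ) (f : Fn V) (w : Form k V), P V k w → P V k (f • w))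
    (hd : ∀ (V : Opens X.pt) (k l : ℤ) (h : 1 + k = l) (f : Fn V) (w : Form k V), P V k w →
      P V l (mul h (dFn f) w))
    (w : Form k U) : P U k w := by
  have hprod : ∀ (V : Opens X.pt) (L : List (Fn V)) (k : ℤ) (_ : (L.length : ℤ) = k)
      (w : Form k V), (w.1 = fun x => (L.map fun g => ExteriorAlgebra.ι 𝕂 (dAt g x)).prod) →
      P V k w := by
    intro V L
    induction L with
    | nil =>
      rintro k rfl w hw
      have : w = ofFn 1 := by
        ext x
        rw [hw, ofFn_val]
        exact (map_one (algebraMap 𝕂 (Ext X))).symm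
      rw [this]
      exact hfn V 1
    | cons g L ih =>
      intro k hk w hw
      have hm : (fun x => (L.map fun g => ExteriorAlgebra.ι 𝕂 (dAt g x)).prod) ∈
          formSubmodule (L.length : ℤ) V := fun x => ⟨V, le_rfl, x.2, AddSubgroup.subset_closure
        ⟨1, L, rfl, by funext y; exact (one_smul 𝕂 _).symm⟩⟩
      have h : 1 + (L.length : ℤ) = k := by rw [← hk, List.length_cons]; push_cast; ring
      have : w = mul h (dFn g) ⟨_, hm⟩ := by
        ext x
        rw [hw]
        rfl
      rw [this]
      exact hd _ _ _ _ _ _ (ih _ rfl _ rfl)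
  refine hloc U k w fun x => ?_
  obtain ⟨V, hV, hx, h⟩ := w.2 x
  refine ⟨V, hV, hx, ?_⟩
  have key : ∀ (w' : V → Ext X), w' ∈ AddSubgroup.closure (monomials k V) →
      ∃ hw : w' ∈ formSubmodule k V, P V k ⟨w', hw⟩ := by
    intro w' hw
    induction hw using AddSubgroup.closure_induction with
    | mem w' hw =>
      obtain ⟨f, L, hL, rfl⟩ := hw
      have hm : (fun x => (L.map fun g => ExteriorAlgebra.ι 𝕂 (dAt g x)).prod) ∈
          formSubmodule k V := fun x => ⟨V, le_rfl, x.2, AddSubgroup.subset_closure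
        ⟨1, L, hL, by funext y; exact (one_smul 𝕂 _).symm⟩⟩
      exact ⟨(formSubmodule k V).smul_mem f hm, hsmul V k f ⟨_, hm⟩ (hprod V L k hL _ rfl)⟩
    | zero => exact ⟨zero_mem _, hzero V k⟩
    | add a b _ _ ha hb =>
      obtain ⟨h1, h1'⟩ := ha
      obtain ⟨h2, h2'⟩ := hb
      exact ⟨add_mem h1 h2, hadd V k ⟨a, h1⟩ ⟨b, h2⟩ h1' h2'⟩
    | neg a _ ha =>
      obtain ⟨h1, h1'⟩ := ha
      exact ⟨neg_mem h1, hneg V k ⟨a, h1⟩ h1'⟩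
  exact (key _ h).2

lemma eq_of_local {w w' : Form k U} (h : ∀ x : U, ∃ (V : Opens X.pt) (hV : V ≤ U),
    (x : X.pt) ∈ V ∧ res hV w = res hV w') : w = w' :=
  (sheaf X k).eq_of_local h

/-- There are no forms of negative degree. -/
lemma eq_zero_of_neg (hk : k < 0) (w : Form k U) : w = 0 := by
  have := induction (fun V k (w : Form k V) => k < 0 → w = 0)
    (fun V k w h hk => eq_of_local fun x => by
      obtain ⟨W, hW, hx, hw⟩ := h x
      exact ⟨W, hW, hx, by rw [hw hk, map_zero]⟩)
    (fun V k w w' h h' hk => by rw [h hk, h' hk, add_zero])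
    (fun V k w h hk => by rw [h hk, neg_zero]) (fun _ _ _ => rfl)
    (fun V f hk => absurd hk (lt_irrefl 0)) (fun V k f w h hk => by rw [h hk, smul_zero])
    (fun V k l h f w hw hl => by
      ext x
      rw [mul_val, hw (by lia), zero_val, zero_val, mul_zero]) w
  exact this hk

lemma add_mul (h : k + l = m) (w w' : Form k U) (v : Form l U) :
    mul h (w + w') v = mul h w v + mul h w' v := by
  ext x; simp only [mul_val, add_val, _root_.add_mul]

lemma mul_add (h : k + l = m) (w : Form k U) (v v' : Form l U) :
    mul h w (v + v') = mul h w v + mul h w v' := by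
  ext x; simp only [mul_val, add_val, _root_.mul_add]

lemma neg_mul (h : k + l = m) (w : Form k U) (v : Form l U) :
    mul h (-w) v = -mul h w v := by
  ext x; simp only [mul_val, neg_val, _root_.neg_mul]

lemma mul_neg (h : k + l = m) (w : Form k U) (v : Form l U) :
    mul h w (-v) = -mul h w v := by
  ext x; simp only [mul_val, neg_val, _root_.mul_neg]

lemma zero_mul (h : k + l = m) (v : Form l U) : mul h (0 : Form k U) v = 0 := by
  ext x; simp only [mul_val, zero_val, MulZeroClass.zero_mul]

lemma mul_zero (h : k + l = m) (w : Form k U) : mul h w (0 : Form l U) = 0 := by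
  ext x; simp only [mul_val, zero_val, MulZeroClass.mul_zero]

lemma mul_zsmul (h : k + l = m) (n : ℤ) (w : Form k U) (v : Form l U) :
    mul h w (n • v) = n • mul h w v := by
  ext x; simp only [mul_val, zsmul_val, mul_smul_comm]

lemma zsmul_mul (h : k + l = m) (n : ℤ) (w : Form k U) (v : Form l U) :
    mul h (n • w) v = n • mul h w v := by
  ext x; simp only [mul_val, zsmul_val, smul_mul_assoc]

lemma mul_smul (h : k + l = m) (f : Fn U) (w : Form k U) (v : Form l U) :
    mul h w (f • v) = f • mul h w v := by
  ext x; simp only [mul_val, smul_val, mul_smul_comm]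

lemma smul_mul (h : k + l = m) (f : Fn U) (w : Form k U) (v : Form l U) :
    mul h (f • w) v = f • mul h w v := by
  ext x; simp only [mul_val, smul_val, smul_mul_assoc]

lemma mul_assoc {p q r s : ℤ} (h₁ : k + l = p) (h₂ : p + q = r) (h₃ : l + q = s)
    (h₄ : k + s = r) (w : Form k U) (w' : Form l U) (w'' : Form q U) :
    mul h₂ (mul h₁ w w') w'' = mul h₄ w (mul h₃ w' w'') := by
  ext x; simp only [mul_val, _root_.mul_assoc]

lemma ofFn_mul (h : 0 + k = m) (f : Fn U) (w : Form k U) (h' : k = m) :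
    mul h (ofFn f) w = h' ▸ (f • w) := by
  subst h'
  ext x; rw [mul_val, ofFn_val, smul_val, Algebra.smul_def]

lemma ofFn_mul' (h : 0 + k = k) (f : Fn U) (w : Form k U) : mul h (ofFn f) w = f • w :=
  ofFn_mul h f w rfl

lemma mul_ofFn (h : k + 0 = k) (f : Fn U) (w : Form k U) : mul h w (ofFn f) = f • w := by
  ext x
  rw [mul_val, ofFn_val, smul_val, Algebra.smul_def, Algebra.commutes]

lemma ofFn_one_mul (h : 0 + k = k) (w : Form k U) : mul h (ofFn 1) w = w := by
  rw [ofFn_mul', one_smul]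

lemma mul_ofFn_one (h : k + 0 = k) (w : Form k U) : mul h w (ofFn 1) = w := by
  rw [mul_ofFn, one_smul]

lemma ofFn_add (f g : Fn U) : ofFn (f + g) = ofFn f + ofFn g := by
  ext x; simp only [ofFn_val, add_val, Fn.add_val, map_add]

lemma ofFn_zero : ofFn (0 : Fn U) = 0 := by
  ext x; simp only [ofFn_val, zero_val, Fn.zero_val, map_zero]

lemma ofFn_smul (f g : Fn U) : ofFn (f * g) = f • ofFn g := by
  ext x; simp only [ofFn_val, smul_val, Fn.mul_val, map_mul, Algebra.smul_def]

lemma smul_ofFn_one (f : Fn U) : f • ofFn (1 : Fn U) = ofFn f := by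
  rw [← ofFn_smul, mul_one]

lemma dFn_add (f g : Fn U) : dFn (f + g) = dFn f + dFn g := by
  ext x; simp only [dFn_val, add_val, dAt_add, map_add]

lemma dFn_mul (f g : Fn U) : dFn (f * g) = f • dFn g + g • dFn f := by
  ext x; simp only [dFn_val, add_val, smul_val, dAt_mul, map_add, map_smul]

lemma dFn_algebraMap (c : 𝕂) : dFn (algebraMap 𝕂 (Fn U) c) = 0 := by
  ext x; rw [dFn_val, dAt_algebraMap, map_zero, zero_val]

lemma dFn_one : dFn (1 : Fn U) = 0 := by
  ext x; rw [dFn_val, dAt_one, map_zero, zero_val]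

lemma res_mul (hV : V ≤ U) (h : k + l = m) (w : Form k U) (v : Form l U) :
    res hV (mul h w v) = mul h (res hV w) (res hV v) := rfl

lemma res_smul (hV : V ≤ U) (f : Fn U) (w : Form k U) :
    res hV (f • w) = resFn hV f • res hV w := rfl

lemma res_ofFn (hV : V ≤ U) (f : Fn U) : res hV (ofFn f) = ofFn (resFn hV f) := rfl

lemma res_dFn (hV : V ≤ U) (f : Fn U) : res hV (dFn f) = dFn (resFn hV f) := by
  ext x; rw [res_val, dFn_val, dFn_val, dAt_resFn]

lemma res_res (hV : V ≤ U) (hW : W ≤ V) (w : Form k U) :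
    res hW (res hV w) = res (hW.trans hV) w := rfl

lemma res_id (w : Form k U) : res le_rfl w = w := rfl

/-- The function underlying a form of degree zero. -/
lemma exists_ofFn (w : Form 0 U) : ∃ f : Fn U, ofFn f = w := by
  have key : ∀ (V : Opens X.pt) (w : V → Ext X), w ∈ AddSubgroup.closure (monomials 0 V) →
      ∃ f : Fn V, ∀ x, algebraMap 𝕂 (Ext X) (f.1 x) = w x := by
    intro V w hw
    induction hw using AddSubgroup.closure_induction with
    | mem w hw =>
      obtain ⟨f, L, hL, rfl⟩ := hw
      have : L = [] := List.length_eq_zero_iff.1 (by exact_mod_cast hL)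
      subst this
      exact ⟨f, fun x => by simp [Algebra.smul_def]⟩
    | zero => exact ⟨0, fun x => map_zero _⟩
    | add a b _ _ ha hb =>
      obtain ⟨f, hf⟩ := ha
      obtain ⟨g, hg⟩ := hb
      exact ⟨f + g, fun x => by rw [Fn.add_val, map_add, hf, hg]; rfl⟩
    | neg a _ ha =>
      obtain ⟨f, hf⟩ := ha
      exact ⟨-f, fun x => by rw [Fn.neg_val, map_neg, hf]; rfl⟩
  have hinv : ∀ c : 𝕂, ExteriorAlgebra.algebraMapInv (algebraMap 𝕂 (Ext X) c) = c :=
    ExteriorAlgebra.algebraMap_leftInverse (R := 𝕂) (Cot X)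
  let f : U → 𝕂 := fun x => ExteriorAlgebra.algebraMapInv (w.1 x)
  have hloc : ∀ x : U, ∃ (V : Opens X.pt) (h : V ≤ U), (x : X.pt) ∈ V ∧ ∃ g : Fn V,
      ∀ y : V, algebraMap 𝕂 (Ext X) (g.1 y) = w.1 ⟨y, h y.2⟩ := fun x => by
    obtain ⟨V, hV, hx, h⟩ := w.2 x
    obtain ⟨g, hg⟩ := key V _ h
    exact ⟨V, hV, hx, g, hg⟩
  have hs : Smooth f := by
    intro x
    obtain ⟨V, hV, hx, g, hg⟩ := hloc x
    have he : g.1 = fun y : V => f ⟨y, hV y.2⟩ := by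
      funext y; rw [← hinv (g.1 y), hg y]
    have := g.2 ⟨x, hx⟩
    rw [he] at this
    exact this.congr_of_eventuallyEq (ext0_eventuallyEq hV f ⟨x, hx⟩).symm
  refine ⟨⟨f, hs⟩, ?_⟩
  ext x
  obtain ⟨V, hV, hx, g, hg⟩ := hloc x
  change algebraMap 𝕂 (Ext X) (ExteriorAlgebra.algebraMapInv (w.1 x)) = w.1 x
  have := hg ⟨x, hx⟩
  change algebraMap 𝕂 (Ext X) (g.1 ⟨x, hx⟩) = w.1 x at this
  rw [← this, hinv]

lemma ofFn_injective {f g : Fn U} (h : ofFn f = ofFn g) : f = g := by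
  ext x
  have := congrArg (fun w : Form 0 U => ExteriorAlgebra.algebraMapInv (w.1 x)) h
  simp only [ofFn_val] at this
  rwa [ExteriorAlgebra.algebraMap_leftInverse, ExteriorAlgebra.algebraMap_leftInverse] at this

/-- The function underlying a form of degree zero. -/
def toFn (w : Form 0 U) : Fn U := (exists_ofFn w).choose

lemma ofFn_toFn (w : Form 0 U) : ofFn (toFn w) = w := (exists_ofFn w).choose_spec

lemma toFn_ofFn (f : Fn U) : toFn (ofFn f) = f := ofFn_injective (ofFn_toFn _)

lemma mul_dFn_comm (h : 1 + k = m) (h' : k + 1 = m) (f : Fn U) (w : Form k U) :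
    mul h' w (dFn f) = sg k • mul h (dFn f) w := by
  refine induction (fun V k (w : Form k V) => ∀ (f : Fn V) (m : ℤ) (h : 1 + k = m)
    (h' : k + 1 = m), mul h' w (dFn f) = sg k • mul h (dFn f) w) ?_ ?_ ?_ ?_ ?_ ?_ ?_ w f m h h'
  · intro V k w hw f m h h'
    refine eq_of_local fun x => ?_
    obtain ⟨W, hW, hx, hw⟩ := hw x
    refine ⟨W, hW, hx, ?_⟩
    rw [map_zsmul, res_mul, res_mul, res_dFn, hw]
  · intro V k w w' hw hw' f m h h'
    rw [add_mul, mul_add, hw, hw', smul_add]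
  · intro V k w hw f m h h'
    rw [neg_mul, mul_neg, hw f m h, smul_neg]
  · intro V k f m h h'
    rw [zero_mul, mul_zero, smul_zero]
  · rintro V g f m rfl h'
    ext x
    rw [zsmul_val, mul_val, mul_val, ofFn_val, sg_zero, one_smul, Algebra.commutes]
  · intro V k g w hw f m h h'
    rw [smul_mul, mul_smul, hw f m h, smul_comm]
  · intro V k l h1 g w hw f m h h'
    have h2 : k + 1 = l := by lia
    ext x
    have e := congrArg (fun v : Form l V => v.1 x) (hw f l h1 h2)
    simp only [zsmul_val, mul_val] at e ⊢
    rw [_root_.mul_assoc, e, ← h1, sg_add, sg_one, mul_smul_comm, ← _root_.mul_assoc,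
      ← _root_.mul_assoc, dFn_val, dFn_val, ι_mul_ι_swap]
    simp only [_root_.neg_mul, one_mul, neg_smul, smul_neg]

/-- The algebra of forms is graded commutative. -/
lemma mul_comm (h : k + l = m) (h' : l + k = m) (w : Form k U) (v : Form l U) :
    mul h w v = sg (k * l) • mul h' v w := by
  refine induction (fun V k (w : Form k V) => ∀ (l m : ℤ) (v : Form l V) (h : k + l = m)
    (h' : l + k = m), mul h w v = sg (k * l) • mul h' v w) ?_ ?_ ?_ ?_ ?_ ?_ ?_ w l m v h h'
  · intro V k w hw l m v h h'
    refine eq_of_local fun x => ?_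
    obtain ⟨W, hW, hx, hw⟩ := hw x
    refine ⟨W, hW, hx, ?_⟩
    rw [map_zsmul, res_mul, res_mul, hw]
  · intro V k w w' hw hw' l m v h h'
    rw [add_mul, mul_add, hw l m v h h', hw' l m v h h', smul_add]
  · intro V k w hw l m v h h'
    rw [neg_mul, mul_neg, hw l m v h h', smul_neg]
  · intro V k l m v h h'
    rw [zero_mul, mul_zero, smul_zero]
  · intro V g l m v h h'
    ext x
    rw [zsmul_val, mul_val, mul_val, ofFn_val, MulZeroClass.zero_mul, sg_zero, one_smul,
      Algebra.commutes]
  · intro V k g w hw l m v h h'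
    rw [smul_mul, mul_smul, hw l m v h h', smul_comm]
  · intro V k p h1 g w hw l m v h h'
    ext x
    have e := congrArg (fun v : Form (k + l) V => v.1 x) (hw l _ v rfl (by lia))
    have e' := congrArg (fun v : Form (l + 1) V => v.1 x) (mul_dFn_comm (by lia) rfl g v)
    simp only [zsmul_val, mul_val] at e e' ⊢
    rw [_root_.mul_assoc, e, ← _root_.mul_assoc, e', ← h1, _root_.add_mul, sg_add, one_mul,
      mul_smul_comm, smul_mul_assoc, smul_smul, _root_.mul_assoc, _root_.mul_comm (sg l),
      _root_.mul_assoc (sg (k * l)), sg_mul_self, _root_.mul_one, _root_.mul_assoc]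

end Form

namespace Form
variable {U V W : Opens X.pt} {k l m : ℤ}

lemma resExt_dMonomials {U V : Opens X.pt} (h : V ≤ U) {p : (U → Ext X) × (U → Ext X)}
    (hp : p ∈ AddSubgroup.closure (dMonomials k U)) :
    (resExt h p.1, resExt h p.2) ∈ AddSubgroup.closure (dMonomials k V) := by
  induction hp using AddSubgroup.closure_induction with
  | mem p hp =>
    obtain ⟨f, L, hL, h1, h2⟩ := hp
    refine AddSubgroup.subset_closure ⟨resFn h f, L.map (resFn h), by simpa using hL, ?_, ?_⟩
    · rw [h1]; funext x
      simp only [List.map_map, Function.comp_def, dAt_resFn]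
      rfl
    · rw [h2]; funext x
      simp only [List.map_map, Function.comp_def, dAt_resFn]
      rfl
  | zero => simp only [Prod.fst_zero, Prod.snd_zero, map_zero]; exact zero_mem _
  | add a b _ _ ha hb =>
    simp only [Prod.fst_add, Prod.snd_add, map_add]; exact add_mem ha hb
  | neg a _ ha => simp only [Prod.fst_neg, Prod.snd_neg, map_neg]; exact neg_mem ha

lemma IsD.res {w : Form k U} {v : Form l U} (h : IsD w v) (hV : V ≤ U) :
    IsD (Form.res hV w) (Form.res hV v) := by
  refine ⟨h.1, fun x => ?_⟩
  obtain ⟨W, hW, hx, hp⟩ := h.2 ⟨x, hV x.2⟩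
  exact ⟨V ⊓ W, inf_le_left, ⟨x.2, hx⟩, resExt_dMonomials (inf_le_right : V ⊓ W ≤ W) hp⟩

lemma IsD.add {w w' : Form k U} {v v' : Form l U} (h : IsD w v) (h' : IsD w' v') :
    IsD (w + w') (v + v') := by
  refine ⟨h.1, fun x => ?_⟩
  obtain ⟨V, hV, hx, hp⟩ := h.2 x
  obtain ⟨V', hV', hx', hp'⟩ := h'.2 x
  exact ⟨V ⊓ V', inf_le_left.trans hV, ⟨hx, hx'⟩,
    add_mem (resExt_dMonomials (inf_le_left : V ⊓ V' ≤ V) hp)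
      (resExt_dMonomials (inf_le_right : V ⊓ V' ≤ V') hp')⟩

lemma IsD.neg {w : Form k U} {v : Form l U} (h : IsD w v) : IsD (-w) (-v) := by
  refine ⟨h.1, fun x => ?_⟩
  obtain ⟨V, hV, hx, hp⟩ := h.2 x
  exact ⟨V, hV, hx, neg_mem hp⟩

/-- The exterior derivative is well defined. -/
lemma IsD.unique {w : Form k U} {v v' : Form l U} (h : IsD w v) (h' : IsD w v') : v = v' := by
  have h0 : IsD (0 : Form k U) (v - v') := by
    have := h.add h'.neg
    rwa [add_neg_cancel, ← sub_eq_add_neg] at this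
  suffices hs : v - v' = 0 from sub_eq_zero.1 hs
  refine eq_of_local fun x => ?_
  obtain ⟨V, hV, hx, hp⟩ := h0.2 x
  refine ⟨V ⊓ chartDom (X := X) x, inf_le_left.trans hV, ⟨hx, mem_chart_source X.E (x : X.pt)⟩, ?_⟩
  have := dMonomials_eq_zero (inf_le_right : V ⊓ chartDom (X := X) x ≤ _)
    (resExt_dMonomials (inf_le_left : V ⊓ chartDom (X := X) x ≤ V) hp) (by funext y; rfl)
  exact Subtype.ext this

lemma exists_isD (h : k + 1 = l) (w : Form k U) : ∃ v : Form l U, IsD w v := by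
  have key : ∀ (V : Opens X.pt) (w : V → Ext X), w ∈ AddSubgroup.closure (monomials k V) →
      ∃ v : V → Ext X, v ∈ AddSubgroup.closure (monomials l V) ∧
        (w, v) ∈ AddSubgroup.closure (dMonomials k V) := by
    intro V w hw
    induction hw using AddSubgroup.closure_induction with
    | mem w hw =>
      obtain ⟨f, L, hL, rfl⟩ := hw
      refine ⟨fun x => ExteriorAlgebra.ι 𝕂 (dAt f x) *
          (L.map fun g => ExteriorAlgebra.ι 𝕂 (dAt g x)).prod,
        AddSubgroup.subset_closure ⟨1, f :: L, ?_, ?_⟩,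
        AddSubgroup.subset_closure ⟨f, L, hL, rfl, rfl⟩⟩
      · rw [List.length_cons, ← h, ← hL]; push_cast; ring
      · funext x
        rw [List.map_cons, List.prod_cons]
        exact (one_smul 𝕂 _).symm
    | zero => exact ⟨0, zero_mem _, zero_mem _⟩
    | add a b _ _ ha hb =>
      obtain ⟨v, h1, h2⟩ := ha
      obtain ⟨v', h1', h2'⟩ := hb
      exact ⟨v + v', add_mem h1 h1', add_mem h2 h2'⟩
    | neg a _ ha =>
      obtain ⟨v, h1, h2⟩ := ha
      exact ⟨-v, neg_mem h1, neg_mem h2⟩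
  obtain ⟨t, ht⟩ := (sheaf X l).glue_local (U := U)
    (fun V (s : Form l V) => ∃ h : V ≤ U, IsD (Form.res h w) s) (fun x => by
      obtain ⟨V, hV, hx, hw⟩ := w.2 x
      obtain ⟨v, h1, h2⟩ := key V _ hw
      exact ⟨V, hV, hx, ⟨v, fun y => ⟨V, le_rfl, y.2, h1⟩⟩, hV, h.symm,
        fun y => ⟨V, le_rfl, y.2, h2⟩⟩) (by
      rintro V V' s s' - - ⟨hV, h1⟩ ⟨hV', h2⟩
      exact (h1.res (inf_le_left : V ⊓ V' ≤ V)).unique (h2.res (inf_le_right : V ⊓ V' ≤ V')))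
  refine ⟨t, h.symm, fun x => ?_⟩
  obtain ⟨V, hV, hx, hw⟩ := w.2 x
  obtain ⟨v, h1, h2⟩ := key V _ hw
  refine ⟨V, hV, hx, ?_⟩
  have hs : Form.res hV t = (⟨v, fun y => ⟨V, le_rfl, y.2, h1⟩⟩ : Form l V) :=
    ht V hV ⟨v, fun y => ⟨V, le_rfl, y.2, h1⟩⟩ ⟨hV, h.symm, fun y => ⟨V, le_rfl, y.2, h2⟩⟩
  have hs' : resExt hV t.1 = v := congrArg Subtype.val hs
  rw [hs']
  exact h2

/-- The exterior derivative. -/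
def d (h : k + 1 = l) : Form k U →+ Form l U :=
  AddMonoidHom.mk' (fun w => (exists_isD h w).choose) fun w w' =>
    (exists_isD h (w + w')).choose_spec.unique
      ((exists_isD h w).choose_spec.add (exists_isD h w').choose_spec)

lemma isD_d (h : k + 1 = l) (w : Form k U) : IsD w (d h w) := (exists_isD h w).choose_spec

lemma IsD.eq {w : Form k U} {v : Form l U} (H : IsD w v) (h : k + 1 = l) : v = d h w :=
  H.unique (isD_d h w)

lemma res_d (hV : V ≤ U) (h : k + 1 = l) (w : Form k U) :
    Form.res hV (d h w) = d h (Form.res hV w) := ((isD_d h w).res hV).eq h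

lemma d_ofFn (h : (0 : ℤ) + 1 = 1) (f : Fn U) : d h (ofFn f) = dFn f := by
  refine (IsD.eq ⟨rfl, fun x => ⟨U, le_rfl, x.2, AddSubgroup.subset_closure
    ⟨f, [], rfl, ?_, ?_⟩⟩⟩ h).symm
  · funext y; simp [Algebra.smul_def]; rfl
  · funext y; simp; rfl

lemma d_d (h : k + 1 = l) (h' : l + 1 = m) (w : Form k U) : d h' (d h w) = 0 := by
  refine (IsD.eq ⟨h'.symm, fun x => ?_⟩ h').symm
  obtain ⟨V, hV, hx, hp⟩ := (isD_d h w).2 x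
  refine ⟨V, hV, hx, ?_⟩
  have key : ∀ p : (V → Ext X) × (V → Ext X), p ∈ AddSubgroup.closure (dMonomials k V) →
      (p.2, (0 : V → Ext X)) ∈ AddSubgroup.closure (dMonomials l V) := by
    intro p hp
    induction hp using AddSubgroup.closure_induction with
    | mem p hp =>
      obtain ⟨f, L, hL, h1, h2⟩ := hp
      refine AddSubgroup.subset_closure ⟨1, f :: L, ?_, ?_, ?_⟩
      · rw [List.length_cons, ← h, ← hL]; push_cast; ring
      · rw [h2]; funext y
        rw [List.map_cons, List.prod_cons]
        exact (one_smul 𝕂 _).symm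
      · funext y
        rw [dAt_one, map_zero, MulZeroClass.zero_mul]; rfl
    | zero => exact zero_mem _
    | add a b _ _ ha hb => have := add_mem ha hb; rwa [Prod.mk_add_mk, add_zero] at this
    | neg a _ ha => have := neg_mem ha; rwa [Prod.neg_mk, neg_zero] at this
  exact key _ hp

lemma prod_mul_ι (L : List (Cot X)) (a : Cot X) :
    (L.map (ExteriorAlgebra.ι 𝕂)).prod * ExteriorAlgebra.ι 𝕂 a =
      sg L.length • (ExteriorAlgebra.ι 𝕂 a * (L.map (ExteriorAlgebra.ι 𝕂)).prod) := by
  induction L with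
  | nil => simp [sg_zero]
  | cons b L ih =>
    rw [List.map_cons, List.prod_cons, _root_.mul_assoc, ih, mul_smul_comm, ← _root_.mul_assoc,
      ← _root_.mul_assoc, ι_mul_ι_swap b a, List.length_cons, Nat.cast_add, sg_add]
    simp [sg_one]

/-- The graded Leibniz rule. -/
lemma d_mul {k' l' m' : ℤ} (h : k + l = m) (hm : m + 1 = m') (hk : k + 1 = k') (hl : l + 1 = l')
    (h₁ : k' + l = m') (h₂ : k + l' = m') (w : Form k U) (v : Form l U) :
    d hm (mul h w v) = mul h₁ (d hk w) v + sg k • mul h₂ w (d hl v) := by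
  refine (IsD.eq ⟨hm.symm, fun x => ?_⟩ hm).symm
  obtain ⟨V, hV, hx, hp⟩ := (isD_d hk w).2 x
  obtain ⟨V', hV', hx', hq⟩ := (isD_d hl v).2 x
  refine ⟨V ⊓ V', inf_le_left.trans hV, ⟨hx, hx'⟩, ?_⟩
  have key : ∀ (W : Opens X.pt) (p q : (W → Ext X) × (W → Ext X)),
      p ∈ AddSubgroup.closure (dMonomials k W) → q ∈ AddSubgroup.closure (dMonomials l W) →
      (p.1 * q.1, p.2 * q.1 + sg k • (p.1 * q.2)) ∈ AddSubgroup.closure (dMonomials m W) := by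
    intro W p q hp hq
    induction hp using AddSubgroup.closure_induction with
    | mem p hp =>
      induction hq using AddSubgroup.closure_induction with
      | mem q hq =>
        obtain ⟨f, L, hL, h1, h2⟩ := hp
        obtain ⟨g, L', hL', h1', h2'⟩ := hq
        refine AddSubgroup.subset_closure ⟨f * g, L ++ L', by simp [hL, hL', h], ?_, ?_⟩
        · rw [h1, h1']; funext y
          simp only [Pi.mul_apply, List.map_append, List.prod_append, smul_mul_smul_comm]
          rfl
        · have hc := fun y : W => prod_mul_ι (L.map fun g => dAt g y) (dAt g y)
          simp only [List.map_map, Function.comp_def, List.length_map, hL] at hc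
          rw [h1, h1', h2, h2']; funext y
          simp only [Pi.mul_apply, Pi.add_apply, Pi.smul_apply, List.map_append, List.prod_append,
            dAt_mul, map_add, map_smul, smul_mul_assoc, mul_smul_comm, _root_.add_mul]
          rw [← _root_.mul_assoc (List.prod _), hc, smul_mul_assoc, smul_comm (sg k) (f.1 y),
            smul_smul (sg k), sg_mul_self, one_smul, add_comm, _root_.mul_assoc, _root_.mul_assoc]
      | zero => simp only [Prod.fst_zero, Prod.snd_zero, MulZeroClass.mul_zero, add_zero, smul_zero]
                exact zero_mem _
      | add a b _ _ ha hb =>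
        have := add_mem ha hb
        rw [Prod.mk_add_mk] at this
        convert this using 2
        · exact _root_.mul_add _ _ _
        · simp only [Prod.fst_add, Prod.snd_add, _root_.mul_add, smul_add]; abel
      | neg a _ ha =>
        have := neg_mem ha
        rw [Prod.neg_mk] at this
        convert this using 2
        · exact _root_.mul_neg _ _
        · simp only [Prod.fst_neg, Prod.snd_neg, _root_.mul_neg, smul_neg]; abel
    | zero => simp only [Prod.fst_zero, Prod.snd_zero, MulZeroClass.zero_mul, add_zero, smul_zero]
              exact zero_mem _
    | add a b _ _ ha hb =>
      have := add_mem ha hb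
      rw [Prod.mk_add_mk] at this
      convert this using 2
      · exact _root_.add_mul _ _ _
      · simp only [Prod.fst_add, Prod.snd_add, _root_.add_mul, smul_add]; abel
    | neg a _ ha =>
      have := neg_mem ha
      rw [Prod.neg_mk] at this
      convert this using 2
      · exact _root_.neg_mul _ _
      · simp only [Prod.fst_neg, Prod.snd_neg, _root_.neg_mul, smul_neg]; abel
  exact key _ _ _ (resExt_dMonomials (inf_le_left : V ⊓ V' ≤ V) hp)
    (resExt_dMonomials (inf_le_right : V ⊓ V' ≤ V') hq)

lemma d_smul (h : k + 1 = l) (h' : 1 + k = l) (f : Fn U) (w : Form k U) :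
    d h (f • w) = mul h' (dFn f) w + f • d h w := by
  rw [← ofFn_mul' (zero_add k), d_mul (zero_add k) h rfl h h' (zero_add l), d_ofFn, ofFn_mul',
    sg_zero, one_smul]

lemma d_dFn (h : (1 : ℤ) + 1 = l) (f : Fn U) : d h (dFn f) = 0 := by
  rw [← d_ofFn rfl, d_d]

end Form

/-! ### Contractions and Lie derivatives -/

@[ext] lemma VField.ext {U : Opens X.pt} {v v' : VField U} (h : ∀ x, v.toFun x = v'.toFun x) :
    v = v' := by
  cases v; cases v'
  congr
  exact funext h

/-- Restriction of vector fields. -/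
def VField.res {U V : Opens X.pt} (h : V ≤ U) (v : VField U) : VField V where
  toFun x := v.toFun ⟨x, h x.2⟩
  smooth W hW f := v.smooth W (hW.trans h) f

lemma VField.res_apply {U V : Opens X.pt} (h : V ≤ U) (v : VField U) (f : Fn U) :
    (v.res h).apply (resFn h f) = resFn h (v.apply f) := by
  ext x
  change v.toFun _ (dAt (resFn h f) x) = v.toFun _ (dAt f ⟨x, h x.2⟩)
  rw [dAt_resFn]

namespace VField
open Form
variable {U V : Opens X.pt} {k l m : ℤ}

lemma contract_monomials (v : VField U) (h : -1 + k = l) {w : U → Ext X}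
    (hw : w ∈ AddSubgroup.closure (monomials k U)) :
    (fun x => contract (v.toFun x) (w x)) ∈ AddSubgroup.closure (monomials l U) := by
  have hprod : ∀ (L : List (Fn U)) (l : ℤ), -1 + (L.length : ℤ) = l →
      (fun x => contract (v.toFun x) (L.map fun g => ExteriorAlgebra.ι 𝕂 (dAt g x)).prod) ∈
        AddSubgroup.closure (monomials l U) := by
    intro L
    induction L with
    | nil =>
      intro l hl
      have : (fun x : U => contract (v.toFun x)
          (([] : List (Fn U)).map fun g => ExteriorAlgebra.ι 𝕂 (dAt g x)).prod) = 0 := by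
        funext x
        exact CliffordAlgebra.contractLeft_one (Q := (0 : QuadraticForm 𝕂 (Cot X))) (v.toFun x)
      rw [this]
      exact zero_mem _
    | cons g L ih =>
      intro l hl
      have : (fun x : U => contract (v.toFun x)
          ((g :: L).map fun g => ExteriorAlgebra.ι 𝕂 (dAt g x)).prod) =
          (fun x => (v.apply g).1 x • (L.map fun g => ExteriorAlgebra.ι 𝕂 (dAt g x)).prod) -
          (fun x => ExteriorAlgebra.ι 𝕂 (dAt g x)) * fun x => contract (v.toFun x)
            (L.map fun g => ExteriorAlgebra.ι 𝕂 (dAt g x)).prod := by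
        funext x
        rw [List.map_cons, List.prod_cons]
        exact CliffordAlgebra.contractLeft_ι_mul (v.toFun x) (dAt g x) _
      rw [this]
      refine sub_mem (AddSubgroup.subset_closure ⟨v.apply g, L, ?_, rfl⟩)
        (mul_monomials (k := 1) (l := -1 + L.length) ?_ (AddSubgroup.subset_closure
          ⟨1, [g], rfl, ?_⟩) (ih _ rfl))
      · rw [← hl, List.length_cons]; push_cast; ring
      · rw [← hl, List.length_cons]; push_cast; ring
      · funext x
        rw [List.map_singleton, List.prod_singleton]
        exact (one_smul 𝕂 _).symm
  induction hw using AddSubgroup.closure_induction with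
  | mem w hw =>
    obtain ⟨f, L, hL, rfl⟩ := hw
    have := smul_monomials f (hprod L l (by rw [hL, h]))
    convert this using 1
    funext x
    exact map_smul (CliffordAlgebra.contractLeft (v.toFun x)) (f.1 x) _
  | zero =>
    convert zero_mem (AddSubgroup.closure (monomials l U)) using 1
    funext x
    exact map_zero (CliffordAlgebra.contractLeft (v.toFun x))
  | add a b _ _ ha hb =>
    convert add_mem ha hb using 1
    funext x
    exact map_add (CliffordAlgebra.contractLeft (v.toFun x)) _ _
  | neg a _ ha =>
    convert neg_mem ha using 1
    funext x
    exact map_neg (CliffordAlgebra.contractLeft (v.toFun x)) _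

/-- The contraction of forms with a vector field. -/
def contr (v : VField U) (h : -1 + k = l) : Form k U →+ Form l U where
  toFun w := ⟨fun x => contract (v.toFun x) (w.1 x), fun x => by
    obtain ⟨V, hV, hx, hw⟩ := w.2 x
    exact ⟨V, hV, hx, (v.res hV).contract_monomials h hw⟩⟩
  map_zero' := by
    ext x; exact map_zero (CliffordAlgebra.contractLeft (v.toFun x))
  map_add' w w' := by
    ext x; exact map_add (CliffordAlgebra.contractLeft (v.toFun x)) _ _

lemma contr_val (v : VField U) (h : -1 + k = l) (w : Form k U) (x : U) :
    (v.contr h w).1 x = contract (v.toFun x) (w.1 x) := rfl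

lemma contracts_iff (v : VField U) (h : -1 + k = l) (w : Form k U) (w' : Form l U) :
    v.Contracts w w' ↔ w' = v.contr h w :=
  ⟨fun H => Form.ext H, fun H x => by rw [H]; rfl⟩

lemma res_contr (hV : V ≤ U) (v : VField U) (h : -1 + k = l) (w : Form k U) :
    Form.res hV (v.contr h w) = (v.res hV).contr h (Form.res hV w) := rfl

lemma contr_smul (v : VField U) (h : -1 + k = l) (f : Fn U) (w : Form k U) :
    v.contr h (f • w) = f • v.contr h w := by
  ext x; exact map_smul (CliffordAlgebra.contractLeft (v.toFun x)) (f.1 x) _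

lemma contr_ofFn (v : VField U) (h : -1 + 0 = l) (f : Fn U) : v.contr h (ofFn f) = 0 := by
  ext x
  exact CliffordAlgebra.contractLeft_algebraMap (Q := (0 : QuadraticForm 𝕂 (Cot X))) (v.toFun x) (f.1 x)

lemma contr_dFn (v : VField U) (h : -1 + 1 = (0 : ℤ)) (f : Fn U) :
    v.contr h (dFn f) = ofFn (v.apply f) := by
  ext x
  exact CliffordAlgebra.contractLeft_ι (Q := (0 : QuadraticForm 𝕂 (Cot X))) (v.toFun x) (dAt f x)

lemma contr_contr (v v' : VField U) (h : -1 + k = l) (h' : -1 + l = m) (w : Form k U) :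
    v.contr h' (v'.contr h w) = -v'.contr h' (v.contr h w) := by
  ext x
  exact CliffordAlgebra.contractLeft_comm (v.toFun x) (v'.toFun x) (w.1 x)

lemma contr_dFn_mul {k' : ℤ} (v : VField U) (h : 1 + k = l) (hl : -1 + l = k)
    (hk : -1 + k = k') (h' : 1 + k' = k) (f : Fn U) (w : Form k U) :
    v.contr hl (mul h (dFn f) w) = v.apply f • w - mul h' (dFn f) (v.contr hk w) := by
  ext x
  exact CliffordAlgebra.contractLeft_ι_mul (v.toFun x) (dAt f x) (w.1 x)

lemma contr_mul {k' l' m' : ℤ} (v : VField U) (h : k + l = m) (hm : -1 + m = m')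
    (hk : -1 + k = k') (hl : -1 + l = l') (h₁ : k' + l = m') (h₂ : k + l' = m') (w : Form k U)
    (w' : Form l U) : v.contr hm (mul h w w') =
      mul h₁ (v.contr hk w) w' + sg k • mul h₂ w (v.contr hl w') := by
  refine Form.induction (fun V k (w : Form k V) => ∀ (l m k' l' m' : ℤ) (v : VField V)
    (w' : Form l V) (h : k + l = m) (hm : -1 + m = m') (hk : -1 + k = k') (hl : -1 + l = l')
    (h₁ : k' + l = m') (h₂ : k + l' = m'), v.contr hm (mul h w w') =
      mul h₁ (v.contr hk w) w' + sg k • mul h₂ w (v.contr hl w')) ?_ ?_ ?_ ?_ ?_ ?_ ?_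
    w l m k' l' m' v w' h hm hk hl h₁ h₂
  · intro V k w hw l m k' l' m' v w' h hm hk hl h₁ h₂
    refine Form.eq_of_local fun x => ?_
    obtain ⟨W, hW, hx, hw⟩ := hw x
    exact ⟨W, hW, hx, hw l m k' l' m' (v.res hW) (Form.res hW w') h hm hk hl h₁ h₂⟩
  · intro V k a b ha hb l m k' l' m' v w' h hm hk hl h₁ h₂
    rw [Form.add_mul, map_add, ha _ _ _ _ _ v w' h hm hk hl h₁ h₂,
      hb _ _ _ _ _ v w' h hm hk hl h₁ h₂, map_add, Form.add_mul, Form.add_mul, smul_add]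
    abel
  · intro V k a ha l m k' l' m' v w' h hm hk hl h₁ h₂
    rw [Form.neg_mul, map_neg, ha _ _ _ _ _ v w' h hm hk hl h₁ h₂, map_neg, Form.neg_mul,
      Form.neg_mul, smul_neg]
    abel
  · intro V k l m k' l' m' v w' h hm hk hl h₁ h₂
    rw [Form.zero_mul, map_zero, map_zero, Form.zero_mul, Form.zero_mul, smul_zero, add_zero]
  · intro V f l m k' l' m' v w' h hm hk hl h₁ h₂
    obtain rfl : l = m := by lia
    obtain rfl : l' = m' := by lia
    rw [Form.ofFn_mul', contr_smul, contr_ofFn, Form.zero_mul, Form.ofFn_mul', sg_zero, one_smul,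
      zero_add]
  · intro V k f w hw l m k' l' m' v w' h hm hk hl h₁ h₂
    rw [Form.smul_mul, contr_smul, hw _ _ _ _ _ v w' h hm hk hl h₁ h₂, contr_smul, Form.smul_mul,
      Form.smul_mul, smul_add, smul_comm f]
  · intro V k p h1 f w hw l m k' l' m' v w' h hm hk hl h₁ h₂
    obtain rfl : k = k' := ◇
    obtain ⟨e1, e2, e3, e4, e5, e6⟩ : k + l = m' ∧ -1 + k + l = -1 + m' ∧ k + l' = -1 + m' ∧ 1 + m'
      = m ∧ 1 + (-1 + m') = m' ∧ 1 + (-1 + k) = k := ◇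
    have es : sg p = -sg k := by rw [← h1, sg_add, sg_one, _root_.neg_one_mul]
    have e := hw l m' (-1 + k) l' (-1 + m') v w' e1 rfl rfl hl e2 e3
    rw [Form.mul_assoc h1 h e1 e4, contr_dFn_mul v e4 hm rfl e5, e,
      contr_dFn_mul v h1 hk rfl e6, sub_eq_add_neg, sub_eq_add_neg, Form.add_mul,
      Form.smul_mul, Form.neg_mul, es, Form.mul_add, Form.mul_zsmul,
      Form.mul_assoc e6 e1 e2 e5, Form.mul_assoc h1 h₂ e3 e5]
    simp only [neg_smul, neg_add]
    abel

/-- The Lie derivative of forms. -/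
def lie (v : VField U) : Form k U →+ Form k U :=
  (d (k := -1 + k) (by lia)).comp (v.contr rfl) +
    (v.contr (k := k + 1) (by lia)).comp (d rfl)

lemma lie_eq (v : VField U) (h₁ : -1 + k = l) (h₁' : l + 1 = k) (h₂ : k + 1 = m)
    (h₂' : -1 + m = k) (w : Form k U) : v.lie w = d h₁' (v.contr h₁ w) + v.contr h₂' (d h₂ w) := by
  subst h₁ h₂; rfl

lemma res_lie (hV : V ≤ U) (v : VField U) (w : Form k U) :
    Form.res hV (v.lie w) = (v.res hV).lie (Form.res hV w) := by
  rw [lie_eq v rfl (by lia) rfl (by lia), lie_eq _ rfl (by lia) rfl (by lia), map_add, res_d,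
    res_contr, res_contr, res_d]

lemma lie_d (v : VField U) (h : k + 1 = l) (w : Form k U) : v.lie (d h w) = d h (v.lie w) := by
  rw [lie_eq v (by lia : -1 + l = k) h rfl (by lia), lie_eq v rfl (by lia) h (by lia), d_d,
    map_zero, add_zero, map_add, d_d, zero_add]

lemma lie_mul (v : VField U) (h : k + l = m) (w : Form k U) (w' : Form l U) :
    v.lie (mul h w w') = mul h (v.lie w) w' + mul h w (v.lie w') := by
  have a1 : -1 + m + 1 = m := by lia
  have a2 : -1 + (m + 1) = m := by lia
  have b1 : -1 + k + 1 = k := by lia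
  have b2 : -1 + (k + 1) = k := by lia
  have c1 : -1 + l + 1 = l := by lia
  have c2 : -1 + (l + 1) = l := by lia
  have e1 : -1 + k + l = -1 + m := by lia
  have e2 : k + (-1 + l) = -1 + m := by lia
  have e3 : k + 1 + l = m + 1 := by lia
  have e4 : k + (l + 1) = m + 1 := by lia
  have e5 : -1 + k + (l + 1) = m := by lia
  have e6 : k + 1 + (-1 + l) = m := by lia
  rw [lie_eq v rfl a1 rfl a2, contr_mul v h rfl rfl rfl e1 e2,
    d_mul h rfl rfl rfl e3 e4, map_add, map_add, map_zsmul, map_zsmul,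
    d_mul e1 a1 b1 rfl h e5, d_mul e2 a1 rfl c1 e6 h,
    contr_mul v e3 a2 b2 rfl h e6, contr_mul v e4 a2 rfl c2 e5 h,
    lie_eq v rfl b1 rfl b2, lie_eq v rfl c1 rfl c2,
    Form.add_mul, Form.mul_add, sg_add, sg_add, sg_neg, sg_one]
  simp only [smul_add, smul_smul, sg_mul_self, one_smul, _root_.mul_neg, _root_.mul_one, _root_.neg_mul,
    _root_.one_mul, neg_smul]
  abel

lemma lie_ofFn (v : VField U) (f : Fn U) : v.lie (ofFn f) = ofFn (v.apply f) := by
  rw [lie_eq v rfl (by lia) (zero_add 1) (by lia), contr_ofFn, map_zero, zero_add, d_ofFn,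
    contr_dFn]

lemma lie_dFn (v : VField U) (f : Fn U) : v.lie (dFn f) = dFn (v.apply f) := by
  rw [← d_ofFn rfl, lie_d, lie_ofFn, d_ofFn]

lemma lie_smul (v : VField U) (f : Fn U) (w : Form k U) :
    v.lie (f • w) = v.apply f • w + f • v.lie w := by
  rw [← ofFn_mul' (zero_add k), lie_mul, lie_ofFn, ofFn_mul', ofFn_mul']

lemma lieDer_iff (v : VField U) (w w' : Form 1 U) : v.LieDer w w' ↔ w' = v.lie w := by
  have a1 : (-1 : ℤ) + 1 = 0 := by lia
  have a2 : (-1 : ℤ) + 2 = 1 := by lia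
  have a3 : (1 : ℤ) + 1 = 2 := by lia
  have e := lie_eq v a1 (zero_add 1) a3 a2 w
  constructor
  · rintro ⟨dw, f, idw, h1, h2, h3, h4⟩
    rw [contracts_iff v a1] at h2
    rw [contracts_iff v a2] at h3
    rw [h4, e, ← h2, d_ofFn, h3, h1.eq a3, add_comm]
  · intro h
    refine ⟨d a3 w, toFn (v.contr a1 w), v.contr a2 (d a3 w), isD_d _ _, ?_, ?_, ?_⟩
    · rw [contracts_iff v a1, ofFn_toFn]
    · rw [contracts_iff v a2]
    · rw [h, e, ← d_ofFn (zero_add 1), ofFn_toFn, add_comm]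

/-- Cartan's formula for the commutator of a Lie derivative and a contraction. -/
lemma lie_contr {v v' v'' : VField U} (hv : ∀ (V : Opens X.pt) (h : V ≤ U) (f : Fn V),
      (v''.res h).apply f = (v.res h).apply ((v'.res h).apply f) -
        (v'.res h).apply ((v.res h).apply f)) (h : -1 + k = l) (w : Form k U) :
    v.lie (v'.contr h w) = v''.contr h w + v'.contr h (v.lie w) := by
  refine Form.induction (fun V k (w : Form k V) => ∀ (hV : V ≤ U) (l : ℤ) (h : -1 + k = l),
    (v.res hV).lie ((v'.res hV).contr h w) =
      (v''.res hV).contr h w + (v'.res hV).contr h ((v.res hV).lie w)) ?_ ?_ ?_ ?_ ?_ ?_ ?_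
    w le_rfl l h
  · intro V k w hw hV l h
    refine Form.eq_of_local fun x => ?_
    obtain ⟨W, hW, hx, hw⟩ := hw x
    refine ⟨W, hW, hx, ?_⟩
    have := hw (hW.trans hV) l h
    rw [map_add, res_lie, res_contr, res_contr, res_contr, res_lie]
    exact this
  · intro V k a b ha hb hV l h
    simp only [map_add, ha hV l h, hb hV l h]; abel
  · intro V k a ha hV l h
    simp only [map_neg, ha hV l h, neg_add]
  · intro V k hV l h
    simp only [map_zero, add_zero]
  · intro V f hV l h
    rw [contr_ofFn, map_zero, contr_ofFn, lie_ofFn, contr_ofFn, add_zero]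
  · intro V k f w hw hV l h
    simp only [contr_smul, lie_smul, hw hV l h, map_add, smul_add]; abel
  · intro V k p h1 f w hw hV l h
    obtain rfl : k = l := ◇
    have e0 : -1 + k = -1 + k := rfl
    have e1 : 1 + (-1 + k) = k := ◇
    rw [contr_dFn_mul _ h1 h e0 e1, contr_dFn_mul _ h1 h e0 e1, map_sub, lie_smul,
      lie_mul, lie_mul, map_add, lie_dFn, hw hV _ rfl, contr_dFn_mul _ h1 h e0 e1,
      contr_dFn_mul _ h1 h e0 e1, hv, Form.mul_add, sub_smul]
    abel

/-- Lie derivatives represent commutators. -/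
lemma lie_lie {v v' v'' : VField U} (hv : ∀ (V : Opens X.pt) (h : V ≤ U) (f : Fn V),
      (v''.res h).apply f = (v.res h).apply ((v'.res h).apply f) -
        (v'.res h).apply ((v.res h).apply f)) (w : Form k U) :
    v.lie (v'.lie w) = v''.lie w + v'.lie (v.lie w) := by
  have h1 : -1 + k + 1 = k := by lia
  have h2 : -1 + (k + 1) = k := by lia
  rw [lie_eq v' rfl h1 rfl h2, map_add, lie_d, lie_contr hv, lie_contr hv, lie_d, map_add,
    lie_eq v'' rfl h1 rfl h2, lie_eq v' rfl h1 rfl h2]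
  abel

end VField

/-! ### DG modules over the de Rham complex -/

namespace DGMod
variable (N : DGMod X) {U V : Opens X.pt} {i j k l m : ℤ}

/-- The action of forms, as a biadditive map. -/
def actHom (h : k + i = j) : Form k U →+ (N.sh i).sec U →+ (N.sh j).sec U :=
  AddMonoidHom.mk' (fun w => AddMonoidHom.mk' (N.act h w) (N.act_add h w))
    fun w w' => by ext m; exact N.add_act h w w' m

lemma zero_act (h : k + i = j) (m : (N.sh i).sec U) : N.act h (0 : Form k U) m = 0 :=
  DFunLike.congr_fun (map_zero (N.actHom h)) m

lemma neg_act (h : k + i = j) (w : Form k U) (m : (N.sh i).sec U) :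
    N.act h (-w) m = -N.act h w m := DFunLike.congr_fun (map_neg (N.actHom h) w) m

lemma sub_act (h : k + i = j) (w w' : Form k U) (m : (N.sh i).sec U) :
    N.act h (w - w') m = N.act h w m - N.act h w' m :=
  DFunLike.congr_fun (map_sub (N.actHom h) w w') m

lemma zsmul_act (h : k + i = j) (n : ℤ) (w : Form k U) (m : (N.sh i).sec U) :
    N.act h (n • w) m = n • N.act h w m := DFunLike.congr_fun (map_zsmul (N.actHom h) n w) m

lemma act_zero (h : k + i = j) (w : Form k U) : N.act h w (0 : (N.sh i).sec U) = 0 :=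
  map_zero (N.actHom h w)

lemma act_neg (h : k + i = j) (w : Form k U) (m : (N.sh i).sec U) :
    N.act h w (-m) = -N.act h w m := map_neg (N.actHom h w) m

lemma act_sub (h : k + i = j) (w : Form k U) (m m' : (N.sh i).sec U) :
    N.act h w (m - m') = N.act h w m - N.act h w m' := map_sub (N.actHom h w) m m'

lemma act_zsmul (h : k + i = j) (n : ℤ) (w : Form k U) (m : (N.sh i).sec U) :
    N.act h w (n • m) = n • N.act h w m := map_zsmul (N.actHom h w) n m

lemma D_act' {k' i' : ℤ} (h : k + i = j) (h₁ : j + 1 = l) (h₂ : k' + i = l) (h₃ : i + 1 = i')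
    (h₄ : k + i' = l) (hk : k + 1 = k') (w : Form k U) (m : (N.sh i).sec U) :
    N.D h₁ (N.act h w m) = N.act h₂ (Form.d hk w) m + sg k • N.act h₄ w (N.D h₃ m) :=
  N.D_act h h₁ h₂ h₃ h₄ w _ m (Form.isD_d hk w)

lemma smul_act (h : k + i = j) (h' : 0 + j = j) (f : Fn U) (w : Form k U) (m : (N.sh i).sec U) :
    N.act h (f • w) m = N.act h' (Form.ofFn f) (N.act h w m) := by
  rw [← N.mul_act (zero_add k) h h' h, Form.ofFn_mul']

lemma act_ofFn (h : k + i = j) (h' : 0 + i = i) (f : Fn U) (w : Form k U) (m : (N.sh i).sec U) :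
    N.act h w (N.act h' (Form.ofFn f) m) = N.act h (f • w) m := by
  rw [← N.mul_act (add_zero k) h' h h, Form.mul_ofFn]

end DGMod

namespace DGMod.Hom

/-- Composition of morphisms of DG modules. -/
def comp {M N P : DGMod X} (g : DGMod.Hom N P) (f : DGMod.Hom M N) : DGMod.Hom M P where
  map i U := (g.map i U).comp (f.map i U)
  res_map h m := by simp [g.res_map, f.res_map]
  map_act h _ w m := by simp [g.map_act, f.map_act]
  map_D h _ m := by simp [g.map_D, f.map_D]

end DGMod.Hom

variable (X) in
/-- Presheaves of DG modules over the de Rham complex with a subpresheaf `K`; the axioms are only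
required to hold modulo `K`. -/
structure PreDG where
  pre : ℤ → AbPre X
  K : ∀ i U, AddSubgroup ((pre i).sec U)
  act : ∀ {k i j : ℤ}, k + i = j → ∀ {U : Opens X.pt}, Form k U → (pre i).sec U →+ (pre j).sec U
  D : ∀ {i j : ℤ}, i + 1 = j → ∀ {U : Opens X.pt}, (pre i).sec U →+ (pre j).sec U
  res_K : ∀ {i : ℤ} {U V : Opens X.pt} (h : V ≤ U) (p : (pre i).sec U), p ∈ K i U →
    (pre i).res h p ∈ K i V
  act_K : ∀ {k i j : ℤ} (h : k + i = j) {U : Opens X.pt} (w : Form k U) (p : (pre i).sec U),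
    p ∈ K i U → act h w p ∈ K j U
  D_K : ∀ {i j : ℤ} (h : i + 1 = j) {U : Opens X.pt} (p : (pre i).sec U), p ∈ K i U →
    D h p ∈ K j U
  res_act : ∀ {k i j : ℤ} (h : k + i = j) {U V : Opens X.pt} (hV : V ≤ U) (w : Form k U)
    (p : (pre i).sec U), (pre j).res hV (act h w p) = act h (Form.res hV w) ((pre i).res hV p)
  res_D : ∀ {i j : ℤ} (h : i + 1 = j) {U V : Opens X.pt} (hV : V ≤ U) (p : (pre i).sec U),
    (pre j).res hV (D h p) = D h ((pre i).res hV p)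
  add_act : ∀ {k i j : ℤ} (h : k + i = j) {U : Opens X.pt} (w w' : Form k U) (p : (pre i).sec U),
    act h (w + w') p - (act h w p + act h w' p) ∈ K j U
  one_act : ∀ {i : ℤ} (h : 0 + i = i) {U : Opens X.pt} (p : (pre i).sec U),
    act h (Form.ofFn 1) p - p ∈ K i U
  mul_act : ∀ {k l p i j q : ℤ} (h : k + l = p) (h₁ : l + i = j) (h₂ : k + j = q) (h₃ : p + i = q)
    {U : Opens X.pt} (w : Form k U) (w' : Form l U) (m : (pre i).sec U),
    act h₃ (Form.mul h w w') m - act h₂ w (act h₁ w' m) ∈ K q U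
  D_D : ∀ {i j l : ℤ} (h : i + 1 = j) (h' : j + 1 = l) {U : Opens X.pt} (p : (pre i).sec U),
    D h' (D h p) ∈ K l U
  D_act : ∀ {k k' i j i' l : ℤ} (h : k + i = j) (h₁ : j + 1 = l) (h₂ : k' + i = l) (h₃ : i + 1 = i')
    (h₄ : k + i' = l) (hk : k + 1 = k') {U : Opens X.pt} (w : Form k U) (p : (pre i).sec U),
    D h₁ (act h w p) - (act h₂ (Form.d hk w) p + sg k • act h₄ w (D h₃ p)) ∈ K l U

/-- `N` is the DG module associated to the presheaf `P / K`. -/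
structure PreDG.IsQuot (P : PreDG X) (N : DGMod X)
    (π : ∀ i U, (P.pre i).sec U →+ (N.sh i).sec U) : Prop where
  quot : ∀ i, IsSheafQuot (P.pre i) (N.sh i) (π i)
  act : ∀ {k i j : ℤ} (h : k + i = j) {U : Opens X.pt} (w : Form k U) (p : (P.pre i).sec U),
    π j U (P.act h w p) = N.act h w (π i U p)
  D : ∀ {i j : ℤ} (h : i + 1 = j) {U : Opens X.pt} (p : (P.pre i).sec U),
    π j U (P.D h p) = N.D h (π i U p)
  zero : ∀ {i : ℤ} {U : Opens X.pt} (p : (P.pre i).sec U), p ∈ P.K i U → π i U p = 0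
  ker : ∀ {i : ℤ} {U : Opens X.pt} (p : (P.pre i).sec U), π i U p = 0 → ∀ x : U,
    ∃ (V : Opens X.pt) (h : V ≤ U), (x : X.pt) ∈ V ∧ (P.pre i).res h p ∈ P.K i V

lemma PreDG.exists_isQuot (P : PreDG X) : ∃ N π, P.IsQuot N π := by
  choose F π hres hsurj hK hker using fun i =>
    (P.pre i).exists_sheafify (P.K i) (fun h p hp => P.res_K h p hp)
  have quot : ∀ i, IsSheafQuot (P.pre i) (F i) (π i) := fun i =>
    ⟨fun h p => hres i _ _ h p, fun s x => hsurj i _ s x⟩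
  have hK' : ∀ {i : ℤ} {U : Opens X.pt} {p q : (P.pre i).sec U}, p - q ∈ P.K i U →
      π i U p = π i U q := fun h => sub_eq_zero.1 ((map_sub _ _ _).symm.trans (hK _ _ _ h))
  have hact : ∀ (k i j : ℤ) (h : k + i = j), ∃ ψ : ∀ U, (F i).sec U →+ Form k U →+ (F j).sec U,
      (∀ {U V : Opens X.pt} (hV : V ≤ U) (s : (F i).sec U) (w : Form k U),
        (F j).res hV (ψ U s w) = ψ V ((F i).res hV s) (Form.res hV w)) ∧
      ∀ {U : Opens X.pt} (p : (P.pre i).sec U) (w : Form k U),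
        ψ U (π i U p) w = π j U (P.act h w p) := by
    intro k i j h
    refine (quot i).descend₂ (A := (Form.sheaf X k).pre) (G := F j)
      (fun U => AddMonoidHom.mk' (fun p => AddMonoidHom.mk' (fun w : Form k U =>
        π j U (P.act h w p)) fun w w' => (hK' (P.add_act h w w' p)).trans (map_add _ _ _))
          fun p q => by
            ext w; exact (congrArg (π j U) (map_add (P.act h w) p q)).trans (map_add (π j U) _ _)) ?_ ?_
    · intro U V hV p w
      exact ((quot j).res hV _).trans (congrArg _ (P.res_act h hV w p))
    · intro U p w hp
      refine (F j).eq_zero_of_local fun x => ?_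
      obtain ⟨V, hV, hx, hp⟩ := hker i U p hp x
      refine ⟨V, hV, hx, ?_⟩
      exact ((quot j).res hV _).trans ((congrArg _ (P.res_act h hV w p)).trans
        (hK _ _ _ (P.act_K h _ _ hp)))
  have hD : ∀ (i j : ℤ) (h : i + 1 = j), ∃ ψ : ∀ U, (F i).sec U →+ (F j).sec U,
      (∀ {U V : Opens X.pt} (hV : V ≤ U) (s : (F i).sec U),
        (F j).res hV (ψ U s) = ψ V ((F i).res hV s)) ∧
      ∀ {U : Opens X.pt} (p : (P.pre i).sec U), ψ U (π i U p) = π j U (P.D h p) := by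
    intro i j h
    refine (quot i).descend (fun U => (π j U).comp (P.D h)) ?_ ?_
    · intro U V hV p
      exact ((quot j).res hV _).trans (congrArg _ (P.res_D h hV p))
    · intro U p hp
      refine (F j).eq_zero_of_local fun x => ?_
      obtain ⟨V, hV, hx, hp⟩ := hker i U p hp x
      refine ⟨V, hV, hx, ?_⟩
      exact ((quot j).res hV _).trans ((congrArg _ (P.res_D h hV p)).trans
        (hK _ _ _ (P.D_K h _ hp)))
  choose a ares aπ using hact
  choose D Dres Dπ using hD
  refine ⟨{ sh := F
            act := fun {k i j} h U w m => a k i j h U m w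
            D := fun {i j} h U => D i j h U
            add_act := fun h U w w' m => map_add _ _ _
            act_add := fun {k i j} h U w m m' =>
              DFunLike.congr_fun (map_add (a k i j h U) m m') w
            one_act := ?_
            mul_act := ?_
            res_act := fun {k i j} h U V hV w m => ares k i j h hV m w
            res_D := fun {i j} h U V hV m => Dres i j h hV m
            D_D := ?_
            D_act := ?_ }, π, quot, fun h U w p => (aπ _ _ _ h p w).symm,
    fun h U p => (Dπ _ _ h p).symm, fun p hp => hK _ _ _ hp, fun p hp => hker _ _ _ hp⟩
  · intro i h U m
    refine (F i).eq_of_local fun x => ?_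
    obtain ⟨V, hV, p, hx, hp⟩ := (quot i).surj m x
    refine ⟨V, hV, hx, ?_⟩
    rw [ares, hp, aπ]
    exact hK' (P.one_act h p)
  · intro k l p i j q h h₁ h₂ h₃ U w w' m
    refine (F q).eq_of_local fun x => ?_
    obtain ⟨V, hV, r, hx, hr⟩ := (quot i).surj m x
    refine ⟨V, hV, hx, ?_⟩
    rw [ares, ares, ares, hr, aπ, aπ, aπ]
    exact hK' (P.mul_act h h₁ h₂ h₃ (Form.res hV w) (Form.res hV w') r)
  · intro i j l h h' U m
    refine (F l).eq_zero_of_local fun x => ?_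
    obtain ⟨V, hV, r, hx, hr⟩ := (quot i).surj m x
    refine ⟨V, hV, hx, ?_⟩
    rw [Dres, Dres, hr, Dπ, Dπ]
    exact hK _ _ _ (P.D_D h h' r)
  · intro k k' i j i' l h h₁ h₂ h₃ h₄ U w w' m hw
    have hk := hw.1.symm
    have hw' := hw.eq hk
    clear hw
    subst hw'
    refine (F l).eq_of_local fun x => ?_
    obtain ⟨V, hV, r, hx, hr⟩ := (quot i).surj m x
    refine ⟨V, hV, hx, ?_⟩
    rw [Dres, ares, map_add, map_zsmul, ares, ares, Dres, hr, aπ, aπ, Dπ, Dπ, aπ, Form.res_d,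
      ← map_zsmul, ← map_add]
    exact hK' (P.D_act h h₁ h₂ h₃ h₄ hk (Form.res hV w) r)

/-! ### Sheaves of forms as DG modules -/

/-- Transport of forms along an equality of degrees. -/
def Form.cast {k l : ℤ} (h : k = l) {U : Opens X.pt} : Form k U →+ Form l U :=
  h ▸ AddMonoidHom.id _

@[simp] lemma Form.cast_rfl {k : ℤ} {U : Opens X.pt} (w : Form k U) : Form.cast rfl w = w := rfl

/-- The sheaf of forms on `W ⊓ U`, `U` open, as a sheaf on `X`. -/
def Form.sheafOn (W : Opens X.pt) (k : ℤ) : AbSheaf X where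
  sec U := Form k (U ⊓ W)
  res h := Form.res (inf_le_inf_right W h)
  res_id _ := rfl
  res_res _ _ _ := rfl
  glue {ι} U s hs := by
    have hle : ∀ i, U i ⊓ W ≤ iSup U ⊓ W := fun i => inf_le_inf_right W (le_iSup U i)
    have hcov : ∀ x : ↥(iSup U ⊓ W : Opens X.pt), ∃ i, (x : X.pt) ∈ U i ⊓ W := fun x => by
      obtain ⟨i, hi⟩ := Opens.mem_iSup.1 x.2.1
      exact ⟨i, hi, x.2.2⟩
    obtain ⟨t, ht⟩ := (Form.sheaf X k).glue_local (U := iSup U ⊓ W)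
      (fun V r => ∃ (i : ι) (h : V = U i ⊓ W), r = Form.res h.le (s i)) (fun x => by
        obtain ⟨i, hi⟩ := hcov x
        exact ⟨_, hle i, hi, _, i, rfl, rfl⟩) (by
        rintro _ _ _ _ hV hV' ⟨i, rfl, rfl⟩ ⟨j, rfl, rfl⟩
        exact congrArg (Form.res (show U i ⊓ W ⊓ (U j ⊓ W) ≤ U i ⊓ U j ⊓ W from
          le_inf (inf_le_inf inf_le_left inf_le_left) (inf_le_left.trans inf_le_right)))
          (hs i j))
    refine ⟨t, fun i => ht _ (hle i) _ ⟨i, rfl, rfl⟩, fun t' ht' => ?_⟩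
    refine Form.eq_of_local fun x => ?_
    obtain ⟨i, hi⟩ := hcov x
    exact ⟨_, hle i, hi, (ht' i).trans (ht _ (hle i) _ ⟨i, rfl, rfl⟩).symm⟩

/-- The DG module `i_* i^* Ω[2]`, for the inclusion `i` of the open set `W`. -/
def Form.shiftOn (W : Opens X.pt) : DGMod X where
  sh m := Form.sheafOn W (m + 2)
  act {k i j} h U w m := Form.mul (k := k) (l := i + 2) (m := j + 2) (by rw [← h, add_assoc])
    (Form.res inf_le_left w) m
  D {i j} h U := Form.d (k := i + 2) (l := j + 2) (by rw [← h]; ring)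
  add_act h U w w' m := (congrArg (Form.mul _ · m) (map_add _ _ _)).trans (Form.add_mul _ _ _ _)
  act_add h U w m m' := Form.mul_add _ _ _ _
  one_act h U m := Form.ofFn_one_mul _ _
  mul_act h h₁ h₂ h₃ U w w' m := by
    rw [Form.res_mul]; exact Form.mul_assoc _ _ _ _ _ _ _
  res_act h U V hV w m := Form.res_mul _ _ _ _
  res_D h U V hV m := Form.res_d _ _ _
  D_D h h' U m := Form.d_d _ _ _
  D_act {k k' i j i' l} h h₁ h₂ h₃ h₄ U w w' m hw := by
    have hk := hw.1.symm
    have hw' := hw.eq hk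
    clear hw
    subst hw'
    rw [Form.res_d]
    exact Form.d_mul _ _ _ _ _ _ _ _

/-! ### The functor `pr_* ev^*`: existence -/

lemma FreeAbelianGroup.map_eq {α : Type u} {G : Type u} [AddCommGroup G]
    (f g : FreeAbelianGroup α →+ G) (h : ∀ a, f (FreeAbelianGroup.of a) = g (FreeAbelianGroup.of a))
    (p : FreeAbelianGroup α) : f p = g p := DFunLike.congr_fun (FreeAbelianGroup.lift_ext f g h) p

lemma FreeAbelianGroup.comp_eq {α : Type u} {B B' G : Type u} [AddCommGroup G] [AddCommGroup B]
    [AddCommGroup B'] (f : B →+ G) (g : FreeAbelianGroup α →+ B) (f' : B' →+ G)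
    (g' : FreeAbelianGroup α →+ B')
    (h : ∀ a, f (g (FreeAbelianGroup.of a)) = f' (g' (FreeAbelianGroup.of a)))
    (p : FreeAbelianGroup α) : f (g p) = f' (g' p) := by
  induction p using FreeAbelianGroup.induction_on with
  | zero => simp only [map_zero]
  | of a => exact h a
  | neg a _ => simp only [map_neg, h a]
  | add a b ha hb => simp only [map_add, ha, hb]

section
variable (E : OMod X) {i j k m : ℤ} {U V : Opens X.pt}

/-- Restriction of formal sums of elements `(w + v ε) ⊗ e`. -/
def evRes (m : ℤ) (h : V ≤ U) : FreeAbelianGroup (EvGen E m U) →+ FreeAbelianGroup (EvGen E m V) :=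
  FreeAbelianGroup.map fun g => (Form.res h g.1, Form.res h g.2.1, E.res h g.2.2)

/-- Multiplication of formal sums of elements `(w + v ε) ⊗ e` with a form. -/
def evAct (h : k + i = j) (u : Form k U) :
    FreeAbelianGroup (EvGen E i U) →+ FreeAbelianGroup (EvGen E j U) :=
  FreeAbelianGroup.map fun g =>
    (Form.mul h u g.1, Form.mul (by rw [← h, add_assoc]) u g.2.1, g.2.2)

/-- The differential `d + ∂/∂ε` of formal sums of elements `(w + v ε) ⊗ e`. -/
def evD (h : i + 1 = j) : FreeAbelianGroup (EvGen E i U) →+ FreeAbelianGroup (EvGen E j U) :=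
  FreeAbelianGroup.map fun g =>
    (Form.d h g.1 + sg j • Form.cast h g.2.1, Form.d (by rw [h]) g.2.1, g.2.2)

variable {E}

lemma evRes_of (h : V ≤ U) (w : Form m U) (v : Form (m + 1) U) (e : E.sec U) :
    evRes E m h (.of (w, v, e)) = .of (Form.res h w, Form.res h v, E.res h e) :=
  FreeAbelianGroup.map_of_apply _

lemma evAct_of (h : k + i = j) (h' : k + (i + 1) = j + 1) (u : Form k U) (w : Form i U)
    (v : Form (i + 1) U) (e : E.sec U) :
    evAct E h u (.of (w, v, e)) = .of (Form.mul h u w, Form.mul h' u v, e) :=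
  FreeAbelianGroup.map_of_apply _

lemma evD_of (h : i + 1 = j) (h' : i + 1 + 1 = j + 1) (w : Form i U)
    (v : Form (i + 1) U) (e : E.sec U) :
    evD E h (.of (w, v, e)) = .of (Form.d h w + sg j • Form.cast h v, Form.d h' v, e) :=
  FreeAbelianGroup.map_of_apply _

end

/-- The relations of `Ω[ε] ⊗ E`. -/
def evK (E : OMod X) (m : ℤ) (U : Opens X.pt) : AddSubgroup (FreeAbelianGroup (EvGen E m U)) :=
  AddSubgroup.closure {r | EvRel E m U r}

section
variable {E : OMod X} {m : ℤ} {U V : Opens X.pt}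

/-- The class of `(w + v ε) ⊗ e`. -/
def evMk (w : Form m U) (v : Form (m + 1) U) (e : E.sec U) :
    FreeAbelianGroup (EvGen E m U) ⧸ evK E m U :=
  QuotientAddGroup.mk (FreeAbelianGroup.of (w, v, e))

lemma evMk_add (w w' : Form m U) (v v' : Form (m + 1) U) (e : E.sec U) :
    evMk (w + w') (v + v') e = evMk w v e + evMk w' v' e := by
  have h : FreeAbelianGroup.of (w + w', v + v', e) - FreeAbelianGroup.of (w, v, e) -
        FreeAbelianGroup.of (w', v', e) ∈ evK E m U := AddSubgroup.subset_closure (.add_left _ _ _ _ _)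
  have := (QuotientAddGroup.eq_zero_iff _).2 h
  rw [QuotientAddGroup.mk_sub, QuotientAddGroup.mk_sub, sub_sub, sub_eq_zero] at this
  exact this

lemma evMk_add_right (w : Form m U) (v : Form (m + 1) U) (e e' : E.sec U) :
    evMk w v (e + e') = evMk w v e + evMk w v e' := by
  have h : FreeAbelianGroup.of (w, v, e + e') - FreeAbelianGroup.of (w, v, e) -
        FreeAbelianGroup.of (w, v, e') ∈ evK E m U := AddSubgroup.subset_closure (.add_right _ _ _ _)
  have := (QuotientAddGroup.eq_zero_iff _).2 h
  rw [QuotientAddGroup.mk_sub, QuotientAddGroup.mk_sub, sub_sub, sub_eq_zero] at this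
  exact this

lemma evMk_smul (w : Form m U) (v : Form (m + 1) U) (f : Fn U) (e : E.sec U) :
    evMk (f • w) (f • v + Form.mul rfl w (Form.dFn f)) e = evMk w v (f • e) := by
  have h : FreeAbelianGroup.of (f • w, f • v + Form.mul rfl w (Form.dFn f), e) -
        FreeAbelianGroup.of (w, v, f • e) ∈ evK E m U := AddSubgroup.subset_closure (.balanced _ _ _ _)
  have := (QuotientAddGroup.eq_zero_iff _).2 h
  rw [QuotientAddGroup.mk_sub, sub_eq_zero] at this
  exact this

lemma evMk_zero (e : E.sec U) : evMk (0 : Form m U) 0 e = 0 := by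
  have := evMk_add (0 : Form m U) 0 0 0 e
  rwa [add_zero, add_zero, left_eq_add] at this

lemma evMk_neg (w : Form m U) (v : Form (m + 1) U) (e : E.sec U) :
    evMk (-w) (-v) e = -evMk w v e := by
  rw [eq_neg_iff_add_eq_zero, ← evMk_add, neg_add_cancel, neg_add_cancel, evMk_zero]

lemma evMk_sg (n : ℤ) (w : Form m U) (v : Form (m + 1) U) (e : E.sec U) :
    evMk (sg n • w) (sg n • v) e = sg n • evMk w v e := by
  rcases sg_cases n with h | h <;> simp only [h, one_smul, neg_smul, evMk_neg]

lemma evK_le {G : Type u} [AddCommGroup G] (f : FreeAbelianGroup (EvGen E m U) →+ G)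
    (h1 : ∀ (w w' : Form m U) (v v' : Form (m + 1) U) (e : E.sec U),
      f (.of (w + w', v + v', e)) = f (.of (w, v, e)) + f (.of (w', v', e)))
    (h2 : ∀ (w : Form m U) (v : Form (m + 1) U) (e e' : E.sec U),
      f (.of (w, v, e + e')) = f (.of (w, v, e)) + f (.of (w, v, e')))
    (h3 : ∀ (w : Form m U) (v : Form (m + 1) U) (r : Fn U) (e : E.sec U),
      f (.of (r • w, r • v + Form.mul rfl w (Form.dFn r), e)) = f (.of (w, v, r • e)))
    (p : FreeAbelianGroup (EvGen E m U)) (hp : p ∈ evK E m U) : f p = 0 := by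
  have : evK E m U ≤ f.ker := by
    refine (AddSubgroup.closure_le _).2 ?_
    rintro _ (⟨w, w', v, v', e⟩ | ⟨w, v, e, e'⟩ | ⟨w, v, r, e⟩)
    · simp only [SetLike.mem_coe, AddMonoidHom.mem_ker, map_sub, h1]; abel
    · simp only [SetLike.mem_coe, AddMonoidHom.mem_ker, map_sub, h2]; abel
    · simp only [SetLike.mem_coe, AddMonoidHom.mem_ker, map_sub, h3]; abel
  exact this hp

/-- The projection from formal sums. -/
abbrev evQ (E : OMod X) (m : ℤ) (U : Opens X.pt) : FreeAbelianGroup (EvGen E m U) →+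
    FreeAbelianGroup (EvGen E m U) ⧸ evK E m U := QuotientAddGroup.mk' _

lemma evQ_of (w : Form m U) (v : Form (m + 1) U) (e : E.sec U) :
    evQ E m U (.of (w, v, e)) = evMk w v e := rfl

lemma evQ_eq_zero {p : FreeAbelianGroup (EvGen E m U)} (h : evQ E m U p = 0) : p ∈ evK E m U :=
  (QuotientAddGroup.eq_zero_iff p).1 h

lemma evQ_eq {p q : FreeAbelianGroup (EvGen E m U)} (h : evQ E m U p = evQ E m U q) :
    p - q ∈ evK E m U :=
  evQ_eq_zero (by rw [map_sub, h, sub_self])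

lemma evRes_mem (h : V ≤ U) (p : FreeAbelianGroup (EvGen E m U)) (hp : p ∈ evK E m U) :
    evRes E m h p ∈ evK E m V := by
  refine evQ_eq_zero (evK_le ((evQ E m V).comp (evRes E m h)) ?_ ?_ ?_ p hp)
  · intro w w' v v' e
    simp only [AddMonoidHom.comp_apply, evRes_of, evQ_of, map_add, evMk_add]
  · intro w v e e'
    simp only [AddMonoidHom.comp_apply, evRes_of, evQ_of, map_add, evMk_add_right]
  · intro w v r e
    simp only [AddMonoidHom.comp_apply, evRes_of, evQ_of, map_add, E.res_smul, Form.res_smul,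
      Form.res_mul, Form.res_dFn, evMk_smul]

lemma evAct_mem {i j k : ℤ} (h : k + i = j) (u : Form k U) (p : FreeAbelianGroup (EvGen E i U))
    (hp : p ∈ evK E i U) : evAct E h u p ∈ evK E j U := by
  have h' : k + (i + 1) = j + 1 := ◇
  refine evQ_eq_zero (evK_le ((evQ E j U).comp (evAct E h u)) ?_ ?_ ?_ p hp)
  · intro w w' v v' e
    simp only [AddMonoidHom.comp_apply, evAct_of h h', evQ_of, Form.mul_add, evMk_add]
  · intro w v e e'
    simp only [AddMonoidHom.comp_apply, evAct_of h h', evQ_of, evMk_add_right]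
  · intro w v r e
    simp only [AddMonoidHom.comp_apply, evAct_of h h', evQ_of, Form.mul_add, Form.mul_smul]
    rw [← Form.mul_assoc h rfl]
    exact evMk_smul _ _ _ _

lemma evD_mem {i j : ℤ} (h : i + 1 = j) (p : FreeAbelianGroup (EvGen E i U))
    (hp : p ∈ evK E i U) : evD E h p ∈ evK E j U := by
  subst h
  refine evQ_eq_zero (evK_le ((evQ E (i + 1) U).comp (evD E rfl)) ?_ ?_ ?_ p hp)
  · intro w w' v v' e
    simp only [AddMonoidHom.comp_apply, evD_of rfl rfl, evQ_of, map_add, smul_add]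
    rw [add_add_add_comm, evMk_add]
  · intro w v e e'
    simp only [AddMonoidHom.comp_apply, evD_of rfl rfl, evQ_of, evMk_add_right]
  · intro w v r e
    simp only [AddMonoidHom.comp_apply, evD_of rfl rfl, evQ_of, map_add, Form.cast_rfl]
    refine Eq.trans ?_ (evMk_smul _ _ _ _)
    refine congrArg₂ (fun a b => evMk a b e) ?_ ?_
    · rw [Form.d_smul _ (add_comm 1 i), Form.mul_dFn_comm (add_comm 1 i) rfl, smul_add, smul_add,
        sg_add, sg_one, mul_neg_one, neg_smul, neg_smul, neg_smul, smul_neg, smul_comm r (sg i), smul_smul,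
        sg_mul_self, one_smul]
      abel
    · rw [Form.d_smul _ (add_comm 1 (i + 1)), Form.mul_dFn_comm (add_comm 1 (i + 1)) rfl,
        Form.d_mul rfl rfl rfl (rfl : (1 : ℤ) + 1 = 1 + 1) rfl (add_assoc _ _ _).symm,
        Form.d_dFn, Form.mul_zero, smul_zero, add_zero, Form.mul_add, Form.mul_zsmul, smul_add,
        smul_smul, sg_mul_self, one_smul, Form.mul_dFn_comm (add_comm 1 (i + 1)) rfl]
      abel

end

section
variable {E : OMod X} {i j k l m : ℤ} {U V : Opens X.pt}

lemma evRes_evAct (h : k + i = j) (hV : V ≤ U) (w : Form k U)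
    (p : FreeAbelianGroup (EvGen E i U)) :
    evRes E j hV (evAct E h w p) = evAct E h (Form.res hV w) (evRes E i hV p) := by
  have h' : k + (i + 1) = j + 1 := ◇
  refine FreeAbelianGroup.comp_eq (evRes E j hV) (evAct E h w) (evAct E h (Form.res hV w))
    (evRes E i hV) ?_ p
  rintro ⟨u, v, e⟩
  rw [evAct_of h h', evRes_of, evRes_of, evAct_of h h', Form.res_mul, Form.res_mul]

lemma evRes_evD (h : i + 1 = j) (hV : V ≤ U) (p : FreeAbelianGroup (EvGen E i U)) :
    evRes E j hV (evD E h p) = evD E h (evRes E i hV p) := by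
  subst h
  refine FreeAbelianGroup.comp_eq (evRes E _ hV) (evD E rfl) (evD E rfl) (evRes E i hV) ?_ p
  rintro ⟨u, v, e⟩
  rw [evD_of rfl rfl, evRes_of, evRes_of, evD_of rfl rfl, map_add, map_zsmul, Form.res_d,
    Form.res_d, Form.cast_rfl, Form.cast_rfl]

lemma evAct_add (h : k + i = j) (w w' : Form k U) (p : FreeAbelianGroup (EvGen E i U)) :
    evQ E j U (evAct E h (w + w') p) = evQ E j U (evAct E h w p + evAct E h w' p) := by
  have h' : k + (i + 1) = j + 1 := ◇
  refine FreeAbelianGroup.comp_eq (evQ E j U) (evAct E h (w + w')) (evQ E j U)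
    (evAct E h w + evAct E h w') ?_ p
  rintro ⟨u, v, e⟩
  simp only [AddMonoidHom.add_apply, evAct_of h h', Form.add_mul, map_add, evQ_of, evMk_add]

lemma evAct_one (h : 0 + i = i) (p : FreeAbelianGroup (EvGen E i U)) :
    evAct E h (Form.ofFn 1) p = p := by
  refine FreeAbelianGroup.map_eq (evAct E h (Form.ofFn 1)) (AddMonoidHom.id _) ?_ p
  rintro ⟨u, v, e⟩
  rw [evAct_of h (zero_add _), Form.ofFn_one_mul, Form.ofFn_one_mul, AddMonoidHom.id_apply]

lemma evAct_mul {p q : ℤ} (h : k + l = p) (h₁ : l + i = j) (h₂ : k + j = q) (h₃ : p + i = q)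
    (w : Form k U) (w' : Form l U) (t : FreeAbelianGroup (EvGen E i U)) :
    evAct E h₃ (Form.mul h w w') t = evAct E h₂ w (evAct E h₁ w' t) := by
  obtain ⟨h₁', h₂', h₃'⟩ : l + (i + 1) = j + 1 ∧ k + (j + 1) = q + 1 ∧ p + (i + 1) = q + 1 := ◇
  refine FreeAbelianGroup.map_eq (evAct E h₃ (Form.mul h w w'))
    ((evAct E h₂ w).comp (evAct E h₁ w')) ?_ t
  rintro ⟨u, v, e⟩
  rw [AddMonoidHom.comp_apply, evAct_of h₃ h₃', evAct_of h₁ h₁', evAct_of h₂ h₂',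
    Form.mul_assoc h h₃ h₁ h₂, Form.mul_assoc h h₃' h₁' h₂']

lemma evD_evD (h : i + 1 = j) (h' : j + 1 = l) (p : FreeAbelianGroup (EvGen E i U)) :
    evQ E l U (evD E h' (evD E h p)) = 0 := by
  subst h h'
  refine FreeAbelianGroup.map_eq ((evQ E _ U).comp ((evD E rfl).comp (evD E rfl))) 0 ?_ p
  rintro ⟨u, v, e⟩
  rw [AddMonoidHom.comp_apply, AddMonoidHom.comp_apply, evD_of rfl rfl, evD_of rfl rfl, map_add,
    map_zsmul, Form.d_d, Form.d_d, Form.cast_rfl, Form.cast_rfl, zero_add, evQ_of,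
    sg_add (i + 1) 1, sg_one, mul_neg_one, neg_smul, add_neg_cancel, evMk_zero,
    AddMonoidHom.zero_apply]

lemma evD_evAct {k' i' : ℤ} (h : k + i = j) (h₁ : j + 1 = l) (h₂ : k' + i = l) (h₃ : i + 1 = i')
    (h₄ : k + i' = l) (hk : k + 1 = k') (w : Form k U) (p : FreeAbelianGroup (EvGen E i U)) :
    evQ E l U (evD E h₁ (evAct E h w p)) =
      evQ E l U (evAct E h₂ (Form.d hk w) p + sg k • evAct E h₄ w (evD E h₃ p)) := by
  subst h h₁ h₃ hk
  refine FreeAbelianGroup.map_eq ((evQ E _ U).comp ((evD E rfl).comp (evAct E rfl w)))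
    ((evQ E _ U).comp (evAct E h₂ (Form.d rfl w) + sg k • (evAct E h₄ w).comp (evD E rfl))) ?_ p
  rintro ⟨u, v, e⟩
  have e1 : k + (i + 1) = k + i + 1 := (add_assoc _ _ _).symm
  have e2 : k + 1 + (i + 1) = k + i + 1 + 1 := by ring
  have e3 : k + (i + 1 + 1) = k + i + 1 + 1 := by ring
  have es : sg (k + i + 1) = sg k * sg (i + 1) := by rw [add_assoc, sg_add]
  simp only [AddMonoidHom.comp_apply, AddMonoidHom.add_apply, AddMonoidHom.smul_apply,
    evD_of rfl rfl, evAct_of rfl e1, evAct_of h₂ e2, evAct_of h₄ e3, Form.cast_rfl, map_add,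
    map_zsmul, evQ_of]
  rw [← evMk_sg, ← evMk_add, Form.d_mul rfl rfl rfl rfl h₂ h₄, Form.d_mul e1 rfl rfl rfl e2 e3,
    add_assoc (Form.mul h₂ _ _), Form.mul_add, smul_add, Form.mul_zsmul, smul_smul, ← es]

end

/-- The presheaf of formal sums of elements `(w + v ε) ⊗ e`. -/
def evPre (E : OMod X) (m : ℤ) : AbPre X where
  sec U := FreeAbelianGroup (EvGen E m U)
  res h := evRes E m h
  res_id {U} s := by
    refine FreeAbelianGroup.map_eq (evRes E m le_rfl) (AddMonoidHom.id _) ?_ s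
    rintro ⟨w, v, e⟩
    rw [evRes_of, E.res_id, Form.res_id, Form.res_id, AddMonoidHom.id_apply]
  res_res {U V W} h h' s := by
    refine FreeAbelianGroup.map_eq ((evRes E m h').comp (evRes E m h)) (evRes E m (h'.trans h)) ?_ s
    rintro ⟨w, v, e⟩
    rw [AddMonoidHom.comp_apply, evRes_of, evRes_of, evRes_of, E.res_res, Form.res_res,
      Form.res_res]

/-- The presheaf of DG modules `Ω[ε] ⊗ E`. -/
def evDG (E : OMod X) : PreDG X where
  pre := evPre E
  K := evK E
  act h U u := evAct E h u
  D h U := evD E h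
  res_K h p hp := evRes_mem h p hp
  act_K h U u p hp := evAct_mem h u p hp
  D_K h U p hp := evD_mem h p hp
  res_act h U V hV w p := evRes_evAct h hV w p
  res_D h U V hV p := evRes_evD h hV p
  add_act h U w w' p := evQ_eq (evAct_add h w w' p)
  one_act h U p := evQ_eq (congrArg _ (evAct_one h p))
  mul_act h h₁ h₂ h₃ U w w' m := evQ_eq (congrArg _ (evAct_mul h h₁ h₂ h₃ w w' m))
  D_D h h' U p := evQ_eq_zero (evD_evD h h' p)
  D_act h h₁ h₂ h₃ h₄ hk U w p := evQ_eq (evD_evAct h h₁ h₂ h₃ h₄ hk w p)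

lemma exists_oddPullback (E : OMod X) : ∃ N j, OddPullback E N j := by
  obtain ⟨N, π, H⟩ := (evDG E).exists_isQuot
  have hπ : ∀ {m : ℤ} {U : Opens X.pt} {p q : FreeAbelianGroup (EvGen E m U)},
      evQ E m U p = evQ E m U q → π m U p = π m U q := fun {m U p q} h =>
    sub_eq_zero.1 ((map_sub (π m U) p q).symm.trans (H.zero _ (evQ_eq h)))
  have hπadd : ∀ {m : ℤ} {U : Opens X.pt} {w w' w'' : Form m U} {v v' v'' : Form (m + 1) U}
      {e e' e'' : E.sec U}, evMk w v e = evMk w' v' e' + evMk w'' v'' e'' →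
      π m U (FreeAbelianGroup.of ((w, v, e) : EvGen E m U)) =
        π m U (FreeAbelianGroup.of ((w', v', e') : EvGen E m U)) +
          π m U (FreeAbelianGroup.of ((w'', v'', e'') : EvGen E m U)) :=
    fun {m U w w' w'' v v' v'' e e' e''} h =>
      (hπ (q := (FreeAbelianGroup.of (w', v', e') + FreeAbelianGroup.of (w'', v'', e'') :
        FreeAbelianGroup (EvGen E m U))) (h.trans (map_add (evQ E m U) _ _).symm)).trans
          (map_add (π m U) _ _)
  let j : ∀ U : Opens X.pt, E.sec U →+ (N.sh (-1)).sec U := fun U =>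
    AddMonoidHom.mk' (fun e => π (-1) U (FreeAbelianGroup.of
      ((0, Form.cast (neg_add_cancel 1).symm (Form.ofFn 1), e) : EvGen E (-1) U))) fun e e' =>
        hπadd (evMk_add_right _ _ _ _)
  have hcast : ∀ {k : ℤ} (h : 0 = k) {U : Opens X.pt} (l m : ℤ) (hm : l + k = m) (hl : l = m)
      (v : Form l U), Form.mul hm v (Form.cast h (Form.ofFn 1)) = Form.cast hl v := by
    intro k h U l m hm hl v
    subst h hl
    rw [Form.cast_rfl, Form.cast_rfl, Form.mul_ofFn_one]
  have hj : ∀ {m : ℤ} {U : Opens X.pt} (h : (m + 1) + -1 = m) (v : Form (m + 1) U) (e : E.sec U),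
      N.act h v (j U e) = π m U (FreeAbelianGroup.of ((0, v, e) : EvGen E m U)) := by
    intro m U h v e
    refine (H.act h v _).symm.trans (congrArg _ ?_)
    refine (evAct_of h ◇ _ _ _ _).trans ?_
    rw [Form.mul_zero, hcast _ _ _ _ rfl, Form.cast_rfl]
  have hDj : ∀ {U : Opens X.pt} (e : E.sec U), N.D (neg_add_cancel 1) (j U e) =
      π 0 U (FreeAbelianGroup.of ((Form.ofFn 1, 0, e) : EvGen E 0 U)) := by
    intro U e
    refine (H.D _ _).symm.trans (congrArg _ ?_)
    refine (evD_of (neg_add_cancel 1) ◇ _ _ _).trans ?_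
    have h1 : ∀ (k : ℤ) (h : 0 = k) (h' : k + 1 = 0 + 1),
        Form.d h' (Form.cast h (Form.ofFn (1 : Fn U))) = 0 := by
      rintro _ rfl h'
      rw [Form.cast_rfl, Form.d_ofFn, Form.dFn_one]
    have h2 : ∀ (k : ℤ) (h : 0 = k) (h' : k = 0),
        Form.cast h' (Form.cast h (Form.ofFn (1 : Fn U))) = Form.ofFn 1 := by
      rintro _ rfl h'
      rfl
    have h3 : ∀ (w w' : Form 0 U), w' = w →
        Form.d (neg_add_cancel 1) (0 : Form (-1) U) + sg 0 • w' = w := by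
      rintro w w' rfl
      rw [map_zero, _root_.zero_add (sg 0 • w'), sg_zero, one_smul]
    exact congrArg FreeAbelianGroup.of (Prod.ext (h3 _ _ (h2 _ _ _))
      (Prod.ext (h1 _ _ _) rfl))
  have hDj' : ∀ {m : ℤ} {U : Opens X.pt} (h : m + 0 = m) (w : Form m U) (e : E.sec U),
      N.act h w (N.D (neg_add_cancel 1) (j U e)) =
        π m U (FreeAbelianGroup.of ((w, 0, e) : EvGen E m U)) := by
    intro m U h w e
    rw [hDj]
    refine (H.act h w _).symm.trans (congrArg _ ?_)
    refine (evAct_of h ◇ _ _ _ _).trans ?_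
    rw [Form.mul_zero, Form.mul_ofFn_one]
  have key : ∀ {m : ℤ} {U : Opens X.pt} (t : FreeAbelianGroup (EvGen E m U)),
      FreeAbelianGroup.lift (fun g => N.act (add_zero m) g.1 (N.D (neg_add_cancel 1) (j U g.2.2)) +
        N.act (add_neg_cancel_right m 1) g.2.1 (j U g.2.2)) t = π m U t := by
    intro m U t
    refine FreeAbelianGroup.map_eq (FreeAbelianGroup.lift _) (π m U) ?_ t
    rintro ⟨w, v, e⟩
    rw [FreeAbelianGroup.lift_apply_of, hj, hDj']
    refine (hπadd ?_).symm
    rw [← evMk_add, add_zero, zero_add]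
  refine ⟨N, j, ?_, ?_, ?_, ?_⟩
  · intro U V h e
    refine ((H.quot _).res h _).trans (congrArg (π (-1) V) ((evRes_of h _ _ _).trans ?_))
    rw [map_zero]
    rfl
  · intro U f e
    refine Eq.trans (hπ ?_) (H.act _ _ _)
    refine Eq.trans ?_ (congrArg (evQ E (-1) U) (evAct_of (zero_add _) ◇ _ _ _ _).symm)
    rw [Form.mul_zero, Form.ofFn_mul']
    refine ((evMk_smul _ _ _ _).symm.trans ?_)
    rw [smul_zero, Form.zero_mul, add_zero]
    rfl
  · intro m U y x
    obtain ⟨V, h, p, hx, hp⟩ := (H.quot m).surj y x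
    exact ⟨V, h, p, hx, hp.trans (key _).symm⟩
  · intro m U t ht x
    rw [key] at ht
    exact H.ker t ht x

/-! ### Presentations of DG modules by generators and relations -/

/-- The generators of a DG module which is spanned over `Ω` by a section `c` of degree `-2` and by
sections `j e` and `D (j e)` of degrees `-1` and `0`, for `e` in `E`. -/
inductive Gen (E : OMod X) (U : Opens X.pt) : Type u
  | c : Gen E U
  | j (e : E.sec U) : Gen E U
  | D (e : E.sec U) : Gen E U

namespace Gen
variable {E : OMod X} {U V : Opens X.pt}

/-- The degree of a generator. -/
@[reducible] def deg : Gen E U → ℤ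
  | c => -2
  | j _ => -1
  | D _ => 0

/-- Restriction of generators. -/
def res (h : V ≤ U) : Gen E U → Gen E V
  | c => c
  | j e => j (E.res h e)
  | D e => D (E.res h e)

lemma deg_res (h : V ≤ U) (y : Gen E U) : (y.res h).deg = y.deg := by cases y <;> rfl

/-- The section of a DG module given by a generator. -/
def val {N : DGMod X} (jN : ∀ U : Opens X.pt, E.sec U →+ (N.sh (-1)).sec U)
    (cN : (N.sh (-2)).sec ⊤) : ∀ y : Gen E U, (N.sh y.deg).sec U
  | c => (N.sh (-2)).res le_top cN
  | j e => jN U e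
  | D e => N.D (neg_add_cancel 1) (jN U e)

end Gen

/-- A map out of the degree `m` part of a DG module generated by `c`, `j e` and `D (j e)`, with a
parameter in `A`: the image of `w · y` for each generator `y`. It respects the relations
`j (f e) = f · j e`, its differential, `j (κ α) = α · c`, and the differential of the latter. -/
structure GenMap (E : OMod X) (κ : ∀ U : Opens X.pt, Form 1 U → E.sec U) (m : ℤ) (A : AbPre X)
    (F : AbSheaf X) where
  toFun : ∀ {k : ℤ} {U : Opens X.pt} (y : Gen E U), k + y.deg = m → Form k U → A.sec U → F.sec U
  add_form : ∀ {k : ℤ} {U : Opens X.pt} (y : Gen E U) (h : k + y.deg = m) (w w' : Form k U)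
    (a : A.sec U), toFun y h (w + w') a = toFun y h w a + toFun y h w' a
  add_param : ∀ {k : ℤ} {U : Opens X.pt} (y : Gen E U) (h : k + y.deg = m) (w : Form k U)
    (a a' : A.sec U), toFun y h w (a + a') = toFun y h w a + toFun y h w a'
  add_j : ∀ {k : ℤ} {U : Opens X.pt} (e e' : E.sec U) (h : k + -1 = m) (w : Form k U)
    (a : A.sec U), toFun (.j (e + e')) h w a = toFun (.j e) h w a + toFun (.j e') h w a
  add_D : ∀ {k : ℤ} {U : Opens X.pt} (e e' : E.sec U) (h : k + 0 = m) (w : Form k U)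
    (a : A.sec U), toFun (.D (e + e')) h w a = toFun (.D e) h w a + toFun (.D e') h w a
  res : ∀ {k : ℤ} {U V : Opens X.pt} (hV : V ≤ U) (y : Gen E U) (h : k + y.deg = m)
    (h' : k + (y.res hV).deg = m) (w : Form k U) (a : A.sec U),
    F.res hV (toFun y h w a) = toFun (y.res hV) h' (Form.res hV w) (A.res hV a)
  smul_j : ∀ {k : ℤ} {U : Opens X.pt} (f : Fn U) (e : E.sec U) (h : k + -1 = m) (w : Form k U)
    (a : A.sec U), toFun (.j (f • e)) h w a = toFun (.j e) h (f • w) a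
  smul_D : ∀ {k l : ℤ} {U : Opens X.pt} (f : Fn U) (e : E.sec U) (h : k + 0 = m) (h' : l + -1 = m)
    (h₁ : k + 1 = l) (w : Form k U) (a : A.sec U), toFun (.D (f • e)) h w a =
      toFun (.D e) h (f • w) a + toFun (.j e) h' (Form.mul h₁ w (Form.dFn f)) a
  κ_j : ∀ {k l : ℤ} {U : Opens X.pt} (α : Form 1 U) (h : k + -1 = m) (h' : l + -2 = m)
    (h₁ : k + 1 = l) (w : Form k U) (a : A.sec U),
    toFun (.j (κ U α)) h w a = toFun .c h' (Form.mul h₁ w α) a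
  κ_D : ∀ {k l : ℤ} {U : Opens X.pt} (α : Form 1 U) (h : k + 0 = m) (h' : l + -2 = m)
    (h₁ : k + 2 = l) (h₂ : (1 : ℤ) + 1 = 2) (w : Form k U) (a : A.sec U),
    toFun (.D (κ U α)) h w a = toFun .c h' (Form.mul h₁ w (Form.d h₂ α)) a

/-- `N` is generated by `c`, `j e` and `D (j e)`, with the relations listed in `GenMap` and, if
`c = 0`, the relation `c = 0`. -/
structure Presented (E : OMod X) (κ : ∀ U : Opens X.pt, Form 1 U → E.sec U) (N : DGMod X)
    (j : ∀ U : Opens X.pt, E.sec U →+ (N.sh (-1)).sec U) (c : (N.sh (-2)).sec ⊤) : Prop where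
  res_j : ∀ {U V : Opens X.pt} (h : V ≤ U) (e : E.sec U),
    (N.sh (-1)).res h (j U e) = j V (E.res h e)
  j_smul : ∀ {U : Opens X.pt} (f : Fn U) (e : E.sec U),
    j U (f • e) = N.act (zero_add _) (Form.ofFn f) (j U e)
  D_c : ∀ {i : ℤ} (h : -2 + 1 = i), N.D h c = 0
  j_κ : ∀ {U : Opens X.pt} (h : 1 + -2 = (-1 : ℤ)) (α : Form 1 U),
    j U (κ U α) = N.act h α ((N.sh (-2)).res le_top c)
  induction : ∀ P : ∀ (m : ℤ) (U : Opens X.pt), (N.sh m).sec U → Prop,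
    (∀ (m : ℤ) (U : Opens X.pt) (t : (N.sh m).sec U), (∀ x : U, ∃ (V : Opens X.pt) (hV : V ≤ U),
      (x : X.pt) ∈ V ∧ P m V ((N.sh m).res hV t)) → P m U t) →
    (∀ (m : ℤ) (U : Opens X.pt) (t t' : (N.sh m).sec U), P m U t → P m U t' → P m U (t + t')) →
    (∀ (m : ℤ) (U : Opens X.pt) (t : (N.sh m).sec U), P m U t → P m U (-t)) →
    (∀ (k m : ℤ) (U : Opens X.pt) (y : Gen E U) (h : k + y.deg = m) (w : Form k U),
      P m U (N.act h w (y.val j c))) → ∀ (m : ℤ) (U : Opens X.pt) (t : (N.sh m).sec U), P m U t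
  lift : ∀ {m : ℤ} {A : AbPre X} {F : AbSheaf X} (G : GenMap E κ m A F),
    (c = 0 → ∀ (k : ℤ) (U : Opens X.pt) (h : k + -2 = m) (w : Form k U) (a : A.sec U),
      G.toFun .c h w a = 0) → ∃ ψ : ∀ U, (N.sh m).sec U →+ A.sec U →+ F.sec U,
      (∀ {U V : Opens X.pt} (h : V ≤ U) (t : (N.sh m).sec U) (a : A.sec U),
        F.res h (ψ U t a) = ψ V ((N.sh m).res h t) (A.res h a)) ∧
      ∀ {k : ℤ} {U : Opens X.pt} (y : Gen E U) (h : k + y.deg = m) (w : Form k U) (a : A.sec U),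
        ψ U (N.act h w (y.val j c)) a = G.toFun y h w a

namespace GenMap
variable {E : OMod X} {κ : ∀ U : Opens X.pt, Form 1 U → E.sec U} {m : ℤ} {A : AbPre X}
  {F : AbSheaf X} (G : GenMap E κ m A F)

lemma zero_form {k : ℤ} {U : Opens X.pt} (y : Gen E U) (h : k + y.deg = m) (a : A.sec U) :
    G.toFun y h 0 a = 0 := by
  have := G.add_form y h 0 0 a
  rwa [add_zero, left_eq_add] at this

/-- The map `w · y ↦ G (w · y)` as an additive map in the parameter. -/
def paramHom {k : ℤ} {U : Opens X.pt} (y : Gen E U) (h : k + y.deg = m) (w : Form k U) :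
    A.sec U →+ F.sec U := AddMonoidHom.mk' (G.toFun y h w) (G.add_param y h w)

/-- The same map, with value zero on the generator `c` and no relation imposed by `κ`. -/
def dropC : GenMap E (fun _ _ => 0) m A F where
  toFun y := match y with
    | .c => fun _ _ _ => 0
    | .j e => G.toFun (.j e)
    | .D e => G.toFun (.D e)
  add_form y h w w' a := by
    cases y
    · exact (add_zero 0).symm
    · exact G.add_form _ _ _ _ _
    · exact G.add_form _ _ _ _ _
  add_param y h w a a' := by
    cases y
    · exact (add_zero 0).symm
    · exact G.add_param _ _ _ _ _
    · exact G.add_param _ _ _ _ _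
  add_j := G.add_j
  add_D := G.add_D
  res hV y h h' w a := by
    cases y
    · exact map_zero _
    · exact G.res hV (.j _) _ _ _ _
    · exact G.res hV (.D _) _ _ _ _
  smul_j := G.smul_j
  smul_D := G.smul_D
  κ_j α h h' h₁ w a := by
    have := G.add_j 0 0 h w a
    rwa [add_zero, left_eq_add] at this
  κ_D α h h' h₁ h₂ w a := by
    have := G.add_D 0 0 h w a
    rwa [add_zero, left_eq_add] at this

end GenMap

/-- A DG module `pr_* ev^* E` is presented by the sections `j e` and `D (j e)`. -/
lemma OddPullback.presented {E : OMod X} {N : DGMod X}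
    {j : ∀ U : Opens X.pt, E.sec U →+ (N.sh (-1)).sec U} (H : OddPullback E N j) :
    Presented E (fun _ _ => 0) N j 0 where
  res_j := H.res_j
  j_smul := H.j_smul
  D_c h := map_zero _
  j_κ h α := by rw [map_zero, map_zero, N.act_zero]
  induction P hloc hadd hneg hgen m U t := by
    refine hloc m U t fun x => ?_
    obtain ⟨V, hV, s, hx, hs⟩ := H.surj t x
    refine ⟨V, hV, hx, ?_⟩
    rw [hs]
    clear hs
    have hof : ∀ g : EvGen E m V, P m V
        (N.act (add_zero m) g.1 (N.D (neg_add_cancel 1) (j V g.2.2)) +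
          N.act (add_neg_cancel_right m 1) g.2.1 (j V g.2.2)) := fun g =>
      hadd _ _ _ _ (hgen m m V (.D g.2.2) (add_zero m) g.1)
        (hgen (m + 1) m V (.j g.2.2) (add_neg_cancel_right m 1) g.2.1)
    induction s using FreeAbelianGroup.induction_on with
    | zero =>
      have := hgen m m V (.D 0) (add_zero m) 0
      have h0 : N.act (add_zero m) 0 (N.D (neg_add_cancel 1) (j V 0)) = 0 := N.zero_act _ _
      change P m V (N.act (add_zero m) 0 (N.D (neg_add_cancel 1) (j V 0))) at this
      rw [h0] at this
      rwa [map_zero]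
    | of g => rw [FreeAbelianGroup.lift_apply_of]; exact hof g
    | neg g _ => rw [map_neg, FreeAbelianGroup.lift_apply_of]; exact hneg _ _ _ (hof g)
    | add a b ha hb => rw [map_add]; exact hadd _ _ _ _ (ha) (hb)
  lift {m A F} G hc := by
    let π : ∀ U : Opens X.pt, FreeAbelianGroup (EvGen E m U) →+ (N.sh m).sec U := fun U =>
      FreeAbelianGroup.lift (fun g => N.act (add_zero m) g.1 (N.D (neg_add_cancel 1) (j U g.2.2)) +
        N.act (add_neg_cancel_right m 1) g.2.1 (j U g.2.2))
    have hπ : ∀ {U : Opens X.pt} (w : Form m U) (v : Form (m + 1) U) (e : E.sec U),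
        π U (.of (w, v, e)) = N.act (add_zero m) w (N.D (neg_add_cancel 1) (j U e)) +
          N.act (add_neg_cancel_right m 1) v (j U e) := fun w v e =>
      FreeAbelianGroup.lift_apply_of _ _
    have hq : IsSheafQuot (evPre E m) (N.sh m) π := by
      refine ⟨fun {U V} h p => ?_, fun y x => ?_⟩
      · refine FreeAbelianGroup.comp_eq ((N.sh m).res h) (π U) (π V) (evRes E m h) ?_ p
        rintro ⟨w, v, e⟩
        rw [evRes_of, hπ, hπ, map_add, N.res_act, N.res_act, N.res_D, H.res_j]
      · obtain ⟨V, h, s, hx, hs⟩ := H.surj y x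
        exact ⟨V, h, s, hx, hs⟩
    let φ : ∀ U : Opens X.pt, FreeAbelianGroup (EvGen E m U) →+ A.sec U →+ F.sec U := fun U =>
      FreeAbelianGroup.lift fun g => G.paramHom (.D g.2.2) (add_zero m) g.1 +
        G.paramHom (.j g.2.2) (add_neg_cancel_right m 1) g.2.1
    have hφ : ∀ {U : Opens X.pt} (w : Form m U) (v : Form (m + 1) U) (e : E.sec U) (a : A.sec U),
        φ U (.of (w, v, e)) a = G.toFun (.D e) (add_zero m) w a +
          G.toFun (.j e) (add_neg_cancel_right m 1) v a := fun w v e a =>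
      DFunLike.congr_fun (FreeAbelianGroup.lift_apply_of _ _) a
    have hφres : ∀ {U V : Opens X.pt} (h : V ≤ U) (p : FreeAbelianGroup (EvGen E m U))
        (a : A.sec U), F.res h (φ U p a) = φ V (evRes E m h p) (A.res h a) := by
      intro U V h p a
      refine FreeAbelianGroup.map_eq ((F.res h).comp ((AddMonoidHom.eval a).comp (φ U)))
        ((AddMonoidHom.eval (A.res h a)).comp ((φ V).comp (evRes E m h))) ?_ p
      rintro ⟨w, v, e⟩
      simp only [AddMonoidHom.comp_apply, AddMonoidHom.eval_apply_apply]
      rw [evRes_of, hφ, hφ, map_add, G.res h (.D e) _ (add_zero m),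
        G.res h (.j e) _ (add_neg_cancel_right m 1)]
      rfl
    obtain ⟨ψ, h1, h2⟩ := hq.descend₂ φ hφres (by
      intro U p a hp
      refine F.eq_zero_of_local fun x => ?_
      obtain ⟨V, hV, hx, hK⟩ := H.inj p hp x
      refine ⟨V, hV, hx, ?_⟩
      refine (hφres hV p a).trans ?_
      refine DFunLike.congr_fun (evK_le (φ V) ?_ ?_ ?_ (evRes E m hV p) hK) _
      · intro w w' v v' e
        ext a
        rw [AddMonoidHom.add_apply, hφ, hφ, hφ, G.add_form, G.add_form]; abel
      · intro w v e e'
        ext a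
        rw [AddMonoidHom.add_apply, hφ, hφ, hφ, G.add_j, G.add_D]; abel
      · intro w v r e
        ext a
        rw [hφ, hφ, G.smul_D r e (add_zero m) (add_neg_cancel_right m 1) rfl, G.smul_j,
          G.add_form]
        abel)
    refine ⟨ψ, h1, fun {k U} y h w a => ?_⟩
    cases y with
    | c =>
      rw [hc rfl k U h w a]
      have : N.act h w ((Gen.c : Gen E U).val j (0 : (N.sh (-2)).sec ⊤)) = 0 :=
        (congrArg (N.act h w) (map_zero _)).trans (N.act_zero h w)
      rw [this, map_zero]; rfl
    | j e =>
      obtain rfl : k = m + 1 := by have : k + -1 = m := h; omega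
      refine Eq.trans ?_ ((h2 (.of ((0, w, e) : EvGen E m U)) a).trans ?_)
      · refine congrArg (ψ U · a) (Eq.trans ?_ (hπ _ _ _).symm)
        rw [N.zero_act, zero_add]; rfl
      · exact (hφ _ _ _ _).trans (by rw [G.zero_form, zero_add])
    | D e =>
      obtain rfl : k = m := by have : k + 0 = m := h; omega
      refine Eq.trans ?_ ((h2 (.of ((w, 0, e) : EvGen E k U)) a).trans ?_)
      · refine congrArg (ψ U · a) (Eq.trans ?_ (hπ _ _ _).symm)
        rw [N.zero_act, add_zero]; rfl
      · exact (hφ _ _ _ _).trans (by rw [G.zero_form, add_zero])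

namespace Presented
variable {E : OMod X} {κ : ∀ U : Opens X.pt, Form 1 U → E.sec U} {N : DGMod X}
  {j : ∀ U : Opens X.pt, E.sec U →+ (N.sh (-1)).sec U} {c : (N.sh (-2)).sec ⊤}
  (H : Presented E κ N j c)

/-- The presheaf `ℤ`, a trivial parameter. -/
def unitPre (X : Mnfd.{u} 𝕜 𝕂) : AbPre X :=
  ⟨fun _ => ULift ℤ, fun _ => AddMonoidHom.id _, fun _ => rfl, fun _ _ _ => rfl⟩

include H in
lemma res_val {U V : Opens X.pt} (hV : V ≤ U) {k m : ℤ} (y : Gen E U) (h : k + y.deg = m)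
    (h' : k + (y.res hV).deg = m) (w : Form k U) :
    (N.sh m).res hV (N.act h w (y.val j c)) = N.act h' (Form.res hV w) ((y.res hV).val j c) := by
  rw [N.res_act]
  cases y with
  | c => exact congrArg (N.act h _) (AbSheaf.res_res _ _ _ _)
  | j e => exact congrArg (N.act h _) (H.res_j hV e)
  | D e => exact congrArg (N.act h _) ((N.res_D _ hV _).trans (congrArg _ (H.res_j hV e)))

include H in
/-- Morphisms of DG modules which agree on `c` and on the sections `j e` are equal. -/
lemma hom_ext {N' : DGMod X} {f g : DGMod.Hom N N'} (hc : f.map (-2) ⊤ c = g.map (-2) ⊤ c)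
    (hj : ∀ (U : Opens X.pt) (e : E.sec U), f.map (-1) U (j U e) = g.map (-1) U (j U e)) :
    f = g := by
  have : ∀ (m : ℤ) (U : Opens X.pt) (t : (N.sh m).sec U), f.map m U t = g.map m U t := by
    refine H.induction (fun m U t => f.map m U t = g.map m U t) ?_ ?_ ?_ ?_
    · intro m U t h
      refine (N'.sh m).eq_of_local fun x => ?_
      obtain ⟨V, hV, hx, h⟩ := h x
      exact ⟨V, hV, hx, by rw [f.res_map, g.res_map, h]⟩
    · intro m U t t' h h'
      rw [map_add, map_add, h, h']
    · intro m U t h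
      rw [map_neg, map_neg, h]
    · intro k m U y h w
      rw [f.map_act, g.map_act]
      congr 1
      cases y with
      | c => exact (f.res_map le_top c).symm.trans ((congrArg _ hc).trans (g.res_map le_top c))
      | j e => exact hj U e
      | D e => exact (f.map_D _ _).trans ((congrArg _ (hj U e)).trans (g.map_D _ _).symm)
  ext m U t
  exact this m U t

include H in
/-- The universal property: a compatible choice of the images of `c` and of the sections `j e`
defines a morphism of DG modules. -/
lemma exists_hom {N' : DGMod X} (j' : ∀ U : Opens X.pt, E.sec U →+ (N'.sh (-1)).sec U)
    (c' : (N'.sh (-2)).sec ⊤)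
    (res_j' : ∀ {U V : Opens X.pt} (h : V ≤ U) (e : E.sec U),
      (N'.sh (-1)).res h (j' U e) = j' V (E.res h e))
    (j'_smul : ∀ {U : Opens X.pt} (f : Fn U) (e : E.sec U),
      j' U (f • e) = N'.act (zero_add _) (Form.ofFn f) (j' U e))
    (D_c' : ∀ {i : ℤ} (h : -2 + 1 = i), N'.D h c' = 0)
    (j'_κ : ∀ {U : Opens X.pt} (h : 1 + -2 = (-1 : ℤ)) (α : Form 1 U),
      j' U (κ U α) = N'.act h α ((N'.sh (-2)).res le_top c'))
    (hc : c = 0 → c' = 0) :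
    ∃ f : DGMod.Hom N N', f.map (-2) ⊤ c = c' ∧
      ∀ (U : Opens X.pt) (e : E.sec U), f.map (-1) U (j U e) = j' U e := by
  have ofsm : ∀ {k m : ℤ} {U : Opens X.pt} (h : k + -1 = m) (f : Fn U) (e : E.sec U)
      (w : Form k U), N'.act h w (j' U (f • e)) = N'.act h (f • w) (j' U e) := by
    intro k m U h f e w
    rw [j'_smul, N'.act_ofFn]
  have Dκ : ∀ {U : Opens X.pt} (h : 2 + -2 = (0 : ℤ)) (h₂ : (1 : ℤ) + 1 = 2) (α : Form 1 U),
      N'.D (neg_add_cancel 1) (j' U (κ U α)) =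
        N'.act h (Form.d h₂ α) ((N'.sh (-2)).res le_top c') := by
    intro U h h₂ α
    rw [j'_κ ◇, N'.D_act' (l := 0) (i' := -1) _ _ h ◇ ◇ h₂, ← N'.res_D,
      D_c', map_zero, N'.act_zero, smul_zero, add_zero]
  let G : ∀ m : ℤ, GenMap E κ m (unitPre X) (N'.sh m) := fun m =>
    { toFun := fun y h w n => n.down • N'.act h w (y.val j' c')
      add_form := fun y h w w' n => by rw [N'.add_act, smul_add]
      add_param := fun y h w n n' => add_smul _ _ _
      add_j := fun e e' h w n => by
        change n.down • N'.act h w (j' _ (e + e')) = _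
        rw [map_add, N'.act_add, smul_add]; rfl
      add_D := fun e e' h w n => by
        change n.down • N'.act h w (N'.D _ (j' _ (e + e'))) = _
        rw [map_add, map_add, N'.act_add, smul_add]; rfl
      res := fun {k U V} hV y h h' w n => by
        rw [map_zsmul, N'.res_act]
        refine congrArg (fun t => n.down • t) ?_
        cases y with
        | c => exact congrArg (N'.act h _) (AbSheaf.res_res _ _ _ _)
        | j e => exact congrArg (N'.act h _) (res_j' hV e)
        | D e => exact congrArg (N'.act h _) ((N'.res_D _ hV _).trans (congrArg _ (res_j' hV e)))
      smul_j := fun f e h w n => congrArg (fun t => n.down • t) (ofsm h f e w)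
      smul_D := fun {k l U} f e h h' h₁ w n => by
        rw [← smul_add]
        refine congrArg (fun t => n.down • t) ?_
        change N'.act h w (N'.D _ (j' U (f • e))) = N'.act h (f • w) (N'.D _ (j' U e)) +
          N'.act h' _ (j' U e)
        rw [j'_smul, N'.D_act' (zero_add (-1)) (neg_add_cancel 1) (by omega : (1 : ℤ) + -1 = 0)
          (neg_add_cancel 1) (zero_add 0) (zero_add 1), sg_zero, one_smul, N'.act_add,
          N'.act_ofFn, Form.d_ofFn, ← N'.mul_act h₁ _ h h', add_comm]
      κ_j := fun {k l U} α h h' h₁ w n => by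
        refine congrArg (fun t => n.down • t) ?_
        change N'.act h w (j' U (κ U α)) = N'.act h' _ ((N'.sh (-2)).res le_top c')
        rw [j'_κ ◇, N'.mul_act h₁ ◇ h h']
      κ_D := fun {k l U} α h h' h₁ h₂ w n => by
        refine congrArg (fun t => n.down • t) ?_
        change N'.act h w (N'.D _ (j' U (κ U α))) = N'.act h' _ ((N'.sh (-2)).res le_top c')
        rw [Dκ ◇ h₂, N'.mul_act h₁ ◇ h h'] }
  have hG : ∀ m, c = 0 → ∀ (k : ℤ) (U : Opens X.pt) (h : k + -2 = m) (w : Form k U)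
      (a : (unitPre X).sec U), (G m).toFun .c h w a = 0 := by
    intro m h0 k U h w a
    change a.down • N'.act h w ((N'.sh (-2)).res le_top c') = 0
    rw [hc h0, map_zero, N'.act_zero, smul_zero]
  choose ψ hres hψ using fun m => H.lift (G m) (hG m)
  let one : ∀ U, (unitPre X).sec U := fun U => ⟨1⟩
  have hgen : ∀ {k m : ℤ} {U : Opens X.pt} (y : Gen E U) (h : k + y.deg = m) (w : Form k U),
      ψ m U (N.act h w (y.val j c)) (one U) = N'.act h w (y.val j' c') :=
    fun {k m U} y h w => (hψ m y h w _).trans (one_smul ℤ _)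
  have hloc : ∀ {m : ℤ} {U V : Opens X.pt} (h : V ≤ U) (t : (N.sh m).sec U),
      (N'.sh m).res h (ψ m U t (one U)) = ψ m V ((N.sh m).res h t) (one V) :=
    fun h t => hres _ h t _
  have hact : ∀ (m : ℤ) (U : Opens X.pt) (t : (N.sh m).sec U), ∀ {k l : ℤ} (h : k + m = l)
      (w : Form k U), ψ l U (N.act h w t) (one U) = N'.act h w (ψ m U t (one U)) := by
    refine H.induction (fun m U t => ∀ {k l : ℤ} (h : k + m = l)
      (w : Form k U), ψ l U (N.act h w t) (one U) = N'.act h w (ψ m U t (one U))) ?_ ?_ ?_ ?_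
    · intro m U t ht k l h w
      refine (N'.sh l).eq_of_local fun x => ?_
      obtain ⟨V, hV, hx, ht⟩ := ht x
      refine ⟨V, hV, hx, ?_⟩
      rw [hloc, N.res_act, ht, N'.res_act, hloc]
    · intro m U t t' ht ht' k l h w
      rw [N.act_add, map_add, map_add, AddMonoidHom.add_apply, AddMonoidHom.add_apply, ht, ht',
        N'.act_add]
    · intro m U t ht k l h w
      rw [N.act_neg, map_neg, map_neg, AddMonoidHom.neg_apply, AddMonoidHom.neg_apply, ht,
        N'.act_neg]
    · intro p m U y hp u k l h w
      have h' : k + p + y.deg = l := ◇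
      rw [← N.mul_act rfl hp h h', hgen, hgen, N'.mul_act rfl hp h h']
  have h1 : ∀ {m : ℤ} {U : Opens X.pt} (y : Gen E U) (h : y.deg = m),
      ψ m U (h ▸ y.val j c) (one U) = h ▸ y.val j' c' := by
    rintro m U y rfl
    have := hgen y (zero_add _) (Form.ofFn (1 : Fn U))
    rwa [N.one_act, N'.one_act] at this
  have hj : ∀ (U : Opens X.pt) (e : E.sec U), ψ (-1) U (j U e) (one U) = j' U e :=
    fun U e => h1 (.j e) rfl
  have hD : ∀ (m : ℤ) (U : Opens X.pt) (t : (N.sh m).sec U), ∀ {l : ℤ} (h : m + 1 = l),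
      ψ l U (N.D h t) (one U) = N'.D h (ψ m U t (one U)) := by
    refine H.induction (fun m U t => ∀ {l : ℤ} (h : m + 1 = l),
      ψ l U (N.D h t) (one U) = N'.D h (ψ m U t (one U))) ?_ ?_ ?_ ?_
    · intro m U t ht l h
      refine (N'.sh l).eq_of_local fun x => ?_
      obtain ⟨V, hV, hx, ht⟩ := ht x
      refine ⟨V, hV, hx, ?_⟩
      rw [hloc, N.res_D, ht, N'.res_D, hloc]
    · intro m U t t' ht ht' l h
      rw [map_add, map_add, map_add, AddMonoidHom.add_apply, AddMonoidHom.add_apply, ht, ht',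
        map_add]
    · intro m U t ht l h
      rw [map_neg, map_neg, map_neg, AddMonoidHom.neg_apply, AddMonoidHom.neg_apply, ht, map_neg]
    · intro p m U y hp u l h
      obtain ⟨e1, e2⟩ : p + 1 + y.deg = l ∧ p + (y.deg + 1) = l := ◇
      rw [hgen, N.D_act' hp h e1 rfl e2 rfl, N'.D_act' hp h e1 rfl e2 rfl, map_add, map_zsmul,
        AddMonoidHom.add_apply, AddMonoidHom.smul_apply, hgen, hact]
      congr 3
      cases y with
      | c =>
        have a1 : N.D rfl ((Gen.c : Gen E U).val j c) = 0 :=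
          (N.res_D _ _ _).symm.trans ((congrArg _ (H.D_c _)).trans (map_zero _))
        have a2 : N'.D rfl ((Gen.c : Gen E U).val j' c') = 0 :=
          (N'.res_D _ _ _).symm.trans ((congrArg _ (D_c' _)).trans (map_zero _))
        rw [a1, a2, map_zero]; rfl
      | j e => exact h1 (.D e) rfl
      | D e =>
        have a1 : N.D rfl ((Gen.D e : Gen E U).val j c) = 0 := N.D_D _ _ _
        have a2 : N'.D rfl ((Gen.D e : Gen E U).val j' c') = 0 := N'.D_D _ _ _
        rw [a1, a2, map_zero]; rfl
  refine ⟨⟨fun m U => (ψ m U).flip (one U), fun h t => hloc h t, fun h U w t => hact _ _ _ h w,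
    fun h U t => hD _ _ _ h⟩, ?_, fun U e => hj U e⟩
  have := h1 (.c : Gen E ⊤) rfl
  change ψ (-2) ⊤ ((N.sh (-2)).res le_top c) (one ⊤) = (N'.sh (-2)).res le_top c' at this
  rwa [AbSheaf.res_id, AbSheaf.res_id] at this

end Presented

/-! ### The cokernel of `(∫, -pr_* ev^* κ)` -/

/-- For a map `κ : Ω¹ → E`, the DG module `N` is the cokernel of
`(∫, -pr_* ev^* κ) : pr_* ev^* Ω¹ → 𝒪[2] ⊕ pr_* ev^* E`, the maps to `N` being `w ↦ w · c` and a map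
which sends `e ε` to `j e`. -/
structure CokerSquare (E : OMod X) (κ : ∀ U : Opens X.pt, Form 1 U →ₗ[Fn U] E.sec U) (N : DGMod X)
    (j : ∀ U : Opens X.pt, E.sec U →+ (N.sh (-1)).sec U) (c : (N.sh (-2)).sec ⊤) where
  evO : DGMod X
  jO : ∀ U : Opens X.pt, (Omega1 X).sec U →+ (evO.sh (-1)).sec U
  isEvO : OddPullback (Omega1 X) evO jO
  evE : DGMod X
  jE : ∀ U : Opens X.pt, E.sec U →+ (evE.sh (-1)).sec U
  isEvE : OddPullback E evE jE
  evκ : DGMod.Hom evO evE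
  evκ_j : ∀ {U : Opens X.pt} (w : Form 1 U), evκ.map (-1) U (jO U w) = jE U (κ U w)
  int : ∀ {i k : ℤ}, i + 2 = k → ∀ U : Opens X.pt, (evO.sh i).sec U →+ Form k U
  res_int : ∀ {i k : ℤ} (hk : i + 2 = k) {U V : Opens X.pt} (h : V ≤ U) (z : (evO.sh i).sec U),
    Form.res h (int hk U z) = int hk V ((evO.sh i).res h z)
  int_act : ∀ {i k l i' k' : ℤ} (hk : i + 2 = k) (hk' : i' + 2 = k') (h : l + i = i')
    (h' : l + k = k') {U : Opens X.pt} (w : Form l U) (z : (evO.sh i).sec U),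
    int hk' U (evO.act h w z) = Form.mul h' w (int hk U z)
  int_D : ∀ {i k i' k' : ℤ} (hk : i + 2 = k) (hk' : i' + 2 = k') (h : i + 1 = i')
    {U : Opens X.pt} (z : (evO.sh i).sec U), Form.IsD (int hk U z) (int hk' U (evO.D h z))
  int_j : ∀ (h : -1 + 2 = (1 : ℤ)) {U : Opens X.pt} (w : Form 1 U), int h U (jO U w) = w
  toN : DGMod.Hom evE N
  toN_j : ∀ {U : Opens X.pt} (e : E.sec U), toN.map (-1) U (jE U e) = j U e
  D_c : ∀ {i : ℤ} (h : -2 + 1 = i), N.D h c = 0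
  comm : ∀ {i k : ℤ} (h : i + 2 = k) (h' : k + -2 = i) {U : Opens X.pt} (z : (evO.sh i).sec U),
    toN.map i U (evκ.map i U z) = N.act h' (int h U z) ((N.sh (-2)).res le_top c)
  surj : ∀ {i k : ℤ} (hk : k + -2 = i) {U : Opens X.pt} (t : (N.sh i).sec U) (x : U),
    ∃ (V : Opens X.pt) (h : V ≤ U) (w : Form k V) (y : (evE.sh i).sec V), (x : X.pt) ∈ V ∧
      (N.sh i).res h t = N.act hk w ((N.sh (-2)).res le_top c) + toN.map i V y
  inj : ∀ {i k : ℤ} (hk : k + -2 = i) (hk' : i + 2 = k) {U : Opens X.pt} (w : Form k U)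
    (y : (evE.sh i).sec U), N.act hk w ((N.sh (-2)).res le_top c) + toN.map i U y = 0 →
    ∀ x : U, ∃ (V : Opens X.pt) (h : V ≤ U) (z : (evO.sh i).sec V), (x : X.pt) ∈ V ∧
      int hk' V z = Form.res h w ∧ -evκ.map i V z = (evE.sh i).res h y

namespace CokerSquare

/-- The cokernel of `(∫, -pr_* ev^* κ)` exists. -/
lemma exists_cokerSquare (E : OMod X) (κ : ∀ U : Opens X.pt, Form 1 U →ₗ[Fn U] E.sec U)
    (hκ : ∀ {U V : Opens X.pt} (h : V ≤ U) (w : Form 1 U),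
      E.res h (κ U w) = κ V (Form.res h w)) :
    ∃ N j c, Nonempty (CokerSquare E κ N j c) := by
  obtain ⟨evO, jO, isEvO⟩ := exists_oddPullback (Omega1 X)
  obtain ⟨evE, jE, isEvE⟩ := exists_oddPullback E
  obtain ⟨evκ, -, evκ_j⟩ := isEvO.presented.exists_hom (N' := evE)
    (fun U => (jE U).comp (κ U).toAddMonoidHom) 0
    (fun h w => (isEvE.res_j h _).trans (congrArg _ (hκ h w)))
    (fun f w => (congrArg (jE _) (map_smul (κ _) f w)).trans (isEvE.j_smul f _))
    (fun h => map_zero _)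
    (fun {U} h α => ((map_zero ((jE U).comp (κ U).toAddMonoidHom))).trans
      ((congrArg (evE.act h α) (map_zero _)).trans (evE.act_zero _ _)).symm) (fun _ => rfl)
  obtain ⟨I, -, I_j⟩ := isEvO.presented.exists_hom (N' := Form.shiftOn ⊤)
    (fun U => (Form.res inf_le_left : Form 1 U →+ Form 1 (U ⊓ ⊤))) 0
    (fun h w => rfl)
    (fun {U} f w => (Form.ofFn_mul' (zero_add _) (resFn inf_le_left f) (Form.res inf_le_left w)).symm)
    (fun h => map_zero _)
    (fun {U} h α => (map_zero (Form.res _)).trans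
      ((congrArg ((Form.shiftOn ⊤).act h α) (map_zero _)).trans (DGMod.act_zero _ _ _)).symm)
    (fun _ => rfl)
  let int : ∀ {i k : ℤ}, i + 2 = k → ∀ U : Opens X.pt, (evO.sh i).sec U →+ Form k U :=
    fun {i k} h U => (Form.cast h).comp ((Form.res (le_inf le_rfl le_top) :
      Form (i + 2) (U ⊓ ⊤) →+ Form (i + 2) U).comp (I.map i U))
  have res_int : ∀ {i k : ℤ} (hk : i + 2 = k) {U V : Opens X.pt} (h : V ≤ U)
      (z : (evO.sh i).sec U), Form.res h (int hk U z) = int hk V ((evO.sh i).res h z) := by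
    intro i k hk U V h z
    subst hk
    exact congrArg (Form.res (le_inf le_rfl le_top)) (I.res_map h z)
  have int_act : ∀ {i k l i' k' : ℤ} (hk : i + 2 = k) (hk' : i' + 2 = k') (h : l + i = i')
      (h' : l + k = k') {U : Opens X.pt} (w : Form l U) (z : (evO.sh i).sec U),
      int hk' U (evO.act h w z) = Form.mul h' w (int hk U z) := by
    intro i k l i' k' hk hk' h h' U w z
    subst hk hk'
    exact (congrArg (Form.res (le_inf le_rfl le_top)) (I.map_act h w z)).trans
      (Form.res_mul _ ◇ _ _)
  have int_D : ∀ {i k i' k' : ℤ} (hk : i + 2 = k) (hk' : i' + 2 = k') (h : i + 1 = i')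
      (h' : k + 1 = k')
      {U : Opens X.pt} (z : (evO.sh i).sec U), int hk' U (evO.D h z) = Form.d h' (int hk U z) := by
    intro i k i' k' hk hk' h h' U z
    subst hk hk'
    exact (congrArg (Form.res (le_inf le_rfl le_top)) (I.map_D h z)).trans
      (Form.res_d _ ◇ _)
  have int_j : ∀ (h : -1 + 2 = (1 : ℤ)) {U : Opens X.pt} (w : Form 1 U), int h U (jO U w) = w :=
    fun h U w => congrArg (Form.res (le_inf le_rfl le_top)) (I_j U w)
  let R : ∀ (i : ℤ) (U : Opens X.pt), (evO.sh i).sec U →+ Form (i + 2) U × (evE.sh i).sec U :=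
    fun i U => (int rfl U).prod (-evκ.map i U)
  have memeq : ∀ (i : ℤ) (U : Opens X.pt) (q r : Form (i + 2) U × (evE.sh i).sec U), q = r →
      q - r ∈ (R i U).range := fun i U q r h => by rw [h, sub_self]; exact zero_mem _
  have mem0 : ∀ (i : ℤ) (U : Opens X.pt) (q : Form (i + 2) U × (evE.sh i).sec U), q.1 = 0 →
      q.2 = 0 → q ∈ (R i U).range := fun i U q h h' => by
    rw [show q = 0 from Prod.ext h h']; exact zero_mem _
  let P : PreDG X :=
    { pre := fun i =>
        { sec := fun U => Form (i + 2) U × (evE.sh i).sec U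
          res := fun h => (Form.res h).prodMap ((evE.sh i).res h)
          res_id := fun s => Prod.ext rfl (AbSheaf.res_id _ _)
          res_res := fun h h' s => Prod.ext rfl (AbSheaf.res_res _ _ _ _) }
      K := fun i U => (R i U).range
      act := fun {k i j} h U w => AddMonoidHom.mk' (fun p =>
        (Form.mul (by rw [← h, add_assoc]) w p.1, evE.act h w p.2)) fun p q =>
          Prod.ext (Form.mul_add ◇ _ _ _) (evE.act_add _ _ _ _)
      D := fun {i j} h U => (Form.d (by rw [← h]; ring)).prodMap (evE.D h)
      res_K := by
        rintro i U V h _ ⟨z, rfl⟩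
        refine ⟨(evO.sh i).res h z, Prod.ext (res_int _ h z).symm ?_⟩
        exact (congrArg Neg.neg (evκ.res_map h z).symm).trans (map_neg _ _).symm
      act_K := by
        rintro k i j h U w _ ⟨z, rfl⟩
        refine ⟨evO.act h w z, Prod.ext (int_act rfl rfl h ◇ w z) ?_⟩
        exact (congrArg Neg.neg (evκ.map_act h w z)).trans (evE.act_neg _ _ _).symm
      D_K := by
        rintro i j h U _ ⟨z, rfl⟩
        refine ⟨evO.D h z, Prod.ext (int_D rfl rfl h ◇ z) ?_⟩
        exact (congrArg Neg.neg (evκ.map_D h z)).trans (map_neg _ _).symm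
      res_act := fun h U V hV w p => Prod.ext (Form.res_mul _ ◇ _ _) (evE.res_act _ _ _ _)
      res_D := fun h U V hV p => Prod.ext (Form.res_d _ ◇ _) (evE.res_D _ _ _)
      add_act := fun h U w w' p =>
        memeq _ _ _ _ (Prod.ext (Form.add_mul ◇ _ _ _) (evE.add_act _ _ _ _))
      one_act := fun h U p => memeq _ _ _ _ (Prod.ext (Form.ofFn_one_mul ◇ _) (evE.one_act _ _))
      mul_act := fun h h₁ h₂ h₃ U w w' p => memeq _ _ _ _
        (Prod.ext (Form.mul_assoc h ◇ ◇ ◇ _ _ _) (evE.mul_act h h₁ h₂ h₃ _ _ _))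
      D_D := fun h h' U p => mem0 _ _ _ (Form.d_d ◇ ◇ _) (evE.D_D _ _ _)
      D_act := fun h h₁ h₂ h₃ h₄ hk U w p => memeq _ _ _ _
        (Prod.ext (Form.d_mul ◇ ◇ hk ◇ ◇ ◇ _ _)
          (evE.D_act' _ _ _ _ _ _ _ _)) }
  obtain ⟨N, π, H⟩ := P.exists_isQuot
  let c : (N.sh (-2)).sec ⊤ := π (-2) ⊤ ((Form.ofFn 1 : Form 0 ⊤), 0)
  have hc : ∀ {i k : ℤ} (h : k + -2 = i) (h' : k = i + 2) {U : Opens X.pt} (w : Form k U),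
      N.act h w ((N.sh (-2)).res le_top c) = π i U (Form.cast h' w, 0) := by
    intro i k h h' U w
    refine (congrArg (N.act h w) ((H.quot (-2)).res le_top _)).trans ((H.act h w _).symm.trans ?_)
    refine congrArg (π i U) (Prod.ext ?_ ?_)
    · subst h'
      exact Form.mul_ofFn_one ◇ _
    · exact (congrArg (evE.act h w) (map_zero ((evE.sh (-2)).res le_top))).trans (evE.act_zero _ _)
  let toN : DGMod.Hom evE N :=
    { map := fun i U => (π i U).comp (AddMonoidHom.inr _ _)
      res_map := fun {i U V} h y => ((H.quot i).res h _).trans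
        (congrArg (π i V) (Prod.ext (map_zero (Form.res h)) rfl))
      map_act := fun {k i j} h U w y => by
        refine Eq.trans (congrArg (π j U) (Prod.ext ?_ ?_))
          (H.act h w ((0, y) : Form _ U × (evE.sh i).sec U))
        · exact (Form.mul_zero ◇ w).symm
        · rfl
      map_D := fun {i j} h U y => by
        refine Eq.trans (congrArg (π j U) (Prod.ext ?_ ?_))
          (H.D h ((0, y) : Form _ U × (evE.sh i).sec U))
        · exact (map_zero (Form.d ◇)).symm
        · rfl }
  have split : ∀ {i : ℤ} {U : Opens X.pt} (w : Form (i + 2) U) (y : (evE.sh i).sec U),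
      π i U (w, y) = π i U (w, 0) + π i U (0, y) := fun {i U} w y =>
    (congrArg (π i U) (Prod.ext (add_zero w).symm (zero_add y).symm)).trans
      (map_add (π i U) (w, 0) (0, y))
  refine ⟨N, fun U => (toN.map (-1) U).comp (jE U), c, ⟨{
    evO := evO, jO := jO, isEvO := isEvO, evE := evE, jE := jE, isEvE := isEvE, evκ := evκ
    evκ_j := fun w => evκ_j _ w
    int := int, res_int := res_int, int_act := int_act
    int_D := fun {i k i' k'} hk hk' h U z => by
      rw [int_D hk hk' h ◇]; exact Form.isD_d _ _
    int_j := int_j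
    toN := toN, toN_j := fun e => rfl
    D_c := fun {i} h => ?_, comm := fun {i k} h h' U z => ?_, surj := fun {i k} hk U t x => ?_
    inj := fun {i k} hk hk' U w y h0 x => ?_ }⟩⟩
  · refine (H.D h _).symm.trans ((congrArg (π i ⊤) (Prod.ext ?_ (map_zero (evE.D h)))).trans (map_zero (π i ⊤)))
    subst h
    exact (Form.d_ofFn rfl 1).trans Form.dFn_one
  · subst h
    rw [hc h' rfl]
    have := H.zero _ (⟨z, rfl⟩ : R i U z ∈ (R i U).range)
    have h1 : R i U z = (int rfl U z, -evκ.map i U z) := rfl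
    rw [h1, split] at this
    have h2 : π i U (0, -evκ.map i U z) = -π i U (0, evκ.map i U z) :=
      Eq.trans (congrArg (π i U) (show ((0 : Form (i + 2) U), -evκ.map i U z) =
        -((0 : Form (i + 2) U), evκ.map i U z) from Prod.ext neg_zero.symm rfl)) (map_neg (π i U) _)
    rw [h2, add_neg_eq_zero] at this
    exact this.symm
  · obtain ⟨V, h, p, hx, hp⟩ := (H.quot i).surj t x
    obtain rfl : k = i + 2 := ◇
    refine ⟨V, h, p.1, p.2, hx, ?_⟩
    rw [hc hk rfl]
    exact hp.trans (split p.1 p.2)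
  · subst hk'
    rw [hc hk rfl] at h0
    obtain ⟨V, h, hx, z, hz⟩ := H.ker _ ((split w y).trans h0) x
    exact ⟨V, h, z, hx, congrArg Prod.fst hz, congrArg Prod.snd hz⟩

variable {E : OMod X} {κ : ∀ U : Opens X.pt, Form 1 U →ₗ[Fn U] E.sec U} {N : DGMod X}
  {j : ∀ U : Opens X.pt, E.sec U →+ (N.sh (-1)).sec U} {c : (N.sh (-2)).sec ⊤}
  (S : CokerSquare E κ N j c)

/-- A map out of `evE` and the map given by the value on `c` agree on `pr_* ev^* Ω¹`, so that they
descend to the cokernel. -/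
lemma genMap_int {m : ℤ} {A : AbPre X} {F : AbSheaf X} (G : GenMap E (fun U => κ U) m A F)
    (ψ : ∀ U, (S.evE.sh m).sec U →+ A.sec U →+ F.sec U)
    (hres : ∀ {U V : Opens X.pt} (h : V ≤ U) (t : (S.evE.sh m).sec U) (a : A.sec U),
        F.res h (ψ U t a) = ψ V ((S.evE.sh m).res h t) (A.res h a))
    (hψ : ∀ {k : ℤ} {U : Opens X.pt} (y : Gen E U) (h : k + y.deg = m) (w : Form k U) (a : A.sec U),
        ψ U (S.evE.act h w (y.val S.jE 0)) a = G.dropC.toFun y h w a)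
    {k : ℤ} (hk : m + 2 = k) (hk' : k + -2 = m) {U : Opens X.pt} (z : (S.evO.sh m).sec U)
    (a : A.sec U) : G.toFun .c hk' (S.int hk U z) a = ψ U (S.evκ.map m U z) a := by
  revert a
  have := S.isEvO.presented.induction (fun m' U z => ∀ (hm : m' = m) (a : A.sec U),
    G.toFun .c hk' (S.int ◇ U z) a = ψ U (S.evκ.map m U (hm ▸ z)) a) ?_ ?_ ?_ ?_ m U z rfl
  · exact this
  · rintro m' U t ht rfl a
    refine F.eq_of_local fun x => ?_
    obtain ⟨V, hV, hx, h⟩ := ht x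
    refine ⟨V, hV, hx, ?_⟩
    rw [hres, S.evκ.res_map, ← h rfl, ← S.res_int]
    exact G.res hV .c _ _ _ _
  · rintro m' U t t' ht ht' rfl a
    have e1 := ht rfl a
    have e2 := ht' rfl a
    simp only [map_add, AddMonoidHom.add_apply, G.add_form] at e1 e2 ⊢
    rw [e1, e2]
  · rintro m' U t ht rfl a
    have e1 := ht rfl a
    have : G.toFun .c hk' (-S.int hk U t) a = -G.toFun .c hk' (S.int hk U t) a := by
      rw [eq_neg_iff_add_eq_zero, ← G.add_form, neg_add_cancel, G.zero_form]
    simp only [map_neg, AddMonoidHom.neg_apply, this] at e1 ⊢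
    rw [e1]
  · rintro l m' U y hl w rfl a
    cases y with
    | c =>
      have : S.evO.act hl w ((Gen.c : Gen (Omega1 X) U).val S.jO (0 : (S.evO.sh (-2)).sec ⊤)) = 0 :=
        (congrArg (S.evO.act hl w) (map_zero _)).trans (S.evO.act_zero _ _)
      rw [this, map_zero, G.zero_form]
      simp only [map_zero, AddMonoidHom.zero_apply]
    | j α =>
      have hα : S.int (i := -1) (k := 1) rfl U (S.jO U α) = α := S.int_j rfl α
      have hβ : S.evκ.map (-1) U (S.jO U α) = S.jE U (κ U α) := S.evκ_j α
      change G.toFun .c hk' (S.int hk U (S.evO.act hl w (S.jO U α))) a =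
        ψ U (S.evκ.map _ U (S.evO.act hl w (S.jO U α))) a
      rw [S.int_act (i := -1) (k := 1) rfl hk hl (by have : l + -1 = m' := hl; omega), hα, S.evκ.map_act (i := -1), hβ]
      refine Eq.trans ?_ (hψ (.j (κ U α)) hl w a).symm
      exact (G.κ_j α _ _ _ _ _).symm
    | D α =>
      have hα : S.int (i := -1) (k := 1) rfl U (S.jO U α) = α := S.int_j rfl α
      have hβ : S.evκ.map (-1) U (S.jO U α) = S.jE U (κ U α) := S.evκ_j α
      change G.toFun .c hk' (S.int hk U (S.evO.act hl w (S.evO.D (neg_add_cancel 1) (S.jO U α)))) a =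
        ψ U (S.evκ.map _ U (S.evO.act hl w (S.evO.D (neg_add_cancel 1) (S.jO U α)))) a
      rw [S.int_act (i := 0) (k := 2) rfl hk hl (by have : l + 0 = m' := hl; omega),
        (S.int_D (i := -1) (k := 1) (k' := 2) rfl rfl _ (S.jO U α)).eq rfl, hα, S.evκ.map_act (i := 0),
        S.evκ.map_D, hβ]
      refine Eq.trans ?_ (hψ (.D (κ U α)) hl w a).symm
      exact (G.κ_D α _ _ _ _ _ _).symm

include S in
/-- The cokernel is presented by generators and relations. -/
lemma presented : Presented E (fun U => κ U) N j c where
  res_j h e := by rw [← S.toN_j, S.toN.res_map, S.isEvE.res_j, S.toN_j]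
  j_smul f e := by rw [← S.toN_j, S.isEvE.j_smul, S.toN.map_act, S.toN_j]
  D_c h := S.D_c h
  j_κ h α := by rw [← S.toN_j, ← S.evκ_j, S.comm ◇ h, S.int_j]
  induction P hloc hadd hneg hgen m U t := by
    have key := S.isEvE.presented.induction (fun m U y => P m U (S.toN.map m U y)) ?_ ?_ ?_ ?_
    · refine hloc m U t fun x => ?_
      obtain ⟨V, hV, w, y, hx, ht⟩ := S.surj (k := m + 2) ◇ t x
      refine ⟨V, hV, hx, ?_⟩
      rw [ht]
      exact hadd _ _ _ _ (hgen _ _ _ .c _ _) (key _ _ _)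
    · intro m U t ht
      refine hloc _ _ _ fun x => ?_
      obtain ⟨V, hV, hx, h⟩ := ht x
      exact ⟨V, hV, hx, by rwa [S.toN.res_map]⟩
    · intro m U t t' h h'; rw [map_add]; exact hadd _ _ _ _ h h'
    · intro m U t h; rw [map_neg]; exact hneg _ _ _ h
    · intro k m U y h w
      rw [S.toN.map_act]
      cases y with
      | c =>
        have h0 : N.act h w (S.toN.map _ U ((Gen.c : Gen E U).val S.jE 0)) = 0 :=
          (congrArg (N.act h w) ((congrArg _ (map_zero _)).trans (map_zero _))).trans
            (N.act_zero _ _)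
        rw [h0]
        have := hgen k m U .c h 0
        rwa [N.zero_act] at this
      | j e =>
        have := hgen k m U (.j e) h w
        exact (congrArg (fun t => P m U (N.act h w t)) (S.toN_j e)).mpr this
      | D e =>
        have := hgen k m U (.D e) h w
        exact (congrArg (fun t => P m U (N.act h w t)) ((S.toN.map_D _ _).trans
          (congrArg _ (S.toN_j e)))).mpr this
  lift {m A F} G hc := by
    have hk : (m + 2) + -2 = m := ◇
    obtain ⟨ψ, hres, hψ⟩ := S.isEvE.presented.lift G.dropC (fun _ _ _ _ _ _ => rfl)
    have hint : ∀ {U : Opens X.pt} (z : (S.evO.sh m).sec U) (a : A.sec U),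
        G.toFun .c hk (S.int rfl U z) a = ψ U (S.evκ.map m U z) a :=
      fun z a => S.genMap_int G ψ hres hψ rfl hk z a
    let P : AbPre X :=
      { sec := fun U => Form (m + 2) U × (S.evE.sh m).sec U
        res := fun h => (Form.res h).prodMap ((S.evE.sh m).res h)
        res_id := fun s => Prod.ext rfl (AbSheaf.res_id _ _)
        res_res := fun h h' s => Prod.ext rfl (AbSheaf.res_res _ _ _ _) }
    let π : ∀ U, P.sec U →+ (N.sh m).sec U := fun U => AddMonoidHom.mk'
      (fun p => N.act hk p.1 ((N.sh (-2)).res le_top c) + S.toN.map m U p.2) fun p q => by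
        change N.act hk (p.1 + q.1) _ + S.toN.map m U (p.2 + q.2) = _
        rw [N.add_act, map_add, add_add_add_comm]
    let φ : ∀ U, P.sec U →+ A.sec U →+ F.sec U := fun U => AddMonoidHom.mk'
      (fun p => G.paramHom .c hk p.1 + ψ U p.2) fun p q => by
        ext a
        change G.toFun .c hk (p.1 + q.1) a + ψ U (p.2 + q.2) a =
          (G.toFun .c hk p.1 a + ψ U p.2 a) + (G.toFun .c hk q.1 a + ψ U q.2 a)
        rw [G.add_form, map_add, AddMonoidHom.add_apply, add_add_add_comm]
    have hφ : ∀ {U V : Opens X.pt} (h : V ≤ U) (p : P.sec U) (a : A.sec U),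
        F.res h (φ U p a) = φ V (P.res h p) (A.res h a) := by
      intro U V h p a
      exact (map_add _ _ _).trans (congrArg₂ (· + ·) (G.res h .c hk hk _ _) (hres h _ _))
    have hq : IsSheafQuot P (N.sh m) π := by
      refine ⟨fun {U V} h p => ?_, fun t x => ?_⟩
      · change (N.sh m).res h (N.act hk p.1 ((N.sh (-2)).res le_top c) + S.toN.map m U p.2) =
          N.act hk (Form.res h p.1) ((N.sh (-2)).res le_top c) +
            S.toN.map m V ((S.evE.sh m).res h p.2)
        rw [map_add, N.res_act, AbSheaf.res_res, S.toN.res_map]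
      · obtain ⟨V, h, w, y, hx, hp⟩ := S.surj hk t x
        exact ⟨V, h, (w, y), hx, hp⟩
    obtain ⟨Ψ, h1, h2⟩ := hq.descend₂ φ hφ (by
      intro U p a hp
      refine F.eq_zero_of_local fun x => ?_
      obtain ⟨V, hV, z, hx, hz, hz'⟩ := S.inj hk rfl p.1 p.2 hp x
      refine ⟨V, hV, hx, (hφ hV p a).trans ?_⟩
      change G.toFun .c hk (Form.res hV p.1) (A.res hV a) +
        ψ V ((S.evE.sh m).res hV p.2) (A.res hV a) = 0
      rw [← hz, ← hz', hint, map_neg, AddMonoidHom.neg_apply, add_neg_cancel])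
    refine ⟨Ψ, h1, fun {k U} y h w a => ?_⟩
    cases y with
    | c =>
      obtain rfl : k = m + 2 := by have : k + -2 = m := h; omega
      refine Eq.trans ?_ ((h2 ((w, 0) : Form (m + 2) U × (S.evE.sh m).sec U) a).trans ?_)
      · refine congrArg (Ψ U · a) (Eq.symm ?_)
        exact (congrArg (_ + ·) (map_zero _)).trans (add_zero _)
      · exact (congrArg (_ + ·) (by rw [map_zero]; rfl)).trans (add_zero _)
    | j e =>
      refine Eq.trans ?_ ((h2 ((0, S.evE.act h w (S.jE U e)) :
        Form (m + 2) U × (S.evE.sh m).sec U) a).trans ?_)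
      · refine congrArg (Ψ U · a) (Eq.symm ?_)
        refine (congrArg₂ (· + ·) (N.zero_act _ _) ((S.toN.map_act _ _ _).trans
          (congrArg _ (S.toN_j e)))).trans (zero_add _)
      · exact (congrArg₂ (· + ·) (G.zero_form _ _ _) (hψ (.j e) h w a)).trans (zero_add _)
    | D e =>
      refine Eq.trans ?_ ((h2 ((0, S.evE.act h w (S.evE.D (neg_add_cancel 1) (S.jE U e))) :
        Form (m + 2) U × (S.evE.sh m).sec U) a).trans ?_)
      · refine congrArg (Ψ U · a) (Eq.symm ?_)
        refine (congrArg₂ (· + ·) (N.zero_act _ _) ((S.toN.map_act _ _ _).trans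
          (congrArg _ ((S.toN.map_D _ _).trans (congrArg _ (S.toN_j e)))))).trans (zero_add _)
      · exact (congrArg₂ (· + ·) (G.zero_form _ _ _) (hψ (.D e) h w a)).trans (zero_add _)

end CokerSquare

/-- The cokernel square of a transgression, without the extension. -/
def TransgressionSquare.cokerSquare {A : LieAlgebroid X} {B : DGLie X} {Q : CExt A} {T : OExt2 B}
    {j : ∀ U : Opens X.pt, Q.sec U →+ (T.alg.sh (-1)).sec U} (S : TransgressionSquare Q T j) :
    CokerSquare Q.toOMod (fun _ => Q.coanchor) T.alg.toDGMod j T.c where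
  __ := S
  evE := S.evQ
  jE := S.jQ
  isEvE := S.isEvQ
  evκ := S.evπ
  evκ_j := S.evπ_j
  toN := S.toT
  toN_j := S.toT_j
  D_c := T.D_c

/-- Conversely, the cokernel square of an extension. -/
def CokerSquare.transgressionSquare {A : LieAlgebroid X} {B : DGLie X} {Q : CExt A} {T : OExt2 B}
    {j : ∀ U : Opens X.pt, Q.sec U →+ (T.alg.sh (-1)).sec U}
    (S : CokerSquare Q.toOMod (fun _ => Q.coanchor) T.alg.toDGMod j T.c) :
    TransgressionSquare Q T j where
  __ := S
  evQ := S.evE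
  jQ := S.jE
  isEvQ := S.isEvE
  evπ := S.evκ
  evπ_j := S.evκ_j
  toT := S.toN
  toT_j := S.toN_j

/-! ### Cartan calculus on a presented DG module -/

variable (X) in
/-- The structure of a Courant algebroid, without the relation between the pairing and the
co-anchor. Lie algebroids are the case in which the pairing and the co-anchor vanish. -/
structure PreCourant extends OMod X where
  br : ∀ {U : Opens X.pt}, sec U → sec U → sec U
  anchor : ∀ {U : Opens X.pt}, sec U → VField U
  pair : ∀ {U : Opens X.pt}, sec U → sec U → Fn U
  coanchor : ∀ U : Opens X.pt, Form 1 U →ₗ[Fn U] sec U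
  add_br : ∀ {U : Opens X.pt} (a b c : sec U), br (a + b) c = br a c + br b c
  br_add : ∀ {U : Opens X.pt} (a b c : sec U), br a (b + c) = br a b + br a c
  res_br : ∀ {U V : Opens X.pt} (h : V ≤ U) (a b : sec U), res h (br a b) = br (res h a) (res h b)
  leibnizIdentity : ∀ {U : Opens X.pt} (a b c : sec U),
    br a (br b c) = br (br a b) c + br b (br a c)
  anchor_add : ∀ {U : Opens X.pt} (a b : sec U) (x : U),
    (anchor (a + b)).toFun x = (anchor a).toFun x + (anchor b).toFun x
  anchor_smul : ∀ {U : Opens X.pt} (f : Fn U) (a : sec U) (x : U),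
    (anchor (f • a)).toFun x = f.1 x • (anchor a).toFun x
  anchor_res : ∀ {U V : Opens X.pt} (h : V ≤ U) (a : sec U) (x : V),
    (anchor (res h a)).toFun x = (anchor a).toFun ⟨x, h x.2⟩
  anchor_br : ∀ {U : Opens X.pt} (a b : sec U) (f : Fn U), (anchor (br a b)).apply f =
    (anchor a).apply ((anchor b).apply f) - (anchor b).apply ((anchor a).apply f)
  pair_symm : ∀ {U : Opens X.pt} (a b : sec U), pair a b = pair b a
  pair_add : ∀ {U : Opens X.pt} (a b c : sec U), pair a (b + c) = pair a b + pair a c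
  pair_smul : ∀ {U : Opens X.pt} (f : Fn U) (a b : sec U), pair a (f • b) = f * pair a b
  res_pair : ∀ {U V : Opens X.pt} (h : V ≤ U) (a b : sec U),
    resFn h (pair a b) = pair (res h a) (res h b)
  res_coanchor : ∀ {U V : Opens X.pt} (h : V ≤ U) (w : Form 1 U),
    res h (coanchor U w) = coanchor V (Form.res h w)
  anchor_coanchor : ∀ {U : Opens X.pt} (w : Form 1 U) (x : U),
    (anchor (coanchor U w)).toFun x = 0
  leibniz : ∀ {U : Opens X.pt} (a b : sec U) (f : Fn U),
    br a (f • b) = f • br a b + (anchor a).apply f • b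
  pair_br : ∀ {U : Opens X.pt} (a b c : sec U),
    pair (br a b) c + pair b (br a c) = (anchor a).apply (pair b c)
  br_coanchor : ∀ {U : Opens X.pt} (a : sec U) (w : Form 1 U),
    br a (coanchor U w) = coanchor U ((anchor a).lie w)
  br_symm : ∀ {U : Opens X.pt} (a b : sec U),
    br a b + br b a = coanchor U (Form.dFn (pair a b))

/-- A Courant algebroid as a `PreCourant` structure. -/
def CourantAlgebroid.toPreCourant (Q : CourantAlgebroid X) : PreCourant X where
  __ := Q
  coanchor _ := Q.coanchor
  br_coanchor a w := Q.br_coanchor a w _ ((VField.lieDer_iff _ _ _).2 rfl)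

/-- A Lie algebroid as a `PreCourant` structure with zero pairing and co-anchor. -/
def LieAlgebroid.toPreCourant (A : LieAlgebroid X) : PreCourant X where
  __ := A
  pair _ _ := 0
  coanchor _ := 0
  leibnizIdentity := A.jacobi
  pair_symm _ _ := rfl
  pair_add _ _ _ := (add_zero 0).symm
  pair_smul _ _ _ := (mul_zero _).symm
  res_pair _ _ _ := rfl
  res_coanchor h w := map_zero _
  anchor_coanchor {U} w x := by
    have := A.anchor_add (0 : A.sec U) 0 x
    rw [add_zero] at this
    exact left_eq_add.1 this
  leibniz a b f := (A.leibniz a b f).trans (add_comm _ _)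
  pair_br a b c := by
    rw [add_zero]
    refine (Form.ofFn_injective ?_).symm
    rw [← VField.contr_dFn _ ◇, Form.ofFn_zero, ← Form.d_ofFn ◇, Form.ofFn_zero,
      map_zero, map_zero]
  br_coanchor {U} a w := by
    have := A.br_add a 0 0
    rw [add_zero] at this
    exact left_eq_add.1 this
  br_symm a b := by
    have h1 := A.br_self (a + b)
    rw [A.add_br, A.br_add, A.br_add, A.br_self, A.br_self, zero_add, add_zero] at h1
    exact h1

namespace PreCourant
variable (E : PreCourant X) {U V : Opens X.pt} {k l m : ℤ}

lemma anchor_res' (h : V ≤ U) (a : E.sec U) : E.anchor (E.res h a) = (E.anchor a).res h :=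
  VField.ext fun x => E.anchor_res h a x

lemma contr_add (h : -1 + k = l) (a b : E.sec U) (w : Form k U) :
    (E.anchor (a + b)).contr h w = (E.anchor a).contr h w + (E.anchor b).contr h w := by
  ext x
  rw [VField.contr_val, E.anchor_add]
  exact LinearMap.congr_fun (map_add CliffordAlgebra.contractLeft _ _) _

lemma contr_smul (h : -1 + k = l) (f : Fn U) (a : E.sec U) (w : Form k U) :
    (E.anchor (f • a)).contr h w = f • (E.anchor a).contr h w := by
  ext x
  rw [VField.contr_val, E.anchor_smul]
  exact LinearMap.congr_fun (map_smul CliffordAlgebra.contractLeft _ _) _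

lemma contr_coanchor (h : -1 + k = l) (α : Form 1 U) (w : Form k U) :
    (E.anchor (E.coanchor U α)).contr h w = 0 := by
  ext x
  rw [VField.contr_val, E.anchor_coanchor]
  exact LinearMap.congr_fun (map_zero CliffordAlgebra.contractLeft) _

lemma lie_add (a b : E.sec U) (w : Form k U) :
    (E.anchor (a + b)).lie w = (E.anchor a).lie w + (E.anchor b).lie w := by
  obtain ⟨h, h'⟩ : -1 + k + 1 = k ∧ -1 + (k + 1) = k := ◇
  rw [VField.lie_eq _ rfl h rfl h', VField.lie_eq _ rfl h rfl h', VField.lie_eq _ rfl h rfl h',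
    E.contr_add, E.contr_add, map_add]
  abel

lemma lie_smul (h : -1 + k = l) (h' : 1 + l = k) (f : Fn U) (a : E.sec U) (w : Form k U) :
    (E.anchor (f • a)).lie w = f • (E.anchor a).lie w +
      Form.mul h' (Form.dFn f) ((E.anchor a).contr h w) := by
  obtain ⟨h₁, h₂⟩ : l + 1 = k ∧ -1 + (k + 1) = k := ◇
  rw [VField.lie_eq _ h h₁ rfl h₂, VField.lie_eq _ h h₁ rfl h₂, E.contr_smul, E.contr_smul,
    Form.d_smul _ h', smul_add]
  abel

lemma lie_coanchor (α : Form 1 U) (w : Form k U) : (E.anchor (E.coanchor U α)).lie w = 0 := by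
  obtain ⟨h, h'⟩ : -1 + k + 1 = k ∧ -1 + (k + 1) = k := ◇
  rw [VField.lie_eq _ rfl h rfl h', E.contr_coanchor, E.contr_coanchor, map_zero, add_zero]

lemma apply_coanchor (α : Form 1 U) (f : Fn U) :
    (E.anchor (E.coanchor U α)).apply f = 0 := by
  refine Form.ofFn_injective ?_
  rw [← VField.lie_ofFn, E.lie_coanchor, Form.ofFn_zero]

lemma apply_br_res (a b : E.sec U) (V : Opens X.pt) (h : V ≤ U) (f : Fn V) :
    ((E.anchor (E.br a b)).res h).apply f =
      ((E.anchor a).res h).apply (((E.anchor b).res h).apply f) -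
        ((E.anchor b).res h).apply (((E.anchor a).res h).apply f) := by
  rw [← E.anchor_res', E.res_br, E.anchor_br, E.anchor_res', E.anchor_res']

lemma lie_contr (h : -1 + k = l) (a b : E.sec U) (w : Form k U) :
    (E.anchor (E.br a b)).contr h w = (E.anchor a).lie ((E.anchor b).contr h w) -
      (E.anchor b).contr h ((E.anchor a).lie w) := by
  rw [VField.lie_contr (E.apply_br_res a b)]
  abel

lemma lie_lie (a b : E.sec U) (w : Form k U) :
    (E.anchor (E.br a b)).lie w = (E.anchor a).lie ((E.anchor b).lie w) -
      (E.anchor b).lie ((E.anchor a).lie w) := by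
  rw [VField.lie_lie (E.apply_br_res a b)]
  abel

lemma pair_add_left (a b c : E.sec U) : E.pair (a + b) c = E.pair a c + E.pair b c := by
  rw [E.pair_symm, E.pair_add, E.pair_symm c a, E.pair_symm c b]

lemma pair_smul_left (f : Fn U) (a b : E.sec U) : E.pair (f • a) b = f * E.pair a b := by
  rw [E.pair_symm, E.pair_smul, E.pair_symm]

lemma smul_br (f : Fn U) (a b : E.sec U) : E.br (f • a) b =
    f • E.br a b - (E.anchor b).apply f • a + E.coanchor U (E.pair b a • Form.dFn f) := by
  have h1 := E.br_symm (f • a) b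
  have h2 := E.br_symm a b
  rw [E.leibniz, E.pair_smul_left, Form.dFn_mul, map_add, map_smul, ← h2, E.pair_symm a b] at h1
  rw [eq_sub_of_add_eq h1, smul_add]
  abel

lemma coanchor_br (h : (1 : ℤ) + 1 = 2) (h' : -1 + 2 = (1 : ℤ)) (α : Form 1 U) (b : E.sec U)
    (hα : E.coanchor U (Form.dFn (E.pair b (E.coanchor U α))) =
      E.coanchor U (Form.d (zero_add 1) ((E.anchor b).contr (neg_add_cancel 1) α))) :
    E.br (E.coanchor U α) b = -E.coanchor U ((E.anchor b).contr h' (Form.d h α)) := by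
  have h1 := E.br_symm (E.coanchor U α) b
  rw [E.br_coanchor, E.pair_symm, hα,
    VField.lie_eq _ (neg_add_cancel 1) (zero_add 1) h h', map_add] at h1
  rw [eq_sub_of_add_eq h1]
  abel

end PreCourant

/-- The DG module `N` is generated by `c`, `j e` and `D (j e)`, for `e` in `E`, with the relations
`j (κ α) = α · c` and those between the sections `j e`, where `κ` is the co-anchor of `E`; further,
the pairing of `e` with `κ α` is `ι_e α`, at least after multiplication with `c`. -/
structure IsCartan (E : PreCourant X) (N : DGMod X)
    (j : ∀ U : Opens X.pt, E.sec U →+ (N.sh (-1)).sec U) (c : (N.sh (-2)).sec ⊤) : Prop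
    extends Presented E.toOMod (fun U => E.coanchor U) N j c where
  pair_κ : ∀ {k i : ℤ} (hk : k + -2 = i) {U : Opens X.pt} (w : Form k U) (e : E.sec U)
    (α : Form 1 U), N.act hk (E.pair e (E.coanchor U α) • w) ((N.sh (-2)).res le_top c) =
      N.act hk (Form.mul (add_zero k) w ((E.anchor e).contr (neg_add_cancel 1) α))
        ((N.sh (-2)).res le_top c)

section
variable {E : PreCourant X} {U V : Opens X.pt} {k l m p : ℤ}

/-- The derivation of the de Rham complex given by a generator: `0`, `ι_e` or `L_e`. -/
def Gen.der (y : Gen E.toOMod U) (h : y.deg + k = l) : Form k U →+ Form l U :=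
  match y with
  | c => 0
  | j e => (E.anchor e).contr h
  | D e => (Form.cast (by have : 0 + k = l := h; omega)).comp (E.anchor e).lie

lemma Gen.der_D (e : E.sec U) (h : (Gen.D e : Gen E.toOMod U).deg + k = k) (w : Form k U) :
    (Gen.D e : Gen E.toOMod U).der h w = (E.anchor e).lie w := rfl

lemma Gen.deg_assoc (y : Gen E.toOMod U) (h : m + k = l) (hp : p + y.deg = m) :
    p + (y.deg + k) = l := by rw [← add_assoc, hp, h]

lemma Gen.mul_der {q q' : ℤ} (y : Gen E.toOMod U) (h : y.deg + k = q) (h' : y.deg + k = q')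
    (hm : p + q = l) (hm' : p + q' = l) (w : Form p U) (u : Form k U) :
    Form.mul hm w (y.der h u) = Form.mul hm' w (y.der h' u) := by
  subst h h'; rfl

lemma Gen.res_der (hV : V ≤ U) (y : Gen E.toOMod U) (h : y.deg + k = l)
    (h' : (y.res hV).deg + k = l) (w : Form k U) :
    Form.res hV (y.der h w) = (y.res hV).der h' (Form.res hV w) := by
  cases y with
  | c => rfl
  | j e =>
    change _ = (E.anchor (E.res hV e)).contr h _
    rw [E.anchor_res']; rfl
  | D e =>
    obtain rfl : k = l := by have : 0 + k = l := h; omega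
    change Form.res hV ((E.anchor e).lie w) = (E.anchor (E.res hV e)).lie _
    rw [E.anchor_res', VField.res_lie]

/-- Generators act on forms as graded derivations. -/
lemma Gen.der_mul {k' l' p' : ℤ} (y : Gen E.toOMod U) (h : k + l = p) (hp : y.deg + p = p')
    (hk : y.deg + k = k') (hl : y.deg + l = l') (h₁ : k' + l = p') (h₂ : k + l' = p')
    (w : Form k U) (v : Form l U) : y.der hp (Form.mul h w v) =
      Form.mul h₁ (y.der hk w) v + sg (y.deg * k) • Form.mul h₂ w (y.der hl v) := by
  cases y with
  | c =>
    change (0 : Form _ U) = Form.mul h₁ 0 v + _ • Form.mul h₂ w 0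
    rw [Form.zero_mul, Form.mul_zero, smul_zero, add_zero]
  | j e =>
    refine ((E.anchor e).contr_mul h hp hk hl h₁ h₂ w v).trans ?_
    rw [neg_mul, one_mul, sg_neg]; rfl
  | D e =>
    obtain rfl : p = p' := by have : 0 + p = p' := hp; omega
    obtain rfl : k = k' := by have : 0 + k = k' := hk; omega
    obtain rfl : l = l' := by have : 0 + l = l' := hl; omega
    change (E.anchor e).lie _ = Form.mul _ ((E.anchor e).lie w) v +
      sg (0 * k) • Form.mul _ w ((E.anchor e).lie v)
    rw [zero_mul, sg_zero, one_smul]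
    exact VField.lie_mul _ _ _ _

lemma Gen.der_algebraMap (y : Gen E.toOMod U) (h : y.deg + 0 = l) (a : 𝕂) :
    y.der h (Form.ofFn (algebraMap 𝕂 (Fn U) a)) = 0 := by
  cases y with
  | c => rfl
  | j e => exact VField.contr_ofFn _ h _
  | D e =>
    obtain rfl : 0 = l := h
    refine ((E.anchor e).lie_eq (add_zero _) (neg_add_cancel 1) (zero_add 1) (neg_add_cancel 1)
      _).trans ?_
    rw [VField.contr_ofFn, map_zero, Form.d_ofFn, Form.dFn_algebraMap, map_zero, add_zero]

end

namespace IsCartan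
variable {E : PreCourant X} {N : DGMod X} {j : ∀ U : Opens X.pt, E.sec U →+ (N.sh (-1)).sec U}
  {c : (N.sh (-2)).sec ⊤} (H : IsCartan E N j c) {U V : Opens X.pt} {i k l m p : ℤ}

lemma exists_anchor (H : IsCartan E N j c) (h : i + k = l) :
    ∃ δ : ∀ U, (N.sh i).sec U →+ Form k U →+ Form l U,
      (∀ {U V : Opens X.pt} (hV : V ≤ U) (t : (N.sh i).sec U) (u : Form k U),
        Form.res hV (δ U t u) = δ V ((N.sh i).res hV t) (Form.res hV u)) ∧
      ∀ {p : ℤ} {U : Opens X.pt} (y : Gen E.toOMod U) (hp : p + y.deg = i) (w : Form p U)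
        (u : Form k U), δ U (N.act hp w (y.val j c)) u =
          Form.mul (Gen.deg_assoc y h hp) w (y.der rfl u) := by
  refine H.lift (A := (Form.sheaf X k).pre) (F := Form.sheaf X l)
    { toFun := fun {p U} y hp w u => Form.mul (Gen.deg_assoc y h hp) w (y.der rfl u)
      add_form := fun y hp w w' u => Form.add_mul _ _ _ _
      add_param := fun y hp w u u' =>
        (congrArg (Form.mul _ w) (map_add (y.der rfl) u u')).trans (Form.mul_add _ _ _ _)
      add_j := fun e e' hp w u => ?_
      add_D := fun e e' hp w u => ?_
      res := fun {p U V} hV y hp hp' w u => ?_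
      smul_j := fun {p U} f e hp w u => ?_
      smul_D := fun {p q U} f e hp hq hpq w u => ?_
      κ_j := fun {p q U} α hp hq hpq w u => ?_
      κ_D := fun {p q U} α hp hq hpq h2 w u => ?_ } fun _ p U hp w u =>
        Form.mul_zero (Gen.deg_assoc (E := E) (U := U) .c h hp) _
  · change Form k _ at u
    change Form.mul _ w ((E.anchor (e + e')).contr rfl u) = _
    rw [E.contr_add, Form.mul_add]; rfl
  · change Form k _ at u
    have h1 : ∀ e : E.sec _, Form.cast (zero_add k).symm ((E.anchor e).lie u) =
      (Gen.D e : Gen E.toOMod _).der rfl u := fun e => rfl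
    rw [← h1, E.lie_add, map_add, Form.mul_add]; rfl
  · change Form k _ at u
    exact (Form.res_mul _ _ _ _).trans ((congrArg _ (Gen.res_der hV y rfl
      (by rw [Gen.deg_res]) u)).trans (Gen.mul_der (y.res hV) _ _ _ _ _ _))
  · change Form k _ at u
    change Form.mul _ w ((E.anchor (f • e)).contr rfl u) = _
    rw [E.contr_smul, Form.mul_smul, ← Form.smul_mul]; rfl
  · change Form k _ at u
    obtain ⟨hk, hk'⟩ : p + k = l ∧ 1 + (-1 + k) = k := ◇
    rw [Gen.mul_der (.D (f • e)) rfl (zero_add k) _ hk, Gen.mul_der (.D e) rfl (zero_add k) _ hk]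
    change Form.mul hk w ((E.anchor (f • e)).lie u) = Form.mul hk (f • w) ((E.anchor e).lie u) +
      Form.mul (Gen.deg_assoc (.j e) h hq) (Form.mul hpq w (Form.dFn f)) ((E.anchor e).contr rfl u)
    rw [E.lie_smul rfl hk', Form.mul_add, Form.mul_smul, ← Form.smul_mul,
      Form.mul_assoc hpq _ hk' hk]
  · change Form k _ at u
    change Form.mul _ w ((E.anchor (E.coanchor U α)).contr rfl u) = Form.mul _ _ 0
    rw [E.contr_coanchor, Form.mul_zero, Form.mul_zero]
  · change Form k _ at u
    have h1 : ∀ e : E.sec _, Form.cast (zero_add k).symm ((E.anchor e).lie u) =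
      (Gen.D e : Gen E.toOMod _).der rfl u := fun e => rfl
    rw [← h1, E.lie_coanchor, map_zero]
    exact (Form.mul_zero _ _).trans (Form.mul_zero _ _).symm

end IsCartan

lemma sg_smul_smul {M : Type u} [AddCommGroup M] (n : ℤ) (m : M) : sg n • sg n • m = m := by
  rw [smul_smul, sg_mul_self, one_smul]

namespace Presented
variable {E : OMod X} {κ : ∀ U : Opens X.pt, Form 1 U → E.sec U} {N : DGMod X}
  {j : ∀ U : Opens X.pt, E.sec U →+ (N.sh (-1)).sec U} {c : (N.sh (-2)).sec ⊤}
  (H : Presented E κ N j c)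

include H in
/-- Natural additive functions which agree on the multiples of generators are equal. -/
lemma eq_of_gen {m : ℤ} {A : Opens X.pt → Type u} {F : AbSheaf X}
    (rA : ∀ {U V : Opens X.pt}, V ≤ U → A U → A V)
    (f g : ∀ {U : Opens X.pt}, (N.sh m).sec U → A U → F.sec U)
    (hf : ∀ {U V : Opens X.pt} (h : V ≤ U) (t : (N.sh m).sec U) (a : A U),
      F.res h (f t a) = f ((N.sh m).res h t) (rA h a))
    (hg : ∀ {U V : Opens X.pt} (h : V ≤ U) (t : (N.sh m).sec U) (a : A U),
      F.res h (g t a) = g ((N.sh m).res h t) (rA h a))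
    (hf' : ∀ {U : Opens X.pt} (t t' : (N.sh m).sec U) (a : A U), f (t + t') a = f t a + f t' a)
    (hg' : ∀ {U : Opens X.pt} (t t' : (N.sh m).sec U) (a : A U), g (t + t') a = g t a + g t' a)
    (hgen : ∀ {k : ℤ} {U : Opens X.pt} (y : Gen E U) (h : k + y.deg = m) (w : Form k U) (a : A U),
      f (N.act h w (y.val j c)) a = g (N.act h w (y.val j c)) a)
    {U₀ : Opens X.pt} (t₀ : (N.sh m).sec U₀) (a₀ : A U₀) : f t₀ a₀ = g t₀ a₀ := by
  have hn : ∀ {U : Opens X.pt} (t : (N.sh m).sec U) (a : A U) (φ : (N.sh m).sec U → A U → F.sec U),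
      (∀ t t', φ (t + t') a = φ t a + φ t' a) → φ (-t) a = -φ t a :=
    fun t a φ h => (AddMonoidHom.mk' (φ · a) h).map_neg t
  refine H.induction (fun m' U t => ∀ (hm : m' = m) (a : A U), f (hm ▸ t) a = g (hm ▸ t) a)
    ?_ ?_ ?_ ?_ m U₀ t₀ rfl a₀
  · intro m' U t ht hm a
    subst hm
    refine F.eq_of_local fun x => ?_
    obtain ⟨V, hV, hx, h⟩ := ht x
    exact ⟨V, hV, hx, (hf hV t a).trans ((h rfl _).trans (hg hV t a).symm)⟩
  · intro m' U t t' ht ht' hm a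
    subst hm
    exact (hf' t t' a).trans ((congrArg₂ (· + ·) (ht rfl a) (ht' rfl a)).trans (hg' t t' a).symm)
  · intro m' U t ht hm a
    subst hm
    exact (hn t a f fun t t' => hf' t t' a).trans ((congrArg Neg.neg (ht rfl a)).trans
      (hn t a g fun t t' => hg' t t' a).symm)
  · intro k m' U y h w hm a
    subst hm
    exact hgen y h w a

include H in
lemma res_gen {U V : Opens X.pt} (hV : V ≤ U) (y : Gen E U) {k l : ℤ} (h : k + y.deg = l)
    (h' : k + (y.res hV).deg = l) (w : Form k V) :
    N.act h w ((N.sh _).res hV (y.val j c)) = N.act h' w ((y.res hV).val j c) := by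
  have h2 : Form.res le_rfl w = w := rfl
  have := H.res_val hV y (k := 0) (zero_add _) (by rw [Gen.deg_res, zero_add]) (Form.ofFn 1)
  rw [N.one_act] at this
  have e : ∀ (d : ℤ) (hd : y.deg = d) (s : (N.sh d).sec V) (h1 : 0 + d = y.deg) (h2 : k + d = l),
      N.act h w (N.act h1 (Form.ofFn 1) s) = N.act h2 w s := by
    rintro _ rfl s h1 h2
    rw [N.one_act]
  rw [this]
  exact e _ (Gen.deg_res hV y).symm _ _ _

end Presented

namespace IsCartan
variable {E : PreCourant X} {N : DGMod X} {j : ∀ U : Opens X.pt, E.sec U →+ (N.sh (-1)).sec U}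
  {c : (N.sh (-2)).sec ⊤} (H : IsCartan E N j c) {U V : Opens X.pt} {i k l m p q : ℤ}

/-- The action of sections of `N` on forms: `w y` acts as the composition of the derivation given by
the generator `y` and multiplication with `w`. -/
def δ (h : i + k = l) : ∀ U, (N.sh i).sec U →+ Form k U →+ Form l U := (H.exists_anchor h).choose

lemma res_δ (h : i + k = l) (hV : V ≤ U) (t : (N.sh i).sec U) (u : Form k U) :
    Form.res hV (H.δ h U t u) = H.δ h V ((N.sh i).res hV t) (Form.res hV u) :=
  (H.exists_anchor h).choose_spec.1 hV t u

lemma δ_act_val (h : i + k = l) (y : Gen E.toOMod U) (hp : p + y.deg = i) (hy : y.deg + k = q)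
    (hm : p + q = l) (w : Form p U) (u : Form k U) :
    H.δ h U (N.act hp w (y.val j c)) u = Form.mul hm w (y.der hy u) :=
  ((H.exists_anchor h).choose_spec.2 y hp w u).trans (Gen.mul_der _ _ _ _ _ _ _)

lemma δ_val (y : Gen E.toOMod U) (h : y.deg + k = l) (u : Form k U) :
    H.δ h U (y.val j c) u = y.der h u := by
  have := H.δ_act_val h y (zero_add _) h (zero_add _) (Form.ofFn 1) u
  rwa [N.one_act, Form.ofFn_one_mul] at this

lemma δ_act {i' l' : ℤ} (h : i + k = l) (hi : p + i = i') (h' : i' + k = l') (hl : p + l = l')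
    (w : Form p U) (t : (N.sh i).sec U) (u : Form k U) :
    H.δ h' U (N.act hi w t) u = Form.mul hl w (H.δ h U t u) := by
  refine H.eq_of_gen (A := fun U => Form p U × Form k U) (F := Form.sheaf X l')
    (fun h a => (Form.res h a.1, Form.res h a.2))
    (fun {U} t a => H.δ h' U (N.act hi a.1 t) a.2) (fun {U} t a => Form.mul hl a.1 (H.δ h U t a.2))
    (fun hV t a => (H.res_δ _ _ _ _).trans (by rw [N.res_act]))
    (fun hV t a => (Form.res_mul _ _ _ _).trans (by rw [H.res_δ]))
    (fun t t' a => by rw [N.act_add, map_add]; rfl)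
    (fun t t' a => by rw [map_add]; exact Form.mul_add _ _ _ _) ?_ t (w, u)
  rintro r U y hr v ⟨w, u⟩
  have h1 : y.deg + k = y.deg + k := rfl
  obtain ⟨h2, h3⟩ : r + (y.deg + k) = l ∧ (p + r) + y.deg = i' := ◇
  change H.δ h' U (N.act hi w (N.act hr v (y.val j c))) u =
    Form.mul hl w (H.δ h U (N.act hr v (y.val j c)) u)
  rw [H.δ_act_val h y hr rfl h2, ← N.mul_act rfl hr hi h3, H.δ_act_val h' y h3 rfl ◇,
    Form.mul_assoc rfl _ h2 hl]

/-- Sections of `N` act on forms as graded derivations. -/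
lemma δ_mul {k' l' p' : ℤ} (h : k + l = p) (hp : i + p = p') (hk : i + k = k') (hl : i + l = l')
    (h₁ : k' + l = p') (h₂ : k + l' = p') (t : (N.sh i).sec U) (w : Form k U) (v : Form l U) :
    H.δ hp U t (Form.mul h w v) =
      Form.mul h₁ (H.δ hk U t w) v + sg (i * k) • Form.mul h₂ w (H.δ hl U t v) := by
  refine H.eq_of_gen (A := fun U => Form k U × Form l U) (F := Form.sheaf X p')
    (fun h a => (Form.res h a.1, Form.res h a.2))
    (fun {U} t a => H.δ hp U t (Form.mul h a.1 a.2))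
    (fun {U} t a => Form.mul h₁ (H.δ hk U t a.1) a.2 +
      sg (i * k) • Form.mul h₂ a.1 (H.δ hl U t a.2))
    (fun hV t a => (H.res_δ _ _ _ _).trans (by rw [Form.res_mul]))
    (fun hV t a => ((map_add (Form.res hV) _ _).trans (by
      rw [Form.res_mul, H.res_δ, map_zsmul, Form.res_mul, H.res_δ])))
    (fun t t' a => by rw [map_add]; rfl)
    (fun t t' a => by
      rw [map_add, map_add, AddMonoidHom.add_apply, AddMonoidHom.add_apply, Form.add_mul,
        Form.mul_add, smul_add, add_add_add_comm]) ?_ t (w, v)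
  rintro r U y hr u ⟨w, v⟩
  obtain ⟨a1, a2, a3, a4, a5⟩ : r + (y.deg + p) = p' ∧ r + (y.deg + k) = k' ∧ r + (y.deg + l) = l' ∧
    y.deg + k + l = y.deg + p ∧ k + (y.deg + l) = y.deg + p := ◇
  have a6 : k + r = r + k := add_comm _ _
  change H.δ hp U (N.act hr u (y.val j c)) (Form.mul h w v) =
    Form.mul h₁ (H.δ hk U (N.act hr u (y.val j c)) w) v +
      sg (i * k) • Form.mul h₂ w (H.δ hl U (N.act hr u (y.val j c)) v)
  rw [H.δ_act_val hp y hr rfl a1, H.δ_act_val hk y hr rfl a2, H.δ_act_val hl y hr rfl a3,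
    Gen.der_mul y h rfl rfl rfl a4 a5, Form.mul_add, Form.mul_zsmul,
    Form.mul_assoc a2 _ a4 a1, ← Form.mul_assoc a6 (by omega : r + k + (y.deg + l) = p'),
    Form.mul_comm a6 rfl, Form.zsmul_mul, smul_smul, Form.mul_assoc rfl _ a5 a1]
  have e : sg (y.deg * k) = sg (i * k) * sg (k * r) := by
    rw [← hr, add_mul, sg_add, mul_comm k r, mul_comm (sg _), _root_.mul_assoc, sg_mul_self,
      mul_one]
  rw [e]

lemma δ_algebraMap (h : i + 0 = l) (t : (N.sh i).sec U) (a : 𝕂) :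
    H.δ h U t (Form.ofFn (algebraMap 𝕂 (Fn U) a)) = 0 := by
  refine H.eq_of_gen (A := fun U => PUnit) (F := Form.sheaf X l) (fun h a => a)
    (fun {U} t _ => H.δ h U t (Form.ofFn (algebraMap 𝕂 (Fn U) a))) (fun {U} t _ => 0)
    (fun hV t _ => H.res_δ _ _ _ _) (fun hV t _ => map_zero _)
    (fun t t' a => by rw [map_add]; rfl) (fun t t' a => (add_zero 0).symm) ?_ t PUnit.unit
  rintro r U y hr v _
  have a1 : r + (y.deg + 0) = l := ◇
  exact (H.δ_act_val h y hr rfl a1 _ _).trans (by rw [Gen.der_algebraMap, Form.mul_zero])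

lemma δ_one (h : i + 0 = l) (t : (N.sh i).sec U) : H.δ h U t (Form.ofFn 1) = 0 := by
  have := H.δ_algebraMap h t 1
  rwa [map_one] at this

/-- The action on forms is compatible with the differentials. -/
lemma δ_D {i' k' l' : ℤ} (hi : i + 1 = i') (h : i + k = l) (h₁ : i' + k = l') (h₂ : i + k' = l')
    (hk : k + 1 = k') (hl : l + 1 = l') (t : (N.sh i).sec U) (u : Form k U) :
    H.δ h₁ U (N.D hi t) u = Form.d hl (H.δ h U t u) - sg i • H.δ h₂ U t (Form.d hk u) := by
  refine H.eq_of_gen (A := fun U => Form k U) (F := Form.sheaf X l') (fun h a => Form.res h a)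
    (fun {U} t u => H.δ h₁ U (N.D hi t) u)
    (fun {U} t u => Form.d hl (H.δ h U t u) - sg i • H.δ h₂ U t (Form.d hk u))
    (fun hV t a => (H.res_δ _ _ _ _).trans (by rw [N.res_D]))
    (fun hV t a => (map_sub (Form.res hV) _ _).trans (by
      rw [map_zsmul, Form.res_d, H.res_δ, H.res_δ, Form.res_d]))
    (fun t t' a => by rw [map_add, map_add]; rfl)
    (fun t t' a => by
      rw [map_add, map_add, AddMonoidHom.add_apply, AddMonoidHom.add_apply, map_add, smul_add,
        add_sub_add_comm]) ?_ t u
  intro r U y hr v u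
  have gen : ∀ (s q' : ℤ) (hs : y.deg + 1 = s) (hq : s + k = q') (hq' : y.deg + k + 1 = q')
      (hq'' : y.deg + k' = q'), H.δ hq U (N.D hs (y.val j c)) u =
        Form.d hq' (y.der rfl u) - sg y.deg • y.der hq'' (Form.d hk u) := by
    intro s q' hs hq hq' hq''
    cases y with
    | c =>
      have e : N.D hs ((Gen.c : Gen E.toOMod U).val j c) = 0 :=
        (N.res_D _ _ _).symm.trans ((congrArg _ (H.D_c _)).trans (map_zero _))
      rw [e, map_zero]
      change (0 : Form _ _) = Form.d hq' 0 - sg (-2) • 0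
      rw [map_zero, smul_zero, sub_zero]
    | j e =>
      obtain rfl : 0 = s := hs
      obtain rfl : k = q' := ◇
      refine (H.δ_val (.D e) hq u).trans ((VField.lie_eq _ (rfl : -1 + k = _) hq' hk hq'' u).trans ?_)
      rw [sg_neg, sg_one, neg_smul, one_smul, sub_neg_eq_add]; rfl
    | D e =>
      have e0 : N.D hs ((Gen.D e : Gen E.toOMod U).val j c) = 0 := N.D_D _ _ _
      obtain rfl : k' = q' := by have : 0 + k' = q' := hq''; omega
      rw [e0, map_zero, sg_zero, one_smul]
      have e1 : ∀ (n : ℤ) (hn : 0 + k = n) (hn' : n + 1 = k'),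
          Form.d hn' ((Gen.D e : Gen E.toOMod U).der hn u) = (E.anchor e).lie (Form.d hk u) := by
        intro n hn hn'
        obtain rfl : k = n := ◇
        exact (VField.lie_d _ _ _).symm
      rw [e1]
      exact (sub_self _).symm
  obtain ⟨a1, a2, a3, a4, a5, a6, a7⟩ : r + (y.deg + k) = l ∧ r + (y.deg + k') = l' ∧ (r + 1) +
    y.deg = i' ∧ r + (y.deg + 1) = i' ∧ (r + 1) + (y.deg + k) = l' ∧ y.deg + k + 1 = y.deg + k' ∧
    y.deg + 1 + k = y.deg + k' := ◇
  change H.δ h₁ U (N.D hi (N.act hr v (y.val j c))) u = Form.d hl (H.δ h U (N.act hr v _) u) -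
    sg i • H.δ h₂ U (N.act hr v (y.val j c)) (Form.d hk u)
  rw [N.D_act' hr hi a3 rfl a4 rfl, H.δ_act_val h y hr rfl a1, H.δ_act_val h₂ y hr rfl a2, map_add,
    map_zsmul, AddMonoidHom.add_apply, AddMonoidHom.smul_apply, H.δ_act_val h₁ y a3 rfl a5,
    H.δ_act a7 a4 h₁ a2, gen _ _ rfl a7 a6 rfl, Form.d_mul a1 hl rfl a6 a5 a2, ← hr, sg_add,
    sub_eq_add_neg (Form.d a6 _), Form.mul_add, Form.mul_neg, Form.mul_zsmul, smul_add, smul_neg,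
    smul_smul]
  abel

end IsCartan

lemma DGMod.act_contr_mul {N : DGMod X} {U : Opens X.pt} {k l m k' l' m' i n a b : ℤ} (v : VField U)
    (h : k + l = m) (hm : -1 + m = m') (hk : -1 + k = k') (hl : -1 + l = l')
    (h₀ : m' + i = n) (h₁ : l + i = a) (h₂ : k' + a = n) (h₃ : l' + i = b) (h₄ : k + b = n)
    (w : Form k U) (w' : Form l U) (t : (N.sh i).sec U) :
    N.act h₀ (v.contr hm (Form.mul h w w')) t = N.act h₂ (v.contr hk w) (N.act h₁ w' t) +
      sg k • N.act h₄ w (N.act h₃ (v.contr hl w') t) := by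
  obtain ⟨e₁, e₂⟩ : k' + l = m' ∧ k + l' = m' := ◇
  rw [v.contr_mul h hm hk hl e₁ e₂, N.add_act, N.zsmul_act, N.mul_act e₁ h₁ h₂, N.mul_act e₂ h₃ h₄]

namespace Presented
variable {E : OMod X} {κ : ∀ U : Opens X.pt, Form 1 U → E.sec U} {N : DGMod X}
  {j : ∀ U : Opens X.pt, E.sec U →+ (N.sh (-1)).sec U} {c : (N.sh (-2)).sec ⊤}
  (H : Presented E κ N j c) {U : Opens X.pt} {i k l m : ℤ}

include H in
lemma D_mark (h : k + -2 = i) (hi : i + 1 = m) (hk : k + 1 = l) (h' : l + -2 = m) (w : Form k U) :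
    N.D hi (N.act h w ((N.sh (-2)).res le_top c)) =
      N.act h' (Form.d hk w) ((N.sh (-2)).res le_top c) := by
  have e : N.D ◇ ((N.sh (-2)).res (le_top : U ≤ ⊤) c) = (0 : (N.sh (-1)).sec U) :=
    (N.res_D _ _ _).symm.trans ((congrArg _ (H.D_c _)).trans (map_zero _))
  rw [N.D_act' h hi h' (by norm_num : (-2 : ℤ) + 1 = -1) ◇ hk, e, N.act_zero, smul_zero,
    add_zero]

include H in
lemma D_j_smul (h : 1 + -1 = (0 : ℤ)) (f : Fn U) (e : E.sec U) :
    N.D (neg_add_cancel 1) (j U (f • e)) = N.act h (Form.dFn f) (j U e) +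
      N.act (zero_add _) (Form.ofFn f) (N.D (neg_add_cancel 1) (j U e)) := by
  rw [H.j_smul, N.D_act' _ _ h (neg_add_cancel 1) (zero_add _) (zero_add 1), Form.d_ofFn, sg_zero,
    one_smul]

end Presented

namespace IsCartan
variable {E : PreCourant X} {N : DGMod X} {j : ∀ U : Opens X.pt, E.sec U →+ (N.sh (-1)).sec U}
  {c : (N.sh (-2)).sec ⊤} (H : IsCartan E N j c) {U V : Opens X.pt} {i k l m p q r : ℤ}

variable (E j c) in
/-- The sections `w [q ε, y]`, for the generators `y`. -/
def insGen (y : Gen E.toOMod U) (h : k + y.deg = i) (hl : -1 + i = l) (w : Form k U)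
    (q : E.sec U) : (N.sh l).sec U :=
  match y, h with
  | .c, _ => 0
  | .j e, h => N.act (by have : k + -1 = i := h; omega) (E.pair q e • w) ((N.sh (-2)).res le_top c)
  | .D e, h => -N.act (by have : k + 0 = i := h; omega) w (j U (E.br e q))

lemma insGen_add (y : Gen E.toOMod U) (h : k + y.deg = i) (hl : -1 + i = l) (w w' : Form k U)
    (q : E.sec U) :
    insGen E j c y h hl (w + w') q = insGen E j c y h hl w q + insGen E j c y h hl w' q := by
  cases y with
  | c => exact (add_zero 0).symm
  | j e => simp only [insGen]; rw [smul_add, N.add_act]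
  | D e => simp only [insGen]; rw [N.add_act, neg_add]

lemma insGen_add_param (y : Gen E.toOMod U) (h : k + y.deg = i) (hl : -1 + i = l) (w : Form k U)
    (q q' : E.sec U) :
    insGen E j c y h hl w (q + q') = insGen E j c y h hl w q + insGen E j c y h hl w q' := by
  cases y with
  | c => exact (add_zero 0).symm
  | j e => simp only [insGen]; rw [E.pair_add_left, add_smul, N.add_act]
  | D e => simp only [insGen]; rw [E.br_add, map_add, N.act_add, neg_add]

include H in
lemma res_insGen (hV : V ≤ U) (y : Gen E.toOMod U) (h : k + y.deg = i)
    (h' : k + (y.res hV).deg = i) (hl : -1 + i = l) (w : Form k U) (q : E.sec U) :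
    (N.sh l).res hV (insGen E j c y h hl w q) =
      insGen E j c (y.res hV) h' hl (Form.res hV w) (E.res hV q) := by
  cases y with
  | c => exact map_zero _
  | j e =>
    simp only [insGen, Gen.res]
    rw [N.res_act, AbSheaf.res_res, Form.res_smul, E.res_pair]
  | D e =>
    simp only [insGen, Gen.res]
    rw [map_neg, N.res_act, H.res_j, E.res_br]

lemma insGen_mul (y : Gen E.toOMod U) (h : k + y.deg = i) (hl : -1 + i = l) (hm : m + k = p)
    (h' : p + y.deg = q) (hq : -1 + q = r) (hr : m + l = r) (w : Form m U) (v : Form k U)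
    (e : E.sec U) :
    insGen E j c y h' hq (Form.mul hm w v) e = N.act hr w (insGen E j c y h hl v e) := by
  cases y with
  | c => exact (N.act_zero _ _).symm
  | j e => 
    simp only [insGen]
    rw [← N.mul_act hm, Form.mul_smul]
  | D e =>
    simp only [insGen]
    rw [N.act_neg, ← N.mul_act hm]

lemma exists_ins (H : IsCartan E N j c) (hl : -1 + i = l) :
    ∃ δ : ∀ U, (N.sh i).sec U →+ E.sec U →+ (N.sh l).sec U,
      (∀ {U V : Opens X.pt} (hV : V ≤ U) (t : (N.sh i).sec U) (q : E.sec U),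
        (N.sh l).res hV (δ U t q) = δ V ((N.sh i).res hV t) (E.res hV q)) ∧
      ∀ {p : ℤ} {U : Opens X.pt} (y : Gen E.toOMod U) (hp : p + y.deg = i) (w : Form p U)
        (q : E.sec U), δ U (N.act hp w (y.val j c)) q =
          N.act ◇ ((E.anchor q).contr rfl w) (y.val j c) +
            sg p • insGen E j c y hp hl w q := by
  refine H.lift (A := E.pre) (F := N.sh l)
    { toFun := fun {p U} y hp w q => N.act ◇ ((E.anchor q).contr rfl w) (y.val j c) +
            sg p • insGen E j c y hp hl w q
      add_form := fun y hp w w' u => ?_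
      add_param := fun y hp w u u' => ?_
      add_j := fun e e' hp w u => ?_
      add_D := fun e e' hp w u => ?_
      res := fun {p U V} hV y hp hp' w u => ?_
      smul_j := fun {p U} f e hp w u => ?_
      smul_D := fun {p q U} f e hp hq hpq w u => ?_
      κ_j := fun {p q U} α hp hq hpq w u => ?_
      κ_D := fun {p q U} α hp hq hpq h2 w u => ?_ } fun hc p U hp w u => ?_
  · rw [map_add, N.add_act, insGen_add, smul_add]; abel
  · change E.sec _ at u
    change E.sec _ at u'
    rw [E.contr_add, N.add_act, insGen_add_param, smul_add]; abel
  · change E.sec _ at u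
    simp only [insGen, Gen.val]
    rw [map_add, N.act_add, E.pair_add, add_smul, N.add_act, smul_add]; abel
  · change E.sec _ at u
    simp only [insGen, Gen.val]
    rw [map_add, map_add, N.act_add, E.add_br, map_add, N.act_add, neg_add, smul_add]; abel
  · change E.sec _ at u
    rw [map_add, map_zsmul, H.res_insGen hV y hp hp' hl, N.res_act, VField.res_contr hV,
      ← E.anchor_res', H.res_gen hV y _ ◇]
  · change E.sec _ at u
    simp only [insGen, Gen.val]
    rw [H.j_smul, N.act_ofFn, VField.contr_smul, E.pair_smul, _root_.mul_comm, mul_smul]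
  · change E.sec _ at u
    obtain ⟨a1, a2, a3, a4, a5, a6⟩ : -1 + p + 1 = p ∧ -1 + q = p ∧ p + 0 = p ∧ -1 + p + 0 = l ∧ p +
      -1 = l ∧ q + -2 = l := ◇
    have a7 : (1 : ℤ) + -2 = -1 := by norm_num
    have hs : sg q = -sg p := by rw [← hpq, sg_add, sg_one, mul_neg_one]
    simp only [insGen, Gen.val]
    rw [H.D_j_smul ◇, N.act_add, N.act_ofFn, VField.contr_smul,
      DGMod.act_contr_mul _ hpq _ rfl (neg_add_cancel 1) _ ◇ a4 (zero_add _) a5,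
      VField.contr_dFn, E.smul_br, map_add, map_sub,
      H.j_smul, H.j_smul, H.j_κ a7, N.act_add, N.act_sub, N.act_ofFn, N.act_ofFn,
      ← N.mul_act hpq a7 _ a6, Form.mul_smul, hs]
    simp only [smul_neg, smul_sub, smul_add, neg_smul]
    abel
  · change E.sec _ at u
    obtain ⟨a2, a4⟩ : p + -2 = l ∧ p + 0 = p := ◇
    have a5 : 0 + -2 = (-2 : ℤ) := by norm_num
    have a6 : (1 : ℤ) + -2 = -1 := by norm_num
    simp only [insGen, Gen.val]
    rw [H.j_κ a6, H.pair_κ a2, DGMod.act_contr_mul _ hpq _ rfl (neg_add_cancel 1) _ a6 ◇ a5 a2,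
      ← N.mul_act a4 a5 a2 a2, smul_zero, add_zero]
  · change E.sec _ at u
    simp only [insGen, Gen.val]
    have a3 : 1 + -2 = (-1 : ℤ) := by norm_num
    obtain ⟨a4, a5⟩ : p + -1 = l ∧ -1 + p + 0 = l := ◇
    have a6 : 2 + -2 = (0 : ℤ) := by norm_num
    have e1 : j U (E.br (E.coanchor U α) u) = -N.act a3 ((E.anchor u).contr ◇
        (Form.d h2 α)) ((N.sh (-2)).res le_top c) := by
      have h3 : N.D (by norm_num : -2 + 1 = (-1 : ℤ)) (N.act (by norm_num : 0 + -2 = (-2 : ℤ))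
            (E.pair u (E.coanchor U α) • Form.ofFn 1) ((N.sh (-2)).res le_top c)) =
          N.D ◇ (N.act (by norm_num : 0 + -2 = (-2 : ℤ))
            (Form.mul (add_zero 0) (Form.ofFn 1) ((E.anchor u).contr (neg_add_cancel 1) α))
            ((N.sh (-2)).res le_top c)) := by rw [H.pair_κ]
      rw [H.D_mark _ (by norm_num : -2 + 1 = (-1 : ℤ)) (zero_add 1) a3, H.D_mark _ _ (zero_add 1) a3, Form.smul_ofFn_one,
        Form.d_ofFn, Form.ofFn_one_mul] at h3
      have h1 := E.br_symm (E.coanchor U α) u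
      rw [E.br_coanchor, E.pair_symm,
        VField.lie_eq _ (neg_add_cancel 1) (zero_add 1) h2 ◇, map_add] at h1
      rw [eq_sub_of_add_eq h1, map_sub, map_add, H.j_κ a3, H.j_κ a3, H.j_κ a3, h3]
      abel
    rw [e1, H.j_κ a3, H.D_mark a3 _ h2 a6, N.act_neg, neg_neg,
      DGMod.act_contr_mul _ hpq _ rfl ◇ _ a6 a5 a3 a4, smul_zero]
    exact (add_zero _).symm
  · change E.sec _ at u
    simp only [insGen, Gen.val]
    rw [hc, map_zero, N.act_zero, smul_zero, add_zero]

/-- The bracket `[q ε, t]`. -/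
def ins (hl : -1 + i = l) (q : E.sec U) : (N.sh i).sec U →+ (N.sh l).sec U :=
  ((H.exists_ins hl).choose U).flip q

lemma res_ins (hl : -1 + i = l) (hV : V ≤ U) (q : E.sec U) (t : (N.sh i).sec U) :
    (N.sh l).res hV (H.ins hl q t) = H.ins hl (E.res hV q) ((N.sh i).res hV t) :=
  (H.exists_ins hl).choose_spec.1 hV t q

lemma ins_act_gen (hl : -1 + i = l) (y : Gen E.toOMod U) (hp : p + y.deg = i) (hr : -1 + p = r)
    (h : r + y.deg = l) (w : Form p U) (q : E.sec U) : H.ins hl q (N.act hp w (y.val j c)) =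
      N.act h ((E.anchor q).contr hr w) (y.val j c) + sg p • insGen E j c y hp hl w q := by
  subst hr
  exact (H.exists_ins hl).choose_spec.2 y hp w q

lemma ins_add (hl : -1 + i = l) (q q' : E.sec U) (t : (N.sh i).sec U) :
    H.ins hl (q + q') t = H.ins hl q t + H.ins hl q' t :=
  map_add ((H.exists_ins hl).choose U t) q q'

lemma ins_gen (y : Gen E.toOMod U) (hp : 0 + y.deg = y.deg) (hl : -1 + y.deg = l) (q : E.sec U) :
    H.ins hl q (y.val j c) = insGen E j c y hp hl (Form.ofFn 1) q := by
  have := H.ins_act_gen hl y hp (add_zero _) ◇ (Form.ofFn 1) q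
  rwa [N.one_act, VField.contr_ofFn, N.zero_act, zero_add, sg_zero, one_smul] at this

lemma ins_c (hl : -1 + -2 = l) (q : E.sec U) :
    H.ins hl q ((N.sh (-2)).res le_top c) = 0 :=
  H.ins_gen .c ◇ hl q

lemma ins_j (hl : -1 + -1 = l) (h : 0 + -2 = l) (q e : E.sec U) :
    H.ins hl q (j U e) = N.act h (Form.ofFn (E.pair q e)) ((N.sh (-2)).res le_top c) := by
  rw [← Form.smul_ofFn_one]
  exact H.ins_gen (.j e) ◇ hl q

lemma ins_D (hl : -1 + 0 = (-1 : ℤ)) (q e : E.sec U) :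
    H.ins hl q (N.D (neg_add_cancel 1) (j U e)) = -j U (E.br e q) := by
  refine (H.ins_gen (.D e) (zero_add 0) hl q).trans ?_
  simp only [insGen]
  rw [N.one_act]

/-- The bracket with `q ε` is a graded derivation. -/
lemma ins_act {i' l' k' : ℤ} (hl : -1 + i = l) (h : k + i = i') (hl' : -1 + i' = l')
    (hk : -1 + k = k') (h₁ : k' + i = l') (h₂ : k + l = l') (q : E.sec U) (w : Form k U)
    (t : (N.sh i).sec U) : H.ins hl' q (N.act h w t) =
      N.act h₁ ((E.anchor q).contr hk w) t + sg k • N.act h₂ w (H.ins hl q t) := by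
  refine H.eq_of_gen (A := fun U => Form k U × E.sec U) (F := N.sh l')
    (fun h a => (Form.res h a.1, E.res h a.2))
    (fun {U} t a => H.ins hl' a.2 (N.act h a.1 t))
    (fun {U} t a => N.act h₁ ((E.anchor a.2).contr hk a.1) t +
      sg k • N.act h₂ a.1 (H.ins hl a.2 t))
    (fun hV t a => (H.res_ins _ _ _ _).trans (by rw [N.res_act]))
    (fun hV t a => ((map_add ((N.sh l').res hV) _ _).trans (by
      rw [map_zsmul, N.res_act, N.res_act, H.res_ins, VField.res_contr hV, ← E.anchor_res'])))
    (fun t t' a => by rw [N.act_add, map_add])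
    (fun t t' a => by
      rw [map_add, N.act_add, N.act_add, smul_add, add_add_add_comm]) ?_ t (w, q)
  rintro r U y hr v ⟨w, q⟩
  obtain ⟨a1, a2, a3, a4⟩ : k + r + y.deg = i' ∧ -1 + r + y.deg = l ∧ -1 + (k + r) + y.deg = l' ∧ -1
    + r + y.deg = l := ◇
  change H.ins hl' q (N.act h w (N.act hr v (y.val j c))) =
    N.act h₁ ((E.anchor q).contr hk w) (N.act hr v (y.val j c)) +
      sg k • N.act h₂ w (H.ins hl q (N.act hr v (y.val j c)))
  rw [← N.mul_act rfl hr h a1, H.ins_act_gen hl' y a1 rfl a3, H.ins_act_gen hl y hr rfl a2,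
    N.act_add, N.act_zsmul, insGen_mul y hr hl rfl a1 hl' h₂,
    DGMod.act_contr_mul _ rfl rfl hk rfl a3 hr h₁ a4 h₂, sg_add, smul_add, smul_smul]
  abel

lemma insGen_smul (y : Gen E.toOMod U) (h : k + y.deg = i) (hl : -1 + i = l) (hy : y.deg + 0 = p)
    (hq : k + p = q) (h' : q + -1 = l) (f : Fn U) (w : Form k U) (e : E.sec U) (hj : ∀ (f : Fn U)
    (e : E.sec U), j U (f • e) = N.act (zero_add _) (Form.ofFn f) (j U e)) :
    insGen E j c y h hl w (f • e) = N.act (zero_add l) (Form.ofFn f) (insGen E j c y h hl w e) -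
      sg y.deg • N.act h' (Form.mul hq w (y.der hy (Form.ofFn f))) (j U e) := by
  cases y with
  | c => 
    have e1 : N.act h' (Form.mul hq w (0 : Form p U)) (j U e) = 0 := by
      rw [Form.mul_zero, N.zero_act]
    refine Eq.trans ?_ (congrArg₂ (· - ·) (N.act_zero (zero_add l) (Form.ofFn f)).symm
      (congrArg (sg (-2) • ·) e1).symm)
    change (0 : (N.sh l).sec U) = 0 - sg (-2) • (0 : (N.sh l).sec U)
    rw [smul_zero, sub_zero]
  | j e' => 
    have e1 : N.act h' (Form.mul hq w ((E.anchor e').contr hy (Form.ofFn f))) (j U e) = 0 := by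
      rw [VField.contr_ofFn, Form.mul_zero, N.zero_act]
    simp only [insGen]
    refine Eq.trans ?_ (congrArg₂ (· - ·) rfl (congrArg (sg (-1) • ·) e1).symm)
    rw [smul_zero, sub_zero, E.pair_smul_left, mul_smul, N.smul_act _ (zero_add l)]
  | D e' =>
    obtain rfl : 0 = p := hy
    obtain rfl : k = q := ◇
    simp only [insGen]
    rw [Gen.der_D, VField.lie_ofFn, sg_zero, one_smul, E.leibniz, map_add, hj, hj, N.act_add,
      N.act_ofFn, N.act_ofFn, N.act_neg, ← N.smul_act _ _ f, Form.mul_ofFn]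
    abel

lemma insGen_coanchor (H : IsCartan E N j c) (y : Gen E.toOMod U) (h : k + y.deg = i)
    (hl : -1 + i = l) (hy : y.deg + 1 = p) (hq : k + p = q) (h' : q + -2 = l) (w : Form k U)
    (α : Form 1 U) : insGen E j c y h hl w (E.coanchor U α) =
      -(sg y.deg • N.act h' (Form.mul hq w (y.der hy α)) ((N.sh (-2)).res le_top c)) := by
  cases y with
  | c =>
    have e1 : N.act h' (Form.mul hq w (0 : Form p U)) ((N.sh (-2)).res le_top c) = 0 := by
      rw [Form.mul_zero, N.zero_act]
    refine Eq.trans ?_ (congrArg (fun x => -(sg (-2) • x)) e1).symm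
    change (0 : (N.sh l).sec U) = -(sg (-2) • (0 : (N.sh l).sec U))
    rw [smul_zero, neg_zero]
  | j e' =>
    obtain rfl : 0 = p := hy
    obtain rfl : k = q := ◇
    simp only [insGen]
    rw [E.pair_symm, H.pair_κ, sg_neg, sg_one, neg_smul, one_smul, neg_neg]
    rfl
  | D e' =>
    obtain rfl : 1 = p := hy
    have a1 : k + -1 = l := ◇
    simp only [insGen]
    rw [Gen.der_D, sg_zero, one_smul, E.br_coanchor, H.j_κ ◇, ← N.mul_act hq _ a1 h']

lemma ins_smul (hl : -1 + i = l) (h : i + -1 = l) (f : Fn U) (q : E.sec U) (t : (N.sh i).sec U) :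
    H.ins hl (f • q) t = N.act (zero_add _) (Form.ofFn f) (H.ins hl q t) -
      sg i • N.act h (H.δ (add_zero i) U t (Form.ofFn f)) (j U q) := by
  refine H.eq_of_gen (A := fun U => Fn U × E.sec U) (F := N.sh l)
    (fun h a => (resFn h a.1, E.res h a.2))
    (fun {U} t a => H.ins hl (a.1 • a.2) t)
    (fun {U} t a => N.act (zero_add _) (Form.ofFn a.1) (H.ins hl a.2 t) -
      sg i • N.act h (H.δ (add_zero i) U t (Form.ofFn a.1)) (j U a.2))
    (fun hV t a => (H.res_ins _ _ _ _).trans (by rw [E.res_smul]))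
    (fun hV t a => ((map_sub ((N.sh l).res hV) _ _).trans (by
      rw [map_zsmul, N.res_act, N.res_act, H.res_ins, H.res_δ, H.res_j, Form.res_ofFn])))
    (fun t t' a => by rw [map_add])
    (fun t t' a => by
      rw [map_add, map_add, N.act_add, AddMonoidHom.add_apply, N.add_act, smul_add,
        add_sub_add_comm]) ?_ t (f, q)
  rintro r U y hr v ⟨f, q⟩
  obtain ⟨a1, a2⟩ : -1 + r + y.deg = l ∧ r + (y.deg + 0) = i := ◇
  have hs : sg i = sg r * sg y.deg := by rw [← hr, sg_add]
  change H.ins hl (f • q) (N.act hr v (y.val j c)) =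
    N.act (zero_add _) (Form.ofFn f) (H.ins hl q (N.act hr v (y.val j c))) -
      sg i • N.act h (H.δ (add_zero i) U (N.act hr v (y.val j c)) (Form.ofFn f)) (j U q)
  rw [H.ins_act_gen hl y hr rfl a1, H.ins_act_gen hl y hr rfl a1, H.δ_act_val _ y hr rfl a2,
    insGen_smul y hr hl rfl a2 h f v q H.j_smul, N.act_add, N.act_zsmul, E.contr_smul,
    N.smul_act _ (zero_add l), hs, smul_sub, smul_smul]
  abel

lemma ins_coanchor (hl : -1 + i = l) (hk : i + 1 = k) (h : k + -2 = l) (α : Form 1 U)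
    (t : (N.sh i).sec U) : H.ins hl (E.coanchor U α) t =
      -(sg i • N.act h (H.δ hk U t α) ((N.sh (-2)).res le_top c)) := by
  refine H.eq_of_gen (A := fun U => Form 1 U) (F := N.sh l) (fun h a => Form.res h a)
    (fun {U} t a => H.ins hl (E.coanchor U a) t)
    (fun {U} t a => -(sg i • N.act h (H.δ hk U t a) ((N.sh (-2)).res le_top c)))
    (fun hV t a => (H.res_ins _ _ _ _).trans (by rw [E.res_coanchor]))
    (fun hV t a => ((map_neg ((N.sh l).res hV) _).trans (by
      rw [map_zsmul, N.res_act, H.res_δ, AbSheaf.res_res])))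
    (fun t t' a => by rw [map_add])
    (fun t t' a => by
      rw [map_add, AddMonoidHom.add_apply, N.add_act, smul_add, neg_add]) ?_ t α
  intro r U y hr v α
  obtain ⟨a1, a2⟩ : -1 + r + y.deg = l ∧ r + (y.deg + 1) = k := ◇
  have hs : sg i = sg r * sg y.deg := by rw [← hr, sg_add]
  change H.ins hl (E.coanchor U α) (N.act hr v (y.val j c)) =
    -(sg i • N.act h (H.δ hk U (N.act hr v (y.val j c)) α) ((N.sh (-2)).res le_top c))
  rw [H.ins_act_gen hl y hr rfl a1, H.δ_act_val _ y hr rfl a2, H.insGen_coanchor y hr hl rfl a2 h,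
    E.contr_coanchor, N.zero_act, zero_add, hs, smul_neg, smul_smul]

end IsCartan

namespace IsCartan
variable {E : PreCourant X} {N : DGMod X} {j : ∀ U : Opens X.pt, E.sec U →+ (N.sh (-1)).sec U}
  {c : (N.sh (-2)).sec ⊤} (H : IsCartan E N j c) {U V : Opens X.pt} {i k l m p q r : ℤ}

/-- The bracket `[y, t]` with a generator `y`. -/
def ad (y : Gen E.toOMod U) (h : y.deg + i = l) : (N.sh i).sec U →+ (N.sh l).sec U :=
  match y, h with
  | .c, _ => 0
  | .j e, h => H.ins h e
  | .D e, h => (N.D (by have : 0 + i = l := h; omega)).comp (H.ins rfl e) +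
      (H.ins (by have : 0 + i = l := h; omega) e).comp (N.D rfl)

lemma ad_D (e : E.sec U) (h : 0 + i = l) (h₁ : -1 + i = p) (h₂ : p + 1 = l) (h₃ : i + 1 = q)
    (h₄ : -1 + q = l) (t : (N.sh i).sec U) :
    H.ad (.D e) h t = N.D h₂ (H.ins h₁ e t) + H.ins h₄ e (N.D h₃ t) := by
  subst h₁ h₃; rfl

lemma res_ad (hV : V ≤ U) (y : Gen E.toOMod U) (h : y.deg + i = l)
    (h' : (y.res hV).deg + i = l) (t : (N.sh i).sec U) :
    (N.sh l).res hV (H.ad y h t) = H.ad (y.res hV) h' ((N.sh i).res hV t) := by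
  cases y with
  | c => exact map_zero _
  | j e => exact H.res_ins _ _ _ _
  | D e =>
    simp only [ad, Gen.res, AddMonoidHom.add_apply, AddMonoidHom.comp_apply, map_add]
    rw [N.res_D, H.res_ins, H.res_ins, N.res_D]

lemma act_ad (y : Gen E.toOMod U) (h : y.deg + i = l) (h' : y.deg + i = m) (hl : k + l = p)
    (hm : k + m = p) (w : Form k U) (t : (N.sh i).sec U) :
    N.act hl w (H.ad y h t) = N.act hm w (H.ad y h' t) := by
  subst h h'; rfl

/-- The bracket with a generator is a graded derivation. -/
lemma ad_act {i' l' k' : ℤ} (y : Gen E.toOMod U) (hl : y.deg + i = l) (h : k + i = i')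
    (hl' : y.deg + i' = l') (hk : y.deg + k = k') (h₁ : k' + i = l') (h₂ : k + l = l')
    (w : Form k U) (t : (N.sh i).sec U) : H.ad y hl' (N.act h w t) =
      N.act h₁ (y.der hk w) t + sg (y.deg * k) • N.act h₂ w (H.ad y hl t) := by
  cases y with
  | c =>
    have e1 : N.act h₁ (0 : Form k' U) t = 0 := N.zero_act _ _
    have e2 : N.act h₂ w (0 : (N.sh l).sec U) = 0 := N.act_zero _ _
    refine (add_zero (0 : (N.sh l').sec U)).symm.trans (congrArg₂ (· + ·) e1.symm ?_)
    refine (smul_zero _).symm.trans (congrArg (sg (-2 * k) • ·) e2.symm)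
  | j e =>
    refine (H.ins_act hl h hl' hk h₁ h₂ e w t).trans ?_
    rw [neg_mul, one_mul, sg_neg]; rfl
  | D e =>
    obtain rfl : k = k' := by have : 0 + k = k' := hk; omega
    obtain rfl : i = l := by have : 0 + i = l := hl; omega
    obtain rfl : i' = l' := by have : 0 + i' = l' := hl'; omega
    obtain ⟨a1, a2, a3, a4, a5, a6, a7, a8, a9, a10, a11, a12⟩ : -1 + i' + 1 = i' ∧ -1 + (i' + 1) =
      i' ∧ -1 + i + 1 = i ∧ -1 + (i + 1) = i ∧ -1 + k + i = -1 + i' ∧ k + (-1 + i) = -1 + i' ∧ k + 1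
      + i = i' + 1 ∧ k + (i + 1) = i' + 1 ∧ -1 + k + 1 = k ∧ -1 + k + (i + 1) = i' ∧ k + 1 + (-1 +
      i) = i' ∧ -1 + (k + 1) = k := ◇
    change H.ad (.D e) (zero_add i') (N.act h w t) = N.act h ((E.anchor e).lie w) t +
      sg (0 * k) • N.act h w (H.ad (.D e) (zero_add i) t)
    rw [H.ad_D e (zero_add i') rfl a1 rfl a2, H.ad_D e (zero_add i) rfl a3 rfl a4,
      H.ins_act rfl h rfl rfl a5 a6, N.D_act' h rfl a7 rfl a8 rfl, map_add, map_add, map_zsmul,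
      map_zsmul, N.D_act' a5 a1 h rfl a10 a9, N.D_act' a6 a1 a11 a3 h rfl,
      H.ins_act rfl a7 a2 a12 h a11, H.ins_act a4 a8 a2 rfl a10 h,
      VField.lie_eq _ rfl a9 rfl a12, N.add_act, N.act_add, zero_mul, sg_zero, one_smul, smul_add,
      smul_add, smul_smul, smul_smul, sg_mul_self, one_smul, sg_add, sg_add, sg_one, sg_neg, sg_one]
    simp only [mul_neg, mul_one, neg_mul, one_mul, neg_smul, one_smul]
    abel

lemma ad_smul_D (f : Fn U) (q : E.sec U) (h : 0 + i = i) (h₁ : -1 + i = l) (h₂ : 1 + l = i)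
    (h₃ : i + 1 = m) (h₄ : m + -1 = i) (t : (N.sh i).sec U) : H.ad (.D (f • q)) h t =
      N.act h (Form.ofFn f) (H.ad (.D q) h t) + N.act h₂ (Form.dFn f) (H.ins h₁ q t) -
        N.act (add_zero i) (H.δ (add_zero i) U t (Form.ofFn f)) (N.D (neg_add_cancel 1) (j U q)) -
        N.act h₄ (H.δ h₃ U t (Form.dFn f)) (j U q) := by
  obtain ⟨a1, a2, a3⟩ : l + 1 = i ∧ -1 + m = i ∧ i + -1 = l := ◇
  have hs : sg m = -sg i := by rw [← h₃, sg_add, sg_one, mul_neg_one]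
  rw [H.ad_D _ h h₁ a1 h₃ a2, H.ad_D _ h h₁ a1 h₃ a2, H.ins_smul h₁ a3, H.ins_smul a2 h₄, map_sub,
    map_zsmul, N.D_act' _ a1 h₂ a1 h (zero_add 1), N.D_act' a3 a1 h₄ (neg_add_cancel 1) (add_zero i) h₃,
    Form.d_ofFn, sg_zero, one_smul, N.act_add, H.δ_D h₃ (add_zero i) (add_zero m) h₃ (zero_add 1) h₃,
    Form.d_ofFn, N.sub_act, N.zsmul_act, smul_add, smul_sub, hs]
  simp only [neg_smul, smul_neg, sg_smul_smul]
  abel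

lemma ad_coanchor_D (h : 0 + i = i) (h₁ : (1 : ℤ) + 1 = 2) (h₂ : i + 2 = k) (h₃ : k + -2 = i)
    (α : Form 1 U) (t : (N.sh i).sec U) : H.ad (.D (E.coanchor U α)) h t =
      -N.act h₃ (H.δ h₂ U t (Form.d h₁ α)) ((N.sh (-2)).res le_top c) := by
  obtain ⟨a1, a2, a3, a4, a5⟩ : -1 + i + 1 = i ∧ -1 + (i + 1) = i ∧ i + 1 + -2 = -1 + i ∧ i + 1 + 1
    + -2 = i ∧ i + 1 + 1 = k := ◇
  rw [H.ad_D _ h rfl a1 rfl a2, H.ins_coanchor rfl rfl a3, H.ins_coanchor a2 a5 h₃, map_neg,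
    map_zsmul, H.D_mark a3 a1 a5 h₃, H.δ_D rfl rfl a5 h₂ h₁ a5, N.sub_act, N.zsmul_act, smul_sub,
    sg_add, sg_one]
  simp only [mul_neg, mul_one, neg_smul, sg_smul_smul]
  abel

lemma δ_smul (h : i + k = l) (h' : k + i = l) (f : Fn U) (w : Form k U) (t : (N.sh i).sec U) :
    H.δ h U t (f • w) = f • H.δ h U t w +
      sg (i * k) • Form.mul h' w (H.δ (add_zero i) U t (Form.ofFn f)) := by
  rw [← Form.mul_ofFn (add_zero k), H.δ_mul (add_zero k) h h (add_zero i) (add_zero l) h',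
    Form.mul_ofFn]

lemma exists_br (H : IsCartan E N j c) (h : i + m = l) :
    ∃ β : ∀ U, (N.sh m).sec U →+ (N.sh i).sec U →+ (N.sh l).sec U,
      (∀ {U V : Opens X.pt} (hV : V ≤ U) (b : (N.sh m).sec U) (t : (N.sh i).sec U),
        (N.sh l).res hV (β U b t) = β V ((N.sh m).res hV b) ((N.sh i).res hV t)) ∧
      ∀ {k : ℤ} {U : Opens X.pt} (y : Gen E.toOMod U) (hk : k + y.deg = m) (w : Form k U)
        (t : (N.sh i).sec U), β U (N.act hk w (y.val j c)) t =
          N.act ◇ (H.δ rfl U t w) (y.val j c) -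
            sg (i * m) • N.act ◇ w (H.ad y rfl t) := by
  refine H.lift (A := (N.sh i).pre) (F := N.sh l)
    { toFun := fun {k U} y hk w t => N.act ◇ (H.δ rfl U t w) (y.val j c) -
            sg (i * m) • N.act ◇ w (H.ad y rfl t)
      add_form := fun y hp w w' u => ?_
      add_param := fun y hp w u u' => ?_
      add_j := fun e e' hp w u => ?_
      add_D := fun e e' hp w u => ?_
      res := fun {p U V} hV y hp hp' w u => ?_
      smul_j := fun {p U} f e hp w u => ?_
      smul_D := fun {p q U} f e hp hq hpq w u => ?_
      κ_j := fun {p q U} α hp hq hpq w u => ?_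
      κ_D := fun {p q U} α hp hq hpq h2 w u => ?_ } fun hc p U hp w u => ?_
  · rw [map_add, N.add_act, N.add_act, smul_add]; abel
  · rw [map_add, map_add, AddMonoidHom.add_apply, N.add_act, N.act_add, smul_add]; abel
  · simp only [Gen.val, ad]
    rw [map_add, N.act_add, H.ins_add, N.act_add, smul_add]; abel
  · simp only [Gen.val, ad, AddMonoidHom.add_apply, AddMonoidHom.comp_apply]
    rw [map_add, map_add, N.act_add, H.ins_add, H.ins_add, map_add, N.act_add, N.act_add, N.act_add,
      N.act_add, N.act_add, smul_add, smul_add, smul_add, smul_add, smul_add]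
    abel
  · rw [map_sub, map_zsmul, N.res_act, N.res_act, H.res_δ, H.res_ad hV y rfl (by rw [Gen.deg_res]),
      H.res_gen hV y _ (by rw [Gen.deg_res]; omega), H.act_ad (y.res hV) _ rfl]
  · have a1 : i + -1 = -1 + i := ◇
    have a2 : p + i + -1 = l := by have : p + -1 = m := hp; omega
    obtain ⟨a3, a4⟩ : p + (i + -1) = l ∧ p + i = i + p := ◇
    have a5 : p + (-1 + i) = l := by have : p + -1 = m := hp; omega
    have hs : sg (i * m) = sg (i * p) * sg i := by
      have : p + -1 = m := hp
      rw [← this, mul_add, sg_add, mul_neg_one, sg_neg]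
    simp only [Gen.val, ad]
    rw [H.j_smul, N.act_ofFn, H.δ_smul rfl a4, N.add_act, N.zsmul_act, H.ins_smul rfl a1, N.act_sub,
      N.act_zsmul, N.act_ofFn, N.mul_act a4 a1 a5 _, hs, smul_sub, smul_smul, _root_.mul_assoc,
      sg_mul_self, mul_one]
    abel
  · obtain ⟨a1, a2, a3, a4, a5, a6, a7, a8, a9⟩ : -1 + i = i + -1 ∧ 1 + (i + -1) = i ∧ i + 1 + -1 =
      i ∧ p + i = l ∧ p + i = i + p ∧ p + (i + 1) = i + q ∧ i + p + 1 = i + q ∧ i + p + 0 = l ∧ q +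
      (i + -1) = l := ◇
    have hs : sg (i * m) = sg (i * p) := by
      have : p + 0 = m := hp
      rw [← this, add_zero]
    rw [H.act_ad (.D (f • e)) rfl (zero_add i) _ a4, H.act_ad (.D e) rfl (zero_add i) _ a4,
      H.act_ad (.j e) rfl a1 _ a9]
    simp only [Gen.val]
    rw [H.D_j_smul ◇, H.ad_smul_D f e (zero_add i) a1 a2 rfl a3, H.δ_smul rfl a5,
      H.δ_mul hpq rfl rfl rfl a7 a6, N.act_add, N.act_ofFn, N.act_sub, N.act_sub, N.act_add,
      N.act_ofFn, N.add_act, N.add_act, N.zsmul_act, N.zsmul_act,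
      N.mul_act a5 (add_zero i) a4 _, N.mul_act a6 a3 a4 _, N.mul_act a7 (by norm_num : 1 + -1 = (0 : ℤ)) a8 _,
      N.mul_act hpq a2 a4 a9, hs]
    simp only [smul_sub, smul_add, ad]
    abel
  · have a1 : -1 + i = i + -1 := ◇
    have a2 : 1 + -2 = (-1 : ℤ) := by norm_num
    obtain ⟨a3, a5, a6, a7, a8⟩ : i + 1 + -2 = -1 + i ∧ p + (-1 + i) = l ∧ p + (i + 1) = i + q ∧ i +
      p + 1 = i + q ∧ i + p + -1 = l := ◇
    have hs : sg (i * m) = sg (i * p) * sg i := by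
      have : p + -1 = m := hp
      rw [← this, mul_add, sg_add, mul_neg_one, sg_neg]
    simp only [Gen.val, ad]
    rw [H.j_κ a2, H.ins_coanchor rfl rfl a3, H.δ_mul hpq rfl rfl rfl a7 a6, N.add_act, N.zsmul_act,
      N.mul_act a7 a2 a8, N.mul_act a6 a3 a5, N.act_neg, N.act_zsmul, smul_neg, hs, smul_smul,
      _root_.mul_assoc, sg_mul_self, mul_one, AddMonoidHom.zero_apply, N.act_zero, smul_zero,
      sub_zero, sub_neg_eq_add]
  · have a2 : 2 + -2 = (0 : ℤ) := by norm_num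
    obtain ⟨a3, a4, a6, a7, a8⟩ : i + 2 + -2 = i ∧ p + i = l ∧ p + (i + 2) = i + q ∧ i + p + 2 = i +
      q ∧ i + p + 0 = l := ◇
    have hs : sg (i * m) = sg (i * p) := by
      have : p + 0 = m := hp
      rw [← this, add_zero]
    rw [H.act_ad (.D _) rfl (zero_add i) _ a4]
    simp only [Gen.val]
    rw [H.j_κ ◇, H.D_mark _ _ h2 a2, H.ad_coanchor_D _ h2 rfl a3,
      H.δ_mul hpq rfl rfl rfl a7 a6, N.add_act, N.zsmul_act,
      N.mul_act a7 a2 a8, N.mul_act a6 a3 a4, N.act_neg, hs]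
    simp only [ad]
    rw [AddMonoidHom.zero_apply, N.act_zero, smul_zero, sub_zero, smul_neg, sub_neg_eq_add]
  · have e : (N.sh (-2)).res (le_top : U ≤ ⊤) c = 0 := (congrArg _ hc).trans (map_zero _)
    simp only [Gen.val, ad]
    rw [e, N.act_zero, AddMonoidHom.zero_apply, N.act_zero, smul_zero, sub_zero]

end IsCartan

namespace IsCartan
variable {E : PreCourant X} {N : DGMod X} {j : ∀ U : Opens X.pt, E.sec U →+ (N.sh (-1)).sec U}
  {c : (N.sh (-2)).sec ⊤} (H : IsCartan E N j c) {U V : Opens X.pt} {i k l m p q r : ℤ}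

/-- The bracket of sections of `N`. -/
def br (h : i + m = l) (t : (N.sh i).sec U) : (N.sh m).sec U →+ (N.sh l).sec U :=
  ((H.exists_br h).choose U).flip t

lemma res_br (h : i + m = l) (hV : V ≤ U) (t : (N.sh i).sec U) (b : (N.sh m).sec U) :
    (N.sh l).res hV (H.br h t b) = H.br h ((N.sh i).res hV t) ((N.sh m).res hV b) :=
  (H.exists_br h).choose_spec.1 hV b t

lemma add_br (h : i + m = l) (t t' : (N.sh i).sec U) (b : (N.sh m).sec U) :
    H.br h (t + t') b = H.br h t b + H.br h t' b :=
  map_add ((H.exists_br h).choose U b) t t'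

lemma br_act_gen (h : i + m = l) (y : Gen E.toOMod U) (hk : k + y.deg = m) (hp : i + k = p)
    (h₁ : p + y.deg = l) (hq : y.deg + i = q) (h₂ : k + q = l) (w : Form k U) (t : (N.sh i).sec U) :
    H.br h t (N.act hk w (y.val j c)) = N.act h₁ (H.δ hp U t w) (y.val j c) -
      sg (i * m) • N.act h₂ w (H.ad y hq t) := by
  subst hp hq
  exact (H.exists_br h).choose_spec.2 y hk w t

lemma br_gen (y : Gen E.toOMod U) (h : i + y.deg = l) (h' : y.deg + i = l)
    (t : (N.sh i).sec U) : H.br h t (y.val j c) = -(sg (i * y.deg) • H.ad y h' t) := by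
  have := H.br_act_gen h y (zero_add _) (add_zero i) h h' (zero_add l) (Form.ofFn 1) t
  rwa [N.one_act, H.δ_one, N.zero_act, N.one_act, zero_sub] at this

/-- The Leibniz rule. -/
lemma br_act {m' l' : ℤ} (h : i + m = l) (hm : k + m = m') (h' : i + m' = l') (hp : i + k = p)
    (h₁ : p + m = l') (h₂ : k + l = l') (t : (N.sh i).sec U) (w : Form k U) (b : (N.sh m).sec U) :
    H.br h' t (N.act hm w b) =
      N.act h₁ (H.δ hp U t w) b + sg (i * k) • N.act h₂ w (H.br h t b) := by
  refine H.eq_of_gen (A := fun U => Form k U × (N.sh i).sec U) (F := N.sh l')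
    (fun h a => (Form.res h a.1, (N.sh i).res h a.2))
    (fun {U} b a => H.br h' a.2 (N.act hm a.1 b))
    (fun {U} b a => N.act h₁ (H.δ hp U a.2 a.1) b + sg (i * k) • N.act h₂ a.1 (H.br h a.2 b))
    (fun hV t a => (H.res_br _ _ _ _).trans (by rw [N.res_act]))
    (fun hV t a => ((map_add ((N.sh l').res hV) _ _).trans (by
      rw [map_zsmul, N.res_act, N.res_act, H.res_br, H.res_δ])))
    (fun t t' a => by rw [N.act_add, map_add])
    (fun t t' a => by
      rw [map_add, N.act_add, N.act_add, smul_add, add_add_add_comm]) ?_ b (w, t)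
  rintro r U y hr v ⟨w, t⟩
  obtain ⟨a1, a2, a3, a4, a5, a6, a7, a8⟩ : k + r + y.deg = m' ∧ i + r + y.deg = l ∧ r + (y.deg + i)
    = l ∧ p + r + y.deg = l' ∧ p + r = i + (k + r) ∧ k + (i + r) = i + (k + r) ∧ i + (k + r) + y.deg
    = l' ∧ k + r + (y.deg + i) = l' := ◇
  have hs : sg (i * m') = sg (i * k) * sg (i * m) := by rw [← sg_add, ← mul_add, hm]
  change H.br h' t (N.act hm w (N.act hr v (y.val j c))) =
    N.act h₁ (H.δ hp U t w) (N.act hr v (y.val j c)) +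
      sg (i * k) • N.act h₂ w (H.br h t (N.act hr v (y.val j c)))
  rw [← N.mul_act rfl hr hm a1, H.br_act_gen h' y a1 rfl a7 rfl a8,
    H.br_act_gen h y hr rfl a2 rfl a3, H.δ_mul rfl rfl hp rfl a5 a6, N.act_sub, N.act_zsmul,
    N.add_act, N.zsmul_act, N.mul_act a5 hr h₁, N.mul_act a6 a2 h₂, N.mul_act rfl a3 h₂, hs,
    smul_sub, smul_smul]
  abel

/-- The Leibniz rule in the first variable. -/
lemma act_br {i' l' : ℤ} (h : i + m = l) (hi : k + i = i') (h' : i' + m = l') (hp : m + k = p)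
    (h₁ : p + i = l') (h₂ : k + l = l') (w : Form k U) (t : (N.sh i).sec U) (b : (N.sh m).sec U) :
    H.br h' (N.act hi w t) b =
      N.act h₂ w (H.br h t b) - sg (i' * m) • N.act h₁ (H.δ hp U b w) t := by
  refine H.eq_of_gen (A := fun U => Form k U × (N.sh i).sec U) (F := N.sh l')
    (fun h a => (Form.res h a.1, (N.sh i).res h a.2))
    (fun {U} b a => H.br h' (N.act hi a.1 a.2) b)
    (fun {U} b a => N.act h₂ a.1 (H.br h a.2 b) - sg (i' * m) • N.act h₁ (H.δ hp U b a.1) a.2)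
    (fun hV t a => (H.res_br _ _ _ _).trans (by rw [N.res_act]))
    (fun hV t a => ((map_sub ((N.sh l').res hV) _ _).trans (by
      rw [map_zsmul, N.res_act, N.res_act, H.res_br, H.res_δ])))
    (fun t t' a => by rw [map_add])
    (fun t t' a => by
      rw [map_add, map_add, AddMonoidHom.add_apply, N.add_act, N.act_add, smul_add,
        add_sub_add_comm]) ?_ b (w, t)
  rintro r U y hr v ⟨w, t⟩
  obtain ⟨a1, a2, a3, a4, a5, a6, a7, a8⟩ : i' + r + y.deg = l' ∧ r + (y.deg + i') = l' ∧ i + r +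
    y.deg = l ∧ r + (y.deg + i) = l ∧ r + (y.deg + k) = p ∧ y.deg + k + i = y.deg + i' ∧ k + (y.deg
    + i) = y.deg + i' ∧ k + (i + r) = i' + r := ◇
  have a9 : r + k = k + r := add_comm _ _
  have a10 : k + r + (y.deg + i) = l' := ◇
  have hs : sg (i' * m) * sg (y.deg * k) = sg (i * m) * sg (k * r) := by
    have : sg (k * m) = sg (y.deg * k) * sg (k * r) := by
      rw [← hr, mul_add, sg_add, _root_.mul_comm k y.deg, _root_.mul_comm]
    rw [← hi, _root_.add_mul, sg_add, this]
    linear_combination sg (i * m) * sg (k * r) * sg_mul_self (y.deg * k)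
  change H.br h' (N.act hi w t) (N.act hr v (y.val j c)) =
    N.act h₂ w (H.br h t (N.act hr v (y.val j c))) -
      sg (i' * m) • N.act h₁ (H.δ hp U (N.act hr v (y.val j c)) w) t
  rw [H.br_act_gen h' y hr rfl a1 rfl a2, H.br_act_gen h y hr rfl a3 rfl a4,
    H.δ_act_val hp y hr rfl a5, H.ad_act y rfl hi rfl rfl a6 a7, H.δ_act rfl hi rfl a8,
    N.mul_act a8 a3 h₂, N.mul_act a5 a6 a2, N.act_sub, N.act_zsmul, N.act_add, N.act_zsmul, smul_add,
    smul_smul, hs, ← N.mul_act a9 a7 a2 a10, Form.mul_comm a9 rfl, N.zsmul_act, N.mul_act rfl a4 h₂,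
    smul_smul]
  have hs2 : sg (i * m) * sg (k * r) * sg (r * k) = sg (i * m) := by
    rw [_root_.mul_comm r k, _root_.mul_assoc, sg_mul_self, mul_one]
  rw [hs2]
  abel

lemma ad_D_c (e : E.sec U) (h : 0 + -2 = (-2 : ℤ)) :
    H.ad (.D e) h ((N.sh (-2)).res le_top c) = 0 := by
  have e1 : N.D ◇ ((N.sh (-2)).res (le_top : U ≤ ⊤) c) = (0 : (N.sh (-1)).sec U) :=
    (N.res_D _ _ _).symm.trans ((congrArg _ (H.D_c _)).trans (map_zero _))
  rw [H.ad_D e h (rfl : _ = -3) ◇ (rfl : _ = -1) ◇, H.ins_c]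
  refine (congrArg₂ (· + ·) (map_zero _) ((congrArg _ e1).trans (map_zero _))).trans (add_zero 0)

lemma ad_D_j (e e' : E.sec U) (h : 0 + -1 = (-1 : ℤ)) : H.ad (.D e) h (j U e') = j U (E.br e e') := by
  have h2 : (0 : ℤ) + -2 = -2 := by norm_num
  have h1 : (1 : ℤ) + -2 = -1 := by norm_num
  rw [H.ad_D e h (by norm_num : _ = -2) ◇ (neg_add_cancel 1) ◇,
    H.ins_j _ h2, H.D_mark _ _ (zero_add 1) h1, H.ins_D, Form.d_ofFn, ← H.j_κ, ← E.br_symm, map_add]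
  abel

lemma ad_D_D (e e' : E.sec U) (h : 0 + 0 = (0 : ℤ)) :
    H.ad (.D e) h (N.D (neg_add_cancel 1) (j U e')) = N.D (neg_add_cancel 1) (j U (E.br e e')) := by
  have h1 : (1 : ℤ) + -2 = -1 := by norm_num
  have h2 : (2 : ℤ) + -2 = 0 := by norm_num
  have e1 : N.D (neg_add_cancel 1) (j U (E.br e e' + E.br e' e)) = 0 := by
    rw [E.br_symm, H.j_κ h1, H.D_mark _ _ one_add_one_eq_two h2, Form.d_dFn, N.zero_act]
  rw [map_add, map_add] at e1
  rw [H.ad_D e h (add_zero _) (neg_add_cancel 1) (zero_add 1) (neg_add_cancel 1), N.D_D, map_zero,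
    add_zero, H.ins_D, map_neg, eq_neg_of_add_eq_zero_left e1]

lemma ad_c (y : Gen E.toOMod U) (h : y.deg + -2 = l) :
    H.ad y h ((N.sh (-2)).res le_top c) = 0 := by
  cases y with
  | c => rfl
  | j e => exact H.ins_c h e
  | D e => 
    obtain rfl : -2 = l := by have : 0 + -2 = l := h; omega
    exact H.ad_D_c e h

lemma ad_symm (y y' : Gen E.toOMod U) (h : y.deg + y'.deg = l) (h' : y'.deg + y.deg = l) :
    H.ad y h (y'.val j c) = -(sg (y.deg * y'.deg) • H.ad y' h' (y.val j c)) := by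
  cases y' with
  | c =>
    refine (H.ad_c y h).trans ?_
    change 0 = -(_ • (0 : (N.sh l).sec U))
    rw [smul_zero, neg_zero]
  | j e' => cases y with
    | c =>
      refine Eq.trans ?_ (congrArg (fun x => -(sg _ • x)) (H.ad_c (.j e') h').symm)
      change (0 : (N.sh l).sec U) = -(_ • (0 : (N.sh l).sec U))
      rw [smul_zero, neg_zero]
    | j e =>
      have h2 : 0 + -2 = l := by have : -1 + -1 = l := h; omega
      have hs : -sg (-1 * -1) = 1 := by rw [sg_sq, sg_neg, sg_one, neg_neg]
      refine (H.ins_j h h2 e e').trans ?_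
      refine Eq.trans ?_ (congrArg (fun x => -(sg _ • x)) (H.ins_j h h2 e' e).symm)
      rw [← neg_smul, hs, one_smul, E.pair_symm]
    | D e =>
      have hl : -1 = l := h
      subst hl
      refine (H.ad_D_j e e' h).trans ?_
      refine Eq.trans ?_ (congrArg (fun x => -(sg _ • x)) (H.ins_D h' e' e).symm)
      rw [zero_mul, sg_zero, one_smul, neg_neg]
  | D e' => cases y with
    | c =>
      refine Eq.trans ?_ (congrArg (fun x => -(sg _ • x)) (H.ad_c (.D e') h').symm)
      change (0 : (N.sh l).sec U) = -(_ • (0 : (N.sh l).sec U))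
      rw [smul_zero, neg_zero]
    | j e =>
      have hl : -1 = l := h
      subst hl
      refine (H.ins_D h e e').trans ?_
      refine Eq.trans ?_ (congrArg (fun x => -(sg _ • x)) (H.ad_D_j e' e h').symm)
      rw [mul_zero, sg_zero, one_smul]
    | D e =>
      have hl : 0 = l := h
      subst hl
      have h1 : (1 : ℤ) + -2 = -1 := by norm_num
      have h2 : (2 : ℤ) + -2 = 0 := by norm_num
      have e1 : N.D (neg_add_cancel 1) (j U (E.br e e' + E.br e' e)) = 0 := by
        rw [E.br_symm, H.j_κ h1, H.D_mark _ _ one_add_one_eq_two h2, Form.d_dFn, N.zero_act]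
      rw [map_add, map_add] at e1
      refine (H.ad_D_D e e' h).trans ?_
      refine Eq.trans ?_ (congrArg (fun x => -(sg _ • x)) (H.ad_D_D e' e h').symm)
      rw [zero_mul, sg_zero, one_smul, eq_neg_of_add_eq_zero_left e1]

lemma gen_br (y : Gen E.toOMod U) (h : y.deg + m = l) (b : (N.sh m).sec U) :
    H.br h (y.val j c) b = H.ad y h b := by
  have key : ∀ {r : ℤ} {U : Opens X.pt} (y y' : Gen E.toOMod U) (h : y.deg + m = l)
      (hr : r + y'.deg = m) (v : Form r U), H.br h (y.val j c) (N.act hr v (y'.val j c)) =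
        H.ad y h (N.act hr v (y'.val j c)) := by
    intro r U y y' h hr v
    obtain ⟨a1, a2, a3⟩ : y.deg + r + y'.deg = l ∧ r + (y'.deg + y.deg) = l ∧ r + (y.deg + y'.deg) =
      l := ◇
    have a4 : y.deg + y'.deg = y'.deg + y.deg := add_comm _ _
    have hs : sg (y.deg * m) = sg (y.deg * r) * sg (y.deg * y'.deg) := by
      rw [← hr, mul_add, sg_add]
    rw [H.br_act_gen h y' hr rfl a1 rfl a2, H.ad_act y a4 hr h rfl a1 a2, H.δ_val,
      H.ad_symm y y' a4 rfl, hs, N.act_neg, N.act_zsmul, smul_neg, smul_smul, sub_eq_add_neg]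
  cases y with
  | c =>
    exact H.eq_of_gen (A := fun U => PUnit) (F := N.sh l) (fun h a => a)
      (fun {U} b _ => H.br h ((Gen.c : Gen E.toOMod U).val j c) b) (fun {U} b a => H.ad (Gen.c : Gen E.toOMod U) h b)
      (fun hV t a => (H.res_br _ _ _ _).trans (by simp only [Gen.val]; rw [AbSheaf.res_res]))
      (fun hV t a => H.res_ad hV .c h h _) (fun t t' a => by rw [map_add])
      (fun t t' a => by rw [map_add]) (fun y' hr v _ => key .c y' h hr v) b PUnit.unit
  | j e =>
    exact H.eq_of_gen (A := fun U => E.sec U) (F := N.sh l) (fun h a => E.res h a)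
      (fun {U} b e => H.br h ((Gen.j e : Gen E.toOMod U).val j c) b) (fun {U} b e => H.ad (.j e) h b)
      (fun hV t a => (H.res_br _ _ _ _).trans (by simp only [Gen.val]; rw [H.res_j]))
      (fun hV t a => H.res_ad hV (.j a) h h _) (fun t t' a => by rw [map_add])
      (fun t t' a => by rw [map_add]) (fun y' hr v e => key (.j e) y' h hr v) b e
  | D e =>
    exact H.eq_of_gen (A := fun U => E.sec U) (F := N.sh l) (fun h a => E.res h a)
      (fun {U} b e => H.br h ((Gen.D e : Gen E.toOMod U).val j c) b) (fun {U} b e => H.ad (.D e) h b)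
      (fun hV t a => (H.res_br _ _ _ _).trans (by simp only [Gen.val]; rw [N.res_D, H.res_j]))
      (fun hV t a => H.res_ad hV (.D a) h h _) (fun t t' a => by rw [map_add])
      (fun t t' a => by rw [map_add]) (fun y' hr v e => key (.D e) y' h hr v) b e

lemma br_symm (h : i + m = l) (h' : m + i = l) (a : (N.sh i).sec U) (b : (N.sh m).sec U) :
    H.br h a b = -(sg (i * m) • H.br h' b a) := by
  refine H.eq_of_gen (A := fun U => (N.sh i).sec U) (F := N.sh l) (fun h a => (N.sh i).res h a)
    (fun {U} b a => H.br h a b) (fun {U} b a => -(sg (i * m) • H.br h' b a))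
    (fun hV t a => (H.res_br _ _ _ _))
    (fun hV t a => (map_neg ((N.sh l).res hV) _).trans (by rw [map_zsmul, H.res_br]))
    (fun t t' a => by rw [map_add]) (fun t t' a => by rw [H.add_br, smul_add, neg_add]) ?_ b a
  intro r U y hr v a
  obtain ⟨a1, a2⟩ : i + r + y.deg = l ∧ r + (y.deg + i) = l := ◇
  change H.br h a (N.act hr v (y.val j c)) = -(sg (i * m) • H.br h' (N.act hr v (y.val j c)) a)
  rw [H.br_act_gen h y hr rfl a1 rfl a2, H.act_br rfl hr h' rfl a1 a2, H.gen_br, smul_sub,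
    _root_.mul_comm m i, sg_smul_smul]
  abel

end IsCartan

namespace IsCartan
variable {E : PreCourant X} {N : DGMod X} {j : ∀ U : Opens X.pt, E.sec U →+ (N.sh (-1)).sec U}
  {c : (N.sh (-2)).sec ⊤} (H : IsCartan E N j c) {U V : Opens X.pt} {i k l m n p q r : ℤ}

lemma zero_br (h : i + m = l) (b : (N.sh m).sec U) : H.br h (0 : (N.sh i).sec U) b = 0 :=
  map_zero (AddMonoidHom.mk' (fun a => H.br h a b) fun a a' => H.add_br h a a' b)

lemma neg_br (h : i + m = l) (a : (N.sh i).sec U) (b : (N.sh m).sec U) :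
    H.br h (-a) b = -H.br h a b :=
  map_neg (AddMonoidHom.mk' (fun a => H.br h a b) fun a a' => H.add_br h a a' b) a

lemma zsmul_br (h : i + m = l) (z : ℤ) (a : (N.sh i).sec U) (b : (N.sh m).sec U) :
    H.br h (z • a) b = z • H.br h a b :=
  map_zsmul (AddMonoidHom.mk' (fun a => H.br h a b) fun a a' => H.add_br h a a' b) z a

lemma c_br (h : -2 + m = l) (b : (N.sh m).sec U) :
    H.br h ((N.sh (-2)).res le_top c) b = 0 := H.gen_br .c h b

lemma br_c (h : m + -2 = l) (b : (N.sh m).sec U) :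
    H.br h b ((N.sh (-2)).res le_top c) = 0 := by
  rw [H.br_symm h ◇, H.c_br, smul_zero, neg_zero]

lemma br_j_j (h : -1 + -1 = l) (h' : 0 + -2 = l) (e e' : E.sec U) : H.br h (j U e) (j U e') =
    N.act h' (Form.ofFn (E.pair e e')) ((N.sh (-2)).res le_top c) :=
  (H.gen_br (.j e) h _).trans (H.ins_j _ _ _ _)

lemma br_j_D (h : -1 + 0 = (-1 : ℤ)) (e e' : E.sec U) :
    H.br h (j U e) (N.D (neg_add_cancel 1) (j U e')) = -j U (E.br e' e) :=
  (H.gen_br (.j e) h _).trans (H.ins_D _ _ _)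

lemma br_D_j (h : 0 + -1 = (-1 : ℤ)) (e e' : E.sec U) :
    H.br h (N.D (neg_add_cancel 1) (j U e)) (j U e') = j U (E.br e e') :=
  (H.gen_br (.D e) h _).trans (H.ad_D_j _ _ _)

lemma br_D_D (h : 0 + 0 = (0 : ℤ)) (e e' : E.sec U) :
    H.br h (N.D (neg_add_cancel 1) (j U e)) (N.D (neg_add_cancel 1) (j U e')) =
      N.D (neg_add_cancel 1) (j U (E.br e e')) :=
  (H.gen_br (.D e) h _).trans (H.ad_D_D _ _ _)

include H in
lemma D_c' (h : -2 + 1 = l) : N.D h ((N.sh (-2)).res (le_top : U ≤ ⊤) c) = 0 :=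
  (N.res_D _ _ _).symm.trans ((congrArg _ (H.D_c _)).trans (map_zero _))

/-- The differential is a derivation of the bracket. -/
lemma D_br {i' m' l' : ℤ} (h : i + m = l) (hi : i + 1 = i') (hm : m + 1 = m') (hl : l + 1 = l')
    (h₁ : i' + m = l') (h₂ : i + m' = l') (a : (N.sh i).sec U) (b : (N.sh m).sec U) :
    N.D hl (H.br h a b) = H.br h₁ (N.D hi a) b + sg i • H.br h₂ a (N.D hm b) := by
  refine H.eq_of_gen (A := fun U => (N.sh i).sec U) (F := N.sh l') (fun h a => (N.sh i).res h a)
    (fun {U} b a => N.D hl (H.br h a b))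
    (fun {U} b a => H.br h₁ (N.D hi a) b + sg i • H.br h₂ a (N.D hm b))
    (fun hV t a => (N.res_D _ _ _).trans (by rw [H.res_br]))
    (fun hV t a => ((map_add ((N.sh l').res hV) _ _).trans (by
      rw [map_zsmul, H.res_br, N.res_D, H.res_br, N.res_D])))
    (fun t t' a => by rw [map_add, map_add])
    (fun t t' a => by rw [map_add, map_add, map_add, smul_add, add_add_add_comm]) ?_ b a
  intro r U y hr w a
  have key : ∀ {y' l l' : ℤ} (h : i + y.deg = l) (hi : i + 1 = i') (hm : y.deg + 1 = y')
      (hl : l + 1 = l') (h₁ : i' + y.deg = l') (h₂ : i + y' = l'), N.D hl (H.br h a (y.val j c)) =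
        H.br h₁ (N.D hi a) (y.val j c) + sg i • H.br h₂ a (N.D hm (y.val j c)) := by
    intro y' l l' h hi hm hl h₁ h₂
    cases y with
    | c =>
      simp only [Gen.val]
      rw [H.br_c, H.br_c, H.D_c', map_zero, map_zero, smul_zero, add_zero]
    | j e =>
      obtain rfl : 0 = y' := hm
      obtain ⟨a1, a2, a3⟩ : -1 + i = l ∧ -1 + i' = l' ∧ 0 + i = l' := ◇
      have hs : sg (i * -1) = sg i := by rw [mul_neg_one, sg_neg]
      have hs' : sg (i' * -1) = -sg i := by rw [mul_neg_one, sg_neg, ← hi, sg_add, sg_one, mul_neg_one]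
      have e1 := H.br_gen (.j e) h a1 a
      have e2 := H.br_gen (.j e) h₁ a2 (N.D hi a)
      have e3 := H.br_gen (.D e) h₂ a3 a
      rw [H.ad_D e a3 a1 hl hi a2, mul_zero, sg_zero, one_smul] at e3
      rw [hs] at e1
      rw [hs'] at e2
      rw [e1, e2]
      refine Eq.trans ?_ (congrArg (fun x => _ + sg i • x) e3.symm)
      rw [map_neg, map_zsmul]
      change -(sg i • N.D hl (H.ins a1 e a)) = -(-sg i • H.ins a2 e (N.D hi a)) + _
      rw [smul_neg, smul_add, neg_smul]
      abel
    | D e =>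
      have a1 : 0 + i = l := by have : i + 0 = l := h; omega
      have a2 : 0 + i' = l' := by have : i' + 0 = l' := h₁; omega
      obtain rfl : i = l := ◇
      obtain rfl : i' = l' := ◇
      have e1 := H.br_gen (.D e) h a1 a
      have e2 := H.br_gen (.D e) h₁ a2 (N.D hi a)
      obtain ⟨a3, a4, a5⟩ : -1 + i + 1 = i ∧ -1 + i' = i ∧ -1 + (i' + 1) = i' := ◇
      rw [H.ad_D e a1 rfl a3 hi a4, mul_zero, sg_zero, one_smul] at e1
      rw [H.ad_D e a2 a4 hl rfl a5, mul_zero, sg_zero, one_smul, N.D_D, map_zero, add_zero] at e2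
      rw [e1, e2]
      have e4 : N.D hm ((Gen.D e : Gen E.toOMod U).val j c) = 0 := N.D_D _ _ _
      rw [e4, map_neg, map_add, N.D_D, map_zero, smul_zero, add_zero, zero_add]
  obtain ⟨a1, a2, a3, a4, a5, a6, a7, a8, a9, a10, a11, a12, a13, a14⟩ : i + r + y.deg = l ∧ r + (i
    + y.deg) = l ∧ i' + r + y.deg = l' ∧ r + (i' + y.deg) = l' ∧ r + (y.deg + 1) = m' ∧ r + 1 +
    y.deg = m' ∧ i + r + (y.deg + 1) = l' ∧ r + (i' + y.deg) = l' ∧ i + (r + 1) + y.deg = l' ∧ r + 1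
    + (i + y.deg) = l' ∧ i + r + 1 = i' + r ∧ i + (r + 1) = i' + r ∧ i + y.deg + 1 = i' + y.deg ∧ i
    + (y.deg + 1) = i' + y.deg := ◇
  have h1 : sg (i' * r) = sg (i * r) * sg r := by rw [← hi, add_mul, sg_add, one_mul]
  have h2 : sg (i * (r + 1)) = sg (i * r) * sg i := by rw [mul_add, sg_add, mul_one]
  have h3 : sg (i + r) = sg i * sg r := sg_add i r
  have h4 : sg i * (sg (i * r) * sg i) = sg (i * r) := by
    rw [_root_.mul_comm, _root_.mul_assoc, sg_mul_self, mul_one]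
  change N.D hl (H.br h a (N.act hr w (y.val j c))) = H.br h₁ (N.D hi a) (N.act hr w (y.val j c)) +
    sg i • H.br h₂ a (N.D hm (N.act hr w (y.val j c)))
  rw [H.br_act rfl hr h rfl a1 a2, H.br_act rfl hr h₁ rfl a3 a4, N.D_act' hr hm a6 rfl a5 rfl,
    map_add, map_add, map_zsmul, map_zsmul, H.br_act a14 a5 h₂ rfl a7 a8, H.br_act rfl a6 h₂ a12 a3 a10,
    N.D_act' a1 hl a3 rfl a7 a11, N.D_act' a2 hl a10 a13 a4 rfl, key rfl hi rfl a13 rfl a14,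
    H.δ_D hi rfl rfl a12 rfl a11, N.sub_act, N.zsmul_act, h1, h2, h3, N.act_add,
    N.act_zsmul]
  simp only [smul_add, smul_smul, smul_sub, h4]
  module

lemma δ_c (h : -2 + k = l) (u : Form k U) : H.δ h U ((N.sh (-2)).res le_top c) u = 0 :=
  H.δ_val .c h u

lemma δ_j (h : -1 + k = l) (e : E.sec U) (u : Form k U) :
    H.δ h U (j U e) u = (E.anchor e).contr h u :=
  H.δ_val (.j e) h u

lemma δ_Dj (h : 0 + k = k) (e : E.sec U) (u : Form k U) :
    H.δ h U (N.D (neg_add_cancel 1) (j U e)) u = (E.anchor e).lie u :=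
  H.δ_val (.D e) h u

lemma δ_ad_gen (y y' : Gen E.toOMod U) (h : y.deg + y'.deg = i) (h₁ : i + k = p)
    (h₂ : y'.deg + k = l) (h₃ : y.deg + l = p) (h₄ : y.deg + k = m) (h₅ : y'.deg + m = p)
    (u : Form k U) : H.δ h₁ U (H.ad y h (y'.val j c)) u =
      y.der h₃ (y'.der h₂ u) - sg (y.deg * y'.deg) • y'.der h₅ (y.der h₄ u) := by
  cases y with
  | c =>
    refine Eq.trans ?_ (congrArg₂ (· - sg (-2 * y'.deg) • ·)
      (rfl : (0 : Form p U) = _) (map_zero (y'.der h₅)).symm)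
    change H.δ h₁ U 0 u = 0 - sg (-2 * y'.deg) • 0
    rw [map_zero, smul_zero, sub_zero]; rfl
  | j e => cases y' with
    | c =>
      refine Eq.trans ?_ (congrArg₂ (· - sg (-1 * -2) • ·)
        (map_zero ((E.anchor e).contr h₃)).symm (rfl : (0 : Form p U) = _))
      rw [smul_zero, sub_zero]
      refine (congrArg (fun t => H.δ h₁ U t u) (H.ad_c (.j e) h)).trans ?_
      rw [map_zero]; rfl
    | j e' =>
      have a1 : 0 + -2 = i := by have : -1 + -1 = i := h; omega
      obtain ⟨a2, a3⟩ : -2 + k = p ∧ 0 + p = p := ◇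
      have hs : sg (-1 * -1) = -1 := by rw [sg_sq, sg_neg, sg_one]
      refine (congrArg (fun t => H.δ h₁ U t u) (H.ins_j h a1 e e')).trans ?_
      rw [H.δ_act a2 a1 h₁ a3, H.δ_c, Form.mul_zero]
      refine Eq.trans ?_ (congrArg (fun z => _ - z • _) hs.symm)
      rw [neg_smul, one_smul, sub_neg_eq_add]
      refine eq_add_of_sub_eq ((zero_sub _).trans ?_)
      obtain rfl : l = m := by
        have : -1 + k = l := h₂
        have : -1 + k = m := h₄
        omega
      exact (VField.contr_contr (E.anchor e) (E.anchor e') h₄ h₅ u).symm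
    | D e' =>
      obtain rfl : k = l := by have : 0 + k = l := h₂; omega
      obtain rfl : m = p := by have : 0 + m = p := h₅; omega
      have hi : -1 = i := h
      subst hi
      refine (congrArg (fun t => H.δ h₁ U t u) (H.ins_D h e e')).trans ?_
      rw [map_neg, AddMonoidHom.neg_apply, H.δ_j, E.lie_contr, mul_zero, sg_zero, one_smul, neg_sub]
      rfl
  | D e =>
    obtain rfl : k = m := by have : 0 + k = m := h₄; omega
    obtain rfl : l = p := by have : 0 + l = p := h₃; omega
    cases y' with
    | c =>
      refine Eq.trans ?_ (congrArg₂ (· - sg (0 * -2) • ·)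
        (map_zero (E.anchor e).lie).symm (rfl : (0 : Form l U) = _))
      rw [smul_zero, sub_zero]
      refine (congrArg (fun t => H.δ h₁ U t u) (H.ad_c (.D e) h)).trans ?_
      rw [map_zero]; rfl
    | j e' =>
      have hi : -1 = i := h
      subst hi
      refine (congrArg (fun t => H.δ h₁ U t u) (H.ad_D_j e e' h)).trans ?_
      rw [H.δ_j, E.lie_contr, zero_mul, sg_zero, one_smul]
      rfl
    | D e' =>
      have hi : 0 = i := h
      subst hi
      obtain rfl : k = l := by have : 0 + k = l := h₂; omega
      refine (congrArg (fun t => H.δ h₁ U t u) (H.ad_D_D e e' h)).trans ?_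
      rw [H.δ_Dj, E.lie_lie, zero_mul, sg_zero, one_smul]
      rfl

lemma δ_ad (y : Gen E.toOMod U) (h : y.deg + i = n) (h₁ : n + k = p)
    (h₂ : i + k = l) (h₃ : y.deg + l = p) (h₄ : y.deg + k = m) (h₅ : i + m = p)
    (b : (N.sh i).sec U) (u : Form k U) : H.δ h₁ U (H.ad y h b) u =
      y.der h₃ (H.δ h₂ U b u) - sg (y.deg * i) • H.δ h₅ U b (y.der h₄ u) := by
  have key : ∀ (d : ℤ) (h : d + i = n) (h₃ : d + l = p) (h₄ : d + k = m) (b : (N.sh i).sec U)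
      (a : {y : Gen E.toOMod U // y.deg = d} × Form k U),
      H.δ h₁ U (H.ad a.1.1 (by rw [a.1.2, h]) b) a.2 =
        a.1.1.der (by rw [a.1.2, h₃]) (H.δ h₂ U b a.2) -
          sg (d * i) • H.δ h₅ U b (a.1.1.der (by rw [a.1.2, h₄]) a.2) := by
    intro d h h₃ h₄ b a
    refine H.eq_of_gen (A := fun U => {y : Gen E.toOMod U // y.deg = d} × Form k U)
      (F := Form.sheaf X p)
      (fun h a => (⟨a.1.1.res h, (Gen.deg_res _ _).trans a.1.2⟩, Form.res h a.2))
      (fun {U} b a => H.δ h₁ U (H.ad a.1.1 (by rw [a.1.2, h]) b) a.2)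
      (fun {U} b a => a.1.1.der (by rw [a.1.2, h₃]) (H.δ h₂ U b a.2) -
        sg (d * i) • H.δ h₅ U b (a.1.1.der (by rw [a.1.2, h₄]) a.2))
      (fun hV t a => (H.res_δ _ _ _ _).trans (by rw [H.res_ad]))
      (fun hV t a => ((map_sub (Form.res hV) _ _).trans (by
        rw [map_zsmul, H.res_δ, Gen.res_der hV, Gen.res_der hV, H.res_δ])))
      (fun t t' a => by rw [map_add, map_add, AddMonoidHom.add_apply])
      (fun t t' a => by
        rw [map_add, map_add, AddMonoidHom.add_apply, AddMonoidHom.add_apply, map_add, smul_add,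
          add_sub_add_comm]) ?_ b a
    rintro r U y' hr v ⟨⟨y, rfl⟩, u⟩
    obtain ⟨a1, a2, a3, a4, a5, a6, a7⟩ : y.deg + r + y'.deg = n ∧ r + (y.deg + y'.deg) = n ∧ y.deg
      + r + (y'.deg + k) = p ∧ y.deg + y'.deg + k = y.deg + (y'.deg + k) ∧ r + (y.deg + (y'.deg +
      k)) = p ∧ r + (y'.deg + k) = l ∧ y'.deg + m = y.deg + (y'.deg + k) := ◇
    change H.δ h₁ U (H.ad y h (N.act hr v (y'.val j c))) u =
        y.der h₃ (H.δ h₂ U (N.act hr v (y'.val j c)) u) -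
          sg (y.deg * i) • H.δ h₅ U (N.act hr v (y'.val j c)) (y.der h₄ u)
    have hs : sg (y.deg * i) = sg (y.deg * r) * sg (y.deg * y'.deg) := by rw [← hr, mul_add, sg_add]
    rw [H.ad_act y rfl hr h rfl a1 a2, map_add, map_zsmul, AddMonoidHom.add_apply,
      AddMonoidHom.smul_apply, H.δ_act_val h₁ y' a1 rfl a3, H.δ_act a4 a2 h₁ a5,
      H.δ_ad_gen y y' rfl a4 rfl rfl h₄ a7, H.δ_act_val h₂ y' hr rfl a6,
      Gen.der_mul y a6 h₃ rfl rfl a3 a5, H.δ_act_val h₅ y' hr a7 a5, hs, sub_eq_add_neg (y.der _ _),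
      Form.mul_add, Form.mul_neg, Form.mul_zsmul, smul_add, smul_neg, smul_smul]
    abel
  exact key _ h h₃ h₄ b (⟨y, rfl⟩, u)

/-- The action on forms is a morphism of Lie algebras. -/
lemma δ_br {ij ik jk : ℤ} (h : i + m = ij) (hik : i + k = ik) (hjk : m + k = jk)
    (h₁ : ij + k = l) (h₂ : i + jk = l) (h₃ : m + ik = l) (a : (N.sh i).sec U)
    (b : (N.sh m).sec U) (u : Form k U) : H.δ h₁ U (H.br h a b) u =
      H.δ h₂ U a (H.δ hjk U b u) - sg (i * m) • H.δ h₃ U b (H.δ hik U a u) := by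
  refine H.eq_of_gen (A := fun U => (N.sh i).sec U × Form k U) (F := Form.sheaf X l)
    (fun h a => ((N.sh i).res h a.1, Form.res h a.2))
    (fun {U} b a => H.δ h₁ U (H.br h a.1 b) a.2)
    (fun {U} b a => H.δ h₂ U a.1 (H.δ hjk U b a.2) - sg (i * m) • H.δ h₃ U b (H.δ hik U a.1 a.2))
    (fun hV t a => (H.res_δ _ _ _ _).trans (by rw [H.res_br]))
    (fun hV t a => ((map_sub (Form.res hV) _ _).trans (by
      rw [map_zsmul, H.res_δ, H.res_δ, H.res_δ, H.res_δ])))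
    (fun t t' a => by rw [map_add, map_add, AddMonoidHom.add_apply])
    (fun t t' a => by
      rw [map_add, map_add, AddMonoidHom.add_apply, AddMonoidHom.add_apply, map_add, smul_add,
        add_sub_add_comm]) ?_ b (a, u)
  rintro r U y hr v ⟨a, u⟩
  obtain ⟨a1, a2, a3, a4, a5, a6, a7, a8⟩ : i + r + y.deg = ij ∧ r + (i + y.deg) = ij ∧ y.deg + i =
    i + y.deg ∧ i + r + (y.deg + k) = l ∧ i + y.deg + k = i + (y.deg + k) ∧ r + (i + (y.deg + k)) =
    l ∧ r + (y.deg + k) = jk ∧ y.deg + ik = i + (y.deg + k) := ◇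
  have hs : sg (i * m) = sg (i * r) * sg (i * y.deg) := by rw [← hr, mul_add, sg_add]
  change H.δ h₁ U (H.br h a (N.act hr v (y.val j c))) u =
    H.δ h₂ U a (H.δ hjk U (N.act hr v (y.val j c)) u) -
      sg (i * m) • H.δ h₃ U (N.act hr v (y.val j c)) (H.δ hik U a u)
  rw [H.br_act rfl hr h rfl a1 a2, map_add, map_zsmul, AddMonoidHom.add_apply,
    AddMonoidHom.smul_apply, H.δ_act_val h₁ y a1 rfl a4, H.δ_act a5 a2 h₁ a6, H.br_gen y rfl a3,
    map_neg, map_zsmul, AddMonoidHom.neg_apply, AddMonoidHom.smul_apply,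
    H.δ_ad y a3 a5 hik a8 rfl rfl, _root_.mul_comm y.deg i, H.δ_act_val hjk y hr rfl a7,
    H.δ_act_val h₃ y hr a8 a6, H.δ_mul a7 h₂ rfl rfl a4 a6, hs, smul_sub, sg_smul_smul, neg_sub,
    sub_eq_add_neg (H.δ _ _ _ _), Form.mul_add, Form.mul_neg, Form.mul_zsmul, smul_add, smul_neg,
    smul_smul]
  abel

end IsCartan

namespace IsCartan
variable {E : PreCourant X} {N : DGMod X} {j : ∀ U : Opens X.pt, E.sec U →+ (N.sh (-1)).sec U}
  {c : (N.sh (-2)).sec ⊤} (H : IsCartan E N j c) {U V : Opens X.pt} {i k l m n p q r : ℤ}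

/-- The Jacobi identity for three sections. -/
def Jac (a : (N.sh i).sec U) (b : (N.sh m).sec U) (d : (N.sh n).sec U) : Prop :=
  ∀ {ij jl il t : ℤ} (hij : i + m = ij) (hjl : m + n = jl) (hil : i + n = il)
    (h₁ : i + jl = t) (h₂ : ij + n = t) (h₃ : m + il = t), H.br h₁ a (H.br hjl b d) =
      H.br h₂ (H.br hij a b) d + sg (i * m) • H.br h₃ b (H.br hil a d)

lemma Jac.swap_left {a : (N.sh i).sec U} {b : (N.sh m).sec U} {d : (N.sh n).sec U}
    (h : H.Jac a b d) : H.Jac b a d := by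
  intro ij jl il t hij hjl hil h₁ h₂ h₃
  have hij' : i + m = ij := ◇
  rw [h hij' hil hjl h₃ h₂ h₁, H.br_symm hij hij', H.neg_br, H.zsmul_br, smul_add, smul_smul,
    _root_.mul_comm i m, sg_mul_self, one_smul]
  abel

lemma Jac.swap_right {a : (N.sh i).sec U} {b : (N.sh m).sec U} {d : (N.sh n).sec U}
    (h : H.Jac a b d) : H.Jac a d b := by
  intro ij jl il t hij hjl hil h₁ h₂ h₃
  obtain ⟨hjl', h₂', h₃'⟩ : m + n = jl ∧ m + ij = t ∧ il + n = t := ◇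
  have e1 : sg (n * m) * sg (i * m) * sg (m * ij) = 1 := by
    have : sg (m * ij) = sg (i * m) * sg (n * m) := by
      rw [← hij, mul_add, sg_add, _root_.mul_comm m i, _root_.mul_comm m n]
    rw [this]
    linear_combination sg (n * m) * sg (n * m) * sg_mul_self (i * m) + sg_mul_self (n * m)
  have e2 : sg (n * m) * sg (il * n) = sg (i * n) := by
    have : sg (il * n) = sg (i * n) * sg (n * m) := by
      rw [← hil, add_mul, sg_add, _root_.mul_comm m n]
    rw [this]
    linear_combination sg (i * n) * sg_mul_self (n * m)
  rw [H.br_symm hjl hjl', map_neg, map_zsmul, h hil hjl' hij h₁ h₃' h₂', H.br_symm h₂' h₂,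
    H.br_symm h₃' h₃, smul_add, smul_neg, smul_neg, smul_neg, smul_smul, smul_smul, smul_smul, e1, e2,
    one_smul, neg_add, neg_neg, neg_neg]
  abel

/-- The Jacobi identity is linear in the third variable. -/
lemma jac_of_gen (P : ∀ U : Opens X.pt, (N.sh i).sec U → (N.sh m).sec U → Prop)
    (hP : ∀ {U V : Opens X.pt} (h : V ≤ U) (a : (N.sh i).sec U) (b : (N.sh m).sec U),
      P U a b → P V ((N.sh i).res h a) ((N.sh m).res h b))
    (hgen : ∀ (U : Opens X.pt) (a : (N.sh i).sec U) (b : (N.sh m).sec U), P U a b →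
      ∀ y : Gen E.toOMod U, H.Jac a b (y.val j c))
    {a : (N.sh i).sec U} {b : (N.sh m).sec U} (hab : P U a b) (d : (N.sh n).sec U) :
    H.Jac a b d := by
  intro ij jl il t hij hjl hil h₁ h₂ h₃
  refine H.eq_of_gen (A := fun U => {p : (N.sh i).sec U × (N.sh m).sec U // P U p.1 p.2})
    (F := N.sh t) (fun h a => ⟨((N.sh i).res h a.1.1, (N.sh m).res h a.1.2), hP h _ _ a.2⟩)
    (fun {U} d a => H.br h₁ a.1.1 (H.br hjl a.1.2 d))
    (fun {U} d a => H.br h₂ (H.br hij a.1.1 a.1.2) d + sg (i * m) • H.br h₃ a.1.2 (H.br hil a.1.1 d))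
    (fun hV t a => (H.res_br _ _ _ _).trans (by rw [H.res_br]))
    (fun hV t' a => ((map_add ((N.sh t).res hV) _ _).trans (by
      rw [map_zsmul, H.res_br, H.res_br, H.res_br, H.res_br])))
    (fun t t' a => by rw [map_add, map_add])
    (fun t t' a => by rw [map_add, map_add, map_add, smul_add, add_add_add_comm]) ?_ d ⟨(a, b), hab⟩
  rintro r U y hr w ⟨⟨a, b⟩, hab⟩
  obtain ⟨a1, a2, a3, a4, a5, a6, a7, a8, a9, a10, a11, a12⟩ : m + r + y.deg = jl ∧ r + (m + y.deg)
    = jl ∧ ij + r + y.deg = t ∧ r + (ij + y.deg) = t ∧ i + r + y.deg = il ∧ r + (i + y.deg) = il ∧ i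
    + (m + r) = ij + r ∧ m + r + (i + y.deg) = t ∧ i + (m + y.deg) = ij + y.deg ∧ i + r + (m +
    y.deg) = t ∧ m + (i + r) = ij + r ∧ m + (i + y.deg) = ij + y.deg := ◇
  have e1 : sg (i * (m + r)) = sg (i * m) * sg (i * r) := by rw [mul_add, sg_add]
  have e2 : sg (m * (i + r)) = sg (i * m) * sg (m * r) := by
    rw [mul_add, sg_add, _root_.mul_comm m i]
  have e3 : sg (ij * r) = sg (i * r) * sg (m * r) := by rw [← hij, add_mul, sg_add]
  have e4 : sg (i * m) * sg (i * m) = 1 := sg_mul_self _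
  change H.br h₁ a (H.br hjl b (N.act hr w (y.val j c))) =
    H.br h₂ (H.br hij a b) (N.act hr w (y.val j c)) +
      sg (i * m) • H.br h₃ b (H.br hil a (N.act hr w (y.val j c)))
  rw [H.br_act rfl hr hjl rfl a1 a2, map_add, map_zsmul, H.br_act rfl a1 h₁ a7 a3 a8,
    H.br_act a9 a2 h₁ rfl a10 a4, H.br_act rfl hr h₂ rfl a3 a4, H.br_act rfl hr hil rfl a5 a6,
    map_add, map_zsmul, H.br_act rfl a5 h₃ a11 a3 a10, H.br_act a12 a6 h₃ rfl a8 a4,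
    hgen U a b hab y hij rfl rfl a9 rfl a12, H.δ_br hij rfl rfl rfl a7 a11, N.sub_act, N.zsmul_act,
    N.act_add, N.act_zsmul, e1, e2, e3]
  simp only [smul_add, smul_smul, smul_sub]
  have e5 : sg (i * m) * (sg (i * m) * sg (m * r)) = sg (m * r) := by rw [← _root_.mul_assoc, e4, one_mul]
  rw [e5, show sg (i * m) * (sg (i * r)) = sg (i * r) * sg (i * m) from _root_.mul_comm _ _]
  module

/-- The sections given by generators. -/
def IsGen (H : IsCartan E N j c) (t : (N.sh i).sec U) : Prop :=
  ∃ (y : Gen E.toOMod U) (h : 0 + y.deg = i), N.act h (Form.ofFn 1) (y.val j c) = t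

lemma isGen_val (y : Gen E.toOMod U) : H.IsGen (y.val j c) := ⟨y, zero_add _, N.one_act _ _⟩

lemma IsGen.res {H : IsCartan E N j c} (hV : V ≤ U) {t : (N.sh i).sec U} (ht : H.IsGen t) :
    H.IsGen ((N.sh i).res hV t) := by
  obtain ⟨y, h, rfl⟩ := ht
  have h' : 0 + (y.res hV).deg = i := by rw [Gen.deg_res, h]
  refine ⟨y.res hV, h', ?_⟩
  rw [N.res_act, H.res_gen hV y h h']
  rfl

lemma jac_c (b : (N.sh m).sec U) (d : (N.sh n).sec U) :
    H.Jac ((N.sh (-2)).res (le_top : U ≤ ⊤) c) b d := by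
  intro ij jl il t hij hjl hil h₁ h₂ h₃
  rw [H.c_br, H.c_br, H.c_br, H.zero_br, map_zero, smul_zero, add_zero]

lemma br_j_j_j (h : -1 + -1 = m) (h' : -1 + m = n) (e e' e'' : E.sec U) :
    H.br h' (j U e) (H.br h (j U e') (j U e'')) = 0 := by
  obtain ⟨a1, a2⟩ : 0 + -2 = m ∧ -1 + -2 = n := ◇
  have a3 : -1 + 0 = (-1 : ℤ) := by norm_num
  have a4 : 0 + n = n := ◇
  rw [H.br_j_j h a1, H.br_act a2 a1 h' a3 a2 a4, H.br_c, H.δ_j, VField.contr_ofFn, N.zero_act,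
    N.act_zero, smul_zero, add_zero]

lemma jac_j_j_j (e e' e'' : E.sec U) : H.Jac (j U e) (j U e') (j U e'') := by
  intro ij jl il t hij hjl hil h₁ h₂ h₃
  have a1 : -1 + ij = t := ◇
  rw [H.br_j_j_j, H.br_j_j_j, H.br_symm h₂ a1, H.br_j_j_j]
  simp only [smul_zero, neg_zero, add_zero]

lemma jac_D_j_j (e e' e'' : E.sec U) :
    H.Jac (N.D (neg_add_cancel 1) (j U e)) (j U e') (j U e'') := by
  intro ij jl il t hij hjl hil h₁ h₂ h₃
  obtain rfl : -1 = ij := ◇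
  obtain rfl : -1 = il := ◇
  obtain rfl : jl = t := ◇
  have a1 : 0 + -2 = jl := ◇
  have a2 : (0 : ℤ) + -2 = -2 := by norm_num
  rw [H.br_D_j, H.br_D_j, H.br_j_j hjl a1, H.br_j_j h₂ a1, H.br_j_j h₃ a1,
    H.br_act a2 a1 h₁ (zero_add 0) a1 a1, H.br_c, N.act_zero, smul_zero, add_zero, H.δ_Dj,
    VField.lie_ofFn, zero_mul, sg_zero, one_smul, ← N.add_act, ← Form.ofFn_add, E.pair_br]

lemma jac_D_j_D (e e' e'' : E.sec U) : H.Jac (N.D (neg_add_cancel 1) (j U e)) (j U e')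
    (N.D (neg_add_cancel 1) (j U e'')) := by
  intro ij jl il t hij hjl hil h₁ h₂ h₃
  obtain rfl : -1 = ij := ◇
  obtain rfl : 0 = il := ◇
  obtain rfl : -1 = jl := ◇
  obtain rfl : -1 = t := ◇
  rw [H.br_D_j, H.br_D_D, H.br_j_D, map_neg, H.br_D_j, H.br_j_D, H.br_j_D, E.leibnizIdentity,
    zero_mul, sg_zero, one_smul, map_add]
  abel

lemma jac_D_D_j (e e' e'' : E.sec U) : H.Jac (N.D (neg_add_cancel 1) (j U e))
    (N.D (neg_add_cancel 1) (j U e')) (j U e'') := by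
  intro ij jl il t hij hjl hil h₁ h₂ h₃
  obtain rfl : 0 = ij := ◇
  obtain rfl : -1 = il := ◇
  obtain rfl : -1 = jl := ◇
  obtain rfl : -1 = t := ◇
  rw [H.br_D_j, H.br_D_D, H.br_D_j, H.br_D_j, H.br_D_j, H.br_D_j, E.leibnizIdentity,
    zero_mul, sg_zero, one_smul, map_add]

lemma jac_D_D_D (e e' e'' : E.sec U) : H.Jac (N.D (neg_add_cancel 1) (j U e))
    (N.D (neg_add_cancel 1) (j U e')) (N.D (neg_add_cancel 1) (j U e'')) := by
  intro ij jl il t hij hjl hil h₁ h₂ h₃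
  obtain rfl : 0 = ij := ◇
  obtain rfl : 0 = il := ◇
  obtain rfl : 0 = jl := ◇
  obtain rfl : 0 = t := ◇
  rw [H.br_D_D, H.br_D_D, H.br_D_D, H.br_D_D, H.br_D_D, H.br_D_D, E.leibnizIdentity,
    zero_mul, sg_zero, one_smul, map_add, map_add]

lemma jac_gen (y y' y'' : Gen E.toOMod U) : H.Jac (y.val j c) (y'.val j c) (y''.val j c) := by
  cases y with
  | c => exact H.jac_c _ _
  | j e => cases y' with
    | c => exact Jac.swap_left H (H.jac_c _ _)
    | j e' => cases y'' with
      | c => exact Jac.swap_right H (Jac.swap_left H (H.jac_c _ _))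
      | j e'' => exact H.jac_j_j_j e e' e''
      | D e'' => exact Jac.swap_right H (Jac.swap_left H (H.jac_D_j_j e'' e e'))
    | D e' => cases y'' with
      | c => exact Jac.swap_right H (Jac.swap_left H (H.jac_c _ _))
      | j e'' => exact Jac.swap_left H (H.jac_D_j_j e' e e'')
      | D e'' => exact Jac.swap_left H (H.jac_D_j_D e' e e'')
  | D e => cases y' with
    | c => exact Jac.swap_left H (H.jac_c _ _)
    | j e' => cases y'' with
      | c => exact Jac.swap_right H (Jac.swap_left H (H.jac_c _ _))
      | j e'' => exact H.jac_D_j_j e e' e''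
      | D e'' => exact H.jac_D_j_D e e' e''
    | D e' => cases y'' with
      | c => exact Jac.swap_right H (Jac.swap_left H (H.jac_c _ _))
      | j e'' => exact H.jac_D_D_j e e' e''
      | D e'' => exact H.jac_D_D_D e e' e''

/-- The Jacobi identity. By linearity in the third variable and antisymmetry it suffices to verify it
for generators. -/
lemma jacobi (a : (N.sh i).sec U) (b : (N.sh m).sec U) (d : (N.sh n).sec U) : H.Jac a b d := by
  have hcases : ∀ {i : ℤ} {U : Opens X.pt} (Q : ∀ i, (N.sh i).sec U → Prop),
      (∀ y : Gen E.toOMod U, Q _ (y.val j c)) → ∀ t : (N.sh i).sec U, H.IsGen t → Q i t := by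
    rintro i U Q hQ _ ⟨y, h, rfl⟩
    obtain rfl : y.deg = i := ◇
    rw [N.one_act]
    exact hQ y
  have h1 : ∀ {i m n : ℤ} {U : Opens X.pt} (a : (N.sh i).sec U) (b : (N.sh m).sec U)
      (d : (N.sh n).sec U), H.IsGen a → H.IsGen b → H.Jac a b d := fun a b d ha hb =>
    H.jac_of_gen (fun U a b => H.IsGen a ∧ H.IsGen b) (fun h a b hab => ⟨hab.1.res h, hab.2.res h⟩)
      (fun U a b hab y => hcases (fun i a => H.Jac a b (y.val j c))
        (fun y₁ => hcases (fun m b => H.Jac (y₁.val j c) b (y.val j c))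
          (fun y₂ => H.jac_gen y₁ y₂ y) b hab.2) a hab.1) ⟨ha, hb⟩ d
  have h2 : ∀ {i m n : ℤ} {U : Opens X.pt} (a : (N.sh i).sec U) (b : (N.sh m).sec U)
      (d : (N.sh n).sec U), H.IsGen a → H.Jac a b d := fun a b d ha =>
    H.jac_of_gen (fun U a b => H.IsGen a) (fun h a b ha => ha.res h)
      (fun U a b ha y => Jac.swap_right H (h1 a (y.val j c) b ha (H.isGen_val y))) ha d
  have h3 : ∀ (U : Opens X.pt) (a : (N.sh i).sec U) (b : (N.sh m).sec U), True →
      ∀ y : Gen E.toOMod U, H.Jac a b (y.val j c) := fun U a b _ y =>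
    Jac.swap_right H (Jac.swap_left H (h2 (y.val j c) a b (H.isGen_val y)))
  intro ij jl il t hij hjl hil h₁ h₂ h₃
  exact H.jac_of_gen (fun U a b => True) (fun h a b _ => trivial) h3 trivial d hij hjl hil h₁ h₂ h₃

/-- The DG Lie algebroid given by a Cartan calculus. -/
def dgLie : DGLie X where
  toDGMod := N
  br h _ a b := H.br h a b
  anchor h _ a w := H.δ h _ a w
  add_br h _ a a' b := H.add_br h a a' b
  br_add h _ a b b' := map_add _ _ _
  res_br h _ _ hV a b := H.res_br h hV a b
  br_symm h h' _ a b := H.br_symm h h' a b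
  jacobi hij hjl hil h₁ h₂ h₃ _ a b d := H.jacobi a b d hij hjl hil h₁ h₂ h₃
  D_br h hi hj hl h₁ h₂ _ a b := H.D_br h hi hj hl h₁ h₂ a b
  anchor_add_left h _ a a' w := by rw [map_add]; rfl
  anchor_add h _ a w w' := map_add _ _ _
  anchor_const h _ a c := H.δ_algebraMap h a c
  anchor_res h _ _ hV a w := H.res_δ h hV a w
  anchor_mul h h' hp hq h₁ h₂ _ a w w' := H.δ_mul hp hq h h' h₁ h₂ a w w'
  anchor_act hj h h₁ h₂ _ v a w := H.δ_act h hj h₁ h₂ v a w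
  anchor_br h hik hjk h₁ h₂ h₃ _ a b w := H.δ_br h hik hjk h₁ h₂ h₃ a b w
  anchor_D hi h h₁ h₂ _ a w dw daw hw hdaw := by
    have hk := hw.1
    have hl := hdaw.1
    rw [hw.eq hk.symm, hdaw.eq hl.symm]
    exact H.δ_D hi h h₁ h₂ hk.symm hl.symm a w
  leibniz hkj hl hij h₁ h₂ h₃ _ a b w := H.br_act hij hkj h₁ hl h₂ h₃ a w b

end IsCartan

/-! ### Morphisms of DG Lie algebroids out of a presented one -/

namespace DGLie
variable (M : DGLie X) {U V : Opens X.pt} {i k l m : ℤ}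

lemma br_neg (h : i + k = l) (a : (M.sh i).sec U) (b : (M.sh k).sec U) :
    M.br h a (-b) = -M.br h a b :=
  map_neg (AddMonoidHom.mk' (M.br h a) (M.br_add h a)) b

lemma br_zero (h : i + k = l) (a : (M.sh i).sec U) : M.br h a (0 : (M.sh k).sec U) = 0 :=
  map_zero (AddMonoidHom.mk' (M.br h a) (M.br_add h a))

lemma zero_br (h : i + k = l) (b : (M.sh k).sec U) : M.br h (0 : (M.sh i).sec U) b = 0 :=
  map_zero (AddMonoidHom.mk' (fun a => M.br h a b) fun a a' => M.add_br h a a' b)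

lemma neg_br (h : i + k = l) (a : (M.sh i).sec U) (b : (M.sh k).sec U) :
    M.br h (-a) b = -M.br h a b :=
  map_neg (AddMonoidHom.mk' (fun a => M.br h a b) fun a a' => M.add_br h a a' b) a

lemma br_zsmul (h : i + k = l) (n : ℤ) (a : (M.sh i).sec U) (b : (M.sh k).sec U) :
    M.br h a (n • b) = n • M.br h a b :=
  map_zsmul (AddMonoidHom.mk' (M.br h a) (M.br_add h a)) n b

lemma anchor_neg_left (h : i + k = l) (a : (M.sh i).sec U) (w : Form k U) :
    M.anchor h (-a) w = -M.anchor h a w :=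
  map_neg (AddMonoidHom.mk' (fun a => M.anchor h a w) fun a a' => M.anchor_add_left h a a' w) a

lemma anchor_zero_left (h : i + k = l) (w : Form k U) :
    M.anchor h (0 : (M.sh i).sec U) w = 0 :=
  map_zero (AddMonoidHom.mk' (fun a => M.anchor h a w) fun a a' => M.anchor_add_left h a a' w)

lemma anchor_D' {i' k' l' : ℤ} (hi : i + 1 = i') (h : i + k = l) (h₁ : i' + k = l')
    (h₂ : i + k' = l') (hk : k + 1 = k') (hl : l + 1 = l') (a : (M.sh i).sec U) (w : Form k U) :
    M.anchor h₁ (M.D hi a) w = Form.d hl (M.anchor h a w) - sg i • M.anchor h₂ a (Form.d hk w) :=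
  M.anchor_D hi h h₁ h₂ a w _ _ (Form.isD_d _ _) (Form.isD_d _ _)

/-- The map `f` preserves the bracket of `a` and `b`. -/
def PreservesBr {M M' : DGLie X} (f : DGMod.Hom M.toDGMod M'.toDGMod) (a : (M.sh i).sec U)
    (b : (M.sh k).sec U) : Prop :=
  ∀ (l : ℤ) (h : i + k = l), f.map l U (M.br h a b) = M'.br h (f.map i U a) (f.map k U b)

namespace PreservesBr
variable {M} {M' : DGLie X} {f : DGMod.Hom M.toDGMod M'.toDGMod}

lemma symm {a : (M.sh i).sec U} {b : (M.sh k).sec U} (H : PreservesBr f a b) :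
    PreservesBr f b a := by
  intro l h
  rw [M.br_symm h ◇, map_neg, map_zsmul, H _ _, M'.br_symm h ◇]

lemma D_right {a : (M.sh i).sec U} {b : (M.sh k).sec U} (hk : k + 1 = l) (hi : i + 1 = m)
    (H : PreservesBr f a b) (H' : PreservesBr f (M.D hi a) b) : PreservesBr f a (M.D hk b) := by
  intro n h
  have e : ∀ N : DGLie X, ∀ (a : (N.sh i).sec U) (b : (N.sh k).sec U), N.br h a (N.D hk b) =
      sg i • (N.D (i := i + k) ◇ (N.br rfl a b) - N.br ◇ (N.D hi a) b) := by
    intro N a b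
    rw [N.D_br rfl hi hk ◇ ◇ h, add_sub_cancel_left]
    change _ = sg i • sg i • _
    rw [sg_smul_smul]
  rw [e, map_zsmul, map_sub, f.map_D, H _ _, H' _ _, f.map_D, f.map_D, ← e]

lemma induction {E : OMod X} {κ : ∀ U : Opens X.pt, Form 1 U → E.sec U}
    {j : ∀ U : Opens X.pt, E.sec U →+ (M.sh (-1)).sec U} {c : (M.sh (-2)).sec ⊤}
    (H : Presented E κ M.toDGMod j c)
    (hanchor : ∀ {i k l : ℤ} (h : i + k = l) {U : Opens X.pt} (a : (M.sh i).sec U) (w : Form k U),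
      M'.anchor h (f.map i U a) w = M.anchor h a w)
    (a : (M.sh i).sec U) (ha : ∀ (V : Opens X.pt) (hV : V ≤ U) (y : Gen E V),
      PreservesBr f ((M.sh i).res hV a) (y.val j c)) (b : (M.sh k).sec U) : PreservesBr f a b := by
  refine H.induction (fun k U b => ∀ a : (M.sh i).sec U, (∀ (V : Opens X.pt) (hV : V ≤ U)
    (y : Gen E V), PreservesBr f ((M.sh i).res hV a) (y.val j c)) → PreservesBr f a b)
    ?_ ?_ ?_ ?_ k U b a ha
  · intro m U b hb a ha l h
    refine (M'.sh l).eq_of_local fun x => ?_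
    obtain ⟨V, hV, hx, hb⟩ := hb x
    refine ⟨V, hV, hx, ?_⟩
    rw [f.res_map, M.res_br, hb _ (fun W hW y => ?_) l h, M'.res_br, f.res_map, f.res_map]
    rw [AbSheaf.res_res]
    exact ha W _ y
  · intro m U b b' hb hb' a ha l h
    rw [M.br_add, map_add, hb a ha l h, hb' a ha l h, map_add, M'.br_add]
  · intro m U b hb a ha l h
    rw [M.br_neg, map_neg, hb a ha l h, map_neg, M'.br_neg]
  · intro p m U y h w a ha l hl
    have ha' : PreservesBr f a (y.val j c) := by
      have := ha U le_rfl y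
      rwa [AbSheaf.res_id] at this
    rw [M.leibniz h rfl rfl hl ◇ ◇, map_add, map_zsmul, f.map_act, f.map_act,
      f.map_act, ha' _ rfl, M'.leibniz h rfl rfl hl ◇ ◇, hanchor]

end PreservesBr

/-- A morphism of DG modules out of a presented one is a morphism of DG Lie algebroids if it is
compatible with the structures on generators. -/
lemma exists_hom {M M' : DGLie X} {E : OMod X} {κ : ∀ U : Opens X.pt, Form 1 U → E.sec U}
    {j : ∀ U : Opens X.pt, E.sec U →+ (M.sh (-1)).sec U} {c : (M.sh (-2)).sec ⊤}
    (H : Presented E κ M.toDGMod j c) (f : DGMod.Hom M.toDGMod M'.toDGMod)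
    (anchor_c : ∀ {k l : ℤ} (h : -2 + k = l) {U : Opens X.pt} (w : Form k U),
      M'.anchor h (f.map _ U ((M.sh (-2)).res le_top c)) w =
        M.anchor h ((M.sh (-2)).res le_top c) w)
    (anchor_j : ∀ {k l : ℤ} (h : -1 + k = l) {U : Opens X.pt} (e : E.sec U) (w : Form k U),
      M'.anchor h (f.map _ U (j U e)) w = M.anchor h (j U e) w)
    (br_c : ∀ {k : ℤ} {U : Opens X.pt} (b : (M.sh k).sec U),
      PreservesBr f ((M.sh (-2)).res le_top c) b)
    (br_j_j : ∀ {U : Opens X.pt} (e e' : E.sec U), PreservesBr f (j U e) (j U e'))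
    (br_D_j : ∀ {U : Opens X.pt} (e e' : E.sec U),
      PreservesBr f (M.D (neg_add_cancel 1) (j U e)) (j U e')) :
    ∃ F : DGLie.Hom M M', F.toModHom = f := by
  have hanchor : ∀ {i k l : ℤ} (h : i + k = l) {U : Opens X.pt} (a : (M.sh i).sec U)
      (w : Form k U), M'.anchor h (f.map i U a) w = M.anchor h a w := by
    intro i k l h U a w
    refine H.induction (fun i U a => ∀ (k l : ℤ) (h : i + k = l) (w : Form k U),
      M'.anchor h (f.map i U a) w = M.anchor h a w) ?_ ?_ ?_ ?_ i U a k l h w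
    · intro i U a ha k l h w
      refine Form.eq_of_local fun x => ?_
      obtain ⟨V, hV, hx, ha⟩ := ha x
      exact ⟨V, hV, hx, by rw [M'.anchor_res, M.anchor_res, f.res_map, ha]⟩
    · intro i U a a' ha ha' k l h w
      rw [map_add, M'.anchor_add_left, M.anchor_add_left, ha, ha']
    · intro i U a ha k l h w
      rw [map_neg, anchor_neg_left, anchor_neg_left, ha]
    · intro p i U y hp v k l h w
      rw [f.map_act, M'.anchor_act hp rfl h ◇, M.anchor_act hp rfl h ◇]
      congr 1
      cases y with
      | c => exact anchor_c _ _
      | j e => exact anchor_j _ _ _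
      | D e =>
        have e1 : ∀ (N : DGLie X) (a : (N.sh (-1)).sec U) (q : ℤ) (h : 0 + k = q),
            N.anchor h (N.D (neg_add_cancel 1) a) w =
            Form.d ◇ (N.anchor (l := -1 + k) rfl a w) -
              sg (-1) • N.anchor ◇ a (Form.d (l := k + 1) rfl w) :=
          fun N a q h => N.anchor_D' _ rfl h ◇ rfl ◇ a w
        refine (congrArg (M'.anchor _ · w) (f.map_D _ _)).trans ?_
        refine (e1 _ _ _ _).trans (Eq.trans ?_ (e1 _ _ _ _).symm)
        rw [anchor_j, anchor_j]
  have hgen : ∀ {U : Opens X.pt} (y y' : Gen E U), PreservesBr f (y.val j c) (y'.val j c) := by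
    intro U y y'
    have jD : ∀ e e' : E.sec U, PreservesBr f (j U e) (M.D (neg_add_cancel 1) (j U e')) :=
      fun e e' => PreservesBr.D_right _ (neg_add_cancel 1) (br_j_j e e') (br_D_j e e')
    cases y with
    | c => exact br_c _
    | j e => cases y' with
      | c => exact PreservesBr.symm (br_c _)
      | j e' => exact br_j_j e e'
      | D e' => exact jD e e'
    | D e => cases y' with
      | c => exact PreservesBr.symm (br_c _)
      | j e' => exact br_D_j e e'
      | D e' =>
        refine PreservesBr.D_right _ (zero_add 1) (br_D_j e e') fun _ h => ?_
        have e0 : M.D (zero_add 1) ((Gen.D e).val j c) = 0 := M.D_D _ _ _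
        rw [e0, M.zero_br, map_zero, map_zero, M'.zero_br]
  have hgen' : ∀ {k : ℤ} {U : Opens X.pt} (b : (M.sh k).sec U) (y : Gen E U),
      PreservesBr f b (y.val j c) := by
    intro k U b y
    refine PreservesBr.symm (PreservesBr.induction H hanchor _ (fun V hV y' => ?_) b)
    cases y with
    | c =>
      have := hgen (U := V) .c y'
      exact (AbSheaf.res_res (M.sh (-2)) le_top hV c).symm ▸ this
    | j e => exact (H.res_j hV e).symm ▸ hgen (.j (E.res hV e)) y'
    | D e =>
      have e1 : (M.sh 0).res hV (M.D (neg_add_cancel 1) (j U e)) =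
        M.D (neg_add_cancel 1) (j V (E.res hV e)) :=
          (M.res_D _ hV _).trans (congrArg _ (H.res_j hV e))
      exact e1.symm ▸ hgen (.D (E.res hV e)) y'
  exact ⟨⟨f, fun h U a b => PreservesBr.induction H hanchor a (fun V hV y => hgen' _ y) b _ h,
    fun h U a w => hanchor h a w⟩, rfl⟩

end DGLie

/-! ### Transgression of Lie algebroids -/

/-- The DG Lie algebroid `A♯` exists. -/
lemma exists_sharp (A : LieAlgebroid X) : Nonempty (Sharp A) := by
  obtain ⟨N, j, HN⟩ := exists_oddPullback A.toOMod
  have H : IsCartan A.toPreCourant N j 0 :=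
    { HN.presented with
      pair_κ := fun hk U w e α => by
        have e1 : ((N.sh (-2)).res le_top (0 : (N.sh (-2)).sec ⊤) : (N.sh (-2)).sec U) = 0 :=
          map_zero _
        rw [e1, N.act_zero, N.act_zero] }
  refine ⟨⟨H.dgLie, j, HN, fun h U a b => ?_, fun a b => H.br_D_j _ a b, fun h U a w =>
    (VField.contracts_iff _ h _ _).2 (H.δ_j h a w)⟩⟩
  refine (H.br_j_j h ◇ a b).trans ?_
  exact (congrArg (N.act _ _) (map_zero _)).trans (N.act_zero _ _)

/-! ### Transgression of Courant extensions -/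

/-- Finitely many neighbourhoods contain a common one. -/
lemma exists_nhd_le {n : ℕ} {U : Opens X.pt} {x : X.pt} (hx : x ∈ U) (V : Fin n → Opens X.pt)
    (hV : ∀ i, x ∈ V i) : ∃ W : Opens X.pt, x ∈ W ∧ W ≤ U ∧ ∀ i, W ≤ V i := by
  refine ⟨U ⊓ Finset.univ.inf V, ⟨hx, ?_⟩, inf_le_left,
    fun i => inf_le_right.trans (Finset.inf_le (Finset.mem_univ i))⟩
  have : ∀ s : Finset (Fin n), x ∈ s.inf V := by
    intro s
    induction s using Finset.induction_on with
    | empty => exact Opens.mem_top x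
    | insert i s _ ih => rw [Finset.inf_insert]; exact ⟨hV i, ih⟩
  exact this _

namespace CExt
variable {A : LieAlgebroid X} (Q : CExt A) {U V W : Opens X.pt}

lemma coanchor_inj {w w' : Form 1 U} (h : Q.coanchor w = Q.coanchor w') : w = w' := by
  rw [← sub_eq_zero]
  exact Q.coanchor_injective _ (by rw [map_sub, h, sub_self])

/-- If `A` is locally free, `Ω¹ → 𝒬` locally has a retraction. -/
lemma exists_retraction (hA : A.LocallyFree) (x : X.pt) :
    ∃ (V : Opens X.pt) (ρ : ∀ W : Opens X.pt, W ≤ V → Q.sec W →ₗ[Fn W] Form 1 W), x ∈ V ∧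
      (∀ (W W' : Opens X.pt) (h : W' ≤ W) (hW : W ≤ V) (q : Q.sec W),
        Form.res h (ρ W hW q) = ρ W' (h.trans hW) (Q.res h q)) ∧
      ∀ (W : Opens X.pt) (hW : W ≤ V) (w : Form 1 W), ρ W hW (Q.coanchor w) = w := by
  obtain ⟨V₀, r, e, hx₀, he⟩ := hA x
  choose V' hV' q' hx' hq' using fun i => Q.proj_surjective (e i) ⟨x, hx₀⟩
  obtain ⟨V, hx, hV₀, hVV'⟩ := exists_nhd_le hx₀ V' hx'
  let q : Fin r → Q.sec V := fun i => Q.res (hVV' i) (q' i)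
  have hq : ∀ (W : Opens X.pt) (hW : W ≤ V) (i : Fin r),
      Q.proj (Q.res hW (q i)) = A.res (hW.trans hV₀) (e i) := by
    intro W hW i
    have e1 : A.res ((hW.trans (hVV' i)).trans (hV' i)) (e i) = Q.proj (Q.res hW (q i)) := by
      rw [← A.res_res (hV' i) (hW.trans (hVV' i)), ← hq', Q.res_proj]
      exact congrArg _ (Q.res_res _ _ _).symm
    exact e1.symm
  have key : ∀ (W : Opens X.pt) (hW : W ≤ V) (s : Q.sec W), ∃ (w : Form 1 W) (f : Fin r → Fn W),
      s = Q.coanchor w + ∑ i, f i • Q.res hW (q i) := by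
    intro W hW s
    obtain ⟨f, hf, -⟩ := he W (hW.trans hV₀) (Q.proj s)
    obtain ⟨w, hw⟩ := (Q.proj_eq_zero (s - ∑ i, f i • Q.res hW (q i))).1 (by
      rw [map_sub, map_sum, sub_eq_zero]
      refine hf.trans (Finset.sum_congr rfl fun i _ => ?_)
      rw [map_smul, hq])
    exact ⟨w, f, by rw [hw, sub_add_cancel]⟩
  have uniq : ∀ (W : Opens X.pt) (hW : W ≤ V) (w w' : Form 1 W) (f f' : Fin r → Fn W),
      Q.coanchor w + ∑ i, f i • Q.res hW (q i) = Q.coanchor w' + ∑ i, f' i • Q.res hW (q i) →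
        w = w' := by
    intro W hW w w' f f' h
    have hz : ∀ w : Form 1 W, Q.proj (Q.coanchor w) = 0 := fun w => (Q.proj_eq_zero _).2 ⟨w, rfl⟩
    have h1 := congrArg Q.proj h
    simp only [map_add, map_sum, map_smul, hz, hq, zero_add] at h1
    have h2 : f = f' := (he W (hW.trans hV₀) _).unique rfl h1
    rw [h2] at h
    exact Q.coanchor_inj (add_right_cancel h)
  choose ρ g hρ using key
  refine ⟨V, fun W hW =>
    { toFun := ρ W hW
      map_add' := fun s t => uniq W hW _ _ (g W hW (s + t)) (g W hW s + g W hW t) ?_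
      map_smul' := fun f s => uniq W hW _ _ (g W hW (f • s)) (f • g W hW s) ?_ }, hx, ?_, ?_⟩
  · rw [← hρ, map_add]
    nth_rw 1 [hρ W hW s, hρ W hW t]
    simp only [Pi.add_apply, add_smul, Finset.sum_add_distrib]
    exact add_add_add_comm _ _ _ _
  · rw [← hρ, RingHom.id_apply, map_smul]
    nth_rw 1 [hρ W hW s]
    simp only [Pi.smul_apply, smul_add, Finset.smul_sum, smul_smul, smul_eq_mul]
  · intro W W' h hW s
    refine uniq W' (h.trans hW) _ _ (fun i => resFn h (g W hW s i)) (g W' (h.trans hW) (Q.res h s)) ?_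
    change Q.coanchor (Form.res h (ρ W hW s)) + _ = _
    refine Eq.trans ?_ (hρ W' (h.trans hW) (Q.res h s))
    refine Eq.trans ?_ (congrArg (Q.res h) (hρ W hW s)).symm
    rw [map_add, map_sum, Q.res_coanchor]
    congr 1
    refine Finset.sum_congr rfl fun i _ => ?_
    rw [Q.res_smul]
    exact congrArg (resFn h (g W hW s i) • ·) (Q.res_res hW h (q i)).symm
  · intro W hW w
    refine uniq W hW _ _ (g W hW (Q.coanchor w)) 0 ?_
    change Q.coanchor (ρ W hW _) + _ = _
    rw [← hρ W hW (Q.coanchor w)]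
    simp

variable {Q} {N : DGMod X} {j : ∀ U : Opens X.pt, Q.sec U →+ (N.sh (-1)).sec U}
  {c : (N.sh (-2)).sec ⊤}

/-- The map `w ↦ w · c` to the cokernel of `pr_* ev^* Ω¹ → 𝒪[2] ⊕ pr_* ev^* 𝒬` is injective, as
local retractions of `Ω¹ → 𝒬` induce retractions of `pr_* ev^* Ω¹ → pr_* ev^* 𝒬` up to `∫`. -/
lemma eq_zero_of_act_c (hA : A.LocallyFree)
    (C : CokerSquare Q.toOMod (fun _ => Q.coanchor) N j c) {k i : ℤ} (h : k + -2 = i)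
    (w : Form k U) (hw : N.act h w ((N.sh (-2)).res le_top c) = 0) : w = 0 := by
  obtain rfl : k = i + 2 := ◇
  refine Form.eq_of_local fun x => ?_
  obtain ⟨V, ρ, hxV, hρ, hρ'⟩ := Q.exists_retraction hA x
  obtain ⟨W, hW, z, hxW, hz, hz'⟩ := C.inj h rfl w 0 (by rw [map_zero, hw, add_zero]) x
  obtain ⟨f, -, hf⟩ := C.isEvE.presented.exists_hom (N' := Form.shiftOn V)
    (fun U => ((ρ (U ⊓ V) inf_le_right).toAddMonoidHom.comp (Q.res inf_le_left) :
      Q.sec U →+ Form 1 (U ⊓ V))) 0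
    (fun {U U'} h e => by
      refine (hρ _ _ (inf_le_inf_right V h) inf_le_right _).trans (congrArg (ρ _ _) ?_)
      rw [Q.res_res, Q.res_res])
    (fun {U} f e => by
      refine (congrArg (ρ _ _) (Q.res_smul _ _ _)).trans ((map_smul (ρ _ _) _ _).trans ?_)
      exact (Form.ofFn_mul' (zero_add _) (resFn inf_le_left f) _).symm)
    (fun h => map_zero _)
    (fun {U} h α => (map_zero _).trans
      ((congrArg ((Form.shiftOn V).act h α) (map_zero _)).trans (DGMod.act_zero _ _ _)).symm)
    (fun _ => rfl)
  let I : DGMod.Hom C.evO (Form.shiftOn V) :=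
    { map := fun i U => ((Form.res inf_le_left : Form (i + 2) U →+ Form (i + 2) (U ⊓ V)).comp
        (C.int rfl U))
      res_map := fun {i U U'} h z => (congrArg (Form.res (inf_le_left : U' ⊓ V ≤ U'))
        (C.res_int rfl h z) : _)
      map_act := fun {k i j} h U w z => (congrArg (Form.res (inf_le_left : U ⊓ V ≤ U))
        (C.int_act rfl rfl h ◇ w z)).trans (Form.res_mul _ ◇ _ _)
      map_D := fun {i j} h U z => (congrArg (Form.res (inf_le_left : U ⊓ V ≤ U))
        ((C.int_D rfl rfl h z).eq ◇)).trans (Form.res_d _ ◇ _) }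
  have hI : I = f.comp C.evκ := by
    refine C.isEvO.presented.hom_ext ?_ fun U α => ?_
    · rw [map_zero, map_zero]
    · refine (congrArg (Form.res (inf_le_left : U ⊓ V ≤ U)) (C.int_j rfl α)).trans ?_
      refine Eq.trans ?_ ((congrArg (f.map (-1) U) (C.evκ_j α)).trans (hf U _)).symm
      exact ((congrArg (ρ _ _) (Q.res_coanchor _ _)).trans (hρ' _ _ _)).symm
  have h1 := congrArg (fun F => F.map i W z) hI
  have h2 : Form.res (inf_le_left : W ⊓ V ≤ W) (C.int rfl W z) = 0 := by
    refine h1.trans ((congrArg (f.map i W) (?_ : C.evκ.map i W z = 0)).trans (map_zero _))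
    rw [← neg_eq_zero, hz', map_zero]
  refine ⟨W ⊓ V, inf_le_left.trans hW, ⟨hxW, hxV⟩, ?_⟩
  rw [hz] at h2
  exact h2.trans (map_zero _).symm

end CExt

namespace DGMod
variable (N : DGMod X) (c : (N.sh (-2)).sec ⊤)

/-- The map `w ↦ w · c`. -/
def actC {i : ℤ} (U : Opens X.pt) : Form (i + 2) U →+ (N.sh i).sec U :=
  AddMonoidHom.mk' (fun w => N.act ◇ w ((N.sh (-2)).res le_top c))
    fun w w' => N.add_act _ w w' _

lemma actC_eq {k i : ℤ} (h : k + -2 = i) {U : Opens X.pt} (w : Form k U) :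
    ∃ w' : Form (i + 2) U, N.actC c U w' = N.act h w ((N.sh (-2)).res le_top c) := by
  obtain rfl : k = i + 2 := ◇
  exact ⟨w, rfl⟩

/-- The quotient of a DG module by the submodule spanned by a closed section of degree `-2`. -/
lemma exists_quot (D_c : ∀ {j : ℤ} (h : -2 + 1 = j), N.D h c = 0) :
    ∃ (N' : DGMod X) (π : DGMod.Hom N N'),
      (∀ {k i : ℤ} (h : k + -2 = i) (U : Opens X.pt) (w : Form k U),
        π.map i U (N.act h w ((N.sh (-2)).res le_top c)) = 0) ∧
      ∀ {k i : ℤ} (h : k + -2 = i) {U : Opens X.pt} (t : (N.sh i).sec U), π.map i U t = 0 → ∀ x : U,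
        ∃ (V : Opens X.pt) (hV : V ≤ U) (w : Form k V), (x : X.pt) ∈ V ∧
          N.act h w ((N.sh (-2)).res le_top c) = (N.sh i).res hV t := by
  have mem : ∀ {k i : ℤ} (h : k + -2 = i) {U : Opens X.pt} (w : Form k U),
      N.act h w ((N.sh (-2)).res le_top c) ∈ (N.actC (i := i) c U).range := fun h U w => by
    obtain ⟨w', hw'⟩ := N.actC_eq c h w
    exact ⟨w', hw'⟩
  have memeq : ∀ (i : ℤ) (U : Opens X.pt) (q r : (N.sh i).sec U), q = r →
      q - r ∈ (N.actC c U).range := fun i U q r h => by rw [h, sub_self]; exact zero_mem _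
  let P : PreDG X :=
    { pre := fun i => (N.sh i).pre
      K := fun i U => (N.actC c U).range
      act := fun h U w => AddMonoidHom.mk' (N.act h w) (N.act_add h w)
      D := fun h U => N.D h
      res_K := by
        rintro i U V h _ ⟨w, rfl⟩
        have : (N.sh i).res h (N.actC c U w) =
            N.act ◇ (Form.res h w) ((N.sh (-2)).res le_top c) := by
          rw [← AbSheaf.res_res (N.sh (-2)) le_top h]
          exact N.res_act _ _ _ _
        exact this ▸ mem _ _
      act_K := by
        rintro k i j h U v _ ⟨w, rfl⟩
        have : N.act h v (N.actC c U w) =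
            N.act (k := k + (i + 2)) ◇ (Form.mul rfl v w) ((N.sh (-2)).res le_top c) :=
          (N.mul_act rfl _ h _ _ _ _).symm
        change N.act h v (N.actC c U w) ∈ _
        rw [this]
        exact mem _ _
      D_K := by
        rintro i j h U _ ⟨w, rfl⟩
        have : N.D h (N.actC c U w) =
            N.act (k := i + 2 + 1) ◇ (Form.d rfl w) ((N.sh (-2)).res le_top c) := by
          refine (N.D_act' (k' := i + 2 + 1) (i' := -1) ◇ h ◇ ◇ ◇ rfl w _).trans ?_
          rw [← N.res_D, D_c, map_zero, N.act_zero, smul_zero, add_zero]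
        exact this ▸ mem _ _
      res_act := fun h U V hV w p => N.res_act h hV w p
      res_D := fun h U V hV p => N.res_D h hV p
      add_act := fun h U w w' p => memeq _ _ _ _ (N.add_act h w w' p)
      one_act := fun h U p => memeq _ _ _ _ (N.one_act h p)
      mul_act := fun h h₁ h₂ h₃ U w w' p => memeq _ _ _ _ (N.mul_act h h₁ h₂ h₃ w w' p)
      D_D := fun h h' U p => by
        have : N.D h' (N.D h p) = 0 := N.D_D h h' p
        exact this.symm ▸ zero_mem _
      D_act := fun h h₁ h₂ h₃ h₄ hk U w p => memeq _ _ _ _ (N.D_act' h h₁ h₂ h₃ h₄ hk w p) }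
  obtain ⟨N', π, H⟩ := P.exists_isQuot
  refine ⟨N', ⟨π, fun {i} _ _ h m => (H.quot i).res h m, fun h U w m => H.act h w m,
    fun h U m => H.D h m⟩, fun h U w => H.zero _ (mem h w), fun {k i} h U t ht x => ?_⟩
  obtain ⟨V, hV, hx, w, hw⟩ := H.ker t ht x
  obtain rfl : k = i + 2 := ◇
  exact ⟨V, hV, w, hx, hw⟩

end DGMod

namespace CExt
variable {A : LieAlgebroid X} (S : Sharp A) (Q : CExt A) {U V : Opens X.pt}

lemma proj_coanchor (w : Form 1 U) : Q.proj (Q.coanchor w) = 0 :=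
  (Q.proj_eq_zero _).2 ⟨w, rfl⟩

/-- `A` as a quotient sheaf of `𝒬`. -/
lemma isSheafQuot_proj : IsSheafQuot Q.toAbSheaf.pre A.toAbSheaf
    (fun _ => (Q.proj : Q.sec _ →ₗ[Fn _] A.sec _).toAddMonoidHom) where
  res h p := Q.res_proj h p
  surj a x := by
    obtain ⟨V, h, q, hx, hq⟩ := Q.proj_surjective a x
    exact ⟨V, h, q, hx, hq.symm⟩

lemma anchor_proj_contr {k l : ℤ} (h : -1 + k = l) (q : Q.sec U) (w : Form k U) :
    (A.anchor (Q.proj q)).contr h w = (Q.anchor q).contr h w := by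
  refine ((VField.contracts_iff _ h _ _).1 fun x => ?_).symm
  rw [Q.anchor_proj]
  rfl

variable {Q} {N : DGMod X} {j : ∀ U : Opens X.pt, Q.sec U →+ (N.sh (-1)).sec U}
  {c : (N.sh (-2)).sec ⊤}

/-- A map to `A♯` from a DG module presented by `𝒬` is surjective with kernel spanned by `c`. The
inclusion of the kernel holds as `A♯` maps to the quotient by the span of `c`. -/
lemma proj_exact (H : Presented Q.toOMod (fun _ => Q.coanchor) N j c)
    (p : DGMod.Hom N S.alg.toDGMod)
    (hp : ∀ (U : Opens X.pt) (q : Q.sec U), p.map (-1) U (j U q) = S.j U (Q.proj q))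
    (hc : p.map (-2) ⊤ c = 0)
    (hinj : ∀ {k i : ℤ} (h : k + -2 = i) {U : Opens X.pt} (w : Form k U),
      N.act h w ((N.sh (-2)).res le_top c) = 0 → w = 0) {k i : ℤ} (h : k + -2 = i)
    (t : (N.sh i).sec U) :
    p.map i U t = 0 ↔ ∃ w : Form k U, N.act h w ((N.sh (-2)).res le_top c) = t := by
  constructor
  swap
  · rintro ⟨w, rfl⟩
    rw [p.map_act, ← p.res_map, hc, map_zero, DGMod.act_zero]
  intro ht
  obtain ⟨N', π, hπ, hπ'⟩ := N.exists_quot c H.D_c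
  obtain ⟨ψ, hψ, hψj⟩ := Q.isSheafQuot_proj.descend (G := N'.sh (-1))
    (fun U => (π.map (-1) U).comp (j U))
    (fun h q => (π.res_map h _).trans (congrArg _ (H.res_j h q)))
    (fun {U} q hq => by
      obtain ⟨w, rfl⟩ := (Q.proj_eq_zero q).1 hq
      refine (congrArg (π.map (-1) U) (H.j_κ ◇ w)).trans (hπ _ _ _))
  obtain ⟨f, hfc, hf⟩ := S.oddPullback.presented.exists_hom (N' := N') ψ 0 (fun h a => hψ h a)
    (fun {U} f a => by
      refine (N'.sh (-1)).eq_of_local fun x => ?_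
      obtain ⟨V, hV, q, hx, hq⟩ := Q.proj_surjective a x
      refine ⟨V, hV, hx, ?_⟩
      rw [N'.res_act, hψ, hψ, A.res_smul, ← hq, ← map_smul]
      refine (hψj _).trans (Eq.trans ?_ (congrArg (N'.act _ _) (hψj q)).symm)
      refine (congrArg (π.map _ _) (H.j_smul _ _)).trans (π.map_act _ _ _))
    (fun h => map_zero _)
    (fun {U} h α => (map_zero (ψ U)).trans
      ((congrArg (N'.act h α) (map_zero _)).trans (N'.act_zero _ _)).symm) (fun _ => rfl)
  have hfp : f.comp p = π := by
    refine H.hom_ext ?_ fun U q => ?_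
    · refine (congrArg (f.map (-2) ⊤) hc).trans ((map_zero _).trans ?_)
      have := hπ (zero_add (-2)) ⊤ (Form.ofFn 1)
      rw [AbSheaf.res_id, N.one_act] at this
      exact this.symm
    · exact (congrArg (f.map (-1) U) (hp U q)).trans ((hf U _).trans (hψj q))
  have h0 : π.map i U t = 0 := by
    rw [← hfp]
    exact (congrArg (f.map i U) ht).trans (map_zero _)
  have hres : ∀ {U V : Opens X.pt} (hV : V ≤ U) (w : Form k U),
      (N.sh i).res hV (N.act h w ((N.sh (-2)).res le_top c)) =
        N.act h (Form.res hV w) ((N.sh (-2)).res le_top c) := fun hV w => by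
    rw [N.res_act, AbSheaf.res_res]
  obtain ⟨w, hw⟩ := (Form.sheaf X k).glue_local (U := U)
    (fun V w => ∃ hV : V ≤ U, N.act h w ((N.sh (-2)).res le_top c) = (N.sh i).res hV t)
    (fun x => by
      obtain ⟨V, hV, w, hx, hw⟩ := hπ' h t h0 x
      exact ⟨V, hV, hx, w, hV, hw⟩)
    (fun V V' w w' hV hV' ⟨_, hw⟩ ⟨_, hw'⟩ => by
      rw [← sub_eq_zero]
      refine hinj h _ ?_
      rw [N.sub_act]
      refine (congrArg₂ (· - ·) (hres inf_le_left w).symm (hres inf_le_right w').symm).trans ?_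
      rw [hw, hw', AbSheaf.res_res, AbSheaf.res_res, sub_self])
  refine ⟨w, (N.sh i).eq_of_local fun x => ?_⟩
  obtain ⟨V, hV, w', hx, hw'⟩ := hπ' h t h0 x
  refine ⟨V, hV, hx, ?_⟩
  have := hw V hV w' ⟨hV, hw'⟩
  rw [hres, ← hw']
  exact congrArg (fun w => N.act h w _) this

lemma proj_locally_surjective (H : Presented Q.toOMod (fun _ => Q.coanchor) N j c)
    (p : DGMod.Hom N S.alg.toDGMod)
    (hp : ∀ (U : Opens X.pt) (q : Q.sec U), p.map (-1) U (j U q) = S.j U (Q.proj q)) {i : ℤ}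
    (b : (S.alg.sh i).sec U) (x : U) :
    ∃ (V : Opens X.pt) (h : V ≤ U) (a : (N.sh i).sec V), (x : X.pt) ∈ V ∧
      p.map i V a = (S.alg.sh i).res h b := by
  revert x
  refine S.oddPullback.presented.induction (fun i U b => ∀ x : U, ∃ (V : Opens X.pt) (h : V ≤ U)
    (a : (N.sh i).sec V), (x : X.pt) ∈ V ∧ p.map i V a = (S.alg.sh i).res h b) ?_ ?_ ?_ ?_ i U b
  · intro i U b hb x
    obtain ⟨V, hV, hx, hb⟩ := hb x
    obtain ⟨W, hW, a, hx, ha⟩ := hb ⟨x, hx⟩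
    exact ⟨W, hW.trans hV, a, hx, by rw [ha, AbSheaf.res_res]⟩
  · intro i U b b' hb hb' x
    obtain ⟨V, hV, a, hx, ha⟩ := hb x
    obtain ⟨V', hV', a', hx', ha'⟩ := hb' x
    refine ⟨V ⊓ V', inf_le_left.trans hV, (N.sh i).res inf_le_left a + (N.sh i).res inf_le_right a',
      ⟨hx, hx'⟩, ?_⟩
    rw [map_add, map_add, ← p.res_map, ← p.res_map, ha, ha', AbSheaf.res_res, AbSheaf.res_res]
  · intro i U b hb x
    obtain ⟨V, hV, a, hx, ha⟩ := hb x
    exact ⟨V, hV, -a, hx, by rw [map_neg, map_neg, ha]⟩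
  · intro k i U y h w x
    have key : ∃ (V : Opens X.pt) (hV : V ≤ U) (a : (N.sh y.deg).sec V), (x : X.pt) ∈ V ∧
        p.map _ V a = (S.alg.sh y.deg).res hV (y.val S.j 0) := by
      cases y with
      | c => exact ⟨U, le_rfl, 0, x.2, by
          rw [map_zero, AbSheaf.res_id]; exact (map_zero _).symm⟩
      | j e =>
        obtain ⟨V, hV, q, hx, hq⟩ := Q.proj_surjective e x
        refine ⟨V, hV, j V q, hx, (hp V q).trans ?_⟩
        rw [hq]
        exact (S.oddPullback.res_j hV e).symm
      | D e =>
        obtain ⟨V, hV, q, hx, hq⟩ := Q.proj_surjective e x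
        refine ⟨V, hV, N.D (neg_add_cancel 1) (j V q), hx, (p.map_D _ _).trans ?_⟩
        rw [hp V q, hq]
        exact ((S.alg.res_D _ hV _).trans (congrArg _ (S.oddPullback.res_j hV e))).symm
    obtain ⟨V, hV, a, hx, ha⟩ := key
    exact ⟨V, hV, N.act h (Form.res hV w) a, hx, by rw [p.map_act, ha, S.alg.res_act]⟩

variable (Q) in
/-- The transgression of a Courant extension exists. -/
lemma exists_transgression (hA : A.LocallyFree) :
    ∃ (T : OExt2 S.alg) (j : _), IsTransgression S Q T j := by
  obtain ⟨N, j, c, ⟨C⟩⟩ := CokerSquare.exists_cokerSquare Q.toOMod (fun _ => Q.coanchor)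
    (fun h w => Q.res_coanchor h w)
  have H : IsCartan Q.toPreCourant N j c :=
    { C.presented with
      pair_κ := fun {k i} hk U w e α => by
        have e1 : Form.ofFn (Q.pair e (Q.coanchor α)) =
            (Q.anchor e).contr (neg_add_cancel 1) α :=
          (VField.contracts_iff _ _ _ _).1 (Q.pair_coanchor e α)
        refine congrArg (fun w => N.act hk w ((N.sh (-2)).res le_top c)) ?_
        change Q.pair e (Q.coanchor α) • w = Form.mul _ w ((Q.anchor e).contr _ α)
        rw [← e1, Form.mul_ofFn] }
  obtain ⟨p₀, hpc, hpj⟩ := H.toPresented.exists_hom (N' := S.alg.toDGMod)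
    (fun U => (S.j U).comp (Q.proj : Q.sec U →ₗ[Fn U] A.sec U).toAddMonoidHom) 0
    (fun h q => (S.oddPullback.res_j h _).trans (congrArg _ (Q.res_proj h q)))
    (fun f q => (congrArg (S.j _) (map_smul (Q.proj : Q.sec _ →ₗ[Fn _] A.sec _) f q)).trans (S.oddPullback.j_smul f _))
    (fun h => map_zero _)
    (fun {U} h α => ((congrArg (S.j U) (Q.proj_coanchor α)).trans (map_zero _)).trans
      ((congrArg (S.alg.act h α) (map_zero _)).trans (S.alg.act_zero _ _)).symm) (fun _ => rfl)
  have hpc' : ∀ U : Opens X.pt, p₀.map (-2) U ((N.sh (-2)).res le_top c) = 0 := fun U => by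
    rw [← p₀.res_map, hpc, map_zero]
  obtain ⟨p, hp⟩ := DGLie.exists_hom (M := H.dgLie) (M' := S.alg) H.toPresented p₀
    (fun {k l} h U w => by
      refine Eq.trans ?_ (H.δ_c h w).symm
      exact (congrArg (S.alg.anchor h · w) (hpc' U)).trans (S.alg.anchor_zero_left _ _))
    (fun {k l} h U e w => by
      refine Eq.trans ?_ (H.δ_j h e w).symm
      refine (congrArg (S.alg.anchor h · w) (hpj U e)).trans ?_
      exact ((VField.contracts_iff _ h _ _).1 (S.anchor_j h (Q.proj e) w)).trans
        (Q.anchor_proj_contr h e w))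
    (fun {k U} b l h => by
      refine (congrArg (p₀.map l U) (H.c_br h b)).trans ((map_zero _).trans ?_)
      exact ((congrArg (S.alg.br h · _) (hpc' U)).trans (S.alg.zero_br _ _)).symm)
    (fun {U} e e' l h => by
      refine (congrArg (p₀.map l U) (H.br_j_j h ◇ e e')).trans ?_
      rw [p₀.map_act, hpc', DGMod.act_zero]
      refine ((congrArg₂ (S.alg.br h) (hpj U e) (hpj U e')).trans (S.br_j_j h _ _)).symm)
    (fun {U} e e' l h => by
      obtain rfl : -1 = l := ◇
      refine (congrArg (p₀.map (-1) U) (H.br_D_j h e e')).trans ((hpj U _).trans ?_)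
      refine (congrArg (S.j U) (Q.proj_br e e')).trans ?_
      refine (S.br_D_j _ _).symm.trans (congrArg₂ (S.alg.br h) ?_ (hpj U e').symm)
      exact ((p₀.map_D _ _).trans (congrArg _ (hpj U e))).symm)
  have hpm : ∀ {i : ℤ} {U : Opens X.pt} (t : (N.sh i).sec U), p.map i U t = p₀.map i U t :=
    fun {i U} t => congrArg (fun F : DGMod.Hom N S.alg.toDGMod => F.map i U t) hp
  have hinj : ∀ {k i : ℤ} (h : k + -2 = i) {U : Opens X.pt} (w : Form k U),
      N.act h w ((N.sh (-2)).res le_top c) = 0 → w = 0 := fun h U w hw =>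
    eq_zero_of_act_c hA C h w hw
  let T : OExt2 S.alg :=
    { alg := H.dgLie
      c := c
      D_c := H.D_c
      central := fun h U a => H.c_br h a
      proj := p
      mark_injective := hinj
      proj_eq_zero := fun h U a => (iff_of_eq (congrArg (· = 0) (hpm a))).trans
        (proj_exact S H.toPresented p₀ hpj hpc hinj h a)
      proj_surjective := fun b x => by
        obtain ⟨V, hV, a, hx, ha⟩ := proj_locally_surjective S H.toPresented p₀ hpj b x
        exact ⟨V, hV, a, hx, (hpm a).trans ha⟩ }
  refine ⟨T, j, ⟨⟨CokerSquare.transgressionSquare C⟩, fun q => (hpm _).trans (hpj _ q),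
    fun h U q w => (VField.contracts_iff _ h _ _).2 (H.δ_j h q w),
    fun h U q q' => H.br_j_j h _ q q', fun q q' => H.br_D_j _ q q', fun h U q q' => ?_⟩⟩
  refine (H.br_j_D _ q q').trans ?_
  have e1 : j U (Q.br q q') + j U (Q.br q' q) = N.act h (Form.dFn (Q.pair q q'))
      ((N.sh (-2)).res le_top c) := by
    rw [← map_add, Q.br_symm]
    exact H.j_κ h _
  have e2 : -j U (Q.br q' q) =
      -N.act h (Form.dFn (Q.pair q q')) ((N.sh (-2)).res le_top c) + j U (Q.br q q') := by
    rw [← e1]; abel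
  exact e2

end CExt

/-! ### Morphisms of extensions are isomorphisms -/

/-- An injective, locally surjective morphism of sheaves is bijective on sections. -/
lemma AbSheaf.bijective_of_local {F G : AbSheaf X} (f : ∀ U, F.sec U →+ G.sec U)
    (hf : ∀ {U V : Opens X.pt} (h : V ≤ U) (s : F.sec U), G.res h (f U s) = f V (F.res h s))
    (hinj : ∀ {U : Opens X.pt} (s : F.sec U), f U s = 0 → s = 0)
    (hsurj : ∀ {U : Opens X.pt} (t : G.sec U) (x : U), ∃ (V : Opens X.pt) (h : V ≤ U)
      (s : F.sec V), (x : X.pt) ∈ V ∧ f V s = G.res h t) (U : Opens X.pt) :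
    Function.Bijective (f U) := by
  have hinj' : ∀ {U : Opens X.pt}, Function.Injective (f U) := fun {U} =>
    (injective_iff_map_eq_zero (f U)).2 fun s => hinj s
  refine ⟨hinj', fun t => ?_⟩
  obtain ⟨s, hs⟩ := F.glue_local (U := U) (fun V s => ∃ hV : V ≤ U, f V s = G.res hV t)
    (fun x => by
      obtain ⟨V, hV, s, hx, hs⟩ := hsurj t x
      exact ⟨V, hV, hx, s, hV, hs⟩)
    (fun V V' s s' _ _ ⟨hV, hs⟩ ⟨hV', hs'⟩ => by
      apply hinj'
      rw [← hf, ← hf, hs, hs', G.res_res, G.res_res])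
  refine ⟨s, G.eq_of_local fun x => ?_⟩
  obtain ⟨V, hV, s', hx, hs'⟩ := hsurj t x
  exact ⟨V, hV, hx, by rw [hf, hs V hV s' ⟨hV, hs'⟩, hs']⟩

namespace OExt2
variable {B : DGLie X} {R T : OExt2 B} {U V : Opens X.pt} {k l i m n : ℤ}

lemma mark_add (h : k + -2 = i) (w w' : Form k U) : T.mark h (w + w') = T.mark h w + T.mark h w' :=
  T.alg.add_act h w w' _

lemma mark_zero (h : k + -2 = i) : T.mark h (0 : Form k U) = 0 := T.alg.zero_act h _

lemma mark_neg (h : k + -2 = i) (w : Form k U) : T.mark h (-w) = -T.mark h w := T.alg.neg_act h w _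

lemma mark_sub (h : k + -2 = i) (w w' : Form k U) : T.mark h (w - w') = T.mark h w - T.mark h w' :=
  T.alg.sub_act h w w' _

lemma mark_inj (h : k + -2 = i) {w w' : Form k U} (e : T.mark h w = T.mark h w') : w = w' := by
  rw [← sub_eq_zero]
  exact T.mark_injective h _ (by rw [← mark, mark_sub, e, sub_self])

lemma res_mark (h : k + -2 = i) (hV : V ≤ U) (w : Form k U) :
    (T.alg.sh i).res hV (T.mark h w) = T.mark h (Form.res hV w) := by
  rw [mark, mark, T.alg.res_act, AbSheaf.res_res]

lemma act_mark (h : k + -2 = i) (hl : l + i = m) (hk : l + k = n) (hn : n + -2 = m) (v : Form l U)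
    (w : Form k U) : T.alg.act hl v (T.mark h w) = T.mark hn (Form.mul hk v w) :=
  (T.alg.mul_act hk h hl hn v w _).symm

lemma D_mark (h : k + -2 = i) (hi : i + 1 = m) (hk : k + 1 = l) (hl : l + -2 = m) (w : Form k U) :
    T.alg.D hi (T.mark h w) = T.mark hl (Form.d hk w) := by
  rw [mark, T.alg.D_act' h hi hl (i' := -1) ◇ ◇ hk, ← T.alg.res_D, T.D_c, map_zero,
    T.alg.act_zero, smul_zero, add_zero, mark]

lemma proj_mark (h : k + -2 = i) (w : Form k U) : T.proj.map i U (T.mark h w) = 0 :=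
  (T.proj_eq_zero h _).2 ⟨w, rfl⟩

lemma br_mark (h : k + -2 = i) (hl : m + i = l) (hm : m + k = n) (hn : n + -2 = l)
    (a : (T.alg.sh m).sec U) (w : Form k U) :
    T.alg.br hl a (T.mark h w) = T.mark hn (T.alg.anchor hm a w) := by
  rw [mark, T.alg.leibniz h hm rfl hl hn ◇, T.alg.br_symm _ ◇, T.central,
    smul_zero, neg_zero, T.alg.act_zero, smul_zero, add_zero, mark]

lemma Hom.map_c_res (f : R ⟶ T) (U : Opens X.pt) :
    f.map (-2) U ((R.alg.sh (-2)).res le_top R.c) = (T.alg.sh (-2)).res le_top T.c := by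
  rw [← f.res_map, f.map_c]

lemma Hom.map_mark (f : R ⟶ T) (h : k + -2 = i) (w : Form k U) :
    f.map i U (R.mark h w) = T.mark h w := by
  rw [mark, mark, f.map_act, f.map_c_res]

lemma Hom.bijective (f : R ⟶ T) (i : ℤ) (U : Opens X.pt) : Function.Bijective (f.map i U) := by
  refine AbSheaf.bijective_of_local (f.map i) (fun h s => f.res_map h s) (fun {U} s hs => ?_)
    (fun {U} t x => ?_) U
  · obtain ⟨w, rfl⟩ := (R.proj_eq_zero (k := i + 2) ◇ s).1 (by
      rw [← f.map_proj, hs, map_zero])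
    have hw : T.mark (k := i + 2) (i := i) ◇ w = 0 := (f.map_mark _ w).symm.trans hs
    rw [T.mark_injective _ w hw, R.alg.zero_act]
  · obtain ⟨V, hV, s, hx, hs⟩ := R.proj_surjective (T.proj.map i U t) x
    obtain ⟨w, hw⟩ := (T.proj_eq_zero (k := i + 2) ◇ ((T.alg.sh i).res hV t - f.map i V s)).1
      (by rw [map_sub, f.map_proj, hs, T.proj.res_map, sub_self])
    refine ⟨V, hV, s + R.mark ◇ w, hx, ?_⟩
    rw [map_add, f.map_mark]
    exact (congrArg (_ + ·) hw).trans (add_sub_cancel _ _)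

/-- The morphism of DG Lie algebroids inverse to a bijective one. -/
lemma isIso (f : R ⟶ T) : IsIso f := by
  have hinj : ∀ {i : ℤ} {U : Opens X.pt}, Function.Injective (f.map i U) := by
    intro i U; exact (f.bijective i U).1
  let e : ∀ (i : ℤ) (U : Opens X.pt), (R.alg.sh i).sec U ≃+ (T.alg.sh i).sec U := fun i U =>
    AddEquiv.ofBijective (f.map i U) (f.bijective i U)
  have he : ∀ {i : ℤ} {U : Opens X.pt} (t : (T.alg.sh i).sec U), f.map i U ((e i U).symm t) = t :=
    fun t => (e _ _).apply_symm_apply t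
  let g : T ⟶ R :=
    { map := fun i U => (e i U).symm
      res_map := fun h m => hinj ((f.res_map h _).symm.trans
        ((congrArg _ (he m)).trans (he _).symm))
      map_act := fun h _ w m => hinj ((he _).trans ((congrArg _ (he m)).symm.trans
        (f.map_act h w _).symm))
      map_D := fun h _ m => hinj ((he _).trans ((congrArg _ (he m)).symm.trans (f.map_D h _).symm))
      map_br := fun h _ a b => hinj ((he _).trans ((congrArg₂ _ (he a) (he b)).symm.trans
        (f.map_br h _ _).symm))
      map_anchor := fun h _ a w => (f.map_anchor h _ w).symm.trans (congrArg (T.alg.anchor h · w) (he a))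
      map_c := hinj ((he _).trans f.map_c.symm)
      map_proj := fun a => (f.map_proj _).symm.trans (congrArg _ (he a)) }
  refine ⟨g, Hom.ext (funext fun i => funext fun U => AddMonoidHom.ext fun a => ?_),
    Hom.ext (funext fun i => funext fun U => AddMonoidHom.ext fun a => ?_)⟩
  · exact (e i U).symm_apply_apply a
  · exact he a

lemma Hom.ext' {f g : R ⟶ T} (h : ∀ (i : ℤ) (U : Opens X.pt) (a : (R.alg.sh i).sec U),
    f.map i U a = g.map i U a) : f = g :=
  Hom.ext (funext fun i => funext fun U => AddMonoidHom.ext fun a => h i U a)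

end OExt2

namespace CExt
variable {A : LieAlgebroid X} {P Q : CExt A} {U V : Opens X.pt}

lemma Hom.ext' {f g : P ⟶ Q} (h : ∀ (U : Opens X.pt) (a : P.sec U), f.map U a = g.map U a) :
    f = g :=
  Hom.ext (funext fun U => LinearMap.ext fun a => h U a)

lemma Hom.bijective (f : P ⟶ Q) (U : Opens X.pt) : Function.Bijective (f.map U) := by
  refine AbSheaf.bijective_of_local (F := P.toAbSheaf) (G := Q.toAbSheaf)
    (fun U => (f.map U).toAddMonoidHom) (fun h s => f.res_map h s) (fun {U} s hs => ?_)
    (fun {U} t x => ?_) U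
  · have hs' : f.map U s = 0 := hs
    obtain ⟨w, rfl⟩ := (P.proj_eq_zero s).1 (by rw [← f.map_proj, hs', map_zero])
    rw [f.map_coanchor] at hs'
    rw [Q.coanchor_injective w hs', map_zero]
  · obtain ⟨V, hV, s, hx, hs⟩ := P.proj_surjective (Q.proj t) x
    obtain ⟨w, hw⟩ := (Q.proj_eq_zero (Q.res hV t - f.map V s)).1
      (by rw [map_sub, f.map_proj, hs, Q.res_proj, sub_self])
    refine ⟨V, hV, s + P.coanchor w, hx, ?_⟩
    refine (map_add (f.map V) _ _).trans ?_
    rw [f.map_coanchor, hw, add_sub_cancel]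

lemma isIso (f : P ⟶ Q) : IsIso f := by
  have hinj : ∀ {U : Opens X.pt}, Function.Injective (f.map U) := by
    intro U; exact (f.bijective U).1
  let e : ∀ U : Opens X.pt, P.sec U ≃ₗ[Fn U] Q.sec U := fun U =>
    LinearEquiv.ofBijective (f.map U) (f.bijective U)
  have he : ∀ {U : Opens X.pt} (t : Q.sec U), f.map U ((e U).symm t) = t :=
    fun t => (e _).apply_symm_apply t
  let g : Q ⟶ P :=
    { map := fun U => (e U).symm
      res_map := fun h m => hinj ((f.res_map h _).symm.trans
        ((congrArg _ (he m)).trans (he _).symm))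
      map_br := fun a b => hinj ((he _).trans ((congrArg₂ _ (he a) (he b)).symm.trans
        (f.map_br _ _).symm))
      map_pair := fun a b => (f.map_pair _ _).symm.trans (congrArg₂ _ (he a) (he b))
      map_coanchor := fun w => hinj ((he _).trans (f.map_coanchor w).symm)
      map_anchor := fun a x => (f.map_anchor _ x).symm.trans
        (congrArg (fun q => (Q.anchor q).toFun x) (he a))
      map_proj := fun a => (f.map_proj _).symm.trans (congrArg _ (he a)) }
  exact ⟨g, Hom.ext' fun U a => (e U).symm_apply_apply a, Hom.ext' fun U a => he a⟩

end CExt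

/-! ### The universal property of transgression -/

/-- The map `j : 𝒬 → T` of degree `-1` is compatible with the structures of `𝒬` and `T`; in other
words, it is a morphism from `𝒬` to the Courant extension which is the degree `-1` part of `T`. -/
structure IsCourMap {A : LieAlgebroid X} (S : Sharp A) (Q : CExt A) (T : OExt2 S.alg)
    (j : ∀ U : Opens X.pt, Q.sec U →+ (T.alg.sh (-1)).sec U) : Prop where
  res_j : ∀ {U V : Opens X.pt} (h : V ≤ U) (q : Q.sec U),
    (T.alg.sh (-1)).res h (j U q) = j V (Q.res h q)
  j_smul : ∀ {U : Opens X.pt} (f : Fn U) (q : Q.sec U),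
    j U (f • q) = T.alg.act (zero_add _) (Form.ofFn f) (j U q)
  j_coanchor : ∀ (h : 1 + -2 = (-1 : ℤ)) {U : Opens X.pt} (w : Form 1 U),
    j U (Q.coanchor w) = T.mark h w
  proj_j : ∀ {U : Opens X.pt} (q : Q.sec U), T.proj.map (-1) U (j U q) = S.j U (Q.proj q)
  br_j_j : ∀ (h : -1 + -1 = (-2 : ℤ)) {U : Opens X.pt} (p q : Q.sec U),
    T.alg.br h (j U p) (j U q) = T.mark (zero_add (-2)) (Form.ofFn (Q.pair p q))
  br_D_j : ∀ {U : Opens X.pt} (p q : Q.sec U),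
    T.alg.br (zero_add _) (T.alg.D (neg_add_cancel 1) (j U p)) (j U q) = j U (Q.br p q)

section
variable {A : LieAlgebroid X} {S : Sharp A} {P Q : CExt A} {T T' : OExt2 S.alg}
  {j : ∀ U : Opens X.pt, Q.sec U →+ (T.alg.sh (-1)).sec U}

lemma IsCourMap.comp_hom {j : ∀ U : Opens X.pt, Q.sec U →+ (T.alg.sh (-1)).sec U}
    (H : IsCourMap S Q T j) (f : P ⟶ Q) :
    IsCourMap S P T fun U => (j U).comp (f.map U).toAddMonoidHom where
  res_j h q := (H.res_j h _).trans (congrArg _ (f.res_map h q))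
  j_smul g q := (congrArg (j _) (map_smul (f.map _) g q)).trans (H.j_smul g _)
  j_coanchor h U w := (congrArg (j _) (f.map_coanchor w)).trans (H.j_coanchor h w)
  proj_j q := (H.proj_j _).trans (congrArg _ (f.map_proj q))
  br_j_j h U p q := (H.br_j_j h _ _).trans
    (congrArg (fun g => T.mark (zero_add (-2)) (Form.ofFn g)) (f.map_pair p q))
  br_D_j p q := (H.br_D_j _ _).trans (congrArg (j _) (f.map_br p q).symm)

namespace IsTransgression

lemma presented (H : IsTransgression S Q T j) :
    Presented Q.toOMod (fun _ => Q.coanchor) T.alg.toDGMod j T.c :=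
  H.square.some.cokerSquare.presented

lemma isCourMap (H : IsTransgression S Q T j) : IsCourMap S Q T j where
  res_j := H.presented.res_j
  j_smul := H.presented.j_smul
  j_coanchor h U w := H.presented.j_κ h w
  proj_j := H.proj_j
  br_j_j := H.br_j_j
  br_D_j := H.br_D_j

lemma hom_ext (H : IsTransgression S Q T j) {f g : T ⟶ T'}
    (h : ∀ (U : Opens X.pt) (q : Q.sec U), f.map (-1) U (j U q) = g.map (-1) U (j U q)) : f = g := by
  have := H.presented.hom_ext (f := f.toModHom) (g := g.toModHom) (f.map_c.trans g.map_c.symm) h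
  exact OExt2.Hom.ext' fun i U a => congrArg (fun F : DGMod.Hom _ _ => F.map i U a) this

/-- The universal property of `τ𝒬`: a morphism from `𝒬` to the degree `-1` part of `T'` extends to a
morphism from `τ𝒬` to `T'`. -/
lemma exists_hom (H : IsTransgression S Q T j)
    {j' : ∀ U : Opens X.pt, Q.sec U →+ (T'.alg.sh (-1)).sec U} (H' : IsCourMap S Q T' j') :
    ∃ F : T ⟶ T', ∀ (U : Opens X.pt) (q : Q.sec U), F.map (-1) U (j U q) = j' U q := by
  obtain ⟨f, hfc, hfj⟩ := H.presented.exists_hom (N' := T'.alg.toDGMod) j' T'.c H'.res_j H'.j_smul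
    T'.D_c (fun h w => H'.j_coanchor h w) (fun hc => by
      -- the section `c` vanishes only if `1 = 0`
      have h1 : (Form.ofFn 1 : Form 0 (⊤ : Opens X.pt)) = 0 :=
        T.mark_injective (zero_add (-2)) _ (by rw [hc, map_zero, T.alg.act_zero])
      rw [← T'.alg.one_act (zero_add (-2)) T'.c, h1, T'.alg.zero_act])
  have hproj : T'.proj.toModHom.comp f = T.proj.toModHom := by
    refine H.presented.hom_ext ?_ fun U q => ?_
    · have e1 : ∀ R : OExt2 S.alg, R.proj.map (-2) ⊤ R.c = 0 := fun R =>
        (R.proj_eq_zero (zero_add (-2)) _).2 ⟨Form.ofFn 1, by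
          rw [AbSheaf.res_id, R.alg.one_act]⟩
      exact (congrArg (T'.proj.map (-2) ⊤) hfc).trans ((e1 T').trans (e1 T).symm)
    · exact (congrArg (T'.proj.map (-1) U) (hfj U q)).trans ((H'.proj_j q).trans (H.proj_j q).symm)
  have hproj' : ∀ {i : ℤ} {U : Opens X.pt} (a : (T.alg.sh i).sec U),
      T'.proj.map i U (f.map i U a) = T.proj.map i U a := fun {i U} a =>
    congrArg (fun F : DGMod.Hom _ _ => F.map i U a) hproj
  have hanchor : ∀ {i k l : ℤ} (h : i + k = l) {U : Opens X.pt} (a : (T.alg.sh i).sec U)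
      (w : Form k U), T'.alg.anchor h (f.map i U a) w = T.alg.anchor h a w := fun h U a w => by
    rw [← T'.proj.map_anchor, hproj', T.proj.map_anchor]
  have hfc' : ∀ U : Opens X.pt, f.map (-2) U ((T.alg.sh (-2)).res le_top T.c) =
      (T'.alg.sh (-2)).res le_top T'.c := fun U => by rw [← f.res_map, hfc]
  have hmark : ∀ {k i : ℤ} (h : k + -2 = i) {U : Opens X.pt} (w : Form k U),
      f.map i U (T.mark h w) = T'.mark h w := fun h U w => by
    rw [OExt2.mark, f.map_act, hfc', OExt2.mark]
  obtain ⟨F, hF⟩ := DGLie.exists_hom (M := T.alg) (M' := T'.alg) H.presented f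
    (fun h U w => hanchor h _ w) (fun h U e w => hanchor h _ w)
    (fun {k U} b l h => by rw [T.central, map_zero, hfc', T'.central])
    (fun {U} e e' l h => by
      obtain rfl : -2 = l := ◇
      rw [H.br_j_j, hmark, hfj, hfj, H'.br_j_j])
    (fun {U} e e' l h => by
      obtain rfl : -1 = l := ◇
      rw [H.br_D_j, hfj, f.map_D, hfj, hfj, H'.br_D_j])
  subst hF
  exact ⟨{ toLieHom := F, map_c := hfc, map_proj := hproj' }, hfj⟩

end IsTransgression

variable (S) in
/-- The functor `τ` exists. -/
lemma exists_transgressionFunctor (hA : A.LocallyFree) : Nonempty (Transgression S) := by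
  choose T j H using fun Q => CExt.exists_transgression S Q hA
  choose F hF using fun (P Q : CExt A) (f : P ⟶ Q) =>
    (H P).exists_hom ((H Q).isCourMap.comp_hom f)
  exact ⟨{
    functor :=
      { obj := T
        map := fun {P Q} f => F P Q f
        map_id := fun Q => (H Q).hom_ext fun U q => hF Q Q (𝟙 Q) U q
        map_comp := fun {P Q R} f g => (H P).hom_ext fun U q => (hF P R (f ≫ g) U q).trans
          (((congrArg ((F Q R g).map (-1) U) (hF P Q f U q)).trans
            (hF Q R g U (f.map U q))).symm) }
    j := j
    isTransgression := H
    map_j := fun {P Q} f U p => hF P Q f U p }⟩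

end

/-! ### The Courant algebroid of an extension of `A♯` -/

namespace Form
variable {U V : Opens X.pt}

lemma toFn_add (v w : Form 0 U) : toFn (v + w) = toFn v + toFn w :=
  ofFn_injective (by rw [ofFn_add, ofFn_toFn, ofFn_toFn, ofFn_toFn])

lemma toFn_smul (f : Fn U) (v : Form 0 U) : toFn (f • v) = f * toFn v :=
  ofFn_injective (by rw [ofFn_smul, ofFn_toFn, ofFn_toFn])

end Form

namespace Sharp
variable {A : LieAlgebroid X} (S : Sharp A) {U V : Opens X.pt}

/-- There are no sections of `A♯` of degree `-2`, as `deg ε = -1`. -/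
lemma eq_zero_of_deg (y : (S.alg.sh (-2)).sec U) : y = 0 := by
  refine AbSheaf.eq_zero_of_local _ fun x => ?_
  obtain ⟨V, hV, t, hx, ht⟩ := S.oddPullback.surj y x
  refine ⟨V, hV, hx, ht.trans ?_⟩
  clear ht
  induction t using FreeAbelianGroup.induction_on with
  | zero => exact map_zero _
  | of g =>
    rw [FreeAbelianGroup.lift_apply_of, Form.eq_zero_of_neg ◇ g.1,
      Form.eq_zero_of_neg ◇ g.2.1, S.alg.zero_act, S.alg.zero_act, add_zero]
  | neg g h => rw [map_neg, h, neg_zero]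
  | add s t hs ht => rw [map_add, hs, ht, add_zero]

/-- The map `a ↦ a ε` identifies `A` with the degree `-1` part of `A♯`. -/
lemma j_bijective (U : Opens X.pt) : Function.Bijective (S.j U) := by
  refine AbSheaf.bijective_of_local (F := A.toAbSheaf) S.j (fun h a => S.oddPullback.res_j h a)
    (fun {U} a ha => ?_) (fun {U} y x => ?_) U
  · refine A.eq_zero_of_local fun x => ?_
    obtain ⟨V, hV, hx, hm⟩ := S.oddPullback.inj (m := -1)
      (FreeAbelianGroup.of (((0 : Form (-1) U), (Form.ofFn 1 : Form 0 U), a) : EvGen A.toOMod (-1) U)) (by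
        rw [FreeAbelianGroup.lift_apply_of, S.alg.zero_act, zero_add]
        exact (congrArg _ ha).trans (S.alg.act_zero _ _)) x
    refine ⟨V, hV, hx, ?_⟩
    -- the map `(w + v ε) ⊗ e ↦ v e` respects the relations, as forms of degree `-1` vanish
    let φ : FreeAbelianGroup (EvGen A.toOMod (-1) V) →+ A.sec V :=
      FreeAbelianGroup.lift fun g => Form.toFn (g.2.1 : Form 0 V) • g.2.2
    have hφ : ∀ r, r ∈ AddSubgroup.closure {r | EvRel A.toOMod (-1) V r} → φ r = 0 := by
      intro r hr
      refine (AddSubgroup.closure_le φ.ker).2 ?_ hr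
      rintro r hr
      change φ r = 0
      rcases hr with ⟨w, w', v, v', e⟩ | ⟨w, v, e, e'⟩ | ⟨w, v, f, e⟩
      · simp only [φ, map_sub, FreeAbelianGroup.lift_apply_of]
        erw [Form.toFn_add]
        rw [add_smul, add_sub_cancel_left, sub_self]
      · simp only [φ, map_sub, FreeAbelianGroup.lift_apply_of]
        rw [smul_add, add_sub_cancel_left, sub_self]
      · simp only [φ, map_sub, FreeAbelianGroup.lift_apply_of]
        rw [Form.eq_zero_of_neg ◇ w, Form.zero_mul, add_zero]
        erw [Form.toFn_smul]
        rw [mul_comm, mul_smul, sub_self]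
    have h1 := hφ _ hm
    rw [FreeAbelianGroup.map_of_apply] at h1
    have h2 : φ (FreeAbelianGroup.of (((0 : Form (-1) V), (Form.ofFn 1 : Form 0 V), A.res hV a) :
        EvGen A.toOMod (-1) V)) = A.res hV a := by
      refine (FreeAbelianGroup.lift_apply_of _ _).trans ?_
      change Form.toFn (Form.ofFn 1) • _ = _
      rw [Form.toFn_ofFn, one_smul]
    exact h2.symm.trans h1
  · obtain ⟨V, hV, t, hx, ht⟩ := S.oddPullback.surj y x
    refine ⟨V, hV, ?_⟩
    rw [ht]
    have : ∀ t : FreeAbelianGroup (EvGen A.toOMod (-1) V), ∃ s : A.sec V, S.j V s =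
        FreeAbelianGroup.lift (fun g => S.alg.act (add_zero (-1)) g.1
          (S.alg.D (neg_add_cancel 1) (S.j V g.2.2)) +
          S.alg.act (add_neg_cancel_right (-1) 1) g.2.1 (S.j V g.2.2)) t := by
      intro t
      induction t using FreeAbelianGroup.induction_on with
      | zero => exact ⟨0, by rw [map_zero, map_zero]⟩
      | of g =>
        refine ⟨Form.toFn (g.2.1 : Form 0 V) • g.2.2, ?_⟩
        rw [FreeAbelianGroup.lift_apply_of, Form.eq_zero_of_neg ◇ g.1, S.alg.zero_act,
          zero_add]
        refine (S.oddPullback.j_smul _ _).trans ?_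
        rw [Form.ofFn_toFn]
      | neg g h =>
        obtain ⟨s, hs⟩ := h
        exact ⟨-s, by rw [map_neg, map_neg, hs]⟩
      | add s t hs ht =>
        obtain ⟨s, hs⟩ := hs
        obtain ⟨t, ht⟩ := ht
        exact ⟨s + t, by rw [map_add, map_add, hs, ht]⟩
    obtain ⟨s, hs⟩ := this t
    exact ⟨s, hx, hs⟩

/-- The isomorphism `A → A ε`. -/
def jEquiv (U : Opens X.pt) : A.sec U ≃+ (S.alg.sh (-1)).sec U :=
  AddEquiv.ofBijective (S.j U) (S.j_bijective U)

lemma j_inj {a b : A.sec U} (h : S.j U a = S.j U b) : a = b := (S.j_bijective U).1 h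

end Sharp

namespace OExt2
variable {A : LieAlgebroid X} {S : Sharp A} (T : OExt2 S.alg) {U V : Opens X.pt}

/-- The map from the degree `-1` part of `T` to `A`. -/
def projA (U : Opens X.pt) : (T.alg.sh (-1)).sec U →+ A.sec U :=
  (S.jEquiv U).symm.toAddMonoidHom.comp (T.proj.map (-1) U)

lemma j_projA (t : (T.alg.sh (-1)).sec U) : S.j U (T.projA U t) = T.proj.map (-1) U t :=
  (S.jEquiv U).apply_symm_apply _

lemma res_projA (h : V ≤ U) (t : (T.alg.sh (-1)).sec U) :
    A.res h (T.projA U t) = T.projA V ((T.alg.sh (-1)).res h t) :=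
  S.j_inj (by rw [j_projA, ← T.proj.res_map, ← j_projA, S.oddPullback.res_j])

lemma projA_smul (f : Fn U) (t : (T.alg.sh (-1)).sec U) :
    T.projA U (T.alg.act (zero_add _) (Form.ofFn f) t) = f • T.projA U t :=
  S.j_inj (by rw [j_projA, T.proj.map_act, S.oddPullback.j_smul, j_projA])

lemma anchor_eq {k l : ℤ} (h : -1 + k = l) (t : (T.alg.sh (-1)).sec U) (w : Form k U) :
    T.alg.anchor h t w = (A.anchor (T.projA U t)).contr h w := by
  rw [← T.proj.map_anchor, ← j_projA]
  exact (VField.contracts_iff _ h _ _).1 (S.anchor_j h _ w)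

lemma anchor_D_eq {k : ℤ} (h : 0 + k = k) (t : (T.alg.sh (-1)).sec U) (w : Form k U) :
    T.alg.anchor h (T.alg.D (neg_add_cancel 1) t) w = (A.anchor (T.projA U t)).lie w := by
  rw [T.alg.anchor_D' (neg_add_cancel 1) (l := -1 + k) rfl h (k' := k + 1) ◇ rfl ◇,
    anchor_eq, anchor_eq, VField.lie_eq _ rfl ◇ rfl ◇]
  have hs : sg (-1) = -1 := by decide
  rw [hs, neg_smul, one_smul, sub_neg_eq_add]

lemma exists_pair (h : -1 + -1 = (-2 : ℤ)) (a b : (T.alg.sh (-1)).sec U) :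
    ∃ f : Fn U, T.mark (zero_add (-2)) (Form.ofFn f) = T.alg.br h a b := by
  obtain ⟨w, hw⟩ := (T.proj_eq_zero (zero_add (-2)) (T.alg.br h a b)).1 (S.eq_zero_of_deg _)
  exact ⟨Form.toFn w, by rw [Form.ofFn_toFn]; exact hw⟩

/-- The pairing `⟨a, b⟩ c = [a, b]` of sections of degree `-1`. -/
def pairing (a b : (T.alg.sh (-1)).sec U) : Fn U := (T.exists_pair ◇ a b).choose

lemma mark_pairing (h : -1 + -1 = (-2 : ℤ)) (a b : (T.alg.sh (-1)).sec U) :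
    T.mark (zero_add (-2)) (Form.ofFn (T.pairing a b)) = T.alg.br h a b :=
  (T.exists_pair ◇ a b).choose_spec

lemma pairing_eq {h : -1 + -1 = (-2 : ℤ)} {a b : (T.alg.sh (-1)).sec U} {f : Fn U}
    (e : T.alg.br h a b = T.mark (zero_add (-2)) (Form.ofFn f)) : T.pairing a b = f :=
  Form.ofFn_injective (T.mark_inj _ ((T.mark_pairing h a b).trans e))

instance moduleDegNegOne (U : Opens X.pt) : Module (Fn U) ((T.alg.sh (-1)).sec U) where
  smul f t := T.alg.act (zero_add _) (Form.ofFn f) t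
  one_smul t := T.alg.one_act _ t
  mul_smul f g t := by
    change T.alg.act _ (Form.ofFn (f * g)) t = T.alg.act _ _ (T.alg.act _ _ t)
    rw [T.alg.act_ofFn, mul_comm, Form.ofFn_smul]
  smul_zero f := T.alg.act_zero _ _
  smul_add f t t' := T.alg.act_add _ _ _ _
  add_smul f g t := by
    change T.alg.act _ (Form.ofFn (f + g)) t = T.alg.act _ _ t + T.alg.act _ _ t
    rw [Form.ofFn_add, T.alg.add_act]
  zero_smul t := by
    change T.alg.act _ (Form.ofFn 0) t = 0
    rw [Form.ofFn_zero, T.alg.zero_act]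

/-- The `𝒪`-module of sections of degree `-1`. -/
@[reducible] def degNegOne : OMod X where
  toAbSheaf := T.alg.sh (-1)
  mod U := T.moduleDegNegOne U
  res_smul h f t := T.alg.res_act _ h _ _

lemma projA_br (a b : (T.alg.sh (-1)).sec U) :
    T.projA U (T.alg.br (zero_add _) (T.alg.D (neg_add_cancel 1) a) b) =
      A.br (T.projA U a) (T.projA U b) :=
  S.j_inj (by rw [j_projA, T.proj.map_br, T.proj.map_D, ← S.br_D_j, j_projA, j_projA])

lemma projA_mark (h : 1 + -2 = (-1 : ℤ)) (w : Form 1 U) : T.projA U (T.mark h w) = 0 :=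
  S.j_inj (by rw [j_projA, proj_mark, map_zero])

/-- The map `w ↦ w · c` from `Ω¹`. -/
def markLin (U : Opens X.pt) : Form 1 U →ₗ[Fn U] T.degNegOne.sec U where
  toFun w := T.mark ◇ w
  map_add' w w' := T.mark_add _ w w'
  map_smul' f w := by
    refine Eq.trans ?_ (T.act_mark (l := 0) ◇ (zero_add (-1)) (zero_add 1) ◇
      (Form.ofFn f) w).symm
    rw [Form.ofFn_mul']

/-- The map from the degree `-1` part of `T` to `A`, as a linear map. -/
def projALin (U : Opens X.pt) : T.degNegOne.sec U →ₗ[Fn U] A.sec U where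
  __ := T.projA U
  map_smul' f t := T.projA_smul f t

/-- The Courant extension of `A` formed by the sections of `T` of degree `-1`. -/
def cour : CExt A where
  toOMod := T.degNegOne
  br {U} a b := T.alg.br (zero_add _) (T.alg.D (neg_add_cancel 1) a) b
  anchor {U} a := A.anchor (T.projA U a)
  pair {U} a b := T.pairing a b
  coanchor {U} := T.markLin U
  add_br a b c := by rw [map_add, T.alg.add_br]
  br_add a b c := T.alg.br_add _ _ _ _
  res_br h a b := by rw [T.alg.res_br, T.alg.res_D]
  leibnizIdentity {U} a b c := by
    have e1 : T.alg.D (neg_add_cancel 1) (T.alg.br (zero_add _) (T.alg.D (neg_add_cancel 1) a) b) =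
        T.alg.br (zero_add 0) (T.alg.D (neg_add_cancel 1) a) (T.alg.D (neg_add_cancel 1) b) := by
      rw [T.alg.D_br (zero_add (-1)) (zero_add 1) (neg_add_cancel 1) (neg_add_cancel 1) ◇
        (zero_add 0), T.alg.D_D, T.alg.zero_br, zero_add, Int.negOnePow_zero, Units.val_one, one_smul]
    rw [e1, T.alg.jacobi (zero_add 0) (zero_add (-1)) (zero_add (-1)) (zero_add (-1)) (zero_add (-1))
      (zero_add (-1)), mul_zero, Int.negOnePow_zero, Units.val_one, one_smul]
  anchor_add a b x := by rw [map_add]; exact A.anchor_add _ _ x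
  anchor_smul f a x := (congrArg (fun q => (A.anchor q).toFun x) (T.projA_smul f a)).trans
    (A.anchor_smul _ _ x)
  anchor_res h a x := (congrArg (fun q => (A.anchor q).toFun x) (T.res_projA h a).symm).trans
    (A.anchor_res h _ x)
  anchor_br a b f := (congrArg (fun q => (A.anchor q).apply f) (T.projA_br a b)).trans
    (A.anchor_br _ _ f)
  pair_symm a b := T.pairing_eq (h := by norm_num) (by
    rw [mark_pairing _ ◇, T.alg.br_symm _ ◇]
    have hs : (((-1 * -1 : ℤ).negOnePow : ℤˣ) : ℤ) = -1 := by decide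
    rw [hs, neg_smul, one_smul, neg_neg])
  pair_add a b c := T.pairing_eq (h := by norm_num) (by
    rw [Form.ofFn_add, mark_add, mark_pairing _ ◇, mark_pairing _ ◇]
    exact T.alg.br_add _ _ _ _)
  pair_smul {U} f a b := T.pairing_eq (h := by norm_num) (by
    refine (T.alg.leibniz (l := -1) (zero_add (-1)) ◇ (ij := -2) ◇ ◇
      ◇ (zero_add (-2)) a b (Form.ofFn f)).trans ?_
    rw [Form.eq_zero_of_neg ◇ (T.alg.anchor _ a (Form.ofFn f)), T.alg.zero_act, zero_add,
      mul_zero, Int.negOnePow_zero, Units.val_one, one_smul, ← mark_pairing,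
      T.act_mark _ _ (zero_add 0) (zero_add (-2)), Form.ofFn_mul', Form.ofFn_smul])
  res_pair h a b := (T.pairing_eq (h := by norm_num) (by
    rw [← T.alg.res_br, ← mark_pairing, res_mark]; rfl)).symm
  res_coanchor h w := T.res_mark _ h w
  anchor_coanchor {U} w x := (congrArg (fun q => (A.anchor q).toFun x) (T.projA_mark _ w)).trans
    (A.toPreCourant.anchor_coanchor (0 : Form 1 U) x)
  leibniz {U} a b f := by
    refine (T.alg.leibniz (l := 0) (zero_add (-1)) (zero_add 0) (ij := -1) ◇ ◇
      ◇ (zero_add (-1)) _ b (Form.ofFn f)).trans ?_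
    have e1 : (A.anchor (T.projA U a)).lie (Form.ofFn f) =
        Form.ofFn ((A.anchor (T.projA U a)).apply f) := by
      rw [VField.lie_eq _ (l := -1) ◇ ◇ (m := 1) ◇ ◇,
        VField.contr_ofFn, map_zero, zero_add, Form.d_ofFn, VField.contr_dFn]
    rw [T.anchor_D_eq, e1, mul_zero, Int.negOnePow_zero, Units.val_one, one_smul]
    exact add_comm _ _
  pair_br {U} a b c := by
    refine Form.ofFn_injective (T.mark_inj (zero_add (-2)) ?_)
    have e1 : (A.anchor (T.projA U a)).lie (Form.ofFn (T.pairing b c)) =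
        Form.ofFn ((A.anchor (T.projA U a)).apply (T.pairing b c)) := by
      rw [VField.lie_eq _ (l := -1) ◇ ◇ (m := 1) ◇ ◇,
        VField.contr_ofFn, map_zero, zero_add, Form.d_ofFn, VField.contr_dFn]
    rw [Form.ofFn_add, mark_add, mark_pairing _ ◇, mark_pairing _ ◇, ← e1,
      ← T.anchor_D_eq (zero_add 0), ← T.br_mark (zero_add (-2)) (zero_add (-2)) (zero_add 0),
      mark_pairing _ ◇, T.alg.jacobi (zero_add (-1)) ◇ (zero_add (-1)) (zero_add (-2))
        ◇ ◇, zero_mul, Int.negOnePow_zero, Units.val_one, one_smul]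
  br_coanchor {U} a w w' h := by
    refine (T.br_mark ◇ (zero_add (-1)) (zero_add 1) ◇ _ w).trans ?_
    rw [T.anchor_D_eq, (VField.lieDer_iff _ _ _).1 h]
    rfl
  pair_coanchor {U} a w := by
    refine (VField.contracts_iff _ ◇ _ _).2 (T.mark_inj (zero_add (-2)) ?_)
    refine (T.mark_pairing ◇ _ _).trans ?_
    refine (T.br_mark (i := -1) (m := -1) (l := -2) ◇ ◇ ◇
      (zero_add (-2)) a w).trans ?_
    rw [T.anchor_eq]
  br_symm {U} a b := by
    change _ = T.mark _ _
    rw [← Form.d_ofFn (zero_add 1), ← T.D_mark (zero_add (-2)) ◇, mark_pairing _ ◇,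
      T.alg.D_br ◇ (neg_add_cancel 1) (neg_add_cancel 1) ◇ (zero_add (-1))
        (add_zero (-1)), T.alg.br_symm (add_zero (-1)) (zero_add (-1))]
    have hs : (((-1 : ℤ).negOnePow : ℤˣ) : ℤ) = -1 := by decide
    rw [hs, mul_zero, Int.negOnePow_zero, Units.val_one, one_smul, neg_smul, one_smul, neg_neg]
  proj {U} := T.projALin U
  res_proj h q := T.res_projA h q
  proj_br p q := T.projA_br p q
  anchor_proj q x := rfl
  coanchor_injective w h := T.mark_injective _ w h
  proj_eq_zero {U} q := by
    refine Iff.trans ⟨fun h => ?_, fun h => ?_⟩ (T.proj_eq_zero (k := 1) ◇ q)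
    · exact (T.j_projA q).symm.trans ((congrArg (S.j U) h).trans (map_zero _))
    · exact S.j_inj ((T.j_projA q).trans (h.trans (map_zero _).symm))
  proj_surjective {U} a x := by
    obtain ⟨V, hV, t, hx, ht⟩ := T.proj_surjective (S.j U a) x
    refine ⟨V, hV, t, hx, S.j_inj ?_⟩
    exact (T.j_projA t).trans (ht.trans (S.oddPullback.res_j hV a))

lemma isCour_cour : IsCour S T T.cour fun _ => AddEquiv.refl _ where
  res_κ _ _ := rfl
  κ_smul _ _ := rfl
  κ_br _ _ := rfl
  κ_pair h _ _ _ := T.mark_pairing h _ _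
  κ_anchor h _ q w := (VField.contracts_iff _ h _ _).2 (T.anchor_eq h q w)
  κ_coanchor _ _ _ := rfl
  κ_proj q := (T.j_projA q).symm

/-- The functor `Q` on morphisms. -/
def courMap {T T' : OExt2 S.alg} (f : T ⟶ T') : T.cour ⟶ T'.cour where
  map U := { f.map (-1) U with map_smul' := fun g q => f.map_act _ _ _ }
  res_map h q := f.res_map h q
  map_br p q := (f.map_br _ _ _).trans (congrArg (T'.alg.br _ · _) (f.map_D _ _))
  map_pair p q := T'.pairing_eq (h := by norm_num) (by
    refine (f.map_br _ p q).symm.trans ?_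
    exact (congrArg (f.map (-2) _) (T.mark_pairing ◇ p q).symm).trans (f.map_mark _ _))
  map_coanchor w := f.map_mark _ w
  map_anchor p x := congrArg (fun q => (A.anchor q).toFun x) (S.j_inj (by
    refine (T'.j_projA _).trans ((f.map_proj _).trans (T.j_projA _).symm)))
  map_proj p := S.j_inj ((T'.j_projA _).trans ((f.map_proj _).trans (T.j_projA _).symm))

variable (S) in
/-- The functor `Q` exists. -/
lemma exists_courFunctor : Nonempty (CourFunctor S) :=
  ⟨{ functor :=
      { obj := cour
        map := courMap
        map_id := fun _ => rfl
        map_comp := fun _ _ => rfl }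
     κ := fun _ _ => AddEquiv.refl _
     isCour := fun T => T.isCour_cour
     map_κ := fun _ _ _ => rfl }⟩

end OExt2

section EquivalenceOfCategories
variable {A : LieAlgebroid X} {S : Sharp A}

/-! ### The equivalence -/

namespace IsCour
variable {T : OExt2 S.alg} {P Q : CExt A} {κ : ∀ U : Opens X.pt, Q.sec U ≃+ (T.alg.sh (-1)).sec U}

lemma isCourMap (H : IsCour S T Q κ) : IsCourMap S Q T fun U => (κ U).toAddMonoidHom where
  res_j := H.res_κ
  j_smul := H.κ_smul
  j_coanchor h U w := H.κ_coanchor h w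
  proj_j := H.κ_proj
  br_j_j h U p q := (H.κ_pair h p q).symm
  br_D_j p q := (H.κ_br p q).symm

/-- Maps of degree `-1` to `T` are morphisms to its Courant extension. -/
lemma exists_hom (H : IsCour S T Q κ) {j : ∀ U : Opens X.pt, P.sec U →+ (T.alg.sh (-1)).sec U}
    (Hj : IsCourMap S P T j) :
    ∃ f : P ⟶ Q, ∀ (U : Opens X.pt) (p : P.sec U), κ U (f.map U p) = j U p := by
  let f : ∀ U : Opens X.pt, P.sec U →+ Q.sec U := fun U => (κ U).symm.toAddMonoidHom.comp (j U)
  have hf : ∀ {U : Opens X.pt} (p : P.sec U), κ U (f U p) = j U p :=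
    fun p => (κ _).apply_symm_apply _
  have hproj : ∀ {U : Opens X.pt} (p : P.sec U), Q.proj (f U p) = P.proj p := fun p =>
    S.j_inj (by rw [← H.κ_proj, hf, Hj.proj_j])
  exact ⟨
    { map := fun U => { f U with
        map_smul' := fun g p => (κ U).injective (by
          refine (hf _).trans ?_
          rw [Hj.j_smul]
          exact ((H.κ_smul g _).trans (congrArg _ (hf p))).symm) }
      res_map := fun h p => (κ _).injective (by
        refine (H.res_κ h _).symm.trans (Eq.trans ?_ (hf _).symm)
        exact (congrArg _ (hf p)).trans (Hj.res_j h p))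
      map_br := fun p q => (κ _).injective (by
        refine (hf _).trans ((Hj.br_D_j p q).symm.trans (Eq.trans ?_ (H.κ_br _ _).symm))
        exact congrArg₂ (fun a b => T.alg.br _ (T.alg.D _ a) b) (hf p).symm (hf q).symm)
      map_pair := fun p q => Form.ofFn_injective (T.mark_inj (zero_add (-2)) (by
        refine (H.κ_pair ◇ _ _).trans (Eq.trans ?_ (Hj.br_j_j ◇ p q))
        exact congrArg₂ (T.alg.br _) (hf p) (hf q)))
      map_coanchor := fun w => (κ _).injective ((hf _).trans
        ((Hj.j_coanchor ◇ w).trans (H.κ_coanchor ◇ w).symm))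
      map_anchor := fun p x => ((Q.anchor_proj _ x).symm.trans
        (congrArg (fun a => (A.anchor a).toFun x) (hproj p))).trans (P.anchor_proj p x)
      map_proj := fun p => hproj p }, fun U p => hf p⟩

end IsCour

/-- The functors `τ` and `Q` are mutually quasi-inverse: the unit is `q ↦ q ε`, and the counit is
the morphism `τ(Q(T)) → T` which corresponds to the identity of `Q(T)`. -/
lemma exists_equivalence (τ : Transgression S) (G : CourFunctor S) :
    ∃ e : CExt A ≌ OExt2 S.alg, e.functor = τ.functor ∧ e.inverse = G.functor := by
  choose η hη using fun Q => (G.isCour (τ.functor.obj Q)).exists_hom (τ.isTransgression Q).isCourMap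
  choose ε hε using fun T => (τ.isTransgression (G.functor.obj T)).exists_hom (G.isCour T).isCourMap
  have hι : ∀ Q, IsIso (η Q) := fun Q => CExt.isIso _
  have hι' : ∀ T, IsIso (ε T) := fun T => OExt2.isIso _
  refine ⟨CategoryTheory.Equivalence.mk τ.functor G.functor
    (NatIso.ofComponents (fun Q => @asIso _ _ _ _ (η Q) (hι Q)) ?_)
    (NatIso.ofComponents (fun T => @asIso _ _ _ _ (ε T) (hι' T)) ?_), rfl, rfl⟩
  · intro P Q f
    refine CExt.Hom.ext' fun U p => (G.κ _ U).injective ?_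
    refine (hη Q U (f.map U p)).trans (Eq.trans ?_ (G.map_κ (τ.functor.map f) _).symm)
    exact ((congrArg ((τ.functor.map f).map (-1) U) (hη P U p)).trans (τ.map_j f p)).symm
  · intro T T' f
    refine (τ.isTransgression _).hom_ext fun U q => ?_
    refine (congrArg ((ε T').map (-1) U) (τ.map_j (G.functor.map f) q)).trans ?_
    refine (hε T' U _).trans ((G.map_κ f q).trans ?_)
    exact (congrArg (f.map (-1) U) (hε T U q)).symm

end EquivalenceOfCategories

/-! ### Linear combinations of extensions by forms -/

/-- Biadditive maps descend from presheaves to their quotient sheaves. -/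
lemma IsSheafQuot.descend_both {P P' : AbPre X} {F F' G : AbSheaf X} {π : ∀ U, P.sec U →+ F.sec U}
    {π' : ∀ U, P'.sec U →+ F'.sec U} (H : IsSheafQuot P F π) (H' : IsSheafQuot P' F' π')
    (φ : ∀ U, P.sec U →+ P'.sec U →+ G.sec U)
    (hφ : ∀ {U V : Opens X.pt} (h : V ≤ U) (p : P.sec U) (q : P'.sec U),
      G.res h (φ U p q) = φ V (P.res h p) (P'.res h q))
    (h0 : ∀ {U : Opens X.pt} (p : P.sec U) (q : P'.sec U), π U p = 0 → φ U p q = 0)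
    (h0' : ∀ {U : Opens X.pt} (p : P.sec U) (q : P'.sec U), π' U q = 0 → φ U p q = 0) :
    ∃ ψ : ∀ U, F.sec U →+ F'.sec U →+ G.sec U,
      (∀ {U V : Opens X.pt} (h : V ≤ U) (s : F.sec U) (t : F'.sec U),
        G.res h (ψ U s t) = ψ V (F.res h s) (F'.res h t)) ∧
      ∀ {U : Opens X.pt} (p : P.sec U) (q : P'.sec U), ψ U (π U p) (π' U q) = φ U p q := by
  obtain ⟨ψ, h1, h2⟩ := H.descend₂ φ hφ h0
  obtain ⟨χ, h3, h4⟩ := H'.descend₂ (A := F.pre) (fun U => (ψ U).flip)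
    (fun h p a => h1 h a p) fun {U} q s hq => by
      refine G.eq_zero_of_local fun x => ?_
      obtain ⟨V, hV, p, hx, hp⟩ := H.surj s x
      refine ⟨V, hV, hx, (h1 hV s q).trans ?_⟩
      rw [hp, h2]
      exact h0' _ _ (by rw [← H'.res, hq, map_zero])
  exact ⟨fun U => (χ U).flip, fun h s t => h3 h t s, fun p q => (h4 q _).trans (h2 p q)⟩

/-- The linear combination `∑ aᵣ vᵣ` of forms. -/
def Form.comb {n : ℕ} (a : Fin n → 𝕂) {k : ℤ} {U : Opens X.pt} :
    (Fin n → Form k U) →+ Form k U where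
  toFun v := ∑ r, algebraMap 𝕂 (Fn U) (a r) • v r
  map_zero' := Finset.sum_eq_zero fun r _ => smul_zero _
  map_add' v w := by simp [Finset.sum_add_distrib]

lemma Form.map_comb {n : ℕ} (a : Fin n → 𝕂) {k l : ℤ} {U V : Opens X.pt}
    (f : Form k U →+ Form l V)
    (hf : ∀ (c : 𝕂) w, f (algebraMap 𝕂 (Fn U) c • w) = algebraMap 𝕂 (Fn V) c • f w)
    (v : Fin n → Form k U) : f (comb a v) = comb a fun r => f (v r) :=
  by
  change f (∑ r : Fin n, _) = ∑ r : Fin n, _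
  rw [map_sum]
  exact Finset.sum_congr rfl fun r _ => hf _ _

lemma DGLie.anchor_comb (B : DGLie X) {n : ℕ} (a : Fin n → 𝕂) {i k l : ℤ} (h : i + k = l)
    {U : Opens X.pt} (b : (B.sh i).sec U) (v : Fin n → Form k U) :
    B.anchor h b (Form.comb a v) = Form.comb a fun r => B.anchor h b (v r) := by
  refine Form.map_comb a (AddMonoidHom.mk' (B.anchor h b) (B.anchor_add h b)) (fun c w => ?_) v
  change B.anchor h b _ = _ • B.anchor h b w
  rw [← Form.ofFn_mul' (zero_add k), B.anchor_mul (add_zero i) h (zero_add k) h h (zero_add l),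
    B.anchor_const, Form.zero_mul, zero_add, Form.ofFn_mul', mul_zero, ← sg, sg_zero, one_smul]

namespace DGLie
variable (B : DGLie X) {i k l : ℤ} {U : Opens X.pt} (h : i + k = l) (b : (B.sh i).sec U)

lemma anchor_zero : B.anchor h b 0 = 0 := map_zero (AddMonoidHom.mk' _ (B.anchor_add h b))

lemma anchor_sub (v w : Form k U) : B.anchor h b (v - w) = B.anchor h b v - B.anchor h b w :=
  map_sub (AddMonoidHom.mk' _ (B.anchor_add h b)) v w

lemma anchor_zsmul (n : ℤ) (w : Form k U) : B.anchor h b (n • w) = n • B.anchor h b w :=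
  map_zsmul (AddMonoidHom.mk' _ (B.anchor_add h b)) n w

end DGLie

namespace OExt2
variable {B : DGLie X} {n : ℕ} {a : Fin n → 𝕂} {T : Fin n → OExt2 B} {U V : Opens X.pt}
  {i j k l m t : ℤ}

lemma sub_mem_of_eq {G : Type*} [AddCommGroup G] (K : AddSubgroup G) {x y : G} (h : x = y) :
    x - y ∈ K := by
  rw [h, sub_self]; exact zero_mem _

lemma Fib.ext {p q : Fib T i U} (h : p.1.1 = q.1.1) (h' : ∀ r, p.1.2 r = q.1.2 r) : p = q :=
  Subtype.ext (Prod.ext h (funext h'))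

/-- The pairs `(p, w)`, standing for `s p + w c`, of which a linear combination is a quotient. -/
abbrev PreComb (T : Fin n → OExt2 B) (i : ℤ) (U : Opens X.pt) := Fib T i U × Form (i + 2) U

variable (a T i U) in
/-- The map with which the quotient is formed: `s (v₁ c, …, vₙ c)` is to be `(∑ aᵣ vᵣ) c`. -/
def combRel : (Fin n → Form (i + 2) U) →+ PreComb T i U :=
  AddMonoidHom.mk' (fun v => (Fib.ofForms ◇ v, -Form.comb a v)) fun v w =>
    Prod.ext (Fib.ext (add_zero _).symm fun r => (T r).mark_add _ _ _)
      ((congrArg Neg.neg (map_add _ _ _)).trans (neg_add _ _))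

namespace PreComb

def res (h : V ≤ U) : PreComb T i U →+ PreComb T i V :=
  AddMonoidHom.mk' (fun p => (p.1.res h, Form.res h p.2)) fun p q =>
    Prod.ext (Fib.ext (map_add _ _ _) fun r => map_add _ _ _) (map_add _ _ _)

def act (h : k + i = j) (w : Form k U) : PreComb T i U →+ PreComb T j U :=
  have h' : k + (i + 2) = j + 2 := ◇
  AddMonoidHom.mk' (fun p => (p.1.act h w, Form.mul h' w p.2)) fun p q =>
    Prod.ext (Fib.ext (B.act_add _ _ _ _) fun r => (T r).alg.act_add _ _ _ _)
      (Form.mul_add h' _ _ _)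

def D (h : i + 1 = j) : PreComb T i U →+ PreComb T j U :=
  AddMonoidHom.mk' (fun p => (p.1.D h, Form.d ◇ p.2)) fun p q =>
    Prod.ext (Fib.ext (map_add _ _ _) fun r => map_add _ _ _) (map_add _ _ _)

lemma ext {p q : PreComb T i U} (h : p.1.1.1 = q.1.1.1) (h' : ∀ r, p.1.1.2 r = q.1.1.2 r)
    (h'' : p.2 = q.2) : p = q :=
  Prod.ext (Fib.ext h h') h''

end PreComb

open PreComb

variable (a T) in
/-- The presheaf of which the linear combination is the associated sheaf. -/
@[reducible] def combPre : PreDG X where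
  pre i :=
    { sec := PreComb T i
      res := res
      res_id := fun p => PreComb.ext (AbSheaf.res_id _ _) (fun r => AbSheaf.res_id _ _) rfl
      res_res := fun h h' p => PreComb.ext (AbSheaf.res_res _ _ _ _)
        (fun r => AbSheaf.res_res _ _ _ _) rfl }
  K i U := (combRel a T U i).range
  act h U w := act h w
  D h U := D h
  res_K := by
    rintro i U V h _ ⟨v, rfl⟩
    refine ⟨fun r => Form.res h (v r), PreComb.ext
      (map_zero _).symm (fun r => ((T r).res_mark _ _ _).symm) ?_⟩
    exact (congrArg Neg.neg (Form.map_comb a (Form.res h) (fun c w => Form.res_smul _ _ _) v)).symm.trans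
      (map_neg (Form.res h) _).symm
  act_K := by
    rintro k i j h U w _ ⟨v, rfl⟩
    have h' : k + (i + 2) = j + 2 := ◇
    refine ⟨fun r => Form.mul h' w (v r), PreComb.ext
      (B.act_zero _ _).symm (fun r => ((T r).act_mark _ _ h' _ _ _).symm) ?_⟩
    exact (congrArg Neg.neg (Form.map_comb a (AddMonoidHom.mk' (Form.mul h' w)
      (Form.mul_add h' w)) (fun c v => Form.mul_smul h' _ _ _) v)).symm.trans
      (Form.mul_neg h' _ _).symm
  D_K := by
    rintro i j h U _ ⟨v, rfl⟩
    have h' : i + 2 + 1 = j + 2 := ◇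
    refine ⟨fun r => Form.d h' (v r), PreComb.ext
      (map_zero _).symm (fun r => ((T r).D_mark _ _ h' _ _).symm) ?_⟩
    refine (congrArg Neg.neg (Form.map_comb a (Form.d h') (fun c w => ?_) v)).symm.trans
      (map_neg (Form.d h') _).symm
    rw [Form.d_smul h' ◇, Form.dFn_algebraMap, Form.zero_mul, zero_add]
  res_act h U V hV w p := PreComb.ext (B.res_act _ _ _ _) (fun r => (T r).alg.res_act _ _ _ _)
    (Form.res_mul _ ◇ _ _)
  res_D h U V hV p := PreComb.ext (B.res_D _ _ _) (fun r => (T r).alg.res_D _ _ _)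
    (Form.res_d _ _ _)
  add_act h U w w' p := sub_mem_of_eq _ (PreComb.ext (B.add_act _ _ _ _)
    (fun r => (T r).alg.add_act _ _ _ _) (Form.add_mul ◇ _ _ _))
  one_act h U p := sub_mem_of_eq _ (PreComb.ext (B.one_act _ _)
    (fun r => (T r).alg.one_act _ _) (Form.ofFn_one_mul ◇ _))
  mul_act h h₁ h₂ h₃ U w w' p := sub_mem_of_eq _ (PreComb.ext (B.mul_act _ _ _ _ _ _ _)
    (fun r => (T r).alg.mul_act _ _ _ _ _ _ _) (Form.mul_assoc _ ◇ ◇ ◇ _ _ _))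
  D_D h h' U p := by
    have : D h' (D h p) = 0 :=
      PreComb.ext (B.D_D _ _ _) (fun r => (T r).alg.D_D _ _ _) (Form.d_d _ _ _)
    exact this.symm ▸ zero_mem _
  D_act h h₁ h₂ h₃ h₄ hk U w p := sub_mem_of_eq _ (PreComb.ext (B.D_act' _ _ _ _ _ _ _ _)
    (fun r => (T r).alg.D_act' _ _ _ _ _ _ _ _) (Form.d_mul ◇ _ _ _ ◇ ◇ _ _))

/-- The bracket of pairs: `[s p + w c, s q + v c] = s [p, q] + (p v ∓ q w) c`. -/
def combBr (h : i + j = l) : PreComb T i U →+ PreComb T j U →+ PreComb T l U :=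
  AddMonoidHom.mk' (fun p => AddMonoidHom.mk' (fun q => (p.1.br h q.1,
      B.anchor ◇ p.1.1.1 q.2 - sg (i * j) • B.anchor ◇ q.1.1.1 p.2))
    fun q q' => Prod.ext (Fib.ext (B.br_add _ _ _ _) fun r => (T r).alg.br_add _ _ _ _) (by
      change B.anchor _ _ (_ + _) - _ • B.anchor _ (_ + _) _ = _ - _ + (_ - _)
      rw [B.anchor_add, B.anchor_add_left, smul_add]; abel))
    fun p p' => AddMonoidHom.ext fun q => Prod.ext
      (Fib.ext (B.add_br _ _ _ _) fun r => (T r).alg.add_br _ _ _ _) (by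
      change B.anchor _ (_ + _) _ - _ • B.anchor _ _ (_ + _) = _ - _ + (_ - _)
      rw [B.anchor_add, B.anchor_add_left, smul_add]; abel)

lemma combBr_symm (h : i + j = l) (h' : j + i = l) (p : PreComb T i U) (q : PreComb T j U) :
    combBr h p q = -(sg (i * j) • combBr h' q p) := by
  refine Prod.ext (Fib.ext (B.br_symm _ _ _ _) fun r => (T r).alg.br_symm _ _ _ _) ?_
  change (_ - _ : Form (l + 2) U) = -(sg (i * j) • (_ - _ : Form (l + 2) U))
  rw [_root_.mul_comm j i, smul_sub, sg_smul_smul]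
  abel

lemma combBr_res (h : i + j = l) (hV : V ≤ U) (p : PreComb T i U) (q : PreComb T j U) :
    res hV (combBr h p q) =
      combBr h (res hV p) (res hV q) := by
  refine Prod.ext (Fib.ext (B.res_br _ _ _ _) fun r => (T r).alg.res_br _ _ _ _) ?_
  change Form.res hV (_ - _) = (_ - _ : Form (l + 2) V)
  rw [map_sub, map_zsmul, B.anchor_res, B.anchor_res]
  rfl

lemma combBr_mem (h : i + j = l) (p : PreComb T i U) {q : PreComb T j U}
    (hq : q ∈ (combRel a T U j).range) : combBr h p q ∈ (combRel a T U l).range := by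
  obtain ⟨v, rfl⟩ := hq
  refine ⟨fun r => B.anchor ◇ p.1.1.1 (v r), PreComb.ext ?_ (fun r => ?_) ?_⟩
  · exact (B.br_zero _ _).symm
  · refine Eq.symm (((T r).br_mark (n := l + 2) _ _ ◇ ◇ _ _).trans ?_)
    rw [← (T r).proj.map_anchor, p.1.2 r]
    rfl
  · change -Form.comb a _ = B.anchor _ _ (-Form.comb a v) - _ • B.anchor _ 0 _
    rw [B.anchor_zero_left, smul_zero, sub_zero, ← zero_sub, ← zero_sub, B.anchor_sub,
      B.anchor_comb, B.anchor_zero]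

lemma combBr_jacobi {ij jl il : ℤ} (hij : i + j = ij) (hjl : j + l = jl) (hil : i + l = il)
    (h₁ : i + jl = t) (h₂ : ij + l = t) (h₃ : j + il = t) (p : PreComb T i U) (q : PreComb T j U)
    (r : PreComb T l U) : combBr h₁ p (combBr hjl q r) =
      combBr h₂ (combBr hij p q) r + sg (i * j) • combBr h₃ q (combBr hil p r) := by
  refine Prod.ext (Fib.ext (B.jacobi _ _ _ _ _ _ _ _ _)
    fun r => (T r).alg.jacobi _ _ _ _ _ _ _ _ _) ?_
  change (B.anchor _ p.1.1.1 (B.anchor _ q.1.1.1 r.2 - sg (j * l) • B.anchor _ r.1.1.1 q.2) -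
      sg (i * jl) • B.anchor _ (B.br _ q.1.1.1 r.1.1.1) p.2 : Form (t + 2) U) =
    B.anchor _ (B.br _ p.1.1.1 q.1.1.1) r.2 - sg (ij * l) • B.anchor _ r.1.1.1
      (B.anchor _ p.1.1.1 q.2 - sg (i * j) • B.anchor _ q.1.1.1 p.2) + sg (i * j) •
    (B.anchor _ q.1.1.1 (B.anchor _ p.1.1.1 r.2 - sg (i * l) • B.anchor _ r.1.1.1 p.2) -
      sg (j * il) • B.anchor _ (B.br _ p.1.1.1 r.1.1.1) q.2)
  rw [B.anchor_br hij (ik := il + 2) (jk := jl + 2) ◇ ◇ _ ◇ ◇,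
    B.anchor_br hjl (ik := ij + 2) (jk := il + 2) ◇ ◇ _ ◇ ◇,
    B.anchor_br hil (ik := ij + 2) (jk := jl + 2) ◇ ◇ _ ◇ ◇]
  simp only [B.anchor_sub, B.anchor_zsmul, smul_sub]
  subst hij hjl hil
  have e : ∀ m : ℤ, (m.negOnePow : ℤ) = sg m := fun _ => rfl
  simp only [e, _root_.mul_add, _root_.add_mul, sg_add, _root_.mul_comm j i]
  rcases sg_cases (i * j) with h | h <;> rcases sg_cases (i * l) with h' | h' <;>
    rcases sg_cases (j * l) with h'' | h'' <;> simp [h, h', h''] <;> abel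

lemma combBr_D {i' j' l' : ℤ} (h : i + j = l) (hi : i + 1 = i') (hj : j + 1 = j')
    (hl : l + 1 = l') (h₁ : i' + j = l') (h₂ : i + j' = l') (p : PreComb T i U)
    (q : PreComb T j U) : D hl (combBr h p q) =
      combBr h₁ (D hi p) q + sg i • combBr h₂ p (D hj q) := by
  refine Prod.ext (Fib.ext (B.D_br _ _ _ _ _ _ _ _) fun r => (T r).alg.D_br _ _ _ _ _ _ _ _) ?_
  change Form.d _ (B.anchor _ p.1.1.1 q.2 - sg (i * j) • B.anchor _ q.1.1.1 p.2) =
    (B.anchor _ (B.D _ p.1.1.1) q.2 - sg (i' * j) • B.anchor _ q.1.1.1 (Form.d _ p.2) +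
      sg i • (B.anchor _ p.1.1.1 (Form.d _ q.2) - sg (i * j') • B.anchor _ (B.D _ q.1.1.1) p.2) :
      Form (l' + 2) U)
  rw [B.anchor_D' hi (l := l + 2) (k' := j' + 2) ◇ _ ◇ ◇ ◇,
    B.anchor_D' hj (l := l + 2) (k' := i' + 2) ◇ _ ◇ ◇ ◇]
  subst hi hj
  simp only [map_sub, map_zsmul, smul_sub, _root_.mul_add, _root_.add_mul, sg_add, _root_.mul_one,
    _root_.one_mul]
  rcases sg_cases (i * j) with h | h <;> rcases sg_cases i with h' | h' <;>
    rcases sg_cases j with h'' | h'' <;> simp [h, h', h''] <;> abel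

lemma combBr_act {ij kj : ℤ} (hkj : k + j = kj) (hl : i + k = l) (hij : i + j = ij)
    (h₁ : i + kj = t) (h₂ : l + j = t) (h₃ : k + ij = t) (p : PreComb T i U) (q : PreComb T j U)
    (w : Form k U) : combBr h₁ p (act hkj w q) =
      act h₂ (B.anchor hl p.1.1.1 w) q +
        sg (i * k) • act h₃ w (combBr hij p q) := by
  refine Prod.ext (Fib.ext (B.leibniz _ _ _ _ _ _ _ _ _) fun r => ?_) ?_
  · refine ((T r).alg.leibniz hkj hl hij h₁ h₂ h₃ _ _ _).trans ?_
    rw [← (T r).proj.map_anchor, p.1.2 r]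
    rfl
  obtain ⟨hk, hk', hl'⟩ : k + (j + 2) = kj + 2 ∧ k + (ij + 2) = t + 2 ∧ l + (j + 2) = t + 2 := ◇
  change (B.anchor _ p.1.1.1 (Form.mul hk w q.2) - sg (i * kj) • B.anchor _ (B.act _ w q.1.1.1) p.2 :
      Form (t + 2) U) = Form.mul hl' (B.anchor _ p.1.1.1 w) q.2 +
    sg (i * k) • Form.mul hk' w (B.anchor _ p.1.1.1 q.2 - sg (i * j) • B.anchor _ q.1.1.1 p.2)
  rw [B.anchor_mul hl (l' := ij + 2) ◇ ◇ ◇ ◇ ◇,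
    B.anchor_act (l := ij + 2) _ ◇ _ ◇, sub_eq_add_neg (B.anchor _ p.1.1.1 q.2),
    Form.mul_add, Form.mul_neg, Form.mul_zsmul]
  subst hkj
  have e : ∀ m : ℤ, (m.negOnePow : ℤ) = sg m := fun _ => rfl
  simp only [e, _root_.mul_add, sg_add, smul_add, smul_neg, mul_smul]
  abel

variable (a T) in
/-- The DG Lie algebroid underlying a linear combination. -/
lemma exists_combAlg : ∃ (M : DGLie X) (π : ∀ i U, PreComb T i U →+ (M.sh i).sec U)
    (pr : DGLie.Hom M B), (combPre a T).IsQuot M.toDGMod π ∧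
      (∀ (i : ℤ) (U : Opens X.pt) (p : PreComb T i U), pr.map i U (π i U p) = p.1.1.1) ∧
      ∀ (i j l : ℤ) (h : i + j = l) (U : Opens X.pt) (p : PreComb T i U) (q : PreComb T j U),
        M.br h (π i U p) (π j U q) = π l U (combBr h p q) := by
  obtain ⟨N, π, H⟩ := (combPre a T).exists_isQuot
  have Hact : ∀ {k i j : ℤ} (h : k + i = j) {U : Opens X.pt} (w : Form k U) (p : PreComb T i U),
      N.act h w (π i U p) = π j U (act h w p) := fun h U w p => (H.act h w p).symm
  have HD : ∀ {i j : ℤ} (h : i + 1 = j) {U : Opens X.pt} (p : PreComb T i U),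
      N.D h (π i U p) = π j U (D h p) := fun h U p => (H.D h p).symm
  have hker : ∀ (i l : ℤ) (U : Opens X.pt) (g : PreComb T i U → PreComb T l U)
      (f : ∀ V, V ≤ U → PreComb T i V → PreComb T l V)
      (_ : ∀ (V : Opens X.pt) (h : V ≤ U) (p : PreComb T i U), res h (g p) = f V h (res h p))
      (_ : ∀ (V : Opens X.pt) (h : V ≤ U) (p : PreComb T i V), p ∈ (combRel a T V i).range →
        f V h p ∈ (combRel a T V l).range) (p : PreComb T i U), π i U p = 0 → π l U (g p) = 0 := by
    intro i l U g f hf h0 p hp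
    refine (N.sh l).eq_zero_of_local fun x => ?_
    obtain ⟨V, hV, hx, hp⟩ := H.ker p hp x
    exact ⟨V, hV, hx, ((H.quot l).res hV _).trans ((congrArg _ (hf V hV p)).trans
      (H.zero _ (h0 V hV _ hp)))⟩
  have hbr := fun (i j l : ℤ) (h : i + j = l) =>
    IsSheafQuot.descend_both (H.quot i) (H.quot j) (G := N.sh l)
      (fun U => AddMonoidHom.mk' (fun p => (π l U).comp (combBr h p)) fun p p' => by
        rw [map_add]; exact AddMonoidHom.comp_add _ _ _)
      (fun hV p q => ((H.quot l).res hV _).trans (congrArg _ (combBr_res h hV p q)))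
      (fun {U} p q hp => hker i l U (fun p => combBr h p q) (fun V hV p => combBr h p (res hV q))
        (fun V hV p => combBr_res h hV p q) (fun V hV p hp => by
          rw [combBr_symm h ◇]
          exact neg_mem (zsmul_mem (combBr_mem _ _ hp) _)) p hp)
      (fun {U} p q hq => hker j l U (fun q => combBr h p q) (fun V hV q => combBr h (res hV p) q)
        (fun V hV q => combBr_res h hV p q) (fun V hV q hq => combBr_mem _ _ hq) q hq)
  choose br res_br br_π using hbr
  have hpr := fun i : ℤ => (H.quot i).descend (G := B.sh i)
    (fun U => AddMonoidHom.mk' (fun p : PreComb T i U => p.1.1.1) fun p q => rfl)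
    (fun hV p => rfl) (fun {U} p hp => (B.sh i).eq_zero_of_local fun x => by
      obtain ⟨V, hV, hx, v, hv⟩ := H.ker p hp x
      exact ⟨V, hV, hx, (congrArg (fun p : PreComb T i V => p.1.1.1) hv).symm⟩)
  choose pr res_pr pr_π using hpr
  replace br_π : ∀ (i j l : ℤ) (h : i + j = l) {U : Opens X.pt} (p : PreComb T i U)
      (q : PreComb T j U), br i j l h U (π i U p) (π j U q) = π l U (combBr h p q) := br_π
  replace pr_π : ∀ (i : ℤ) {U : Opens X.pt} (p : PreComb T i U), pr i U (π i U p) = p.1.1.1 := pr_π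
  have Hres : ∀ {i : ℤ} {U V : Opens X.pt} (h : V ≤ U) (p : PreComb T i U),
      (N.sh i).res h (π i U p) = π i V (res h p) := fun h p => (H.quot _).res h p
  have loc : ∀ {i : ℤ} {U : Opens X.pt} (s : (N.sh i).sec U) (x : U), ∃ (V : Opens X.pt)
      (h : V ≤ U) (p : PreComb T i V), (x : X.pt) ∈ V ∧ (N.sh i).res h s = π i V p :=
    fun s x => (H.quot _).surj s x
  have loc₂ : ∀ {i j : ℤ} {U : Opens X.pt} (s : (N.sh i).sec U) (t : (N.sh j).sec U) (x : U),
      ∃ (V : Opens X.pt) (h : V ≤ U) (p : PreComb T i V) (q : PreComb T j V), (x : X.pt) ∈ V ∧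
        (N.sh i).res h s = π i V p ∧ (N.sh j).res h t = π j V q := fun {i j U} s t x => by
    obtain ⟨V, hV, p, hx, hp⟩ := loc s x
    obtain ⟨W, hW, q, hx, hq⟩ := loc ((N.sh j).res hV t) ⟨x, hx⟩
    exact ⟨W, hW.trans hV, res hW p, q, hx, by rw [← AbSheaf.res_res _ hV hW, hp, Hres],
      by rw [← AbSheaf.res_res _ hV hW, hq]⟩
  have pr_act : ∀ {k i j : ℤ} (h : k + i = j) {U : Opens X.pt} (w : Form k U) (s : (N.sh i).sec U),
      pr j U (N.act h w s) = B.act h w (pr i U s) := fun {k i j} h U w s => by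
    refine (B.sh j).eq_of_local fun x => ?_
    obtain ⟨V, hV, p, hx, hp⟩ := loc s x
    exact ⟨V, hV, hx, by rw [res_pr, N.res_act, hp, Hact, pr_π, B.res_act, res_pr, hp, pr_π]; rfl⟩
  have pr_D : ∀ {i j : ℤ} (h : i + 1 = j) {U : Opens X.pt} (s : (N.sh i).sec U),
      pr j U (N.D h s) = B.D h (pr i U s) := fun {i j} h U s => by
    refine (B.sh j).eq_of_local fun x => ?_
    obtain ⟨V, hV, p, hx, hp⟩ := loc s x
    exact ⟨V, hV, hx, by rw [res_pr, N.res_D, hp, HD, pr_π, B.res_D, res_pr, hp, pr_π]; rfl⟩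
  have pr_br : ∀ {i j l : ℤ} (h : i + j = l) {U : Opens X.pt} (s : (N.sh i).sec U)
      (t : (N.sh j).sec U), pr l U (br i j l h U s t) = B.br h (pr i U s) (pr j U t) :=
    fun {i j l} h U s t => by
    refine (B.sh l).eq_of_local fun x => ?_
    obtain ⟨V, hV, p, q, hx, hp, hq⟩ := loc₂ s t x
    exact ⟨V, hV, hx, by
      rw [res_pr, res_br, hp, hq, br_π, pr_π, B.res_br, res_pr, res_pr, hp, hq, pr_π, pr_π]; rfl⟩
  let M : DGLie X :=
    { N with
      br := fun {i j l} h U s t => br i j l h U s t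
      anchor := fun {i k l} h U s w => B.anchor h (pr i U s) w
      add_br := fun h U s s' t => by simp only [map_add, AddMonoidHom.add_apply]
      br_add := fun h U s t t' => map_add _ _ _
      res_br := fun {i j l} h U V hV s t => res_br i j l h hV s t
      br_symm := fun {i j l} h h' U s t => by
        refine (N.sh l).eq_of_local fun x => ?_
        obtain ⟨V, hV, p, q, hx, hp, hq⟩ := loc₂ s t x
        refine ⟨V, hV, hx, ?_⟩
        rw [res_br, map_neg, map_zsmul, res_br, hp, hq, br_π, br_π, combBr_symm h h', map_neg,
          map_zsmul]
      jacobi := fun {i j l ij jl il t} hij hjl hil h₁ h₂ h₃ U a b c => by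
        refine (N.sh t).eq_of_local fun x => ?_
        obtain ⟨V, hV, p, q, hx, hp, hq⟩ := loc₂ a b x
        obtain ⟨W, hW, r, hx, hr⟩ := loc ((N.sh l).res hV c) ⟨x, hx⟩
        refine ⟨W, hW.trans hV, hx, ?_⟩
        simp only [← (N.sh t).res_res hV hW, map_add, map_zsmul, res_br, hp, hq, hr, Hres, br_π, combBr_res]
        rw [combBr_jacobi hij hjl hil h₁ h₂ h₃, map_add, map_zsmul]
      D_br := fun {i j l i' j' l'} h hi hj hl h₁ h₂ U a b => by
        refine (N.sh l').eq_of_local fun x => ?_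
        obtain ⟨V, hV, p, q, hx, hp, hq⟩ := loc₂ a b x
        refine ⟨V, hV, hx, ?_⟩
        rw [map_add, map_zsmul, N.res_D, res_br, res_br, res_br, N.res_D, N.res_D, hp, hq, br_π, HD,
          HD, HD, br_π, br_π, combBr_D h hi hj hl h₁ h₂, map_add, map_zsmul]
      anchor_add_left := fun h U s s' w => by rw [map_add, B.anchor_add_left]
      anchor_add := fun h U s w w' => B.anchor_add _ _ _ _
      anchor_const := fun h U s c => B.anchor_const _ _ _
      anchor_res := fun {i k l} h U V hV s w => by rw [B.anchor_res, ← res_pr]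
      anchor_mul := fun h h' hp hq h₁ h₂ U s w w' => B.anchor_mul h h' hp hq h₁ h₂ _ w w'
      anchor_act := fun hj h h₁ h₂ U v s w => by rw [pr_act, B.anchor_act hj h h₁ h₂]
      anchor_br := fun h hik hjk h₁ h₂ h₃ U s t w => by rw [pr_br, B.anchor_br h hik hjk h₁ h₂ h₃]
      anchor_D := fun hi h h₁ h₂ U s w dw dsw hw hsw => by
        rw [pr_D, B.anchor_D hi h h₁ h₂ _ w dw dsw hw hsw]
      leibniz := fun {i j k l ij kj t} hkj hl hij h₁ h₂ h₃ U a b w => by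
        refine (N.sh t).eq_of_local fun x => ?_
        obtain ⟨V, hV, p, q, hx, hp, hq⟩ := loc₂ a b x
        refine ⟨V, hV, hx, ?_⟩
        rw [map_add, map_zsmul, res_br, N.res_act, N.res_act, N.res_act, res_br, B.anchor_res,
          res_pr, hp, hq, Hact, br_π, br_π, pr_π, Hact, Hact,
          combBr_act hkj hl hij h₁ h₂ h₃, map_add, map_zsmul] }
  exact ⟨M, π, { map := pr, res_map := fun {i U V} h m => res_pr i h m,
                 map_act := fun h U w m => pr_act h w m,
                 map_D := fun h U m => pr_D h m,
                 map_br := fun h U s t => pr_br h s t,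
                 map_anchor := fun h U s w => rfl }, H, fun i U p => pr_π i p,
    fun i j l h U p q => br_π i j l h p q⟩

variable (a T) in
/-- Linear combinations of `𝒪[2]`-extensions exist. -/
lemma exists_isLinComb : ∃ R s, IsLinComb a T R s := by
  obtain ⟨M, π, pr, H, pr_π, br_π⟩ := exists_combAlg a T
  let c : (M.sh (-2)).sec ⊤ := π (-2) ⊤ (0, Form.ofFn 1)
  have hc : ∀ U : Opens X.pt, (M.sh (-2)).res le_top c = π (-2) U (0, Form.ofFn 1) := fun U =>
    ((H.quot (-2)).res le_top _).trans (congrArg _ (PreComb.ext (map_zero _)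
      (fun r => map_zero _) rfl))
  have hmark : ∀ {i : ℤ} (h : i + 2 + -2 = i) {U : Opens X.pt} (w : Form (i + 2) U),
      M.act h w ((M.sh (-2)).res le_top c) = π i U (0, w) := fun h U w => by
    rw [hc]
    exact (H.act h w _).symm.trans (congrArg _ (PreComb.ext (B.act_zero _ _)
      (fun r => (T r).alg.act_zero _ _) (Form.mul_ofFn_one ◇ _)))
  have hinj : ∀ {i : ℤ} {U : Opens X.pt} (w : Form (i + 2) U), π i U (0, w) = 0 → w = 0 := by
    intro i U w hw
    refine Form.eq_of_local fun x => ?_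
    obtain ⟨V, hV, hx, v, hv⟩ := H.ker _ hw x
    have hv' : v = 0 := funext fun r => (T r).mark_injective ◇ _
      ((congrArg (fun p : PreComb T i V => p.1.1.2 r) hv).trans (map_zero _))
    refine ⟨V, hV, hx, (congrArg Prod.snd hv).symm.trans ?_⟩
    rw [hv', map_zero, map_zero]
    rfl
  have hsub : ∀ {i : ℤ} {U : Opens X.pt} (w w' : Form (i + 2) U),
      π i U (0, w) - π i U (0, w') = π i U (0, w - w') := fun w w' =>
    (map_sub _ _ _).symm.trans (congrArg _ (Prod.ext (sub_zero 0) rfl))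
  have hker : ∀ {i : ℤ} {U : Opens X.pt} (t : (M.sh i).sec U), pr.map i U t = 0 →
      ∃ w : Form (i + 2) U, π i U (0, w) = t := by
    intro i U t ht
    have hres : ∀ {V W : Opens X.pt} (h : W ≤ V) (w : Form (i + 2) V),
        (M.sh i).res h (π i V (0, w)) = π i W (0, Form.res h w) := fun h w =>
      ((H.quot i).res h _).trans (congrArg _ (PreComb.ext (map_zero _) (fun r => map_zero _) rfl))
    have hloc : ∀ x : U, ∃ (V : Opens X.pt) (hV : V ≤ U) (w : Form (i + 2) V), (x : X.pt) ∈ V ∧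
        π i V (0, w) = (M.sh i).res hV t := fun x => by
      obtain ⟨V, hV, p, hx, hp⟩ := (H.quot i).surj t x
      have hp0 : p.1.1.1 = 0 := by rw [← pr_π, ← hp, ← pr.res_map, ht, map_zero]
      choose v hv using fun r => ((T r).proj_eq_zero (k := i + 2) ◇ _).1
        ((p.1.2 r).trans hp0)
      refine ⟨V, hV, p.2 + Form.comb a v, hx, ?_⟩
      rw [hp, ← sub_eq_zero, ← map_sub, ← neg_eq_zero, ← map_neg]
      refine H.zero _ ⟨v, PreComb.ext ?_ (fun r => ?_) ?_⟩
      · change 0 = -(0 - p.1.1.1)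
        rw [hp0, sub_zero, neg_zero]
      · change (T r).mark _ (v r) = -(0 - p.1.1.2 r)
        rw [zero_sub, neg_neg]
        exact hv r
      · change -_ = -(p.2 + _ - p.2)
        rw [add_sub_cancel_left]
    obtain ⟨w, hw⟩ := (Form.sheaf X (i + 2)).glue_local (U := U)
      (fun V w => ∃ hV : V ≤ U, π i V (0, w) = (M.sh i).res hV t)
      (fun x => by
        obtain ⟨V, hV, w, hx, hw⟩ := hloc x
        exact ⟨V, hV, hx, w, hV, hw⟩)
      (fun V V' w w' _ _ ⟨hV, hw⟩ ⟨hV', hw'⟩ => sub_eq_zero.1 (hinj _ (by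
        refine (hsub _ _).symm.trans (sub_eq_zero.2 ?_)
        refine (hres _ _).symm.trans (Eq.trans ?_ (hres _ _))
        rw [hw, hw', AbSheaf.res_res, AbSheaf.res_res])))
    refine ⟨w, (M.sh i).eq_of_local fun x => ?_⟩
    obtain ⟨V, hV, w', hx, hw'⟩ := hloc x
    exact ⟨V, hV, hx, by rw [hres, ← hw', ← hw V hV w' ⟨hV, hw'⟩]⟩
  let R : OExt2 B :=
    { alg := M
      c := c
      D_c := fun {j} h => by
        obtain rfl : -1 = j := ◇
        have : PreComb.D h ((0, Form.ofFn 1) : PreComb T (-2) ⊤) = 0 :=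
          PreComb.ext (map_zero _) (fun r => map_zero _) ((Form.d_ofFn rfl 1).trans Form.dFn_one)
        exact (H.D h _).symm.trans ((congrArg (π (-1) ⊤) this).trans (map_zero _))
      central := fun {i l} h U s => by
        refine (M.sh l).eq_zero_of_local fun x => ?_
        obtain ⟨V, hV, p, hx, hp⟩ := (H.quot i).surj s x
        refine ⟨V, hV, hx, ?_⟩
        rw [M.res_br, hp, hc, (H.quot _).res, br_π]
        have : combBr h ((0, Form.ofFn 1) : PreComb T (-2) V) p = 0 := by
          refine PreComb.ext (B.zero_br _ _) (fun r => (T r).alg.zero_br _ _) ?_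
          change (B.anchor _ 0 _ - _ • B.anchor _ p.1.1.1 (Form.ofFn 1) : Form (l + 2) V) = 0
          rw [B.anchor_zero_left, ← map_one (algebraMap 𝕂 (Fn V)), zero_sub]
          exact neg_eq_zero.2 ((congrArg _ (B.anchor_const _ _ _)).trans (smul_zero _))
        refine Eq.trans (congrArg (fun q => π l V (combBr h q p)) (Prod.ext ?_ ?_)) ((congrArg (π l V) this).trans (map_zero _))
        · exact Fib.ext (map_zero _) fun r => map_zero _
        · rfl
      proj := pr
      mark_injective := fun {k i} h U w hw => by
        obtain rfl : k = i + 2 := ◇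
        exact hinj w ((hmark h w).symm.trans hw)
      proj_eq_zero := fun {k i} h U s => by
        obtain rfl : k = i + 2 := ◇
        refine ⟨fun hs => ?_, ?_⟩
        · obtain ⟨w, rfl⟩ := hker s hs
          exact ⟨w, hmark h w⟩
        · rintro ⟨w, rfl⟩
          rw [hmark, pr_π]; rfl
      proj_surjective := fun {i U} b x => by
        choose V hV t hx ht using fun r => (T r).proj_surjective b x
        obtain ⟨W, hxW, hWU, hW⟩ := exists_nhd_le x.2 V hx
        refine ⟨W, hWU, π i W (⟨((B.sh i).res hWU b, fun r => ((T r).alg.sh i).res (hW r) (t r)),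
          fun r => ?_⟩, 0), hxW, pr_π _ _ _⟩
        exact ((T r).proj.res_map _ _).symm.trans ((congrArg _ (ht r)).trans (AbSheaf.res_res _ _ _ _)) }
  have add : ∀ {i : ℤ} {U : Opens X.pt} (p : Fib T i U) (w : Form (i + 2) U) (h : i + 2 + -2 = i),
      π i U (p, 0) + R.mark h w = π i U (p, w) := fun p w h =>
    (congrArg (_ + ·) (hmark h w)).trans ((map_add _ _ _).symm.trans
      (congrArg _ (Prod.ext (add_zero p) (zero_add w))))
  refine ⟨R, fun i U => (π i U).comp (AddMonoidHom.inl _ _), ?_⟩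
  constructor
  · exact fun h p => ((H.quot _).res h _).trans (congrArg (π _ _) (Prod.ext rfl (map_zero _)))
  · intro k i j h U w p
    have e : ((p.act h w, 0) : PreComb T j U) = PreComb.act h w (p, 0) :=
      Prod.ext rfl (Form.mul_zero ◇ _).symm
    exact (congrArg (π j U) e).trans (H.act h w (p, 0))
  · intro i j h U p
    have e : ((p.D h, 0) : PreComb T j U) = PreComb.D h (p, 0) := Prod.ext rfl (map_zero _).symm
    exact (congrArg (π j U) e).trans (H.D h (p, 0))
  · exact fun p => pr_π _ _ _
  · intro i j l h U p q
    have e : ((p.br h q, 0) : PreComb T l U) = combBr h (p, 0) (q, 0) := by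
      refine Prod.ext rfl ?_
      change _ = (B.anchor _ _ 0 - _ • B.anchor _ _ 0 : Form (l + 2) U)
      rw [B.anchor_zero, B.anchor_zero, smul_zero, sub_zero]
    exact (congrArg (π l U) e).trans (br_π _ _ _ h U (p, 0) (q, 0)).symm
  · intro k i h U w
    obtain rfl : k = i + 2 := ◇
    refine Eq.trans ?_ (hmark h _).symm
    rw [← sub_eq_zero]
    refine (map_sub (π i U) _ _).symm.trans (H.zero _ ⟨w, Prod.ext (sub_zero _).symm (zero_sub _).symm⟩)
  · intro k i hk U t x
    obtain rfl : k = i + 2 := ◇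
    obtain ⟨V, hV, p, hx, hp⟩ := (H.quot i).surj t x
    exact ⟨V, hV, p.1, p.2, hx, hp.trans (add _ _ _).symm⟩
  · intro k i hk U p w hw x
    obtain rfl : k = i + 2 := ◇
    obtain ⟨V, hV, hx, v, hv⟩ := H.ker _ ((add _ _ _).symm.trans hw) x
    exact ⟨V, hV, v, hx, (congrArg Prod.fst hv).symm, (congrArg Prod.snd hv).symm⟩

end OExt2

/-! ### The universal property of linear combinations -/

/-- A relation between sheaves which locally is the graph of a homomorphism is such a graph. -/
lemma AbSheaf.exists_hom_of_graph {F G : AbSheaf X} (Γ : ∀ U, AddSubgroup (F.sec U × G.sec U))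
    (res : ∀ {U V : Opens X.pt} (h : V ≤ U) (p : F.sec U × G.sec U), p ∈ Γ U →
      (F.res h p.1, G.res h p.2) ∈ Γ V)
    (surj : ∀ {U : Opens X.pt} (a : F.sec U) (x : U), ∃ (V : Opens X.pt) (h : V ≤ U)
      (p : F.sec V × G.sec V), (x : X.pt) ∈ V ∧ p ∈ Γ V ∧ F.res h a = p.1)
    (inj : ∀ {U : Opens X.pt} (p : F.sec U × G.sec U), p ∈ Γ U → p.1 = 0 → p.2 = 0) :
    ∃ f : ∀ U, F.sec U →+ G.sec U,
      (∀ {U V : Opens X.pt} (h : V ≤ U) (a : F.sec U), G.res h (f U a) = f V (F.res h a)) ∧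
      ∀ {U : Opens X.pt} (p : F.sec U × G.sec U), p ∈ Γ U → f U p.1 = p.2 := by
  let P : AbPre X :=
    { sec := fun U => Γ U
      res := fun h => AddMonoidHom.mk' (fun p => ⟨_, res h p.1 p.2⟩) fun p q =>
        Subtype.ext (Prod.ext (map_add _ _ _) (map_add _ _ _))
      res_id := fun p => Subtype.ext (Prod.ext (F.res_id _) (G.res_id _))
      res_res := fun h h' p => Subtype.ext (Prod.ext (F.res_res _ _ _) (G.res_res _ _ _)) }
  obtain ⟨f, hf, hfp⟩ := IsSheafQuot.descend (P := P) (F := F) (G := G)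
    (π := fun U => (AddMonoidHom.fst _ _).comp (Γ U).subtype)
    ⟨fun _ _ => rfl, fun a x => by
      obtain ⟨V, hV, p, hx, hp, e⟩ := surj a x
      exact ⟨V, hV, ⟨p, hp⟩, hx, e⟩⟩
    (fun U => (AddMonoidHom.snd _ _).comp (Γ U).subtype) (fun _ _ => rfl) fun p hp => inj p.1 p.2 hp
  exact ⟨f, hf, fun p hp => hfp ⟨p, hp⟩⟩

namespace OExt2
variable {B : DGLie X} {n : ℕ} {a : Fin n → 𝕂} {T : Fin n → OExt2 B} {R R' : OExt2 B}
  {s : ∀ (i : ℤ) (U : Opens X.pt), Fib T i U →+ (R.alg.sh i).sec U}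
  {s' : ∀ (i : ℤ) (U : Opens X.pt), Fib T i U →+ (R'.alg.sh i).sec U} {U : Opens X.pt} {i k : ℤ}

lemma exists_fib (b : (B.sh i).sec U) (x : U) : ∃ (V : Opens X.pt) (h : V ≤ U) (p : Fib T i V),
    (x : X.pt) ∈ V ∧ p.1.1 = (B.sh i).res h b := by
  choose V hV t hx ht using fun r => (T r).proj_surjective b x
  obtain ⟨W, hxW, hWU, hW⟩ := exists_nhd_le x.2 V hx
  exact ⟨W, hWU, ⟨((B.sh i).res hWU b, fun r => ((T r).alg.sh i).res (hW r) (t r)), fun r =>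
    ((T r).proj.res_map _ _).symm.trans ((congrArg _ (ht r)).trans (AbSheaf.res_res _ _ _ _))⟩,
    hxW, rfl⟩

lemma Fib.eq_ofForms (hk : k + -2 = i) (p : Fib T i U) (hp : p.1.1 = 0) :
    ∃ v, p = ofForms hk v := by
  choose v hv using fun r => ((T r).proj_eq_zero hk _).1 ((p.2 r).trans hp)
  exact ⟨v, Fib.ext hp fun r => (hv r).symm⟩

/-! The square of a linear combination is cocartesian as soon as it commutes, since its rows are
exact. -/

section
variable (proj : ∀ {i : ℤ} {U : Opens X.pt} (p : Fib T i U), R.proj.map i U (s i U p) = p.1.1)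
  (square : ∀ {k i : ℤ} (h : k + -2 = i) {U : Opens X.pt} (w : Fin n → Form k U),
    s i U (Fib.ofForms h w) = R.mark h (∑ r, algebraMap 𝕂 (Fn U) (a r) • w r))
include proj

lemma locally_eq_add_mark (hk : k + -2 = i) (t : (R.alg.sh i).sec U) (x : U) :
    ∃ (V : Opens X.pt) (h : V ≤ U) (p : Fib T i V) (w : Form k V), (x : X.pt) ∈ V ∧
      (R.alg.sh i).res h t = s i V p + R.mark hk w := by
  obtain ⟨V, hV, p, hx, hp⟩ := exists_fib (T := T) (R.proj.map i U t) x
  obtain ⟨w, hw⟩ := (R.proj_eq_zero hk ((R.alg.sh i).res hV t - s i V p)).1 (by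
    rw [map_sub, proj, hp, R.proj.res_map, sub_self])
  exact ⟨V, hV, p, w, hx, by rw [mark, hw, add_sub_cancel]⟩

include square

lemma eq_ofForms_of_add_mark_eq_zero (hk : k + -2 = i) (p : Fib T i U) (w : Form k U)
    (h : s i U p + R.mark hk w = 0) :
    ∃ v, p = Fib.ofForms hk v ∧ w = -∑ r, algebraMap 𝕂 (Fn U) (a r) • v r := by
  obtain ⟨v, rfl⟩ := p.eq_ofForms hk (by rw [← proj, eq_neg_of_add_eq_zero_left h, map_neg,
    proj_mark, neg_zero])
  rw [square, ← mark_add] at h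
  exact ⟨v, rfl, eq_neg_of_add_eq_zero_right (R.mark_injective hk _ h)⟩

lemma locally_eq_ofForms (hk : k + -2 = i) (p : Fib T i U) (w : Form k U)
    (h : s i U p + R.mark hk w = 0) (x : U) : ∃ (V : Opens X.pt) (h : V ≤ U)
      (v : Fin n → Form k V), (x : X.pt) ∈ V ∧ p.res h = Fib.ofForms hk v ∧
        Form.res h w = -∑ r, algebraMap 𝕂 (Fn V) (a r) • v r := by
  obtain ⟨v, rfl, rfl⟩ := eq_ofForms_of_add_mark_eq_zero proj square hk p w h
  exact ⟨U, le_rfl, v, x.2, Fib.ext (AbSheaf.res_id _ _) fun r => AbSheaf.res_id _ _, rfl⟩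

end

/-- Linear combinations are unique up to isomorphism. -/
lemma IsLinComb.exists_hom (H : IsLinComb a T R s) (H' : IsLinComb a T R' s') :
    ∃ f : R ⟶ R', ∀ (i : ℤ) (U : Opens X.pt) (p : Fib T i U), f.map i U (s i U p) = s' i U p := by
  let mk : ∀ (R : OExt2 B) (i : ℤ) (U : Opens X.pt), Form (i + 2) U →+ (R.alg.sh i).sec U :=
    fun R i U => AddMonoidHom.mk' (R.mark ◇) (R.mark_add _)
  have loc : ∀ {i : ℤ} {U : Opens X.pt} (t : (R.alg.sh i).sec U) (x : U), ∃ (V : Opens X.pt)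
      (h : V ≤ U) (p : Fib T i V) (w : Form (i + 2) V), (x : X.pt) ∈ V ∧
        (R.alg.sh i).res h t = s i V p + mk R i V w := fun t x => H.surj _ t x
  have hf := fun i => AbSheaf.exists_hom_of_graph (F := R.alg.sh i) (G := R'.alg.sh i)
    (fun U => (((s i U).coprod (mk R i U)).prod ((s' i U).coprod (mk R' i U))).range)
    (by
      rintro U V h _ ⟨⟨p, w⟩, rfl⟩
      refine ⟨(p.res h, Form.res h w), Prod.ext ?_ ?_⟩
      · exact (congrArg₂ (· + ·) (H.res h p) (R.res_mark _ h w)).symm.trans (map_add _ _ _).symm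
      · exact (congrArg₂ (· + ·) (H'.res h p) (R'.res_mark _ h w)).symm.trans (map_add _ _ _).symm)
    (fun t x => by
      obtain ⟨V, hV, p, w, hx, e⟩ := loc t x
      exact ⟨V, hV, _, hx, ⟨(p, w), rfl⟩, e⟩)
    (by
      rintro U _ ⟨⟨p, w⟩, rfl⟩ h
      obtain ⟨v, rfl, rfl⟩ := eq_ofForms_of_add_mark_eq_zero H.proj H.square _ p w h
      change s' i U (Fib.ofForms _ v) + R'.mark _ (-∑ r, algebraMap 𝕂 (Fn U) (a r) • v r) = 0
      rw [H'.square, ← mark_add, add_neg_cancel, mark_zero])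
  choose f res_f hf using hf
  replace hf : ∀ {i : ℤ} {U : Opens X.pt} (p : Fib T i U) (w : Form (i + 2) U),
      f i U (s i U p + mk R i U w) = s' i U p + mk R' i U w := fun p w =>
    hf _ (_, _) ⟨(p, w), rfl⟩
  have fs : ∀ {i : ℤ} {U : Opens X.pt} (p : Fib T i U), f i U (s i U p) = s' i U p := fun p => by
    have := hf p 0
    rwa [map_zero, map_zero, add_zero, add_zero] at this
  have fm : ∀ {k i : ℤ} (h : k + -2 = i) {U : Opens X.pt} (w : Form k U),
      f i U (R.mark h w) = R'.mark h w := fun {k i} h U w => by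
    obtain rfl : k = i + 2 := ◇
    have := hf (0 : Fib T i U) w
    rwa [map_zero, map_zero, zero_add, zero_add] at this
  have fproj : ∀ {i : ℤ} {U : Opens X.pt} (t : (R.alg.sh i).sec U),
      R'.proj.map i U (f i U t) = R.proj.map i U t := fun {i U} t => by
    refine (B.sh i).eq_of_local fun x => ?_
    obtain ⟨V, hV, p, w, hx, e⟩ := loc t x
    refine ⟨V, hV, hx, ?_⟩
    rw [R'.proj.res_map, R.proj.res_map, res_f, e, hf, map_add, map_add, H.proj, H'.proj]
    exact congrArg (_ + ·) ((R'.proj_mark _ w).trans (R.proj_mark _ w).symm)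
  have hanchor : ∀ {i k l : ℤ} (h : i + k = l) {U : Opens X.pt} (t : (R.alg.sh i).sec U)
      (w : Form k U), R'.alg.anchor h (f i U t) w = R.alg.anchor h t w := fun h U t w => by
    rw [← R'.proj.map_anchor, fproj, R.proj.map_anchor]
  have hmk : ∀ (R : OExt2 B) {i : ℤ} (h : i + 2 + -2 = i) {U : Opens X.pt} (w : Form (i + 2) U),
      mk R i U w = R.mark h w := fun R i h U w => rfl
  refine ⟨{ map := f
            res_map := fun {i U V} h t => res_f i h t
            map_act := fun {k i j} h U v t => ?_
            map_D := fun {i j} h U t => ?_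
            map_br := fun {i j l} h U t t' => ?_
            map_anchor := fun h U t w => hanchor h t w
            map_c := ?_
            map_proj := fun t => fproj t }, fun i U p => fs p⟩
  · refine (R'.alg.sh j).eq_of_local fun x => ?_
    obtain ⟨V, hV, p, w, hx, e⟩ := loc t x
    refine ⟨V, hV, hx, ?_⟩
    rw [res_f, R.alg.res_act, R'.alg.res_act, res_f, e, R.alg.act_add, map_add, map_add,
      R'.alg.act_add, ← H.act, fs, H'.act, fs, hmk R ◇, R.act_mark (n := j + 2) _ _ ◇ ◇,
      fm, fm, R'.act_mark]
  · refine (R'.alg.sh j).eq_of_local fun x => ?_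
    obtain ⟨V, hV, p, w, hx, e⟩ := loc t x
    refine ⟨V, hV, hx, ?_⟩
    rw [res_f, R.alg.res_D, R'.alg.res_D, res_f, e, map_add, map_add, map_add,
      map_add, ← H.D, fs, H'.D, fs, hmk R ◇, R.D_mark (l := j + 2) _ _ ◇ ◇,
      fm, fm, R'.D_mark]
  · have brm : ∀ {i j l : ℤ} (h : i + j = l) {V : Opens X.pt} (t : (R.alg.sh i).sec V)
        (w : Form (j + 2) V), f l V (R.alg.br h t (mk R j V w)) =
          R'.alg.br h (f i V t) (f j V (mk R j V w)) := fun {i j l} h V t w => by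
      rw [hmk R ◇, R.br_mark (n := l + 2) _ _ ◇ ◇, fm, fm,
        R'.br_mark (n := l + 2) _ _ ◇ ◇, hanchor]
    refine (R'.alg.sh l).eq_of_local fun x => ?_
    obtain ⟨V, hV, p, w, hx, e⟩ := loc t x
    obtain ⟨W, hW, q, v, hx, e'⟩ := loc ((R.alg.sh j).res hV t') ⟨x, hx⟩
    refine ⟨W, hW.trans hV, hx, ?_⟩
    replace e : (R.alg.sh i).res (hW.trans hV) t = s i W (p.res hW) + mk R i W (Form.res hW w) := by
      rw [← AbSheaf.res_res _ hV hW, e, map_add, H.res]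
      exact congrArg (_ + ·) (R.res_mark _ _ _)
    rw [AbSheaf.res_res] at e'
    rw [res_f, R.alg.res_br, R'.alg.res_br, res_f, res_f, e', R.alg.br_add, map_add, map_add,
      R'.alg.br_add, brm, e, R.alg.add_br, map_add, map_add]
    refine congrArg (· + _) (Eq.trans (congrArg₂ (· + ·) ?_ ?_) (R'.alg.add_br _ _ _ _).symm)
    · rw [← H.br, fs, fs, fs, H'.br]
    · rw [R.alg.br_symm h ◇, map_neg, map_zsmul, brm, R'.alg.br_symm h ◇]
  · rw [← R.alg.one_act (zero_add (-2)) R.c, ← R'.alg.one_act (zero_add (-2)) R'.c,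
      ← AbSheaf.res_id _ R.c, ← AbSheaf.res_id _ R'.c]
    exact fm (zero_add (-2)) _

lemma IsLinComb.hom_ext (H : IsLinComb a T R s) {f g : R ⟶ R'}
    (h : ∀ (i : ℤ) (U : Opens X.pt) (p : Fib T i U), f.map i U (s i U p) = g.map i U (s i U p)) :
    f = g := by
  refine Hom.ext' fun i U t => (R'.alg.sh i).eq_of_local fun x => ?_
  obtain ⟨V, hV, p, w, hx, e⟩ := H.surj (k := i + 2) ◇ t x
  exact ⟨V, hV, hx, by rw [f.res_map, g.res_map, e, map_add, map_add, h, f.map_mark, g.map_mark]⟩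

end OExt2

namespace CExt
variable {A : LieAlgebroid X} {n : ℕ} {a : Fin n → 𝕂} {Q : Fin n → CExt A} {R R' : CExt A}
  {s : ∀ U : Opens X.pt, Fib Q U →ₗ[Fn U] R.sec U} {s' : ∀ U : Opens X.pt, Fib Q U →ₗ[Fn U] R'.sec U}
  {U : Opens X.pt}

lemma Fib.ext {p q : Fib Q U} (h : p.1.1 = q.1.1) (h' : ∀ r, p.1.2 r = q.1.2 r) : p = q :=
  Subtype.ext (Prod.ext h (funext h'))

section
variable (proj : ∀ {U : Opens X.pt} (p : Fib Q U), R.proj (s U p) = p.1.1)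
  (square : ∀ {U : Opens X.pt} (w : Fin n → Form 1 U),
    s U (Fib.ofForms w) = R.coanchor (∑ r, algebraMap 𝕂 (Fn U) (a r) • w r))
include proj

lemma locally_eq_add_coanchor (t : R.sec U) (x : U) : ∃ (V : Opens X.pt) (h : V ≤ U)
    (p : Fib Q V) (w : Form 1 V), (x : X.pt) ∈ V ∧ R.res h t = s V p + R.coanchor w := by
  choose V hV q hx hq using fun r => (Q r).proj_surjective (R.proj t) x
  obtain ⟨W, hxW, hWU, hW⟩ := exists_nhd_le x.2 V hx
  let p : Fib Q W := ⟨(A.res hWU (R.proj t), fun r => (Q r).res (hW r) (q r)), fun r =>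
    ((Q r).res_proj _ _).symm.trans ((congrArg _ (hq r)).trans (A.res_res _ _ _))⟩
  obtain ⟨w, hw⟩ := (R.proj_eq_zero (R.res hWU t - s W p)).1 (by
    rw [map_sub, proj, ← R.res_proj]; exact sub_self _)
  exact ⟨W, hWU, p, w, hxW, by rw [hw, add_sub_cancel]⟩

include square

lemma eq_ofForms_of_add_coanchor_eq_zero (p : Fib Q U) (w : Form 1 U)
    (h : s U p + R.coanchor w = 0) :
    ∃ v, p = Fib.ofForms v ∧ w = -∑ r, algebraMap 𝕂 (Fn U) (a r) • v r := by
  have hp : p.1.1 = 0 := by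
    rw [← proj, eq_neg_of_add_eq_zero_left h, map_neg, proj_coanchor, neg_zero]
  choose v hv using fun r => ((Q r).proj_eq_zero _).1 ((p.2 r).trans hp)
  obtain rfl : p = Fib.ofForms v := Fib.ext hp fun r => (hv r).symm
  rw [square, ← map_add] at h
  exact ⟨v, rfl, eq_neg_of_add_eq_zero_right (R.coanchor_injective _ h)⟩

lemma locally_eq_ofForms (p : Fib Q U) (w : Form 1 U) (h : s U p + R.coanchor w = 0) (x : U) :
    ∃ (V : Opens X.pt) (h : V ≤ U) (v : Fin n → Form 1 V), (x : X.pt) ∈ V ∧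
      p.res h = Fib.ofForms v ∧ Form.res h w = -∑ r, algebraMap 𝕂 (Fn V) (a r) • v r := by
  obtain ⟨v, rfl, rfl⟩ := eq_ofForms_of_add_coanchor_eq_zero proj square p w h
  exact ⟨U, le_rfl, v, x.2, Fib.ext (A.res_id _) fun r => (Q r).res_id _, rfl⟩

end

/-- Linear combinations are unique up to isomorphism. -/
lemma IsLinComb.exists_hom (H : IsLinComb a Q R s) (H' : IsLinComb a Q R' s') :
    ∃ f : R ⟶ R', ∀ (U : Opens X.pt) (p : Fib Q U), f.map U (s U p) = s' U p := by
  obtain ⟨f, res_f, hf⟩ := AbSheaf.exists_hom_of_graph (F := R.toAbSheaf) (G := R'.toAbSheaf)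
    (fun U => ((((s U).coprod R.coanchor).prod ((s' U).coprod R'.coanchor)).range).toAddSubgroup)
    (by
      rintro U V h _ ⟨⟨p, w⟩, rfl⟩
      refine ⟨(p.res h, Form.res h w), Prod.ext ?_ ?_⟩
      · exact (congrArg₂ (· + ·) (H.res h p) (R.res_coanchor h w)).symm.trans (map_add _ _ _).symm
      · exact (congrArg₂ (· + ·) (H'.res h p) (R'.res_coanchor h w)).symm.trans (map_add _ _ _).symm)
    (fun t x => by
      obtain ⟨V, hV, p, w, hx, e⟩ := H.surj t x
      exact ⟨V, hV, _, hx, ⟨(p, w), rfl⟩, e⟩)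
    (by
      rintro U _ ⟨⟨p, w⟩, rfl⟩ h
      obtain ⟨v, rfl, rfl⟩ := eq_ofForms_of_add_coanchor_eq_zero H.proj H.square p w h
      change s' U (Fib.ofForms v) + R'.coanchor (-∑ r, algebraMap 𝕂 (Fn U) (a r) • v r) = 0
      rw [H'.square, ← map_add, add_neg_cancel, map_zero])
  replace hf : ∀ {U : Opens X.pt} (p : Fib Q U) (w : Form 1 U),
      f U (s U p + R.coanchor w) = s' U p + R'.coanchor w := fun p w => hf (_, _) ⟨(p, w), rfl⟩
  have fs : ∀ {U : Opens X.pt} (p : Fib Q U), f U (s U p) = s' U p := fun p => by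
    have := hf p 0
    rwa [map_zero, map_zero, add_zero, add_zero] at this
  have fproj : ∀ {U : Opens X.pt} (t : R.sec U), R'.proj (f U t) = R.proj t := fun {U} t => by
    refine A.eq_of_local fun x => ?_
    obtain ⟨V, hV, p, w, hx, e⟩ := H.surj t x
    refine ⟨V, hV, hx, ?_⟩
    rw [R'.res_proj, R.res_proj, res_f, e, hf, map_add, map_add, H.proj, H'.proj, proj_coanchor,
      proj_coanchor]
  have fco : ∀ {U : Opens X.pt} (w : Form 1 U), f U (R.coanchor w) = R'.coanchor w := fun w => by
    have := hf (0 : Fib Q _) w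
    rwa [map_zero, map_zero, zero_add, zero_add] at this
  have hσ : ∀ {U : Opens X.pt} (t : R.sec U), R'.anchor (f U t) = R.anchor t := fun t =>
    VField.ext fun x => by rw [← R'.anchor_proj, fproj, R.anchor_proj]
  have brc : ∀ {U : Opens X.pt} (t : R.sec U) (w : Form 1 U),
      f U (R.br t (R.coanchor w)) = R'.br (f U t) (R'.coanchor w) := fun t w => by
    rw [R.br_coanchor t w _ ((VField.lieDer_iff _ _ _).2 rfl), fco,
      R'.br_coanchor _ w _ ((VField.lieDer_iff _ _ _).2 rfl), hσ]
  have pairc : ∀ {U : Opens X.pt} (t : R.sec U) (w : Form 1 U),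
      R'.pair (f U t) (R'.coanchor w) = R.pair t (R.coanchor w) := fun t w =>
    Form.ofFn_injective (by
      rw [(VField.contracts_iff _ ◇ _ _).1 (R'.pair_coanchor (f _ t) w), hσ,
        ← (VField.contracts_iff _ ◇ _ _).1 (R.pair_coanchor t w)])
  have fpair : ∀ {U : Opens X.pt} (t t' : R.sec U), R'.pair (f U t) (f U t') = R.pair t t' :=
    fun {U} t t' => Form.ofFn_injective (Form.eq_of_local fun x => by
    obtain ⟨V, hV, p, w, hx, e⟩ := H.surj t x
    obtain ⟨W, hW, q, v, hx, e'⟩ := H.surj (R.res hV t') ⟨x, hx⟩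
    refine ⟨W, hW.trans hV, hx, ?_⟩
    rw [R.res_res] at e'
    rw [Form.res_ofFn, Form.res_ofFn, R.res_pair, R'.res_pair, res_f, res_f, e', map_add, R'.pair_add, R.pair_add, fco, pairc,
      ← R.res_res hV hW, e, map_add, map_add, H.res, R.res_coanchor, fco, fs, fs,
      R.pair_symm _ (s W q), R.pair_add, R'.pair_symm _ (s' W q), R'.pair_add, H.pair, H'.pair,
      ← fs q, pairc])
  refine ⟨{ map := fun U => { f U with map_smul' := fun g t => R'.eq_of_local fun x => ?_ }
            res_map := fun h t => res_f h t
            map_br := fun {U} t t' => R'.eq_of_local fun x => ?_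
            map_pair := fun t t' => fpair t t'
            map_coanchor := fun w => fco w
            map_anchor := fun t x => congrArg (fun v => VField.toFun v x) (hσ t)
            map_proj := fun t => fproj t }, fun U p => fs p⟩
  · obtain ⟨V, hV, p, w, hx, e⟩ := H.surj t x
    refine ⟨V, hV, hx, ?_⟩
    refine (res_f hV _).trans (Eq.trans ?_ (R'.res_smul hV g (f U t)).symm)
    rw [R.res_smul, res_f, e, smul_add, ← map_smul, ← map_smul, hf, hf, map_smul, map_smul, smul_add]
  · obtain ⟨V, hV, p, w, hx, e⟩ := H.surj t x
    obtain ⟨W, hW, q, v, hx, e'⟩ := H.surj (R.res hV t') ⟨x, hx⟩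
    refine ⟨W, hW.trans hV, hx, ?_⟩
    rw [R.res_res] at e'
    refine (res_f _ _).trans (Eq.trans ?_ (R'.res_br _ (f U t) (f U t')).symm)
    rw [R.res_br, res_f, res_f, e', R.br_add, map_add, map_add, brc, fco, R'.br_add]
    -- by symmetry of the bracket up to an exact form, only the bracket with `s q` is left
    refine congrArg (· + _) ?_
    have sym : ∀ u : R.sec W, f W (R.br (s W q) u) = R'.br (f W (s W q)) (f W u) →
        f W (R.br u (s W q)) = R'.br (f W u) (f W (s W q)) := fun u hu => by
      rw [eq_sub_of_add_eq (R.br_symm u _), map_sub, fco, hu, ← fpair,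
        eq_sub_of_add_eq (R'.br_symm (f W u) _)]
    refine sym _ ?_
    rw [← R.res_res hV hW, e, map_add, H.res, R.res_coanchor, R.br_add, map_add, map_add, brc, fco,
      ← H.br, fs, fs, fs, H'.br, R'.br_add]

lemma IsLinComb.hom_ext (H : IsLinComb a Q R s) {f g : R ⟶ R'}
    (h : ∀ (U : Opens X.pt) (p : Fib Q U), f.map U (s U p) = g.map U (s U p)) : f = g := by
  refine Hom.ext' fun U t => R'.eq_of_local fun x => ?_
  obtain ⟨V, hV, p, w, hx, e⟩ := H.surj t x
  exact ⟨V, hV, hx, by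
    rw [f.res_map, g.res_map, e, map_add, map_add, h, f.map_coanchor, g.map_coanchor]⟩

/-- A linear combination of `𝒪[2]`-extensions gives one of the extensions of which their parts of
degree `-1` consist. -/
lemma exists_isLinComb_of_oExt {S : Sharp A} {T : Fin n → OExt2 S.alg} {E : OExt2 S.alg}
    {t : ∀ (i : ℤ) (U : Opens X.pt), OExt2.Fib T i U →+ (E.alg.sh i).sec U}
    {j : ∀ (r : Fin n) (U : Opens X.pt), (Q r).sec U →+ ((T r).alg.sh (-1)).sec U}
    {κ : ∀ U : Opens X.pt, R.sec U ≃+ (E.alg.sh (-1)).sec U} (H : OExt2.IsLinComb a T E t)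
    (HQ : ∀ r, IsCourMap S (Q r) (T r) (j r)) (HR : IsCour S E R κ) :
    ∃ s : ∀ U : Opens X.pt, Fib Q U →ₗ[Fn U] R.sec U, IsLinComb a Q R s ∧
      ∀ (U : Opens X.pt) (p : Fib Q U) (p' : OExt2.Fib T (-1) U), p'.1.1 = S.j U p.1.1 →
        (∀ r, p'.1.2 r = j r U (p.1.2 r)) → κ U (s U p) = t (-1) U p' := by
  let J : ∀ {U : Opens X.pt}, Fib Q U → OExt2.Fib T (-1) U := fun {U} p =>
    ⟨(S.j U p.1.1, fun r => j r U (p.1.2 r)), fun r =>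
      ((HQ r).proj_j _).trans (congrArg _ (p.2 r))⟩
  have hκ : ∀ {U : Opens X.pt} (e : (E.alg.sh (-1)).sec U), κ U ((κ U).symm e) = e :=
    fun e => (κ _).apply_symm_apply e
  let s : ∀ U : Opens X.pt, Fib Q U →ₗ[Fn U] R.sec U := fun U =>
    { toFun := fun p => (κ U).symm (t (-1) U (J p))
      map_add' := fun p q => by
        rw [← map_add, ← map_add]
        exact congrArg (fun p => (κ U).symm (t (-1) U p))
          (OExt2.Fib.ext (map_add _ _ _) fun r => map_add _ _ _)
      map_smul' := fun f p => (κ U).injective (by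
        refine (hκ _).trans (Eq.trans ?_ (HR.κ_smul f _).symm)
        rw [hκ, ← H.act]
        exact congrArg _ (OExt2.Fib.ext (S.oddPullback.j_smul f _) fun r => (HQ r).j_smul f _)) }
  have hs : ∀ {U : Opens X.pt} (p : Fib Q U), κ U (s U p) = t (-1) U (J p) := fun p => hκ _
  have proj : ∀ {U : Opens X.pt} (p : Fib Q U), R.proj (s U p) = p.1.1 := fun p =>
    S.j_inj (by rw [← HR.κ_proj, hs, H.proj])
  have square : ∀ {U : Opens X.pt} (w : Fin n → Form 1 U),
      s U (Fib.ofForms w) = R.coanchor (∑ r, algebraMap 𝕂 (Fn U) (a r) • w r) := fun {U} w =>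
    (κ U).injective (by
      rw [hs, HR.κ_coanchor ◇, ← H.square]
      exact congrArg _ (OExt2.Fib.ext (map_zero _) fun r => (HQ r).j_coanchor _ _))
  refine ⟨s, ⟨fun {U V} h p => (κ V).injective ?_, proj, fun {U} p q => (κ U).injective ?_,
    fun {U} p q => ?_, square, fun t x => locally_eq_add_coanchor proj t x,
    fun p w h x => locally_eq_ofForms proj square p w h x⟩, fun U p p' h h' => ?_⟩
  · rw [← HR.res_κ, hs, H.res, hs]
    exact congrArg _ (OExt2.Fib.ext (S.oddPullback.res_j h _) fun r => (HQ r).res_j h _)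
  · rw [hs, HR.κ_br, hs, hs, ← H.D, ← H.br]
    exact congrArg _ (OExt2.Fib.ext (S.br_D_j _ _).symm fun r => ((HQ r).br_D_j _ _).symm)
  · refine Form.ofFn_injective (E.mark_inj (zero_add (-2)) ?_)
    rw [HR.κ_pair ◇, hs, hs, ← H.br]
    refine (congrArg (t (-2) U) (?_ : _ = OExt2.Fib.ofForms (zero_add (-2)) fun r =>
      Form.ofFn ((Q r).pair (p.1.2 r) (q.1.2 r)))).trans ((H.square _ _).trans (congrArg _ ?_))
    · exact OExt2.Fib.ext (S.br_j_j _ _ _) fun r => (HQ r).br_j_j _ _ _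
    · simp only [← Form.ofFn_smul]
      exact (map_sum (AddMonoidHom.mk' Form.ofFn Form.ofFn_add) _ _).symm
  · rw [hs]
    exact congrArg _ (OExt2.Fib.ext h.symm fun r => (h' r).symm)

end CExt

/-! ### Vector spaces in categories whose combinations are determined by maps -/

universe w w'

/-- Groupoids `P` of objects `X` with sets `El X i` of sections over a fixed base `Bs i`, and with a
notion of linear combination, which is a map from the fibre product over the base. -/
structure CombTheory (k : Type) [CommRing k] (P : Type u) [Category.{v} P] (ι : Type w) where
  isIso : ∀ {X Y : P} (f : X ⟶ Y), IsIso f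
  Bs : ι → Type w'
  El : P → ι → Type w'
  pr : ∀ {X : P} {i : ι}, El X i → Bs i
  ap : ∀ {X Y : P}, (X ⟶ Y) → ∀ {i : ι}, El X i → El Y i
  ap_id : ∀ {X : P} {i : ι} (x : El X i), ap (𝟙 X) x = x
  ap_comp : ∀ {X Y Z : P} (f : X ⟶ Y) (g : Y ⟶ Z) {i : ι} (x : El X i), ap (f ≫ g) x = ap g (ap f x)
  pr_ap : ∀ {X Y : P} (f : X ⟶ Y) {i : ι} (x : El X i), pr (ap f x) = pr x
  /-- `R`, with the map from the fibre product of the `X r`, is their combination. -/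
  IsComb : ∀ {n : ℕ} (a : Fin n → k) (X : Fin n → P) (R : P),
    (∀ i : ι, {p : Bs i × ∀ r, El (X r) i // ∀ r, pr (p.2 r) = p.1} → El R i) → Prop
  pr_comb : ∀ {n : ℕ} {a : Fin n → k} {X : Fin n → P} {R : P} {s}, IsComb a X R s →
    ∀ (i : ι) (p), pr (s i p) = p.1.1
  exists_comb : ∀ {n : ℕ} (a : Fin n → k) (X : Fin n → P), ∃ R s, IsComb a X R s
  exists_hom : ∀ {n : ℕ} {a : Fin n → k} {X : Fin n → P} {R R' : P} {s s'}, IsComb a X R s →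
    IsComb a X R' s' → ∃ f : R ⟶ R', ∀ (i : ι) (p), ap f (s i p) = s' i p
  hom_ext : ∀ {n : ℕ} {a : Fin n → k} {X : Fin n → P} {R R' : P} {s}, IsComb a X R s →
    ∀ f g : R ⟶ R', (∀ (i : ι) (p), ap f (s i p) = ap g (s i p)) → f = g
  single : ∀ {n : ℕ} (r : Fin n) {X : Fin n → P} {Y : P} (f : X r ⟶ Y),
    IsComb (Pi.single r 1) X Y fun _ p => ap f (p.1.2 r)
  bind : ∀ {m n : ℕ} {a : Fin m → k} {b : Fin m → Fin n → k} {c : Fin n → k}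
    (_ : ∀ i, c i = ∑ j, a j * b j i) {X : Fin n → P} {Y : Fin m → P} {R : P} {s}
    {t : ∀ j (i : ι), {p : Bs i × ∀ r, El (X r) i // ∀ r, pr (p.2 r) = p.1} → El (Y j) i}
    (H : ∀ j, IsComb (b j) X (Y j) (t j)) (_ : IsComb a Y R s),
    IsComb c X R fun i p => s i ⟨(p.1.1, fun j => t j i p), fun j => pr_comb (H j) i p⟩

namespace CombTheory
variable {k : Type} [CommRing k] {P : Type u} [Category.{v} P] {ι : Type w}
  (C : CombTheory.{u, v, w, w'} k P ι)

/-- Elements of fibre products. -/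
abbrev Fib {n : ℕ} (X : Fin n → P) (i : ι) : Type w' :=
  {p : C.Bs i × ∀ r, C.El (X r) i // ∀ r, C.pr (p.2 r) = p.1}

/-- The structure `V` is the one given by the linear combinations. -/
structure Canonical (V : VectCat k P) where
  s : ∀ {n : ℕ} (a : Fin n → k) (X : Fin n → P) (i : ι), C.Fib X i → C.El (V.lin a X) i
  isComb : ∀ {n : ℕ} (a : Fin n → k) (X : Fin n → P), C.IsComb a X (V.lin a X) (s a X)
  linMap_s : ∀ {n : ℕ} (a : Fin n → k) {X Y : Fin n → P} (f : ∀ r, X r ⟶ Y r) {i : ι}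
    (p : C.Fib X i) (q : C.Fib Y i), q.1.1 = p.1.1 → (∀ r, q.1.2 r = C.ap (f r) (p.1.2 r)) →
    C.ap (V.linMap a f) (s a X i p) = s a Y i q
  proj_s : ∀ {n : ℕ} (r : Fin n) (X : Fin n → P) {i : ι} (p : C.Fib X i),
    C.ap (V.proj r X) (s _ X i p) = p.1.2 r
  comp_s : ∀ {m n : ℕ} (a : Fin m → k) (b : Fin m → Fin n → k) (c : Fin n → k)
    (h : ∀ i, c i = ∑ j, a j * b j i) (X : Fin n → P) {i : ι} (p : C.Fib X i)
    (q : C.Fib (fun j => V.lin (b j) X) i), q.1.1 = p.1.1 → (∀ j, q.1.2 j = s (b j) X i p) →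
    C.ap (V.comp a b c h X) (s a _ i q) = s c X i p

lemma exists_canonical : ∃ V, Nonempty (C.Canonical V) := by
  choose lin s hs using fun (n : ℕ) (a : Fin n → k) (X : Fin n → P) => C.exists_comb a X
  have hpull := fun (n : ℕ) (a : Fin n → k) (X Y : Fin n → P) (f : ∀ r, X r ⟶ Y r) =>
    C.bind (c := a) (b := fun r => Pi.single r 1)
      (fun i => by simp [Pi.single_apply]) (fun r => C.single r (f r)) (hs n a Y)
  choose linMap hlin using fun (n : ℕ) (a : Fin n → k) (X Y : Fin n → P) (f : ∀ r, X r ⟶ Y r) =>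
    C.exists_hom (hs n a X) (hpull n a X Y f)
  choose proj hproj using fun (n : ℕ) (r : Fin n) (X : Fin n → P) =>
    C.exists_hom (hs n (Pi.single r 1) X) (C.single r (𝟙 (X r)))
  have hbind := fun (m n : ℕ) (a : Fin m → k) (b : Fin m → Fin n → k) (c : Fin n → k)
    (h : ∀ i, c i = ∑ j, a j * b j i) (X : Fin n → P) =>
    C.bind h (fun j => hs n (b j) X) (hs m a _)
  choose comp hcomp using fun (m n : ℕ) (a : Fin m → k) (b : Fin m → Fin n → k) (c : Fin n → k)
    (h : ∀ i, c i = ∑ j, a j * b j i) (X : Fin n → P) =>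
    C.exists_hom (hbind m n a b c h X) (hs n c X)
  simp only [C.ap_id] at hproj
  refine ⟨{
    isIso := C.isIso
    lin := lin _
    linMap := fun a X Y f => linMap _ a X Y f
    linMap_id := fun a X => C.hom_ext (hs _ a X) _ _ fun i p => by
      rw [hlin, C.ap_id]; simp only [C.ap_id]
    linMap_comp := fun a X Y Z f g => C.hom_ext (hs _ a X) _ _ fun i p => by
      rw [C.ap_comp, hlin, hlin, hlin]; simp only [C.ap_comp]
    proj := fun r X => proj _ r X
    proj_naturality := fun r X Y f => C.hom_ext (hs _ _ X) _ _ fun i p => by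
      rw [C.ap_comp, C.ap_comp, hlin, hproj, hproj]
    comp := fun a b c h X => comp _ _ a b c h X
    comp_naturality := fun a b c h X Y f => C.hom_ext (hbind _ _ a b c h X) _ _ fun i p => by
      rw [C.ap_comp, C.ap_comp, hlin, hcomp, hlin]; simp only [hlin]
      exact hcomp _ _ a b c h Y i ⟨(p.1.1, fun j => C.ap (f j) (p.1.2 j)), fun r =>
        (C.pr_ap _ _).trans (p.2 r)⟩
    comp_proj := fun j b h X => C.hom_ext (hbind _ _ _ b _ h X) _ _ fun i p => by
      rw [hcomp, hproj]
    proj_comp := fun a h X => C.hom_ext (hbind _ _ a _ a h X) _ _ fun i p => by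
      rw [hcomp, hlin]; simp only [hproj]
    assoc := fun a b c ab bc abc hab hbc h₁ h₂ X =>
      C.hom_ext (C.bind h₁ (fun i => hs _ (c i) X) (hbind _ _ a b ab hab fun i => lin _ (c i) X))
        _ _ fun i p => by
          rw [C.ap_comp, C.ap_comp, hlin, hcomp, hcomp]; simp only [hcomp] }, ⟨{
    s := fun a X => s _ a X
    isComb := fun a X => hs _ a X
    linMap_s := fun a X Y f i p q h h' => (hlin _ a X Y f i p).trans
      (congrArg _ (Subtype.ext (Prod.ext h.symm (funext fun r => (h' r).symm))))
    proj_s := fun r X i p => hproj _ r X i p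
    comp_s := fun a b c h X i p q h₁ h₂ => (congrArg _ (congrArg _ (Subtype.ext
      (Prod.ext h₁ (funext h₂))))).trans (hcomp _ _ a b c h X i p) }⟩⟩

/-- A functor which maps combinations to combinations is a morphism of vector spaces in categories. It
suffices to check this, and that morphisms agree, on some sections `J x` of the `F X`. -/
lemma exists_linearFunctor {Q : Type u} [Category.{v} Q] {ι' : Type w}
    (C' : CombTheory.{u, v, w, w'} k Q ι') {V : VectCat k P} {W : VectCat k Q} (hV : C.Canonical V)
    (hW : C'.Canonical W) (F : P ⥤ Q) {κ : Type w} {α : κ → ι} {β : κ → ι'}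
    (J : ∀ X i, C.El X (α i) → C'.El (F.obj X) (β i)) (Jb : ∀ i, C.Bs (α i) → C'.Bs (β i))
    (pr_J : ∀ X i x, C'.pr (J X i x) = Jb i (C.pr x))
    (map_J : ∀ {X Y} (f : X ⟶ Y) i x, C'.ap (F.map f) (J X i x) = J Y i (C.ap f x))
    (ext : ∀ {n} {a : Fin n → k} {X R s}, C.IsComb a X R s → ∀ {T} (f g : F.obj R ⟶ T),
      (∀ i p, C'.ap f (J R i (s (α i) p)) = C'.ap g (J R i (s (α i) p))) → f = g)
    (mu : ∀ {n} (a : Fin n → k) (X : Fin n → P), ∃ m : F.obj (V.lin a X) ⟶ W.lin a fun r => F.obj (X r),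
      ∀ i (p : C.Fib X (α i)) (p' : C'.Fib (fun r => F.obj (X r)) (β i)), p'.1.1 = Jb i p.1.1 →
        (∀ r, p'.1.2 r = J _ i (p.1.2 r)) → C'.ap m (J _ i (hV.s a X _ p)) = hW.s a _ _ p') :
    ∃ L : LinearFunctor V W F, ∀ {n} (a : Fin n → k) (X : Fin n → P) (i)
      (p : C.Fib X (α i)) (p' : C'.Fib (fun r => F.obj (X r)) (β i)), p'.1.1 = Jb i p.1.1 →
        (∀ r, p'.1.2 r = J _ i (p.1.2 r)) →
          C'.ap (L.mu a X) (J _ i (hV.s a X _ p)) = hW.s a _ _ p' := by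
  choose m hm using @mu
  let j : ∀ {n : ℕ} {X : Fin n → P} {i : κ}, C.Fib X (α i) → C'.Fib (fun r => F.obj (X r)) (β i) :=
    fun p => ⟨(Jb _ p.1.1, fun r => J _ _ (p.1.2 r)), fun r => (pr_J _ _ _).trans
      (congrArg _ (p.2 r))⟩
  have hm' : ∀ {n} (a : Fin n → k) (X : Fin n → P) (i) (p : C.Fib X (α i)),
      C'.ap (m a X) (J _ i (hV.s a X _ p)) = hW.s a _ _ (j p) := fun a X i p =>
    hm a X i p (j p) rfl fun r => rfl
  refine ⟨{
    mu := m
    naturality := fun a X Y f => ext (hV.isComb a X) _ _ fun i p => ?_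
    proj := fun r X => ext (hV.isComb _ X) _ _ fun i p => ?_
    comp := fun a b c h X => ext (C.bind h (fun j => hV.isComb (b j) X) (hV.isComb a _)) _ _
      fun i p => ?_ }, hm⟩
  · let q : C.Fib Y (α i) := ⟨(p.1.1, fun r => C.ap (f r) (p.1.2 r)), fun r =>
      (C.pr_ap _ _).trans (p.2 r)⟩
    rw [C'.ap_comp, C'.ap_comp, map_J, hV.linMap_s a f p q rfl fun r => rfl, hm', hm',
      hW.linMap_s a _ (j p) (j q) rfl fun r => (map_J _ _ _).symm]
  · rw [C'.ap_comp, map_J, hV.proj_s, hm', hW.proj_s]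
  · let q : C.Fib (fun j => V.lin (b j) X) (α i) := ⟨(p.1.1, fun j => hV.s (b j) X _ p), fun j =>
      C.pr_comb (hV.isComb (b j) X) _ p⟩
    let q' : C'.Fib (fun l => W.lin (b l) fun r => F.obj (X r)) (β i) :=
      ⟨(Jb i p.1.1, fun l => hW.s (b l) _ _ (j p)), fun l =>
        C'.pr_comb (hW.isComb (b l) _) _ (j p)⟩
    rw [C'.ap_comp, C'.ap_comp, C'.ap_comp, map_J]
    refine (congrArg (fun x => C'.ap (m c X) (J _ i x)) (hV.comp_s a b c h X p q rfl fun j => rfl)).trans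
      ((hm' _ _ _ _).trans (Eq.symm ?_))
    refine (congrArg _ (congrArg _ (hm' a _ i q))).trans ?_
    rw [hW.linMap_s a _ (j q) q' rfl fun l => (hm' _ _ _ _).symm]
    exact hW.comp_s a b c h _ (j p) q' rfl fun l => rfl

end CombTheory

/-! ### The vector spaces in categories of Courant extensions and of marked extensions -/

lemma sum_single_smul {U : Opens X.pt} {M : Type u} [AddCommGroup M] [Module (Fn U) M] {n : ℕ}
    (r : Fin n) (w : Fin n → M) :
    ∑ i, algebraMap 𝕂 (Fn U) ((Pi.single r 1 : Fin n → 𝕂) i) • w i = w r := by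
  rw [Finset.sum_eq_single r (fun i _ hi => by rw [Pi.single_eq_of_ne hi, map_zero, zero_smul])
    fun h => absurd (Finset.mem_univ r) h, Pi.single_eq_same, map_one, one_smul]

lemma sum_smul_sum_smul {U : Opens X.pt} {M : Type u} [AddCommGroup M] [Module (Fn U) M] {m n : ℕ}
    {a : Fin m → 𝕂} {b : Fin m → Fin n → 𝕂} {c : Fin n → 𝕂} (h : ∀ i, c i = ∑ j, a j * b j i)
    (w : Fin n → M) :
    ∑ j, algebraMap 𝕂 (Fn U) (a j) • ∑ i, algebraMap 𝕂 (Fn U) (b j i) • w i =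
      ∑ i, algebraMap 𝕂 (Fn U) (c i) • w i := by
  simp only [h, map_sum, map_mul, Finset.smul_sum, Finset.sum_smul, smul_smul]
  exact Finset.sum_comm

namespace OExt2
variable {B : DGLie X} {m n : ℕ} {a : Fin m → 𝕂} {b : Fin m → Fin n → 𝕂} {c : Fin n → 𝕂}
  {T : Fin n → OExt2 B} {Y : Fin m → OExt2 B} {R : OExt2 B}

lemma isLinComb_single (r : Fin n) (f : T r ⟶ R) :
    IsLinComb (Pi.single r 1) T R fun i U => ⟨⟨fun p => f.map i U (p.1.2 r), map_zero _⟩, fun _ _ =>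
      map_add _ _ _⟩ := by
  let S : ∀ (i : ℤ) (U : Opens X.pt), Fib T i U →+ (R.alg.sh i).sec U := fun i U =>
    ⟨⟨fun p => f.map i U (p.1.2 r), map_zero _⟩, fun _ _ => map_add _ _ _⟩
  have proj : ∀ {i : ℤ} {U : Opens X.pt} (p : Fib T i U), R.proj.map i U (S i U p) = p.1.1 :=
    fun p => (f.map_proj _).trans (p.2 r)
  have square : ∀ {k i : ℤ} (h : k + -2 = i) {U : Opens X.pt} (w : Fin n → Form k U),
      S i U (Fib.ofForms h w) =
        R.mark h (∑ i, algebraMap 𝕂 (Fn U) ((Pi.single r 1 : Fin n → 𝕂) i) • w i) :=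
    fun {k i} h {U} w => (f.map_mark h (w r)).trans (congrArg _ (sum_single_smul r w).symm)
  exact
    { res := fun h p => f.res_map h _
      act := fun h U w p => f.map_act h w _
      D := fun h U p => f.map_D h _
      proj := proj
      br := fun h U p q => f.map_br h _ _
      square := square
      surj := fun {k i} hk {U} => locally_eq_add_mark (s := S) proj hk
      inj := fun {k i} hk {U} p w => locally_eq_ofForms (s := S) proj square hk p w }

/-- The map of fibre products formed by the maps to several combinations. -/
def Fib.lift {t : ∀ (j : Fin m) (i : ℤ) (U : Opens X.pt), Fib T i U →+ ((Y j).alg.sh i).sec U}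
    (H : ∀ j, IsLinComb (b j) T (Y j) (t j)) (i : ℤ) (U : Opens X.pt) : Fib T i U →+ Fib Y i U :=
  ⟨⟨fun p => ⟨(p.1.1, fun j => t j i U p), fun j => (H j).proj p⟩,
    Fib.ext rfl fun j => map_zero (t j i U)⟩, fun p q => Fib.ext rfl fun j => map_add (t j i U) p q⟩

/-- Linear combinations of linear combinations are linear combinations. -/
lemma IsLinComb.bind (h : ∀ i, c i = ∑ j, a j * b j i)
    {s : ∀ (i : ℤ) (U : Opens X.pt), Fib Y i U →+ (R.alg.sh i).sec U}
    {t : ∀ (j : Fin m) (i : ℤ) (U : Opens X.pt), Fib T i U →+ ((Y j).alg.sh i).sec U}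
    (H : ∀ j, IsLinComb (b j) T (Y j) (t j)) (H' : IsLinComb a Y R s) :
    IsLinComb c T R fun i U => (s i U).comp (Fib.lift H i U) := by
  let S := fun (i : ℤ) (U : Opens X.pt) => (s i U).comp (Fib.lift H i U)
  have proj : ∀ {i : ℤ} {U : Opens X.pt} (p : Fib T i U),
      R.proj.map i U (s i U (Fib.lift H i U p)) = p.1.1 := fun p => H'.proj _
  have square : ∀ {k i : ℤ} (h : k + -2 = i) {U : Opens X.pt} (w : Fin n → Form k U),
      s i U (Fib.lift H i U (Fib.ofForms h w)) =
        R.mark h (∑ r, algebraMap 𝕂 (Fn U) (c r) • w r) := fun {k i} hk {U} w =>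
    (congrArg (s i U) (Fib.ext (p := Fib.lift H i U _) (q := Fib.ofForms hk fun j =>
      ∑ r, algebraMap 𝕂 (Fn U) (b j r) • w r) rfl fun j => (H j).square hk w)).trans
        ((H'.square hk _).trans (congrArg _ (sum_smul_sum_smul h w)))
  exact
    { res := fun h p => (H'.res h _).trans (congrArg _ (Fib.ext rfl fun j => (H j).res h p))
      act := fun h U w p => (congrArg (s _ U) (Fib.ext (p := Fib.lift H _ U (p.act h w))
        (q := (Fib.lift H _ U p).act h w) rfl fun j => (H j).act h w p)).trans (H'.act h w _)
      D := fun h U p => (congrArg (s _ U) (Fib.ext (p := Fib.lift H _ U (p.D h))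
        (q := (Fib.lift H _ U p).D h) rfl fun j => (H j).D h p)).trans (H'.D h _)
      proj := proj
      br := fun h U p q => (congrArg (s _ U) (Fib.ext (p := Fib.lift H _ U (p.br h q))
        (q := (Fib.lift H _ U p).br h (Fib.lift H _ U q)) rfl fun j => (H j).br h p q)).trans
          (H'.br h _ _)
      square := square
      surj := fun {k i} hk {U} => locally_eq_add_mark (s := S) proj hk
      inj := fun {k i} hk {U} p w => locally_eq_ofForms (s := S) proj square hk p w }

variable (B) in
/-- The linear combinations of extensions of `B`. -/
def combTheory : CombTheory.{u + 1, u, u, u} 𝕂 (OExt2 B) (ℤ × Opens X.pt) where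
  isIso := isIso
  Bs i := (B.sh i.1).sec i.2
  El T i := (T.alg.sh i.1).sec i.2
  pr {T i} := T.proj.map i.1 i.2
  ap {_ _} f {i} := f.map i.1 i.2
  ap_id _ := rfl
  ap_comp _ _ _ _ := rfl
  pr_ap f _ x := f.map_proj x
  IsComb {n} a T R s := ∃ s' : ∀ (i : ℤ) (U : Opens X.pt), Fib T i U →+ (R.alg.sh i).sec U,
    (∀ i p, s' i.1 i.2 p = s i p) ∧ IsLinComb a T R s'
  pr_comb := by
    rintro n a T R s ⟨s', e, H⟩ i p
    exact (congrArg _ (e i p)).symm.trans (H.proj p)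
  exists_comb a T :=
    have ⟨R, s, H⟩ := exists_isLinComb a T
    ⟨R, fun i p => s i.1 i.2 p, s, fun _ _ => rfl, H⟩
  exists_hom := by
    rintro n a T R R' s s' ⟨t, e, H⟩ ⟨t', e', H'⟩
    obtain ⟨f, hf⟩ := H.exists_hom H'
    exact ⟨f, fun i p => (congrArg _ (e i p)).symm.trans ((hf _ _ p).trans (e' i p))⟩
  hom_ext := by
    rintro n a T R R' s ⟨t, e, H⟩ f g h
    exact H.hom_ext fun i U p => by rw [e (i, U) p]; exact h (i, U) p
  single r _ _ f := ⟨_, fun _ _ => rfl, isLinComb_single r f⟩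
  bind := by
    rintro m n a b c h T Y R s t H ⟨s', e, H'⟩
    choose t' e' H₁ using fun j => H j
    exact ⟨_, fun i p => (e i (Fib.lift H₁ i.1 i.2 p)).trans (by exact congrArg (s i) (Subtype.ext (Prod.ext rfl
      (funext fun j => e' j i p)))), .bind h H₁ H'⟩

lemma exists_oExt2Lin (B : DGLie X) : Nonempty (OExt2Lin B) := by
  obtain ⟨V, ⟨H⟩⟩ := (combTheory B).exists_canonical
  choose s e hs using @H.isComb
  exact ⟨{
    lc := V
    s := s
    isLinComb := hs
    linMap_s := fun a S T f i U p q h h' => (congrArg _ (e a S (i, U) p)).trans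
      ((H.linMap_s a f (i := (i, U)) p q h h').trans (e a T (i, U) q).symm)
    proj_s := fun r T i U p => (congrArg _ (e _ T (i, U) p)).trans (H.proj_s r T (i := (i, U)) p)
    comp_s := fun a b c h T i U p q h₁ h₂ => (congrArg _ (e a _ (i, U) q)).trans
      ((H.comp_s a b c h T (i := (i, U)) p q h₁ fun j => (h₂ j).trans (e (b j) T (i, U) p)).trans
        (e c T (i, U) p).symm) }⟩

/-- The given structure is the one determined by the linear combinations. -/
def _root_.OddTransgression.OExt2Lin.canonical (W : OExt2Lin B) :
    (combTheory B).Canonical W.lc where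
  s a T i p := W.s a T i.1 i.2 p
  isComb a T := ⟨_, fun _ _ => rfl, W.isLinComb a T⟩
  linMap_s a _ _ f _ p q h h' := W.linMap_s a f p q h h'
  proj_s r T _ p := W.proj_s r T p
  comp_s a b c h T _ p q h₁ h₂ := W.comp_s a b c h T p q h₁ h₂

end OExt2

namespace CExt
variable {A : LieAlgebroid X} {m n : ℕ} {a : Fin m → 𝕂} {b : Fin m → Fin n → 𝕂} {c : Fin n → 𝕂}
  {Q : Fin n → CExt A} {Y : Fin m → CExt A} {R : CExt A}

lemma isLinComb_single (r : Fin n) (f : Q r ⟶ R) :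
    IsLinComb (Pi.single r 1) Q R fun U => (f.map U).comp ((LinearMap.proj r).comp
      ((LinearMap.snd _ _ _).comp (fibSubmodule Q U).subtype)) := by
  let S : ∀ U : Opens X.pt, Fib Q U →ₗ[Fn U] R.sec U := fun U => (f.map U).comp
    ((LinearMap.proj r).comp ((LinearMap.snd _ _ _).comp (fibSubmodule Q U).subtype))
  have proj : ∀ {U : Opens X.pt} (p : Fib Q U), R.proj (S U p) = p.1.1 :=
    fun p => (f.map_proj _).trans (p.2 r)
  have square : ∀ {U : Opens X.pt} (w : Fin n → Form 1 U), S U (Fib.ofForms w) =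
      R.coanchor (∑ i, algebraMap 𝕂 (Fn U) ((Pi.single r 1 : Fin n → 𝕂) i) • w i) :=
    fun {U} w => (f.map_coanchor (w r)).trans (congrArg _ (sum_single_smul r w).symm)
  exact
    { res := fun h p => f.res_map h _
      proj := proj
      br := fun p q => f.map_br _ _
      pair := fun {U} p q => (f.map_pair _ _).trans
        (sum_single_smul (𝕂 := 𝕂) (U := U) r fun i => (Q i).pair (p.1.2 i) (q.1.2 i)).symm
      square := square
      surj := locally_eq_add_coanchor (s := S) proj
      inj := fun {U} p w => locally_eq_ofForms (s := S) proj square p w }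

/-- The map of fibre products formed by the maps to several combinations. -/
def Fib.lift {t : ∀ (j : Fin m) (U : Opens X.pt), Fib Q U →ₗ[Fn U] (Y j).sec U}
    (H : ∀ j, IsLinComb (b j) Q (Y j) (t j)) (U : Opens X.pt) : Fib Q U →ₗ[Fn U] Fib Y U :=
  ⟨⟨fun p => ⟨(p.1.1, fun j => t j U p), fun j => (H j).proj p⟩, fun p q => Fib.ext rfl fun j =>
    map_add (t j U) p q⟩, fun f p => Fib.ext rfl fun j => (t j U).map_smul f p⟩

/-- Linear combinations of linear combinations are linear combinations. -/
lemma IsLinComb.bind (h : ∀ i, c i = ∑ j, a j * b j i)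
    {s : ∀ U : Opens X.pt, Fib Y U →ₗ[Fn U] R.sec U}
    {t : ∀ (j : Fin m) (U : Opens X.pt), Fib Q U →ₗ[Fn U] (Y j).sec U}
    (H : ∀ j, IsLinComb (b j) Q (Y j) (t j)) (H' : IsLinComb a Y R s) :
    IsLinComb c Q R fun U => (s U).comp (Fib.lift H U) := by
  let S := fun U : Opens X.pt => (s U).comp (Fib.lift H U)
  have proj : ∀ {U : Opens X.pt} (p : Fib Q U), R.proj (s U (Fib.lift H U p)) = p.1.1 :=
    fun p => H'.proj _
  have square : ∀ {U : Opens X.pt} (w : Fin n → Form 1 U), s U (Fib.lift H U (Fib.ofForms w)) =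
        R.coanchor (∑ r, algebraMap 𝕂 (Fn U) (c r) • w r) := fun {U} w =>
    (congrArg (s U) (Fib.ext (p := Fib.lift H U _)
      (q := Fib.ofForms fun j => ∑ r, algebraMap 𝕂 (Fn U) (b j r) • w r) rfl fun j => (H j).square w)).trans
        ((H'.square _).trans (congrArg _ (sum_smul_sum_smul h w)))
  exact
    { res := fun h p => (H'.res h _).trans (congrArg _ (Fib.ext rfl fun j => (H j).res h p))
      proj := proj
      br := fun {U} p q => (congrArg (s U) (Fib.ext (p := Fib.lift H U (p.br q))
        (q := (Fib.lift H U p).br (Fib.lift H U q)) rfl fun j => (H j).br p q)).trans (H'.br _ _)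
      pair := fun {U} p q => (H'.pair _ _).trans ((Finset.sum_congr rfl fun j _ =>
        congrArg _ ((H j).pair p q)).trans (sum_smul_sum_smul (U := U) h fun i =>
          (Q i).pair (p.1.2 i) (q.1.2 i)))
      square := square
      surj := locally_eq_add_coanchor (s := S) proj
      inj := fun {U} p w => locally_eq_ofForms (s := S) proj square p w }

variable (A) in
/-- The linear combinations of Courant extensions of `A`. -/
def combTheory (hA : ∀ {n : ℕ} (a : Fin n → 𝕂) (Q : Fin n → CExt A), ∃ R s, IsLinComb a Q R s) :
    CombTheory.{u + 1, u, u, u} 𝕂 (CExt A) (Opens X.pt) where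
  isIso := isIso
  Bs U := A.sec U
  El Q U := Q.sec U
  pr {Q _} := Q.proj
  ap {_ _} f {U} := f.map U
  ap_id _ := rfl
  ap_comp _ _ _ _ := rfl
  pr_ap f _ x := f.map_proj x
  IsComb {n} a Q R s := ∃ s' : ∀ U : Opens X.pt, Fib Q U →ₗ[Fn U] R.sec U,
    (∀ U p, s' U p = s U p) ∧ IsLinComb a Q R s'
  pr_comb := by
    rintro n a Q R s ⟨s', e, H⟩ U p
    exact (congrArg _ (e U p)).symm.trans (H.proj p)
  exists_comb a Q :=
    have ⟨R, s, H⟩ := hA a Q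
    ⟨R, fun U p => s U p, s, fun _ _ => rfl, H⟩
  exists_hom := by
    rintro n a Q R R' s s' ⟨t, e, H⟩ ⟨t', e', H'⟩
    obtain ⟨f, hf⟩ := H.exists_hom H'
    exact ⟨f, fun U p => (congrArg _ (e U p)).symm.trans ((hf U p).trans (e' U p))⟩
  hom_ext := by
    rintro n a Q R R' s ⟨t, e, H⟩ f g h
    exact H.hom_ext fun U p => by rw [e U p]; exact h U p
  single r _ _ f := ⟨_, fun _ _ => rfl, isLinComb_single r f⟩
  bind := by
    rintro m n a b c h Q Y R s t H ⟨s', e, H'⟩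
    choose t' e' H₁ using fun j => H j
    exact ⟨_, fun U p => (e U (Fib.lift H₁ U p)).trans (by exact congrArg (s U) (Subtype.ext (Prod.ext rfl
      (funext fun j => e' j U p)))), .bind h H₁ H'⟩

lemma exists_cExtLin
    (hA : ∀ {n : ℕ} (a : Fin n → 𝕂) (Q : Fin n → CExt A), ∃ R s, IsLinComb a Q R s) :
    Nonempty (CExtLin A) := by
  obtain ⟨V, ⟨H⟩⟩ := (combTheory A hA).exists_canonical
  choose s e hs using @H.isComb
  exact ⟨{
    lc := V
    s := s
    isLinComb := hs
    linMap_s := fun a P Q f U p q h h' => (congrArg _ (e a P U p)).trans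
      ((H.linMap_s a f p q h h').trans (e a Q U q).symm)
    proj_s := fun r Q U p => (congrArg _ (e _ Q U p)).trans (H.proj_s r Q p)
    comp_s := fun a b c h Q U p q h₁ h₂ => (congrArg _ (e a _ U q)).trans
      ((H.comp_s a b c h Q p q h₁ fun j => (h₂ j).trans (e (b j) Q U p)).trans
        (e c Q U p).symm) }⟩

/-- The given structure is the one determined by the linear combinations. -/
def _root_.OddTransgression.CExtLin.canonical
    (hA : ∀ {n : ℕ} (a : Fin n → 𝕂) (Q : Fin n → CExt A), ∃ R s, IsLinComb a Q R s)
    (V : CExtLin A) : (combTheory A hA).Canonical V.lc where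
  s a Q U p := V.s a Q U p
  isComb a Q := ⟨_, fun _ _ => rfl, V.isLinComb a Q⟩
  linMap_s a _ _ f _ p q h h' := V.linMap_s a f p q h h'
  proj_s r Q _ p := V.proj_s r Q p
  comp_s a b c h Q _ p q h₁ h₂ := V.comp_s a b c h Q p q h₁ h₂

end CExt

/-! ### Transgression and the Courant functor are linear -/

section Linear
variable {A : LieAlgebroid X} {S : Sharp A}

/-- Combinations of Courant extensions exist: they are the parts of degree `-1` of those of the
transgressions. -/
lemma Transgression.exists_isLinComb (τ : Transgression S) {n : ℕ} (a : Fin n → 𝕂)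
    (Q : Fin n → CExt A) : ∃ R s, CExt.IsLinComb a Q R s := by
  obtain ⟨R, s, H⟩ := OExt2.exists_isLinComb a fun r => τ.functor.obj (Q r)
  obtain ⟨t, Ht, -⟩ := CExt.exists_isLinComb_of_oExt H
    (fun r => (τ.isTransgression (Q r)).isCourMap) R.isCour_cour
  exact ⟨_, t, Ht⟩

lemma CourFunctor.exists_linearFunctor
    (hA : ∀ {n : ℕ} (a : Fin n → 𝕂) (Q : Fin n → CExt A), ∃ R s, CExt.IsLinComb a Q R s)
    (G : CourFunctor S) (V : CExtLin A) (W : OExt2Lin S.alg) :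
    ∃ L : LinearFunctor W.lc V.lc G.functor, G.IsCanonical V W L := by
  obtain ⟨L, hL⟩ := (OExt2.combTheory S.alg).exists_linearFunctor (CExt.combTheory A hA)
    W.canonical (V.canonical hA) G.functor (α := fun U : Opens X.pt => ((-1 : ℤ), U)) (β := id)
    (fun T U => (G.κ T U).symm) (fun U => (S.jEquiv U).symm)
    (fun T U x => (S.jEquiv U).injective (((G.isCour T).κ_proj _).symm.trans
      ((congrArg _ ((G.κ T U).apply_symm_apply x)).trans
        ((S.jEquiv U).apply_symm_apply _).symm)))
    (fun {T T'} f U x => (G.κ T' U).injective ((G.map_κ f _).trans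
      ((congrArg _ ((G.κ T U).apply_symm_apply x)).trans ((G.κ T' U).apply_symm_apply _).symm)))
    (by
      rintro n a T R s ⟨s', e, H⟩ T' f g h
      obtain ⟨t, Ht, hκ⟩ := CExt.exists_isLinComb_of_oExt H (fun r => (G.isCour (T r)).isCourMap)
        (G.isCour R)
      refine Ht.hom_ext fun U p => ?_
      let p' : OExt2.Fib T (-1) U := ⟨(S.j U p.1.1, fun r => G.κ _ U (p.1.2 r)), fun r =>
        ((G.isCour _).κ_proj _).trans (congrArg _ (p.2 r))⟩
      have ht : t U p = (G.κ R U).symm (s (-1, U) p') := (G.κ R U).injective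
        ((hκ U p p' rfl fun r => rfl).trans ((e (-1, U) p').trans
          ((G.κ R U).apply_symm_apply _).symm))
      rw [ht]
      exact h U p')
    (by
      intro n a T
      obtain ⟨t, Ht, hκ⟩ := CExt.exists_isLinComb_of_oExt (W.isLinComb a T)
        (fun r => (G.isCour (T r)).isCourMap) (G.isCour _)
      obtain ⟨m, hm⟩ := Ht.exists_hom (V.isLinComb a _)
      refine ⟨m, fun U p p' h h' => Eq.trans (congrArg (m.map U) ?_) (hm U p')⟩
      refine (AddEquiv.symm_apply_eq _).2 (hκ U p' p ?_ fun r => ?_).symm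
      · exact ((congrArg (S.jEquiv U) h).trans ((S.jEquiv U).apply_symm_apply _)).symm
      · exact ((congrArg (G.κ _ U) (h' r)).trans ((G.κ _ U).apply_symm_apply _)).symm)
  refine ⟨L, fun {n} a T {U} p p' h h' q hq => ?_⟩
  obtain rfl : q = (G.κ _ U).symm (W.s a T (-1) U p') := (AddEquiv.eq_symm_apply _).2 hq
  exact hL a T U p' p ((AddEquiv.eq_symm_apply (S.jEquiv U)).2 h.symm) fun r =>
    ((G.κ (T r) U).eq_symm_apply).2 (h' r).symm

lemma Transgression.exists_linearFunctor (τ : Transgression S) (V : CExtLin A)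
    (W : OExt2Lin S.alg) : ∃ L : LinearFunctor V.lc W.lc τ.functor, τ.IsCanonical V W L := by
  obtain ⟨L, hL⟩ := (CExt.combTheory A τ.exists_isLinComb).exists_linearFunctor
    (OExt2.combTheory S.alg) (V.canonical τ.exists_isLinComb) W.canonical τ.functor (α := id)
    (β := fun U : Opens X.pt => ((-1 : ℤ), U)) (fun Q U => τ.j Q U) (fun U => S.j U)
    (fun Q U q => (τ.isTransgression Q).proj_j q) (fun f U q => τ.map_j f q)
    (by
      rintro n a Q R s ⟨s', e, H⟩ T f g h
      refine (τ.isTransgression R).hom_ext fun U q => (T.alg.sh (-1)).eq_of_local fun x => ?_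
      obtain ⟨V, hV, p, w, hx, hq⟩ := H.surj q x
      have hj := (τ.isTransgression R).isCourMap
      refine ⟨V, hV, hx, ?_⟩
      rw [f.res_map, g.res_map, hj.res_j, hq, map_add, map_add, map_add, e,
        hj.j_coanchor ◇, f.map_mark, g.map_mark]
      exact congrArg (· + _) (h V p))
    (by
      intro n a Q
      obtain ⟨t, Ht, hκ⟩ := CExt.exists_isLinComb_of_oExt (W.isLinComb a fun r => τ.functor.obj (Q r))
        (fun r => (τ.isTransgression (Q r)).isCourMap) (OExt2.isCour_cour _)
      obtain ⟨f, hf⟩ := (V.isLinComb a Q).exists_hom Ht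
      obtain ⟨m, hm⟩ := (τ.isTransgression _).exists_hom ((OExt2.isCour_cour _).isCourMap.comp_hom f)
      exact ⟨m, fun U p p' h h' => (hm U _).trans ((congrArg _ (hf U p)).trans (hκ U p p' h h'))⟩)
  exact ⟨L, fun a Q U p p' h h' => hL a Q U p p' h h'⟩

end Linear

/-! ### Morphisms of Picard groupoids -/

namespace LinearFunctor
variable {k : Type} [CommRing k] {P : Type u} [Category.{v} P] {Q : Type u} [Category.{v} Q]
  {V : VectCat k P} {W : VectCat k Q} {F : P ⥤ Q} (L : LinearFunctor V W F)

/-- The map `F (A + B) → F A + F B`. -/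
def delta (A B : P) : F.obj (V.tensor A B) ⟶ W.tensor (F.obj A) (F.obj B) :=
  L.mu ![1, 1] ![A, B] ≫ W.linMap ![1, 1] (fun | 0 => 𝟙 (F.obj A) | 1 => 𝟙 (F.obj B) :
    ∀ i, F.obj (![A, B] i) ⟶ ![F.obj A, F.obj B] i)

/-- The map `F 0 → 0`. -/
def eta : F.obj V.unit ⟶ W.unit := L.mu ![] ![] ≫ W.linMap ![] fun i => i.elim0

/-- An identification of `A` with a combination of `X` induces one of `F A` with one of `F X`. -/
def mapLin {n : ℕ} {X : Fin n → P} {A : P} {v : Fin n → k} (r : A ⟶ V.lin v X) :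
    F.obj A ⟶ W.lin v fun i => F.obj (X i) :=
  F.map r ≫ L.mu v X

variable {n : ℕ} {X : Fin n → P} {A B : P} {v w : Fin n → k}

lemma map_mapLin (f : A ⟶ B) (r : B ⟶ V.lin v X) :
    L.mapLin (f ≫ r) = F.map f ≫ L.mapLin r := by
  rw [mapLin, F.map_comp, Category.assoc, mapLin]

/-- As in `V` and in `W` coherence isomorphisms are determined by their compositions with `add`, this
implies that `F` is compatible with them. -/
lemma delta_add (r : A ⟶ V.lin v X) (t : B ⟶ V.lin w X) (z : Fin n → k) (h : z = v + w) :
    L.delta A B ≫ W.add (L.mapLin r) (L.mapLin t) z h = L.mapLin (V.add r t z h) := by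
  have e : (fun i => F.map (V.pairLin r t i) ≫ L.mu (![v, w] i) X) = fun i =>
      (fun | 0 => 𝟙 (F.obj A) | 1 => 𝟙 (F.obj B) : ∀ i, F.obj (![A, B] i) ⟶ ![F.obj A, F.obj B] i) i ≫
        W.pairLin (L.mapLin r) (L.mapLin t) i := by
    funext i; fin_cases i <;> exact (Category.id_comp _).symm
  symm
  rw [mapLin, VectCat.add, F.map_comp, Category.assoc, L.comp, ← Category.assoc, L.naturality,
    Category.assoc, ← Category.assoc (W.linMap _ _), ← W.linMap_comp, e, W.linMap_comp, delta,
    VectCat.add]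
  simp only [Category.assoc]

lemma eta_zero (X : Fin n → P) (z : Fin n → k) (h : z = 0) :
    L.eta ≫ W.zero (fun i => F.obj (X i)) z h = L.mapLin (V.zero X z h) := by
  symm
  rw [mapLin, VectCat.zero, F.map_comp, Category.assoc, L.comp, ← Category.assoc, L.naturality,
    Category.assoc, ← Category.assoc (W.linMap _ _), ← W.linMap_comp, eta, VectCat.zero,
    Category.assoc, ← Category.assoc (W.linMap _ _), ← W.linMap_comp]
  congr 3; funext i; exact i.elim0

lemma delta_naturality {A A' B B' : P} (f : A ⟶ A') (g : B ⟶ B') :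
    L.delta A B ≫ W.tensorMap (F.map f) (F.map g) = F.map (V.tensorMap f g) ≫ L.delta A' B' := by
  obtain ⟨n, Y, a, b, -, -, r, s, -⟩ := V.exists_family A' B' B' B'
  apply W.cancel (W.add (L.mapLin r) (L.mapLin s) _ rfl)
  rw [Category.assoc, Category.assoc, W.tensorMap_add, delta_add, ← map_mapLin, ← map_mapLin,
    ← map_mapLin, delta_add, V.tensorMap_add]

lemma delta_assoc (A B C : P) :
    L.delta (V.tensor A B) C ≫ W.tensorMap (L.delta A B) (𝟙 _) ≫ W.assocHom _ _ _ =
      F.map (V.assocHom A B C) ≫ L.delta A (V.tensor B C) ≫ W.tensorMap (𝟙 _) (L.delta B C) := by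
  obtain ⟨n, Y, a, b, c, -, r, s, t, -⟩ := V.exists_family A B C C
  apply W.cancel (W.add (L.mapLin r) (W.add (L.mapLin s) (L.mapLin t) _ rfl) _ rfl)
  simp only [Category.assoc]
  rw [W.assocHom_add _ _ _ _ _ _ rfl rfl (add_assoc a b c).symm, W.tensorMap_add, W.tensorMap_add,
    delta_add, delta_add, Category.id_comp, Category.id_comp, delta_add, delta_add, ← map_mapLin,
    V.assocHom_add _ _ _ _ _ _ rfl rfl (add_assoc a b c).symm]

lemma delta_left (A : P) :
    L.delta V.unit A ≫ W.tensorMap L.eta (𝟙 _) ≫ W.leftHom _ = F.map (V.leftHom A) := by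
  obtain ⟨n, Y, a, -, -, -, r, -⟩ := V.exists_family A A A A
  apply W.cancel (L.mapLin r)
  simp only [Category.assoc]
  rw [W.leftHom_comp _ 0 rfl (zero_add a).symm, W.tensorMap_add, eta_zero, Category.id_comp,
    delta_add, ← map_mapLin, V.leftHom_comp]

lemma delta_right (A : P) :
    L.delta A V.unit ≫ W.tensorMap (𝟙 _) L.eta ≫ W.rightHom _ = F.map (V.rightHom A) := by
  obtain ⟨n, Y, a, -, -, -, r, -⟩ := V.exists_family A A A A
  apply W.cancel (L.mapLin r)
  simp only [Category.assoc]
  rw [W.rightHom_comp _ 0 rfl (add_zero a).symm, W.tensorMap_add, eta_zero, Category.id_comp,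
    delta_add, ← map_mapLin, V.rightHom_comp]

lemma delta_braid (A B : P) :
    L.delta A B ≫ W.braidHom _ _ = F.map (V.braidHom A B) ≫ L.delta B A := by
  obtain ⟨n, Y, a, b, -, -, r, s, -⟩ := V.exists_family A B B B
  apply W.cancel (W.add (L.mapLin s) (L.mapLin r) _ rfl)
  rw [Category.assoc, Category.assoc, W.braidHom_add _ _ _ (add_comm b a), delta_add, delta_add,
    ← map_mapLin, V.braidHom_add _ _ _ (add_comm b a)]

lemma exists_picardFunctor : ∃ B : PicardFunctor V.picard W.picard F, L.IsUnderlying B := by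
  let := V.picard.monoidal
  let := V.picard.symmetric
  let := W.picard.monoidal
  let := W.picard.symmetric
  let o : F.OplaxMonoidal :=
    { η := L.eta
      δ := L.delta
      δ_natural_left := fun f A => by
        have := L.delta_naturality f (𝟙 A)
        rwa [F.map_id] at this
      δ_natural_right := fun A f => by
        have := L.delta_naturality (𝟙 A) f
        rwa [F.map_id] at this
      oplax_associativity := L.delta_assoc
      oplax_left_unitality := fun A => ((F.mapIso (V.iso (V.leftHom A))).eq_inv_comp).2
        ((W.iso (W.leftHom (F.obj A))).comp_inv_eq.2 ((L.delta_left A).symm.trans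
          (Category.assoc _ _ _).symm))
      oplax_right_unitality := fun A => ((F.mapIso (V.iso (V.rightHom A))).eq_inv_comp).2
        ((W.iso (W.rightHom (F.obj A))).comp_inv_eq.2 ((L.delta_right A).symm.trans
          (Category.assoc _ _ _).symm)) }
  have : IsIso (Functor.OplaxMonoidal.η F) := W.isIso _
  have hδ : ∀ A B, IsIso (Functor.OplaxMonoidal.δ F A B) := fun A B => W.isIso _
  let m : F.Monoidal := Functor.Monoidal.ofOplaxMonoidal F
  have hμ : ∀ A B : P, Functor.LaxMonoidal.μ F A B = inv (Functor.OplaxMonoidal.δ F A B) :=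
    fun A B => rfl
  let B : F.Braided :=
    { braided := fun A B => by
        rw [hμ, hμ, IsIso.inv_comp_eq, ← Category.assoc, IsIso.eq_comp_inv]
        exact (L.delta_braid A B).symm }
  exact ⟨B, fun A B => IsIso.hom_inv_id (Functor.OplaxMonoidal.δ F A B)⟩

end LinearFunctor

end

end OddTransgression

theorem mainTheorem8 {𝕜 𝕂 : Type} [RCLike 𝕜] [RCLike 𝕂] [NormedAlgebra 𝕜 𝕂]
    (X : OddTransgression.Mnfd.{u} 𝕜 𝕂) (A : OddTransgression.LieAlgebroid X)
    (hA : A.LocallyFree) :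
    Nonempty (OddTransgression.Sharp A) ∧
    ∀ S : OddTransgression.Sharp A,
      Nonempty (OddTransgression.CExtLin A) ∧
      Nonempty (OddTransgression.OExt2Lin S.alg) ∧
      Nonempty (OddTransgression.Transgression S) ∧
      Nonempty (OddTransgression.CourFunctor S) ∧
      ∀ (τ : OddTransgression.Transgression S) (Q : OddTransgression.CourFunctor S),
        (∃ e : OddTransgression.CExt A ≌ OddTransgression.OExt2 S.alg,
          e.functor = τ.functor ∧ e.inverse = Q.functor) ∧
        ∀ (V : OddTransgression.CExtLin A) (W : OddTransgression.OExt2Lin S.alg),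
          (∃ L : OddTransgression.LinearFunctor V.lc W.lc τ.functor, τ.IsCanonical V W L ∧
            ∃ B : OddTransgression.PicardFunctor V.lc.picard W.lc.picard τ.functor,
              L.IsUnderlying B) ∧
          (∃ L : OddTransgression.LinearFunctor W.lc V.lc Q.functor, Q.IsCanonical V W L ∧
            ∃ B : OddTransgression.PicardFunctor W.lc.picard V.lc.picard Q.functor,
              L.IsUnderlying B) := by
  refine ⟨OddTransgression.exists_sharp A, fun S => ?_⟩
  obtain ⟨τ₀⟩ := OddTransgression.exists_transgressionFunctor S hA
  refine ⟨OddTransgression.CExt.exists_cExtLin τ₀.exists_isLinComb,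
    OddTransgression.OExt2.exists_oExt2Lin S.alg, ⟨τ₀⟩, OddTransgression.OExt2.exists_courFunctor S,
    fun τ G => ⟨OddTransgression.exists_equivalence τ G, fun V W => ⟨?_, ?_⟩⟩⟩
  · obtain ⟨L, hL⟩ := τ.exists_linearFunctor V W
    exact ⟨L, hL, L.exists_picardFunctor⟩
  · obtain ⟨L, hL⟩ := G.exists_linearFunctor τ₀.exists_isLinComb V W
    exact ⟨L, hL, L.exists_picardFunctor⟩
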